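/- Let $n$ be odd and $p\ge 1$. Let $\mathcal A=\bigoplus_d\mathcal A^d$ be the space of smooth complex-valued functions on $T^*\mathbb{RP}^n$ that are polynomial along the cotangent fibres ($\mathcal A^d$: homogeneous of degree $d$), and let $\mathcal B$ be the algebra of smooth linear differential operators on half-densities on $\mathbb{RP}^n$. There is exactly one $SL_{n+1}(\mathbb R)$-equivariant quantization map $Q:\mathcal A\to\mathcal B$, i.e. linear isomorphism such that $\phi$ is the principal symbol of $Q(\phi)$ for $\phi\in\mathcal A^d$, equivariant for $SL_{n+1}(\mathbb R)$ and for its Lie algebra. Put $Q_t(\phi)=t^dQ(\phi)$ for $\phi\in\mathcal A^d$ and let $\phi\star\psi=Q_t^{-1}(Q_t(\phi)Q_t(\psi))=\sum_{p\ge0}C_p(\phi,\psi)t^p$ be the associated star product. Let $E$ be the fibrewise Euler vector field on $T^*\mathbb{RP}^n$, $E'=E+\frac n2$, and $$T_p=\prod_{i=1}^{[p/2]}(E'+i),\qquad S_p=\prod_{i=1}^{[p/2]}(E'-i).$$ Let $\mathcal R\subset\mathcal A$ be the momentum algebra, i.e. the complex algebra generated by the momentum functions $\mu^x$, $x\in\mathfrak{sl}_{n+1}(\mathbb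 R)$. Then $T_p$ and $S_p$ are invertible on $\mathcal A$, and: (1) There is an $SL_{n+1}(\mathbb R)$-invariant bidifferential operator $Z_p$ on $T^*\mathbb{RP}^n$ such that $$C_p(\phi,\psi)=T_p^{-1}Z_p\bigl(S_p^{-1}\phi,S_p^{-1}\psi\bigr)\qquad\text{for all }\phi,\psi\in\mathcal A.\tag{$*$}$$ (2) If a bidifferential operator on $T^*\mathbb{RP}^n$ satisfies $(*)$ for all $\phi,\psi\in\mathcal R$, then it equals $Z_p$. Consequently, if $C':\mathcal A\times\mathcal A\to\mathcal A$ is a map such that $(\phi,\psi)\mapsto T_pC'(S_p\phi,S_p\psi)$ is given by a bidifferential operator on $T^*\mathbb{RP}^n$, and $C'=C_p$ on $\mathcal R\times\mathcal R$, then $C'=C_p$ on $\mathcal A\times\mathcal A$. (3) $Z_p$ extends to an $SL_{n+1}(\mathbb C)$-invariant algebraic bidifferential operator on $T^*\mathbb{CP}^n$, and this is its only extension to an algebraic bidifferential operator on $T^*\mathbb{CP}^n$. Likewise $E'$ extends to an $SL_{n+1}(\mathbb C)$-invariant algebraic differential operator on $T^*\mathbb{CP}^n$, and this is its only algebraic extension.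 -/

import Mathlib

open scoped ContDiff LinearAlgebra.Projectivization

noncomputable section

namespace StarProj

/-! ### Grothendieck differential operators -/

/-- `D` is a differential operator of order at most `k` over the ring `O`: commuting it successively
with `k + 1` multiplications by elements of `O` gives zero. (Linearity over the ground field is
carried separately.) -/
def IsDiffOp (O : Type*) {M N : Type*} [SMul O M] [SMul O N] [Sub N] : ℕ → (M → N) → Prop
  | 0, D => ∀ (f : O) (s : M), D (f • s) = f • D s
  | k + 1, D => ∀ f : O, IsDiffOp O k (fun s => D (f • s) - f • D s)

/-- A bilinear operator on a commutative algebra is bidifferential of order at most `k` in each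
argument. -/
def IsBidiffOfOrder {O : Type*} [CommRing O] [Algebra ℂ O] (k : ℕ) (Z : O →ₗ[ℂ] O →ₗ[ℂ] O) : Prop :=
  (∀ φ, IsDiffOp O k (fun ψ => Z φ ψ)) ∧ (∀ ψ, IsDiffOp O k (fun φ => Z φ ψ))

/-- A bilinear operator on a commutative algebra is bidifferential. -/
def IsBidiff {O : Type*} [CommRing O] [Algebra ℂ O] (Z : O →ₗ[ℂ] O →ₗ[ℂ] O) : Prop :=
  ∃ k, IsBidiffOfOrder k Z

/-! ### The projective space and its cotangent bundle, with standard charts -/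

section Spaces

variable (K : Type*) [Field K] (n : ℕ)

/-- Nonzero vectors of `K^{n+1}`: homogeneous coordinates of points of `P^n`. -/
abbrev NZ := {x : Fin (n + 1) → K // x ≠ 0}

/-- Pairs `(x, ξ)`, `x ≠ 0`, `ξ · x = 0`. The covectors `ξ` annihilating `x` are exactly the
pullbacks to `K^{n+1}`, at the point `x`, of covectors of `P^n` at `[x]`. -/
abbrev CotPair :=
  {v : (Fin (n + 1) → K) × (Fin (n + 1) → K) // v.1 ≠ 0 ∧ v.2 ⬝ᵥ v.1 = 0}

/-- `(x, ξ)` and `(t x, t⁻¹ ξ)` represent the same covector of `P^n`. -/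
instance cotSetoid : Setoid (CotPair K n) where
  r v w := ∃ t : Kˣ, w.1.1 = (t : K) • v.1.1 ∧ w.1.2 = ((t⁻¹ : Kˣ) : K) • v.1.2
  iseqv :=
    { refl := fun v => ⟨1, by simp, by simp⟩
      symm := by
        rintro v w ⟨t, h1, h2⟩
        exact ⟨t⁻¹, by simp [h1, smul_smul], by simp [h2, smul_smul]⟩
      trans := by
        rintro v w z ⟨t, h1, h2⟩ ⟨s, h3, h4⟩
        exact ⟨s * t, by simp [h1, h3, smul_smul], by simp [h2, h4, smul_smul, mul_comm]⟩ }

/-- The cotangent bundle `T*P^n` over `K`. -/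
def CotP := Quotient (cotSetoid K n)

end Spaces

section Maps

variable {K : Type*} [Field K] {n : ℕ}

/-- Homogeneous coordinates of the point with affine coordinates `u` in the chart where the `i`-th
homogeneous coordinate is `1`. -/
def nzChart (i : Fin (n + 1)) (u : Fin n → K) : NZ K n :=
  ⟨i.insertNth (1 : K) u, fun h => by simpa using congrFun h i⟩

/-- The `i`-th affine chart of `P^n`. -/
def projChart (i : Fin (n + 1)) (u : Fin n → K) : ℙ K (Fin (n + 1) → K) :=
  Projectivization.mk K (nzChart i u).1 (nzChart i u).2

/-- Darboux coordinates on `T*P^n` over the `i`-th affine chart: the covector `∑ ξ_k du_k` at `u`. -/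
def cotChart (i : Fin (n + 1)) (u ξ : Fin n → K) : CotP K n :=
  Quotient.mk (cotSetoid K n) ⟨(i.insertNth (1 : K) u, i.insertNth (-(ξ ⬝ᵥ u)) ξ),
    (nzChart i u).2, by simp [dotProduct, Fin.sum_univ_succAbove _ i]⟩

/-- Scaling in the cotangent fibres. -/
def dil (t : K) : CotP K n → CotP K n :=
  Quotient.map (fun v => ⟨(v.1.1, t • v.1.2), v.2.1, by simp [v.2.2]⟩) (by
    rintro v w ⟨s, h1, h2⟩
    exact ⟨s, h1, by simp only [h2]; rw [smul_comm]⟩)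

/-- A linear automorphism acting on nonzero vectors. -/
def nzAct (g : GL (Fin (n + 1)) K) (x : NZ K n) : NZ K n :=
  ⟨g.val.mulVec x.1, fun h => x.2 (by
    have h' := congrArg (Matrix.mulVec (g⁻¹ : GL (Fin (n + 1)) K).val) h
    rw [Matrix.mulVec_mulVec, ← Units.val_mul, inv_mul_cancel] at h'
    simpa using h')⟩

/-- The canonical lift to `T*P^n` of the action of a linear automorphism on `P^n`:
`(x, ξ) ↦ (g x, ξ g⁻¹)`. -/
def cotAct (g : GL (Fin (n + 1)) K) : CotP K n → CotP K n :=
  Quotient.map (fun v => ⟨(g.val.mulVec v.1.1,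
      Matrix.vecMul v.1.2 (g⁻¹ : GL (Fin (n + 1)) K).val),
      (nzAct g ⟨v.1.1, v.2.1⟩).2, by
        rw [Matrix.dotProduct_mulVec, Matrix.vecMul_vecMul, ← Units.val_mul, inv_mul_cancel]
        simpa using v.2.2⟩) (by
    rintro v w ⟨s, h1, h2⟩
    exact ⟨s, by simp [h1, Matrix.mulVec_smul], by simp [h2, Matrix.smul_vecMul]⟩)

end Maps

/-- `SL_{n+1}` inside `GL_{n+1}`. -/
abbrev slGL {K : Type*} [Field K] {n : ℕ} (g : Matrix.SpecialLinearGroup (Fin (n + 1)) K) :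
    GL (Fin (n + 1)) K := g

/-- The one-parameter group `exp (-t X)`. -/
def expFlow {n : ℕ} (X : Matrix (Fin (n + 1)) (Fin (n + 1)) ℝ) (t : ℝ) : GL (Fin (n + 1)) ℝ where
  val := NormedSpace.exp (-(t • X))
  inv := NormedSpace.exp (t • X)
  val_inv := by
    rw [← Matrix.exp_add_of_commute _ _ (Commute.refl (t • X)).neg_left, neg_add_cancel,
      NormedSpace.exp_zero]
  inv_val := by
    rw [← Matrix.exp_add_of_commute _ _ (Commute.refl (t • X)).neg_right, add_neg_cancel,
      NormedSpace.exp_zero]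

/-! ### Smooth functions, symbols -/

section Smooth

variable (n : ℕ)

/-- The algebra `C^∞(RP^n)` of complex-valued smooth functions. -/
def SmoothP : Subalgebra ℂ (ℙ ℝ (Fin (n + 1) → ℝ) → ℂ) where
  carrier := {f | ∀ i, ContDiff ℝ ∞ (fun u => f (projChart i u))}
  mul_mem' hf hg i := (hf i).mul (hg i)
  add_mem' hf hg i := (hf i).add (hg i)
  algebraMap_mem' _ _ := contDiff_const

/-- The algebra `C^∞(T*RP^n)` of complex-valued smooth functions. -/
def SmoothT : Subalgebra ℂ (CotP ℝ n → ℂ) where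
  carrier := {f | ∀ i, ContDiff ℝ ∞ (fun w : (Fin n → ℝ) × (Fin n → ℝ) => f (cotChart i w.1 w.2))}
  mul_mem' hf hg i := (hf i).mul (hg i)
  add_mem' hf hg i := (hf i).add (hg i)
  algebraMap_mem' _ _ := contDiff_const

instance : CommRing (SmoothT n) := (SmoothT n).toCommRing

instance : Algebra ℂ (SmoothT n) := (SmoothT n).algebra

/-- `𝒜^d`: smooth functions on `T*RP^n` which are homogeneous polynomials of degree `d` along the
cotangent fibres. -/
def PolDeg (d : ℕ) : Submodule ℂ (SmoothT n) where
  carrier := {f | ∀ i u, ∃ P : MvPolynomial (Fin n) ℂ, P.IsHomogeneous d ∧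
    ∀ ξ, f.1 (cotChart i u ξ) = MvPolynomial.eval (fun k => (ξ k : ℂ)) P}
  zero_mem' _ _ := ⟨0, MvPolynomial.isHomogeneous_zero _ _ _, fun _ => by simp⟩
  add_mem' := by
    intro f g hf hg i u
    obtain ⟨P, hP, h1⟩ := hf i u
    obtain ⟨R, hR, h2⟩ := hg i u
    exact ⟨P + R, hP.add hR, fun ξ => by simp [h1, h2]⟩
  smul_mem' := by
    intro c f hf i u
    obtain ⟨P, hP, h1⟩ := hf i u
    exact ⟨c • P, (MvPolynomial.homogeneousSubmodule (Fin n) ℂ d).smul_mem c hP,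
      fun ξ => by simp [h1]⟩

/-- The symbol space `𝒜 = ⊕ 𝒜^d`: smooth functions on `T*RP^n`, polynomial (of bounded degree)
along the cotangent fibres. -/
def Pol : Submodule ℂ (SmoothT n) := ⨆ d, PolDeg n d

instance : AddCommGroup (Pol n) := (Pol n).addCommGroup

instance : Module ℂ (Pol n) := (Pol n).module

instance : Ring (Module.End ℂ (Pol n)) := Module.End.instRing

variable {n}

lemma dil_cotChart (t : ℝ) (i : Fin (n + 1)) (u ξ : Fin n → ℝ) :
    dil t (cotChart i u ξ) = cotChart i u (t • ξ) := by
  apply congrArg (Quotient.mk (cotSetoid ℝ n))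
  apply Subtype.ext
  refine Prod.ext rfl ?_
  funext k
  refine Fin.succAboveCases i ?_ (fun j => ?_) k <;> simp

lemma exists_cotChart {K : Type*} [Field K] (m : CotP K n) : ∃ i u ξ, m = cotChart i u ξ := by
  induction m using Quotient.inductionOn with
  | _ v =>
  obtain ⟨⟨x, ξ⟩, hx, h⟩ := v
  obtain ⟨i, hi⟩ := Function.ne_iff.1 hx
  have hi' : x i ≠ 0 := hi
  refine ⟨i, fun k => (x i)⁻¹ * x (i.succAbove k), fun k => x i * ξ (i.succAbove k), ?_⟩
  apply Quotient.sound
  refine ⟨(Units.mk0 _ hi')⁻¹, ?_, ?_⟩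
  · funext k
    refine Fin.succAboveCases i ?_ (fun j => ?_) k <;> simp [hi']
  · simp only [dotProduct, Fin.sum_univ_succAbove _ i] at h
    funext k
    refine Fin.succAboveCases i ?_ (fun j => ?_) k
    · have : ∀ k, x i * ξ (i.succAbove k) * ((x i)⁻¹ * x (i.succAbove k))
          = ξ (i.succAbove k) * x (i.succAbove k) := fun k => by field_simp
      simp [dotProduct, this]
      linear_combination -h
    · simp

lemma PolDeg.dil_eq {d : ℕ} {f : SmoothT n} (hf : f ∈ PolDeg n d) (t : ℝ) (m : CotP ℝ n) :
    f.1 (dil t m) = (t : ℂ) ^ d * f.1 m := by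
  obtain ⟨i, u, ξ, rfl⟩ := exists_cotChart m
  obtain ⟨P, hP, h⟩ := hf i u
  rw [dil_cotChart, h, h]
  rw [MvPolynomial.eval_eq, MvPolynomial.eval_eq, Finset.mul_sum]
  refine Finset.sum_congr rfl fun a ha => ?_
  have hd : ∑ k, a k = d := by
    have := hP (MvPolynomial.mem_support_iff.1 ha)
    rw [← this, Finsupp.weight_apply, Finsupp.sum_fintype] <;> simp
  have hs : ∀ z : Fin n → ℂ, ∏ k ∈ a.support, z k ^ a k = ∏ k, z k ^ a k := fun z =>
    Finset.prod_subset (Finset.subset_univ _) fun k _ hk => by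
      rw [Finsupp.notMem_support_iff.1 hk, pow_zero]
  rw [hs, hs, ← hd, ← Finset.prod_pow_eq_pow_sum, mul_left_comm, ← Finset.prod_mul_distrib]
  simp [mul_pow]

lemma euler_aux (f : SmoothT n) (i : Fin (n + 1)) (w : (Fin n → ℝ) × (Fin n → ℝ)) :
    HasDerivAt (fun t : ℝ => f.1 (dil t (cotChart i w.1 w.2)))
      (fderiv ℝ (fun w : (Fin n → ℝ) × (Fin n → ℝ) => f.1 (cotChart i w.1 w.2)) w (0, w.2)) 1 := by
  simp only [dil_cotChart]
  have hc : HasDerivAt (fun t : ℝ => (w.1, t • w.2)) (0, w.2) 1 :=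
    (hasDerivAt_const 1 w.1).prodMk (by simpa using (hasDerivAt_id (1 : ℝ)).smul_const w.2)
  have hf : HasFDerivAt (fun w : (Fin n → ℝ) × (Fin n → ℝ) => f.1 (cotChart i w.1 w.2))
      (fderiv ℝ (fun w : (Fin n → ℝ) × (Fin n → ℝ) => f.1 (cotChart i w.1 w.2)) w)
      (w.1, (1 : ℝ) • w.2) := by
    rw [one_smul]
    exact ((f.2 i).differentiable (by simp) w).hasFDerivAt
  exact hf.comp_hasDerivAt 1 hc

/-- The fibrewise Euler vector field `E = ∑ ξ_k ∂/∂ξ_k` on `T*RP^n`, i.e. the derivative along the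
fibre dilations. -/
def euler : SmoothT n →ₗ[ℂ] SmoothT n where
  toFun f := ⟨fun m => deriv (fun t : ℝ => f.1 (dil t m)) 1, by
    intro i
    have h : (fun w : (Fin n → ℝ) × (Fin n → ℝ) =>
        deriv (fun t : ℝ => f.1 (dil t (cotChart i w.1 w.2))) 1) =
        fun w => fderiv ℝ (fun w : (Fin n → ℝ) × (Fin n → ℝ) => f.1 (cotChart i w.1 w.2)) w
          (0, w.2) := by
      funext w
      exact (euler_aux f i w).deriv
    rw [h]
    exact ((f.2 i).fderiv_right (m := ∞) (by simp)).clm_apply (contDiff_const.prodMk contDiff_snd)⟩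
  map_add' f g := by
    apply Subtype.ext
    funext m
    obtain ⟨i, u, ξ, rfl⟩ := exists_cotChart m
    exact ((euler_aux f i (u, ξ)).add (euler_aux g i (u, ξ))).deriv.trans
      (congrArg₂ (· + ·) (euler_aux f i (u, ξ)).deriv (euler_aux g i (u, ξ)).deriv).symm
  map_smul' c f := by
    apply Subtype.ext
    funext m
    obtain ⟨i, u, ξ, rfl⟩ := exists_cotChart m
    exact ((euler_aux f i (u, ξ)).const_mul c).deriv.trans
      (congrArg (c * ·) (euler_aux f i (u, ξ)).deriv).symm

lemma euler_polDeg {d : ℕ} {f : SmoothT n} (hf : f ∈ PolDeg n d) : euler f = (d : ℂ) • f := by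
  apply Subtype.ext
  funext m
  change deriv (fun t : ℝ => f.1 (dil t m)) 1 = (d : ℂ) * f.1 m
  have h : (fun t : ℝ => f.1 (dil t m)) = fun t : ℝ => (t : ℂ) ^ d * f.1 m :=
    funext fun t => PolDeg.dil_eq hf t m
  rw [h]
  have h1 : HasDerivAt (fun t : ℝ => (t : ℂ)) 1 1 := Complex.ofRealCLM.hasDerivAt
  simpa using ((h1.pow d).mul_const (f.1 m)).deriv

lemma euler_pol {f : SmoothT n} (hf : f ∈ Pol n) : euler f ∈ Pol n := by
  have h : Pol n ≤ (Pol n).comap euler := iSup_le fun d f hf => by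
    rw [Submodule.mem_comap, euler_polDeg hf]
    exact (Pol n).smul_mem _ (le_iSup (PolDeg n) d hf)
  exact h hf

/-- The Euler operator `E` on the symbol space `𝒜`. -/
def eulerPol (n : ℕ) : Module.End ℂ (Pol n) := euler.restrict fun _ hf => euler_pol hf

/-- `E + r` on `𝒜`; in particular `E' = E + n/2`. -/
def eulerShift (n : ℕ) (r : ℂ) : Module.End ℂ (Pol n) := eulerPol n + r • 1

/-- `T_p = ∏_{i=1}^{[p/2]} (E' + i)` on `𝒜`. -/
def opT (n p : ℕ) : Module.End ℂ (Pol n) :=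
  ((List.range (p / 2)).map fun i : ℕ => eulerShift n ((n : ℂ) / 2 + (i + 1))).prod

/-- `S_p = ∏_{i=1}^{[p/2]} (E' - i)` on `𝒜`. -/
def opS (n p : ℕ) : Module.End ℂ (Pol n) :=
  ((List.range (p / 2)).map fun i : ℕ => eulerShift n ((n : ℂ) / 2 - (i + 1))).prod

/-- The homogeneous components of a symbol (unique, by `polDeg_indep`). -/
def components (φ : Pol n) : Π₀ d, PolDeg n d :=
  ((Submodule.mem_iSup_iff_exists_dfinsupp (PolDeg n) φ.1).1 φ.2).choose

lemma polDeg_indep : iSupIndep (PolDeg n) := by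
  refine (Module.End.eigenspaces_iSupIndep (euler (n := n))).comp
    (f := fun d : ℕ => (d : ℂ)) Nat.cast_injective |>.mono fun d f hf => ?_
  exact Module.End.mem_eigenspace_iff.2 (euler_polDeg hf)

/-- The component of degree `d` of a symbol. -/
def comp (d : ℕ) (φ : Pol n) : Pol n :=
  ⟨(components φ d).1, le_iSup (PolDeg n) d (components φ d).2⟩

/-- The momentum algebra `ℛ`: generated by the momentum functions `μ^X (x, ξ) = ξ · X x`, the
principal symbols of the vector fields on `RP^n` defined by `X ∈ sl_{n+1}(ℝ)`. -/
def momentumAlg (n : ℕ) : Subalgebra ℂ (SmoothT n) :=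
  Algebra.adjoin ℂ {f | ∃ X : Matrix (Fin (n + 1)) (Fin (n + 1)) ℝ, X.trace = 0 ∧
    ∀ v : CotPair ℝ n, f.1 (Quotient.mk (cotSetoid ℝ n) v) =
      ((v.1.2 ⬝ᵥ X.mulVec v.1.1 : ℝ) : ℂ)}

end Smooth

/-! ### Densities and their differential operators -/

section Densities

variable (lam : ℝ) (n : ℕ)

/-- Smooth (complex) `λ`-densities on `RP^n`. With `vol` the standard volume form of `ℝ^{n+1}`, a
`λ`-density is written uniquely as `F(x) |ι_x vol|^λ` at `[x]`, where `F` is homogeneous of degree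
`-λ (n+1)` (in absolute value) because `|ι_{tx} vol| = |t|^{n+1} |ι_x vol|` as densities on
`T_[x] RP^n`. Its expression in the `i`-th affine chart is
`F(u_1, …, 1, …, u_n) |du_1 ⋯ du_n|^λ`. -/
def Dens : Submodule ℂ (NZ ℝ n → ℂ) where
  carrier := {F | (∀ (t : ℝ) (x y : NZ ℝ n), y.1 = t • x.1 →
      F y = ((|t| ^ (-(lam * (n + 1))) : ℝ) : ℂ) * F x) ∧
    ∀ i, ContDiff ℝ ∞ (fun u => F (nzChart i u))}
  zero_mem' := ⟨fun _ _ _ _ => by simp, fun _ => contDiff_const⟩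
  add_mem' hF hG := ⟨fun t x y h => by simp [hF.1 t x y h, hG.1 t x y h, mul_add],
    fun i => (hF.2 i).add (hG.2 i)⟩
  smul_mem' c F hF := ⟨fun t x y h => by simp [hF.1 t x y h, mul_left_comm],
    fun i => contDiff_const.mul (hF.2 i)⟩

instance : AddCommGroup (Dens lam n) := (Dens lam n).addCommGroup

instance : Module ℂ (Dens lam n) := (Dens lam n).module

instance : Ring (Module.End ℂ (Dens lam n)) := Module.End.instRing

variable {lam n}

/-- Multiplication of a density by a smooth function on `RP^n`. -/
instance : SMul (SmoothP n) (Dens lam n) where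
  smul f F := ⟨fun x => f.1 (Projectivization.mk ℝ x.1 x.2) * F.1 x, by
    refine ⟨fun t x y h => ?_, fun i => (f.2 i).mul (F.2.2 i)⟩
    have ht : t ≠ 0 := fun h0 => y.2 (by simp [h, h0])
    have : Projectivization.mk ℝ y.1 y.2 = Projectivization.mk ℝ x.1 x.2 :=
      (Projectivization.mk_eq_mk_iff' ℝ _ _ _ _).2 ⟨t, h.symm⟩
    simp only [this, F.2.1 t x y h]
    ring⟩

lemma dens_smul_apply (f : SmoothP n) (F : Dens lam n) (x : NZ ℝ n) :
    (f • F).1 x = f.1 (Projectivization.mk ℝ x.1 x.2) * F.1 x := rfl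

lemma dens_smul_add (f : SmoothP n) (F G : Dens lam n) : f • (F + G) = f • F + f • G :=
  Subtype.ext (funext fun x => by
    simp only [dens_smul_apply, Submodule.coe_add, Pi.add_apply, mul_add])

lemma dens_smul_smul (f : SmoothP n) (c : ℂ) (F : Dens lam n) : f • c • F = c • f • F :=
  Subtype.ext (funext fun x => by
    simp only [dens_smul_apply, Submodule.coe_smul, Pi.smul_apply, smul_eq_mul, mul_left_comm])

/-- Multiplication by a smooth function as a linear operator on densities. -/
def densMul (f : SmoothP n) : Module.End ℂ (Dens lam n) where
  toFun F := f • F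
  map_add' := dens_smul_add f
  map_smul' c F := dens_smul_smul f c F

/-- Linear differential operators of order at most `k` on `λ`-densities. -/
abbrev IsDensOp (k : ℕ) (D : Module.End ℂ (Dens lam n)) : Prop :=
  IsDiffOp (SmoothP n) k (fun F => D F)

lemma isDensOp_succ {k : ℕ} {D : Module.End ℂ (Dens lam n)} :
    IsDensOp (k + 1) D ↔ ∀ f : SmoothP n, IsDensOp k (D * densMul f - densMul f * D) := Iff.rfl

lemma isDensOp_zero {D : Module.End ℂ (Dens lam n)} :
    IsDensOp 0 D ↔ ∀ f : SmoothP n, D * densMul f - densMul f * D = 0 :=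
  forall_congr' fun f => by
    refine Iff.trans ?_ (sub_eq_zero (a := D * densMul f) (b := densMul f * D)).symm
    exact ⟨fun h => LinearMap.ext h, fun h F => congrArg (fun L : Module.End ℂ _ => L F) h⟩

lemma isDensOp_of_zero (k : ℕ) : IsDensOp k (0 : Module.End ℂ (Dens lam n)) := by
  induction k with
  | zero => rw [isDensOp_zero]; simp
  | succ k ih => rw [isDensOp_succ]; simpa using ih

lemma IsDensOp.succ {k : ℕ} {D : Module.End ℂ (Dens lam n)} (h : IsDensOp k D) :
    IsDensOp (k + 1) D := by
  induction k generalizing D with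
  | zero =>
    rw [isDensOp_succ]
    intro f
    rw [isDensOp_zero.1 h f]
    exact isDensOp_of_zero 0
  | succ k ih => exact isDensOp_succ.2 fun f => ih (isDensOp_succ.1 h f)

lemma IsDensOp.mono {k l : ℕ} {D : Module.End ℂ (Dens lam n)} (h : IsDensOp k D) (hkl : k ≤ l) :
    IsDensOp l D := Nat.le_induction h (fun _ _ h => h.succ) l hkl

lemma IsDensOp.add {k : ℕ} {D D' : Module.End ℂ (Dens lam n)} (h : IsDensOp k D)
    (h' : IsDensOp k D') : IsDensOp k (D + D') := by
  have key : ∀ f : SmoothP n, (D + D') * densMul f - densMul f * (D + D') =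
      (D * densMul f - densMul f * D) + (D' * densMul f - densMul f * D') := fun f => by
    noncomm_ring
  induction k generalizing D D' with
  | zero =>
    rw [isDensOp_zero] at h h' ⊢
    intro f
    rw [key, h, h', add_zero]
  | succ k ih =>
    refine isDensOp_succ.2 fun f => ?_
    rw [key]
    exact ih (isDensOp_succ.1 h f) (isDensOp_succ.1 h' f) fun g => by noncomm_ring

lemma IsDensOp.mul {k l : ℕ} {D D' : Module.End ℂ (Dens lam n)} (h : IsDensOp k D)
    (h' : IsDensOp l D') : IsDensOp (k + l) (D * D') := by
  have key : ∀ (D D' : Module.End ℂ (Dens lam n)) (f : SmoothP n),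
      (D * D') * densMul f - densMul f * (D * D') =
      D * (D' * densMul f - densMul f * D') + (D * densMul f - densMul f * D) * D' := by
    intro D D' f
    noncomm_ring
  obtain ⟨N, hN⟩ : ∃ N, N = k + l := ⟨_, rfl⟩
  induction N generalizing k l D D' with
  | zero =>
    obtain ⟨rfl, rfl⟩ : k = 0 ∧ l = 0 := by omega
    refine isDensOp_zero.2 fun f => ?_
    rw [key, isDensOp_zero.1 h f, isDensOp_zero.1 h' f]
    simp
  | succ N ih =>
    rw [← hN]
    refine isDensOp_succ.2 fun f => ?_
    rw [key]
    refine IsDensOp.add ?_ ?_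
    · cases l with
      | zero =>
        rw [isDensOp_zero.1 h' f, mul_zero]
        exact isDensOp_of_zero _
      | succ l =>
        have := ih h (isDensOp_succ.1 h' f) (by omega)
        exact this.mono (by omega)
    · cases k with
      | zero =>
        rw [isDensOp_zero.1 h f, zero_mul]
        exact isDensOp_of_zero _
      | succ k =>
        have := ih (isDensOp_succ.1 h f) h' (by omega)
        exact this.mono (by omega)

variable (lam n) in
/-- The algebra `ℬ^λ` of smooth linear differential operators on `λ`-densities on `RP^n`. -/
def DensOps : Subalgebra ℂ (Module.End ℂ (Dens lam n)) where
  carrier := {D | ∃ k, IsDensOp k D}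
  mul_mem' := fun ⟨k, h⟩ ⟨l, h'⟩ => ⟨k + l, h.mul h'⟩
  add_mem' := fun ⟨k, h⟩ ⟨l, h'⟩ =>
    ⟨max k l, (h.mono (le_max_left k l)).add (h'.mono (le_max_right k l))⟩
  algebraMap_mem' c := ⟨0, fun f F => by
    simp only [Module.algebraMap_end_apply, dens_smul_smul]⟩

/-- `φ ∈ 𝒜^d` is the principal symbol of the differential operator `D` of order at most `d`: if
`f` is a real smooth function vanishing at a point, then `D (f^d F) = d! φ(df) F` there. -/
def HasSymbol (d : ℕ) (D : Module.End ℂ (Dens lam n)) (φ : SmoothT n) : Prop :=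
  IsDensOp d D ∧ ∀ (f : SmoothP n) (i : Fin (n + 1)) (u : Fin n → ℝ) (F : Dens lam n),
    (∀ l, (f.1 l).im = 0) → f.1 (projChart i u) = 0 →
    (D (f ^ d • F)).1 (nzChart i u) = (d.factorial : ℂ) *
      φ.1 (cotChart i u fun k =>
        fderiv ℝ (fun u' : Fin n → ℝ => (f.1 (projChart i u')).re) u (Pi.single k 1)) *
      F.1 (nzChart i u)

/-- `φ' = X · φ`: infinitesimal action of `X` on functions on `T*RP^n` (it equals `{μ^X, φ}` up to
the sign convention for the bracket). -/
def IsInfT (X : Matrix (Fin (n + 1)) (Fin (n + 1)) ℝ) (φ φ' : SmoothT n) : Prop :=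
  ∀ m, HasDerivAt (fun t : ℝ => φ.1 (cotAct (expFlow X t) m)) (φ'.1 m) 0

/-- `F' = X · F`: infinitesimal action (Lie derivative) of `X` on `λ`-densities. For `X` of trace
zero the flow preserves `vol`, so that it acts on `F(x) |ι_x vol|^λ` through `F` alone. -/
def IsInfDens (X : Matrix (Fin (n + 1)) (Fin (n + 1)) ℝ) (F F' : Dens lam n) : Prop :=
  ∀ x, HasDerivAt (fun t : ℝ => F.1 (nzAct (expFlow X t) x)) (F'.1 x) 0

/-- `Q : 𝒜 → ℬ^λ` is an `SL_{n+1}(ℝ)`-equivariant quantization map: a linear isomorphism, with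
`φ` the principal symbol of `Q φ` for `φ ∈ 𝒜^d`, equivariant for the group, `Q (g φ) = g (Q φ) g⁻¹`,
and for its Lie algebra, `Q (X · φ) = [X, Q φ]`. -/
structure IsEquivariantQuantization (Q : Pol n ≃ₗ[ℂ] DensOps lam n) : Prop where
  symbol : ∀ (d : ℕ) (φ : Pol n), φ.1 ∈ PolDeg n d → HasSymbol d (Q φ).1 φ.1
  equivariant : ∀ (g : Matrix.SpecialLinearGroup (Fin (n + 1)) ℝ) (φ φ' : Pol n)
    (F F' : Dens lam n), (∀ m, φ'.1.1 (cotAct (slGL g) m) = φ.1.1 m) →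
    (∀ x, F'.1 (nzAct (slGL g) x) = F.1 x) →
    ∀ x, ((Q φ').1 F').1 (nzAct (slGL g) x) = ((Q φ).1 F).1 x
  inf_equivariant : ∀ X : Matrix (Fin (n + 1)) (Fin (n + 1)) ℝ, X.trace = 0 →
    ∀ φ φ' : Pol n, IsInfT X φ.1 φ'.1 → ∀ F F' : Dens lam n, IsInfDens X F F' →
    IsInfDens X ((Q φ).1 F) ((Q φ').1 F + (Q φ).1 F')

/-- The coefficient `C_p` of the star product `φ ⋆ ψ = Q_t⁻¹ (Q_t φ · Q_t ψ) = ∑ C_p(φ, ψ) t^p`,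
where `Q_t φ = t^d Q φ` for `φ ∈ 𝒜^d`. For `φ ∈ 𝒜^j`, `ψ ∈ 𝒜^k`, the operator
`t^{j+k} Q φ Q ψ` is the image under `Q_t` of `∑_d t^{j+k-d} (Q⁻¹ (Q φ Q ψ))_d`, so that
`C_p(φ, ψ)` is the component of degree `j + k - p` of `Q⁻¹ (Q φ Q ψ)`. -/
def starCoeff (Q : Pol n ≃ₗ[ℂ] DensOps lam n) (p : ℕ) (φ ψ : Pol n) : Pol n :=
  open Classical in
  ∑ j ∈ (components φ).support, ∑ k ∈ (components ψ).support,
    if p ≤ j + k then comp (j + k - p) (Q.symm (Q (comp j φ) * Q (comp k ψ))) else 0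

/-- `C_p(φ, ψ) = T_p⁻¹ Z (S_p⁻¹ φ, S_p⁻¹ ψ)`; in particular `Z (S_p⁻¹ φ, S_p⁻¹ ψ)` is in `𝒜`. -/
def StarForm (Q : Pol n ≃ₗ[ℂ] DensOps lam n) (p : ℕ)
    (Z : SmoothT n →ₗ[ℂ] SmoothT n →ₗ[ℂ] SmoothT n) (φ ψ : Pol n) : Prop :=
  ∃ ζ : Pol n, ζ.1 = Z (Ring.inverse (opS n p) φ).1 (Ring.inverse (opS n p) ψ).1 ∧
    starCoeff Q p φ ψ = Ring.inverse (opT n p) ζ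

/-- `SL_{n+1}(ℝ)`-invariance of a bilinear operator on `C^∞(T*RP^n)`:
`Z (g f, g h) = g Z (f, h)`. -/
def IsSLRInvariant (Z : SmoothT n →ₗ[ℂ] SmoothT n →ₗ[ℂ] SmoothT n) : Prop :=
  ∀ (g : Matrix.SpecialLinearGroup (Fin (n + 1)) ℝ) (f f' h h' : SmoothT n),
    (∀ m, f'.1 (cotAct (slGL g) m) = f.1 m) → (∀ m, h'.1 (cotAct (slGL g) m) = h.1 m) →
    ∀ m, (Z f' h').1 (cotAct (slGL g) m) = (Z f h).1 m

end Densities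

/-! ### The complex algebraic variety `T*CP^n` -/

section Algebraic

variable (n : ℕ)

/-- Zariski open subsets of `T*CP^n`, glued from the `n + 1` affine charts `T*ℂ^n = ℂ^{2n}`. -/
structure ZOpen where
  carrier : Set (CotP ℂ n)
  isOpen : ∀ i : Fin (n + 1), ∃ S : Set (MvPolynomial (Fin n ⊕ Fin n) ℂ), ∀ u ξ : Fin n → ℂ,
    cotChart i u ξ ∈ carrier ↔ ∃ P ∈ S, MvPolynomial.eval (Sum.elim u ξ) P ≠ 0

variable {n}

/-- The algebra `O(U)` of regular functions: in each affine chart, locally a quotient of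
polynomials. -/
def Reg (U : ZOpen n) : Subalgebra ℂ (U.carrier → ℂ) where
  carrier := {φ | ∀ (i : Fin (n + 1)) (u ξ : Fin n → ℂ), cotChart i u ξ ∈ U.carrier →
    ∃ P R : MvPolynomial (Fin n ⊕ Fin n) ℂ, MvPolynomial.eval (Sum.elim u ξ) R ≠ 0 ∧
      ∀ (u' ξ' : Fin n → ℂ) (h : cotChart i u' ξ' ∈ U.carrier),
        MvPolynomial.eval (Sum.elim u' ξ') R ≠ 0 → φ ⟨cotChart i u' ξ', h⟩ =
          MvPolynomial.eval (Sum.elim u' ξ') P / MvPolynomial.eval (Sum.elim u' ξ') R}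
  mul_mem' := by
    intro φ ψ hφ hψ i u ξ h
    obtain ⟨P, R, h1, h2⟩ := hφ i u ξ h
    obtain ⟨P', R', h1', h2'⟩ := hψ i u ξ h
    refine ⟨P * P', R * R', by simp [h1, h1'], fun u' ξ' h' hR => ?_⟩
    rw [map_mul] at hR
    rw [Pi.mul_apply, h2 _ _ h' (left_ne_zero_of_mul hR), h2' _ _ h' (right_ne_zero_of_mul hR),
      map_mul, map_mul, div_mul_div_comm]
  add_mem' := by
    intro φ ψ hφ hψ i u ξ h
    obtain ⟨P, R, h1, h2⟩ := hφ i u ξ h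
    obtain ⟨P', R', h1', h2'⟩ := hψ i u ξ h
    refine ⟨P * R' + R * P', R * R', by simp [h1, h1'], fun u' ξ' h' hR => ?_⟩
    rw [map_mul] at hR
    rw [Pi.add_apply, h2 _ _ h' (left_ne_zero_of_mul hR), h2' _ _ h' (right_ne_zero_of_mul hR),
      map_mul, map_add, map_mul, map_mul,
      div_add_div _ _ (left_ne_zero_of_mul hR) (right_ne_zero_of_mul hR)]
  algebraMap_mem' c i u ξ h := ⟨MvPolynomial.C c, 1, by simp, fun u' ξ' h' _ => by
    simp [Pi.algebraMap_apply]⟩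

variable (n) in
/-- An algebraic bidifferential operator on `T*CP^n`: a bilinear morphism of sheaves `O × O → O`
which is bidifferential. -/
structure AlgBidiffOp where
  toFun : ∀ U : ZOpen n, Reg U →ₗ[ℂ] Reg U →ₗ[ℂ] Reg U
  restrict : ∀ (U V : ZOpen n) (hVU : V.carrier ⊆ U.carrier) (φ ψ : Reg U) (φ' ψ' : Reg V),
    (∀ m : V.carrier, φ'.1 m = φ.1 ⟨m, hVU m.2⟩) → (∀ m : V.carrier, ψ'.1 m = ψ.1 ⟨m, hVU m.2⟩) →
    ∀ m : V.carrier, (toFun V φ' ψ').1 m = (toFun U φ ψ).1 ⟨m, hVU m.2⟩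
  bidiff : ∃ k, ∀ U, IsBidiffOfOrder k (toFun U)

variable (n) in
/-- An algebraic differential operator on `T*CP^n`: a linear morphism of sheaves `O → O` which is
a differential operator. -/
structure AlgDiffOp where
  toFun : ∀ U : ZOpen n, Reg U →ₗ[ℂ] Reg U
  restrict : ∀ (U V : ZOpen n) (hVU : V.carrier ⊆ U.carrier) (φ : Reg U) (φ' : Reg V),
    (∀ m : V.carrier, φ'.1 m = φ.1 ⟨m, hVU m.2⟩) →
    ∀ m : V.carrier, (toFun V φ').1 m = (toFun U φ).1 ⟨m, hVU m.2⟩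
  diff : ∃ k, ∀ U, IsDiffOp (Reg U) k (fun φ => toFun U φ)

/-- `φ'` on `V = g U` is the translate `g φ` of the regular function `φ` on `U`. -/
def IsTranslate (g : Matrix.SpecialLinearGroup (Fin (n + 1)) ℂ) {U V : ZOpen n}
    (hUV : ∀ m, cotAct (slGL g) m ∈ V.carrier ↔ m ∈ U.carrier) (φ : Reg U) (φ' : Reg V) : Prop :=
  ∀ m : U.carrier, φ'.1 ⟨cotAct (slGL g) m, (hUV m).2 m.2⟩ = φ.1 m

/-- `SL_{n+1}(ℂ)`-invariance. -/
def AlgBidiffOp.IsInvariant (Z : AlgBidiffOp n) : Prop :=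
  ∀ (g : Matrix.SpecialLinearGroup (Fin (n + 1)) ℂ) (U V : ZOpen n)
    (hUV : ∀ m, cotAct (slGL g) m ∈ V.carrier ↔ m ∈ U.carrier) (φ ψ : Reg U) (φ' ψ' : Reg V),
    IsTranslate g hUV φ φ' → IsTranslate g hUV ψ ψ' →
    IsTranslate g hUV (Z.toFun U φ ψ) (Z.toFun V φ' ψ')

/-- `SL_{n+1}(ℂ)`-invariance. -/
def AlgDiffOp.IsInvariant (L : AlgDiffOp n) : Prop :=
  ∀ (g : Matrix.SpecialLinearGroup (Fin (n + 1)) ℂ) (U V : ZOpen n)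
    (hUV : ∀ m, cotAct (slGL g) m ∈ V.carrier ↔ m ∈ U.carrier) (φ : Reg U) (φ' : Reg V),
    IsTranslate g hUV φ φ' → IsTranslate g hUV (L.toFun U φ) (L.toFun V φ')

/-- The point of `T*CP^n` given by the real point of `T*RP^n` with Darboux coordinates `w`. -/
def realPt (i : Fin (n + 1)) (w : (Fin n → ℝ) × (Fin n → ℝ)) : CotP ℂ n :=
  cotChart i (fun k => (w.1 k : ℂ)) (fun k => (w.2 k : ℂ))

/-- The smooth function `f` on `T*RP^n` coincides, near the real point with coordinates `w`, with
the restriction of the regular function `φ`. -/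
def GermEq {U : ZOpen n} (i : Fin (n + 1)) (w : (Fin n → ℝ) × (Fin n → ℝ)) (f : SmoothT n)
    (φ : Reg U) : Prop :=
  ∀ᶠ w' in nhds w, ∃ h : realPt i w' ∈ U.carrier, f.1 (cotChart i w'.1 w'.2) = φ.1 ⟨realPt i w', h⟩

/-- The algebraic bidifferential operator `Zc` on `T*CP^n` extends the operator `Z` on `T*RP^n`. -/
def AlgBidiffOp.Extends (Zc : AlgBidiffOp n)
    (Z : SmoothT n →ₗ[ℂ] SmoothT n →ₗ[ℂ] SmoothT n) : Prop :=
  ∀ (U : ZOpen n) (φ ψ : Reg U) (f h : SmoothT n) (i : Fin (n + 1))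
    (w : (Fin n → ℝ) × (Fin n → ℝ)), GermEq i w f φ → GermEq i w h ψ →
    GermEq i w (Z f h) (Zc.toFun U φ ψ)

/-- The algebraic differential operator `Lc` on `T*CP^n` extends the operator `L` on `T*RP^n`. -/
def AlgDiffOp.Extends (Lc : AlgDiffOp n) (L : SmoothT n →ₗ[ℂ] SmoothT n) : Prop :=
  ∀ (U : ZOpen n) (φ : Reg U) (f : SmoothT n) (i : Fin (n + 1))
    (w : (Fin n → ℝ) × (Fin n → ℝ)), GermEq i w f φ → GermEq i w (L f) (Lc.toFun U φ)

end Algebraic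

end StarProj

end

set_option linter.unusedSectionVars false

noncomputable section

namespace StarProj

open scoped ContDiff LinearAlgebra.Projectivization

open Finset Polynomial TopologicalSpace

/-! The cotangent bundle of projective space is the cone `J = ∑ x_a ξ_a = 0`, `x ≠ 0`, in the space
of pairs `(x, ξ)`, divided by the scalings `(x, ξ) ↦ (t x, t⁻¹ ξ)`. Half-densities are functions of
`x` of weight `-(n + 1) / 2`. Upstairs the natural operators have a simple form and commute with
linear changes of coordinates: the terms `star q` of the composition of standard ordered symbols,
the divergence `lap`, and the fibrewise Euler operator `E`. The problem is to find combinations of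
them that descend to the quotient, that is, that send `J` times an invariant function to a multiple
of `J`. On invariant functions `lap` and multiplication by `J` generate an `sl₂`-triple
(`lap_J_mul`), and descent becomes a two-term recursion on coefficients.

Quantization. The operator attached to a symbol `f` of degree `d` is `F ↦ ∑ quantCoeff · star (d -
s) (lap^s f) F`. The coefficients make the series of `J * g` equal to the composition of `J + (n +
1) / 2` with another series. As the Euler field plus `(n + 1) / 2` kills half-densities, only a
multiple of `J` remains (`quantOp_J`). The same formula holds in every affine chart (`Homogenize`),
so the operators glue and are equivariant (`ChartEq.quantOp`). Bijectivity is an induction on the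
order through principal symbols (`quantEnd_surj`, `quantEnd_eq_zero`). For uniqueness, the Casimir
operator acts on symbols of degree `d` by `2 d (d + n)`, and these numbers are distinct. Hence two
equivariant quantizations differ by a map preserving the degree, which is the identity by the symbol
condition (`isEquivariantQuantization_unique`).

Star product. Composing quantized operators means passing to standard ordered symbols, composing
there and coming back with the inverse coefficients `symbCoeff` (`quantOp_comp`,
`sum_quantOp_symbCoeff`). So `C_p` is a sum over `s + q + a + b = p` of terms `lap^s (star q (lap^a
φ) (lap^b ψ))` with coefficients rational in the degrees. With `X = n + 2 d`, the numerators of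
`quantCoeff` are the `X - (2 r + 1)` and the denominators the `X - (r + 1)`; for half-densities the
odd denominators cancel. Only `X - 2 i` with `i ≤ p / 2` remain, and these are cleared by `S_p`; the
reflected factors `X + 2 i` of `symbCoeff` are cleared by `T_p`. What is left is `bidiff`, with
polynomial coefficients `sig` and `tau` in `n + 2 E` (`bidiff_eq`). These satisfy the same
recursions, so `bidiff` descends on all functions, not only on fibrewise polynomial ones
(`bidiff_J_left`, `bidiff_J_right`, `ChartEq.bidiff`). For odd `n` the number `n / 2 + d` is never
an integer, so `S_p` is invertible.

Descent is proved without dividing by `J`: `slide` deforms the identity into a retraction onto the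
cone, the derivative along the deformation is a multiple of `J`, and a natural operator preserving
multiples of `J` is therefore constant along it on the cone (`eq_on_cone_of_natural`). The argument
works over `ℝ` and over `ℂ` at once.

Determination by the momentum algebra. Off the zero section the differentials of momentum functions
span the cotangent spaces, so momentum functions approximate every function to any finite order at
such a point. A differential operator vanishing on them vanishes there, and on the zero section by
continuity (`diffOp_eq_zero_of_momentum`).

Complexification. The chart formula preserves functions that are locally quotients of polynomials,
so it defines an algebraic operator, and complex partial derivatives restrict to real ones at real
points. The extension is unique because the real points are Zariski dense and every germ of a
regular function at a real point comes from a smooth function (`reg_eq_of_real`, `exists_germEq`).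
-/

/-! ### Commuting derivations with canonical coordinates -/

/-- A commutative algebra with coordinates `x_a, ξ_a` and the commuting partial derivatives with
respect to them. -/
structure Darboux (ι : Type) [Fintype ι] [DecidableEq ι] (O : Type) [CommRing O] [Algebra ℂ O] where
  dx : ι → Derivation ℂ O O
  dξ : ι → Derivation ℂ O O
  x : ι → O
  ξ : ι → O
  dx_dx : ∀ a b f, dx a (dx b f) = dx b (dx a f)
  dx_dξ : ∀ a b f, dx a (dξ b f) = dξ b (dx a f)
  dξ_dξ : ∀ a b f, dξ a (dξ b f) = dξ b (dξ a f)
  dx_x : ∀ a b, dx a (x b) = if a = b then 1 else 0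
  dx_ξ : ∀ a b, dx a (ξ b) = 0
  dξ_x : ∀ a b, dξ a (x b) = 0
  dξ_ξ : ∀ a b, dξ a (ξ b) = if a = b then 1 else 0

namespace Darboux

variable {ι : Type} [Fintype ι] [DecidableEq ι] {O : Type} [CommRing O] [Algebra ℂ O]
  (S : Darboux ι O)

/-- The fibrewise Euler operator `∑ ξ_a ∂/∂ξ_a`. -/
def E : Module.End ℂ O := ∑ a, LinearMap.mulLeft ℂ (S.ξ a) * (S.dξ a).toLinearMap

/-- The Euler operator `∑ x_a ∂/∂x_a`. -/
def Ex : Module.End ℂ O := ∑ a, LinearMap.mulLeft ℂ (S.x a) * (S.dx a).toLinearMap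

/-- The divergence `∑ ∂²/∂x_a∂ξ_a`. -/
def lap : Module.End ℂ O := ∑ a, (S.dx a).toLinearMap * (S.dξ a).toLinearMap

/-- The moment `∑ x_a ξ_a` of the scalings. -/
def J : O := ∑ a, S.x a * S.ξ a

/-- `(∑ ∂/∂ξ_a ⊗ ∂/∂x_a)^q`. -/
def D : ℕ → O →ₗ[ℂ] O →ₗ[ℂ] O
  | 0 => LinearMap.mul ℂ O
  | q + 1 => ∑ a, (D q).compl₁₂ (S.dξ a).toLinearMap (S.dx a).toLinearMap

/-- The term of degree `-q` of the composition of standard ordered symbols. -/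
def star (q : ℕ) : O →ₗ[ℂ] O →ₗ[ℂ] O := ((q.factorial : ℂ)⁻¹) • S.D q

lemma E_apply (f : O) : S.E f = ∑ a, S.ξ a * S.dξ a f := by simp [E]

lemma Ex_apply (f : O) : S.Ex f = ∑ a, S.x a * S.dx a f := by simp [Ex]

lemma lap_apply (f : O) : S.lap f = ∑ a, S.dx a (S.dξ a f) := by simp [lap]

lemma star_zero (f g : O) : S.star 0 f g = f * g := by simp [star, D]

lemma star_succ (q : ℕ) (f g : O) :
    ((q : ℂ) + 1) • S.star (q + 1) f g = ∑ a, S.star q (S.dξ a f) (S.dx a g) := by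
  simp only [star, D, LinearMap.smul_apply, LinearMap.sum_apply, LinearMap.compl₁₂_apply,
    Derivation.coeFn_coe, ← Finset.smul_sum, smul_smul]
  congr 1
  have h : ((q : ℂ) + 1) ≠ 0 := by exact_mod_cast Nat.succ_ne_zero q
  rw [Nat.factorial_succ]
  push_cast
  field_simp

/-- The recursion `star_succ` determines `star (q + 1)` only after multiplication by `q + 1`;
cancelling this nonzero scalar opens the inductions on `q` below. -/
lemma star_ext {q : ℕ} {u v : O} (h : ((q : ℂ) + 1) • u = ((q : ℂ) + 1) • v) : u = v := by
  have hq : ((q : ℂ) + 1) ≠ 0 := by exact_mod_cast Nat.succ_ne_zero q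
  have := congrArg (fun w => ((q : ℂ) + 1)⁻¹ • w) h
  simpa [smul_smul, inv_mul_cancel₀ hq] using this

lemma star_one (f g : O) : S.star 1 f g = ∑ a, S.dξ a f * S.dx a g := by
  have := S.star_succ 0 f g
  simpa [star_zero] using this

/-- `star q` has constant coefficients, so the Leibniz rule holds for every derivation commuting
with the partial derivatives. Besides these, the derivative along an external parameter is of this
kind. -/
lemma deriv_star (d : Derivation ℂ O O) (h1 : ∀ a f, d (S.dx a f) = S.dx a (d f))
    (h2 : ∀ a f, d (S.dξ a f) = S.dξ a (d f)) (q : ℕ) (f g : O) :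
    d (S.star q f g) = S.star q (d f) g + S.star q f (d g) := by
  induction q generalizing f g with
  | zero => simp [star_zero, mul_comm, add_comm]
  | succ q ih =>
    apply star_ext (q := q)
    rw [← d.map_smul, smul_add, star_succ, star_succ, star_succ, map_sum, ← sum_add_distrib]
    simp only [ih, h1, h2]

lemma dx_star (a : ι) (q : ℕ) (f g : O) :
    S.dx a (S.star q f g) = S.star q (S.dx a f) g + S.star q f (S.dx a g) :=
  S.deriv_star _ (fun b f => S.dx_dx a b f) (fun b f => S.dx_dξ a b f) q f g

lemma dξ_star (a : ι) (q : ℕ) (f g : O) :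
    S.dξ a (S.star q f g) = S.star q (S.dξ a f) g + S.star q f (S.dξ a g) :=
  S.deriv_star _ (fun b f => (S.dx_dξ b a f).symm) (fun b f => S.dξ_dξ a b f) q f g

lemma star_mul_left {m : O} (h : ∀ a, S.dξ a m = 0) (q : ℕ) (f g : O) :
    S.star q (m * f) g = m * S.star q f g := by
  induction q generalizing f g with
  | zero => simp [star_zero, mul_assoc]
  | succ q ih =>
    apply star_ext (q := q)
    rw [star_succ, ← mul_smul_comm, star_succ, mul_sum]
    simp [h, ih]

lemma star_mul_right {m : O} (h : ∀ a, S.dx a m = 0) (q : ℕ) (f g : O) :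
    S.star q f (m * g) = m * S.star q f g := by
  induction q generalizing f g with
  | zero => simp [star_zero]; ring
  | succ q ih =>
    apply star_ext (q := q)
    rw [star_succ, ← mul_smul_comm, star_succ, mul_sum]
    simp [h, ih]

/-- The commutator of `∑ ∂/∂ξ_a ⊗ ∂/∂x_a` with multiplication by `ξ_c` in the first slot is `∂/∂x_c`
in the second slot. -/
lemma star_ξ_left (c : ι) (q : ℕ) (f g : O) :
    S.star (q + 1) (S.ξ c * f) g = S.ξ c * S.star (q + 1) f g + S.star q f (S.dx c g) := by
  induction q generalizing f g with
  | zero =>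
    simp only [zero_add, star_one, star_zero, Derivation.leibniz, S.dξ_ξ, smul_eq_mul, add_mul,
      sum_add_distrib, mul_sum]
    simp [mul_assoc]
  | succ q ih =>
    apply star_ext (q := q + 1)
    rw [star_succ, smul_add, ← mul_smul_comm, star_succ, mul_sum]
    have h1 : ∀ a, S.star (q + 1) (S.dξ a (S.ξ c * f)) (S.dx a g) =
        S.ξ c * S.star (q + 1) (S.dξ a f) (S.dx a g) + (S.star q (S.dξ a f) (S.dx a (S.dx c g)) +
          if a = c then S.star (q + 1) f (S.dx c g) else 0) := by
      intro a
      rw [Derivation.leibniz, S.dξ_ξ, map_add, LinearMap.add_apply, smul_eq_mul, ih, S.dx_dx c a,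
        add_assoc]
      congr 2
      split_ifs with h
      · subst h; simp
      · simp
    simp only [h1, sum_add_distrib, sum_ite_eq', mem_univ, if_true, ← star_succ]
    push_cast
    rw [add_smul ((q : ℂ) + 1) 1, one_smul]

/-- Mirror image of `star_ξ_left`: multiplication by `x_c` in the second slot leaves `∂/∂ξ_c` in the
first. -/
lemma star_x_right (c : ι) (q : ℕ) (f g : O) :
    S.star (q + 1) f (S.x c * g) = S.x c * S.star (q + 1) f g + S.star q (S.dξ c f) g := by
  induction q generalizing f g with
  | zero =>
    simp only [zero_add, star_one, star_zero, Derivation.leibniz, S.dx_x, smul_eq_mul, mul_add,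
      sum_add_distrib, mul_sum]
    simp [mul_left_comm]
  | succ q ih =>
    apply star_ext (q := q + 1)
    rw [star_succ, smul_add, ← mul_smul_comm, star_succ, mul_sum]
    have h1 : ∀ a, S.star (q + 1) (S.dξ a f) (S.dx a (S.x c * g)) =
        S.x c * S.star (q + 1) (S.dξ a f) (S.dx a g) + (S.star q (S.dξ a (S.dξ c f)) (S.dx a g) +
          if a = c then S.star (q + 1) (S.dξ c f) g else 0) := by
      intro a
      rw [Derivation.leibniz, S.dx_x, map_add, smul_eq_mul, ih, S.dξ_dξ c a, add_assoc]
      congr 2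
      split_ifs with h
      · subst h; simp
      · simp
    simp only [h1, sum_add_distrib, sum_ite_eq', mem_univ, if_true, ← star_succ]
    push_cast
    rw [add_smul ((q : ℂ) + 1) 1, one_smul]

lemma star_x_left (c : ι) (q : ℕ) (f g : O) :
    S.star q (S.x c * f) g = S.x c * S.star q f g := S.star_mul_left (fun a => S.dξ_x a c) q f g

lemma star_ξ_right (c : ι) (q : ℕ) (f g : O) :
    S.star q f (S.ξ c * g) = S.ξ c * S.star q f g := S.star_mul_right (fun a => S.dx_ξ a c) q f g

/-- Each of the `q` derivatives `∂/∂ξ` lowers the fibre degree by one. `Ex_star` is the same count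
for `x`. -/
lemma E_star (q : ℕ) (f g : O) :
    S.E (S.star q f g) = S.star q (S.E f) g + S.star q f (S.E g) - (q : ℂ) • S.star q f g := by
  cases q with
  | zero =>
    simp only [star_zero, E_apply, Derivation.leibniz, smul_eq_mul, mul_add, sum_add_distrib,
      sum_mul, mul_sum]
    simp only [CharP.cast_eq_zero, zero_smul, sub_zero]
    rw [add_comm]
    congr 1 <;> exact sum_congr rfl fun a _ => by ring
  | succ q =>
    push_cast
    rw [star_succ, E_apply, E_apply, E_apply]
    simp only [dξ_star, map_sum, LinearMap.sum_apply, star_ξ_left, star_ξ_right, mul_add,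
      sum_add_distrib]
    abel

lemma Ex_star (q : ℕ) (f g : O) :
    S.Ex (S.star q f g) = S.star q (S.Ex f) g + S.star q f (S.Ex g) - (q : ℂ) • S.star q f g := by
  cases q with
  | zero =>
    simp only [star_zero, Ex_apply, Derivation.leibniz, smul_eq_mul, mul_add, sum_add_distrib,
      sum_mul, mul_sum]
    simp only [CharP.cast_eq_zero, zero_smul, sub_zero]
    rw [add_comm]
    congr 1 <;> exact sum_congr rfl fun a _ => by ring
  | succ q =>
    push_cast
    rw [star_succ, Ex_apply, Ex_apply, Ex_apply]
    simp only [dx_star, map_sum, LinearMap.sum_apply, star_x_left, star_x_right, mul_add,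
      sum_add_distrib]
    abel

/-- Composing with the symbol `J` on the left is `a ↦ J * a + Ex a`, so this is one degree of the
associativity `(J ∘ a) ∘ b = J ∘ (a ∘ b)`. -/
lemma star_J_left (q : ℕ) (a b : O) :
    S.star (q + 1) (S.J * a) b + S.star q (S.Ex a) b =
      S.J * S.star (q + 1) a b + S.Ex (S.star q a b) := by
  simp only [J, Ex_apply, sum_mul, map_sum, LinearMap.sum_apply, mul_assoc, star_x_left,
    star_ξ_left, dx_star, mul_add, sum_add_distrib]
  abel

/-- Composing with `J` on the right is `b ↦ J * b + E b`: the two sides of `J` produce the two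
different Euler operators. -/
lemma star_J_right (q : ℕ) (a b : O) :
    S.star (q + 1) a (S.J * b) + S.star q a (S.E b) =
      S.J * S.star (q + 1) a b + S.E (S.star q a b) := by
  have hJ : S.J = ∑ c, S.ξ c * S.x c := by simp only [J, mul_comm]
  simp only [hJ, E_apply, sum_mul, map_sum, mul_assoc, star_ξ_right,
    star_x_right, dξ_star, mul_add, sum_add_distrib]
  abel

/-- Graded associativity of the composition of standard ordered symbols. -/
lemma star_assoc (r : ℕ) (f g h : O) :
    ∑ i ∈ antidiagonal r, S.star i.2 (S.star i.1 f g) h =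
      ∑ i ∈ antidiagonal r, S.star i.2 f (S.star i.1 g h) := by
  induction r generalizing f g h with
  | zero => simp [star_zero, mul_assoc]
  | succ r ih =>
    apply star_ext (q := r)
    -- Writing `r + 1` as the sum of the two indices makes `star_succ` applicable to one factor of
    -- each term, which brings the sum down to total degree `r` with differentiated arguments.
    have key : ∀ T : ℕ × ℕ → O, ((r : ℂ) + 1) • ∑ i ∈ antidiagonal (r + 1), T i =
        ∑ i ∈ antidiagonal r, ((i.1 : ℂ) + 1) • T (i.1 + 1, i.2) +
        ∑ i ∈ antidiagonal r, ((i.2 : ℂ) + 1) • T (i.1, i.2 + 1) := by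
      intro T
      have h1 : ∀ i ∈ antidiagonal (r + 1), ((r : ℂ) + 1) • T i =
          (i.1 : ℂ) • T i + (i.2 : ℂ) • T i := by
        intro i hi
        rw [← add_smul]
        congr 1
        exact_mod_cast (mem_antidiagonal.1 hi).symm
      rw [smul_sum, sum_congr rfl h1, sum_add_distrib]
      congr 1
      · rw [Finset.Nat.sum_antidiagonal_succ]
        simp
      · rw [Finset.Nat.sum_antidiagonal_succ']
        simp
    rw [key, key]
    have l1 : ∀ i : ℕ × ℕ, ((i.1 : ℂ) + 1) • S.star i.2 (S.star (i.1 + 1) f g) h =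
        ∑ a, S.star i.2 (S.star i.1 (S.dξ a f) (S.dx a g)) h := fun i => by
      rw [← LinearMap.smul_apply, ← map_smul, star_succ, map_sum, LinearMap.sum_apply]
    have l2 : ∀ i : ℕ × ℕ, ((i.2 : ℂ) + 1) • S.star (i.2 + 1) (S.star i.1 f g) h =
        ∑ a, (S.star i.2 (S.star i.1 (S.dξ a f) g) (S.dx a h) +
          S.star i.2 (S.star i.1 f (S.dξ a g)) (S.dx a h)) := fun i => by
      rw [star_succ]
      simp only [dξ_star, map_add, LinearMap.add_apply]
    have l3 : ∀ i : ℕ × ℕ, ((i.1 : ℂ) + 1) • S.star i.2 f (S.star (i.1 + 1) g h) =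
        ∑ a, S.star i.2 f (S.star i.1 (S.dξ a g) (S.dx a h)) := fun i => by
      rw [← map_smul, star_succ, map_sum]
    have l4 : ∀ i : ℕ × ℕ, ((i.2 : ℂ) + 1) • S.star (i.2 + 1) f (S.star i.1 g h) =
        ∑ a, (S.star i.2 (S.dξ a f) (S.star i.1 (S.dx a g) h) +
          S.star i.2 (S.dξ a f) (S.star i.1 g (S.dx a h))) := fun i => by
      rw [star_succ]
      simp only [dx_star, map_add]
    simp only [l1, l2, l3, l4, sum_add_distrib]
    simp only [sum_comm (s := antidiagonal r), ih]
    abel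

/-- A function `f` of `x` alone composes on the left by plain multiplication, so associativity turns
`f * h` into an iterated composition. This extracts principal symbols. -/
lemma star_mul_of_dξ_eq_zero {f : O} (hf : ∀ a, S.dξ a f = 0) (r : ℕ) (b h : O) :
    S.star r b (f * h) = ∑ i ∈ antidiagonal r, S.star i.2 (S.star i.1 b f) h := by
  have h0 : ∀ q (g : O), S.star (q + 1) f g = 0 := by
    intro q g
    apply star_ext (q := q)
    rw [star_succ]
    simp [hf]
  rw [star_assoc]
  cases r with
  | zero => simp [star_zero]
  | succ r =>
    rw [Finset.Nat.sum_antidiagonal_succ]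
    simp [h0, star_zero]

/-! ### The divergence, the moment and the Euler operators -/

lemma dx_J (a : ι) : S.dx a S.J = S.ξ a := by
  simp only [J, map_sum, Derivation.leibniz, smul_eq_mul, S.dx_x, S.dx_ξ]
  simp

lemma dξ_J (a : ι) : S.dξ a S.J = S.x a := by
  simp only [J, map_sum, Derivation.leibniz, smul_eq_mul, S.dξ_x, S.dξ_ξ]
  simp

lemma E_mul (f g : O) : S.E (f * g) = S.E f * g + f * S.E g := by
  simp only [E_apply, Derivation.leibniz, smul_eq_mul, sum_mul, mul_sum, ← sum_add_distrib]
  exact sum_congr rfl fun a _ => by ring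

lemma Ex_mul (f g : O) : S.Ex (f * g) = S.Ex f * g + f * S.Ex g := by
  simp only [Ex_apply, Derivation.leibniz, smul_eq_mul, sum_mul, mul_sum, ← sum_add_distrib]
  exact sum_congr rfl fun a _ => by ring

lemma E_J : S.E S.J = S.J := by
  rw [E_apply]
  simp only [dξ_J]
  exact sum_congr rfl fun a _ => mul_comm _ _

lemma E_J_mul (f : O) : S.E (S.J * f) = S.J * (S.E f + f) := by
  rw [E_mul, E_J]; ring

lemma dξ_E (a : ι) (f : O) : S.dξ a (S.E f) = S.E (S.dξ a f) + S.dξ a f := by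
  simp only [E_apply, map_sum, Derivation.leibniz, smul_eq_mul, S.dξ_ξ, sum_add_distrib]
  congr 1
  · exact sum_congr rfl fun b _ => by rw [S.dξ_dξ a b]
  · simp

lemma dx_E (a : ι) (f : O) : S.dx a (S.E f) = S.E (S.dx a f) := by
  simp only [E_apply, map_sum, Derivation.leibniz, smul_eq_mul, S.dx_ξ, sum_add_distrib]
  simp [S.dx_dξ]

lemma dx_Ex (a : ι) (f : O) : S.dx a (S.Ex f) = S.Ex (S.dx a f) + S.dx a f := by
  simp only [Ex_apply, map_sum, Derivation.leibniz, smul_eq_mul, S.dx_x, sum_add_distrib]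
  congr 1
  · exact sum_congr rfl fun b _ => by rw [S.dx_dx a b]
  · simp

lemma dξ_Ex (a : ι) (f : O) : S.dξ a (S.Ex f) = S.Ex (S.dξ a f) := by
  simp only [Ex_apply, map_sum, Derivation.leibniz, smul_eq_mul, S.dξ_x, sum_add_distrib]
  simp [S.dx_dξ]

lemma lap_E (f : O) : S.lap (S.E f) = S.E (S.lap f) + S.lap f := by
  simp only [lap_apply, dξ_E, map_add, dx_E, sum_add_distrib, map_sum]

lemma lap_Ex (f : O) : S.lap (S.Ex f) = S.Ex (S.lap f) + S.lap f := by
  simp only [lap_apply, dξ_Ex, dx_Ex, sum_add_distrib, map_sum]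

/-- The basic commutation relation: `lap`, `J` and `Ex + E + card ι` span a copy of `sl₂`. The
recursions for the coefficients originate here. -/
lemma lap_J_mul (f : O) :
    S.lap (S.J * f) = S.J * S.lap f + (S.Ex f + S.E f + (Fintype.card ι : ℂ) • f) := by
  simp only [lap_apply, Derivation.leibniz, smul_eq_mul, S.dξ_J, S.dx_J, map_add, S.dx_x,
    sum_add_distrib, mul_sum, Ex_apply, E_apply]
  simp only [if_true, mul_one, sum_const, card_univ]
  rw [← Nat.cast_smul_eq_nsmul ℂ]
  simp only [mul_comm (S.ξ _)]
  abel

/-- Infinitesimal invariance under `(x, ξ) ↦ (t x, t⁻¹ ξ)`. -/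
def Inv (f : O) : Prop := S.Ex f = S.E f

variable {S}

lemma Inv.add {f g : O} (hf : S.Inv f) (hg : S.Inv g) : S.Inv (f + g) := by
  simp only [Inv, map_add] at *; rw [hf, hg]

lemma Inv.smul {f : O} (c : ℂ) (hf : S.Inv f) : S.Inv (c • f) := by
  simp only [Inv, map_smul] at *; rw [hf]

lemma Inv.sum {κ : Type*} {s : Finset κ} {f : κ → O} (hf : ∀ i ∈ s, S.Inv (f i)) :
    S.Inv (∑ i ∈ s, f i) := by
  simp only [Inv, map_sum] at *; exact sum_congr rfl hf

lemma Inv.star {f g : O} (hf : S.Inv f) (hg : S.Inv g) (q : ℕ) : S.Inv (S.star q f g) := by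
  unfold Inv at *
  rw [Ex_star, E_star, hf, hg]

lemma Ex_E (f : O) : S.Ex (S.E f) = S.E (S.Ex f) := by
  have h : ∀ a, S.E (S.x a) = 0 := fun a => by simp [E_apply, S.dξ_x]
  rw [Ex_apply, Ex_apply, map_sum]
  refine sum_congr rfl fun a _ => ?_
  rw [dx_E, E_mul, h, zero_mul, zero_add]

lemma Inv.E {f : O} (hf : S.Inv f) : S.Inv (S.E f) := by
  unfold Inv at *
  rw [Ex_E, hf]

lemma Inv.lap {f : O} (hf : S.Inv f) : S.Inv (S.lap f) := by
  unfold Inv at *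
  have h1 := S.lap_E f
  have h2 := S.lap_Ex f
  rw [hf, h1] at h2
  exact (add_right_cancel h2).symm

lemma Inv.lap_pow {f : O} (hf : S.Inv f) (s : ℕ) : S.Inv ((S.lap ^ s) f) := by
  induction s with
  | zero => simpa
  | succ s ih => rw [pow_succ', Module.End.mul_apply]; exact ih.lap

end Darboux

lemma aeval_intertwine {M M' : Type*} [AddCommGroup M] [Module ℂ M] [AddCommGroup M'] [Module ℂ M']
    {A : Module.End ℂ M} {B : Module.End ℂ M'} {T : M →ₗ[ℂ] M'} (h : ∀ f, B (T f) = T (A f))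
    (q : ℂ[X]) (f : M) : aeval B q (T f) = T (aeval A q f) := by
  induction q using Polynomial.induction_on' with
  | add p q hp hq => simp [hp, hq]
  | monomial k a =>
    have : ∀ (k : ℕ) (f : M), (B ^ k) (T f) = T ((A ^ k) f) := by
      intro k
      induction k with
      | zero => simp
      | succ k ih => intro f; rw [pow_succ, pow_succ, Module.End.mul_apply, h, ih]; rfl
    simp [aeval_monomial, this]

/-- Reordering of a triple sum. -/
lemma sum_antidiagonal_triple {M : Type*} [AddCommMonoid M] (r : ℕ) (F : ℕ → ℕ → ℕ → M) :
    ∑ i ∈ antidiagonal r, ∑ j ∈ antidiagonal i.2, F i.1 j.1 j.2 =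
      ∑ i ∈ antidiagonal r, ∑ j ∈ antidiagonal i.2, F j.2 j.1 i.1 := by
  rw [sum_sigma', sum_sigma']
  refine sum_nbij' (fun p => ⟨(p.2.2, p.2.1 + p.1.1), (p.2.1, p.1.1)⟩)
    (fun p => ⟨(p.2.2, p.2.1 + p.1.1), (p.2.1, p.1.1)⟩) ?_ ?_ ?_ ?_ ?_
  · rintro ⟨⟨a, b⟩, ⟨c, d⟩⟩; simp; omega
  · rintro ⟨⟨a, b⟩, ⟨c, d⟩⟩; simp; omega
  · rintro ⟨⟨a, b⟩, ⟨c, d⟩⟩; simp +contextual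
  · rintro ⟨⟨a, b⟩, ⟨c, d⟩⟩; simp +contextual
  · rintro ⟨⟨a, b⟩, ⟨c, d⟩⟩; simp

/-! ### Polynomials in the Euler operator, and descent of the operators to `J = 0` -/

namespace Darboux

variable {ι : Type} [Fintype ι] [DecidableEq ι] {O : Type} [CommRing O] [Algebra ℂ O]
  (S : Darboux ι O)

/-- `c + 2 E`. -/
def Y (c : ℂ) : Module.End ℂ O := c • 1 + (2 : ℂ) • S.E

lemma Y_apply (c : ℂ) (f : O) : S.Y c f = c • f + (2 : ℂ) • S.E f := by simp [Y]

lemma aeval_Y_add (c b : ℂ) (q : ℂ[X]) :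
    aeval (S.Y (c + b)) q = aeval (S.Y c) (q.comp (X + C b)) := by
  rw [aeval_comp]
  congr 1
  simp [Y, add_smul, Algebra.algebraMap_eq_smul_one]
  abel_nf

lemma aeval_Y_X_add (c b : ℂ) (f : O) : aeval (S.Y c) (X + C b) f = S.Y c f + b • f := by
  rw [map_add, aeval_X, aeval_C, LinearMap.add_apply, Module.algebraMap_end_apply]

/-- `J` raises the fibre degree by one, hence shifts `Y = c + 2 E` by two. `lap` lowers the degree
by one, which gives the same shift when it passes a polynomial in `Y` from left to right. -/
lemma aeval_Y_J_mul (c : ℂ) (q : ℂ[X]) (f : O) :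
    aeval (S.Y c) q (S.J * f) = S.J * aeval (S.Y c) (q.comp (X + C 2)) f := by
  rw [← aeval_Y_add]
  refine aeval_intertwine (T := LinearMap.mulLeft ℂ S.J) (fun f => ?_) q f
  simp only [Y_apply, LinearMap.mulLeft_apply, E_J_mul, mul_add, add_smul, smul_add, mul_smul_comm]
  abel

lemma aeval_Y_lap (c : ℂ) (q : ℂ[X]) (f : O) :
    S.lap (aeval (S.Y c) q f) = aeval (S.Y c) (q.comp (X + C 2)) (S.lap f) := by
  rw [← aeval_Y_add]
  refine (aeval_intertwine (T := S.lap) (fun f => ?_) q f).symm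
  simp only [Y_apply, map_add, map_smul, lap_E, add_smul, smul_add]
  abel

lemma aeval_Y_lap_pow (c : ℂ) (q : ℂ[X]) (s : ℕ) (f : O) :
    (S.lap ^ s) (aeval (S.Y c) q f) = aeval (S.Y c) (q.comp (X + C (2 * s : ℂ))) ((S.lap ^ s) f) := by
  induction s generalizing f with
  | zero => simp
  | succ s ih =>
    rw [pow_succ', Module.End.mul_apply, ih, aeval_Y_lap, Module.End.mul_apply, comp_assoc]
    congr 3
    simp only [add_comp, X_comp, C_comp]
    rw [add_assoc, ← C_add]
    push_cast
    ring_nf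

variable {S}

lemma Inv.poly {f : O} (hf : S.Inv f) (c : ℂ) (q : ℂ[X]) : S.Inv (aeval (S.Y c) q f) := by
  have h : ∀ k : ℕ, S.Inv ((S.Y c ^ k) f) := by
    intro k
    induction k with
    | zero => simpa
    | succ k ih =>
      rw [pow_succ', Module.End.mul_apply, Y_apply]
      exact (ih.smul c).add (ih.E.smul 2)
  induction q using Polynomial.induction_on' with
  | add p q hp hq => rw [map_add]; exact hp.add hq
  | monomial k a => simpa [aeval_monomial] using (h k).smul a

lemma Inv.lap_J_mul {c : ℂ} (hc : (Fintype.card ι : ℂ) = c + 1) {f : O} (hf : S.Inv f) :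
    S.lap (S.J * f) = S.J * S.lap f + (S.Y c f + f) := by
  rw [Darboux.lap_J_mul, hf, hc, Y_apply, add_smul, two_smul, one_smul]
  abel

/-- The usual `sl₂` formula for the commutator of a power of the lowering operator with the raising
one. On invariant functions the commutator of `lap` and `J` is `Y + 1`. -/
lemma Inv.lap_pow_J_mul {c : ℂ} (hc : (Fintype.card ι : ℂ) = c + 1) {f : O} (hf : S.Inv f) (s : ℕ) :
    (S.lap ^ (s + 1)) (S.J * f) = S.J * (S.lap ^ (s + 1)) f +
      ((s : ℂ) + 1) • (aeval (S.Y c) (X + C (s + 1 : ℂ))) ((S.lap ^ s) f) := by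
  induction s with
  | zero => simp [hf.lap_J_mul hc]
  | succ s ih =>
    rw [pow_succ', Module.End.mul_apply, ih, map_add, (hf.lap_pow (s + 1)).lap_J_mul hc, map_smul,
      aeval_Y_lap]
    have e : ∀ k, S.lap ((S.lap ^ k) f) = (S.lap ^ (k + 1)) f := fun k => by
      rw [pow_succ', Module.End.mul_apply]
    simp only [e, add_comp, X_comp, C_comp, add_assoc, ← C_add, aeval_Y_X_add]
    push_cast
    rw [← pow_succ']
    module

/-- The polynomial in `Y` stands to the right of `lap^s` here, because `lapSeq` applies polynomials
before divergences; moving it costs `2 s`. -/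
lemma Inv.lap_pow_J_mul' {c : ℂ} (hc : (Fintype.card ι : ℂ) = c + 1) {f : O} (hf : S.Inv f)
    (s : ℕ) : (S.lap ^ (s + 1)) (S.J * f) = S.J * (S.lap ^ (s + 1)) f +
      ((s : ℂ) + 1) • (S.lap ^ s) (aeval (S.Y c) (X + C (1 - s : ℂ)) f) := by
  rw [hf.lap_pow_J_mul hc, aeval_Y_lap_pow]
  congr 4
  simp only [add_comp, X_comp, C_comp]
  rw [add_assoc, ← C_add]
  congr 2
  ring

variable (S)

/-- Multiplication of a series by the composition symbol of `∑ x_a ∂/∂x_a + κ`. -/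
def jx (κ : ℂ) (a : ℕ → O) : ℕ → O
  | 0 => S.J * a 0
  | s + 1 => S.J * a (s + 1) + (S.Ex (a s) + κ • a s)

/-- Multiplication of a series by `J + E + κ`. -/
def je (κ : ℂ) (a : ℕ → O) : ℕ → O
  | 0 => S.J * a 0
  | s + 1 => S.J * a (s + 1) + (S.E (a s) + κ • a s)

-- `jx` and `je` are the compositions with `J + κ` on the left and on the right. They agree on
-- invariant functions: `J` is central there. This lets the factor pass from the argument of an
-- operator to its result.
variable {S} in
lemma jx_eq_je (κ : ℂ) {a : ℕ → O} (ha : ∀ s, S.Inv (a s)) : S.jx κ a = S.je κ a := by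
  funext s
  cases s with
  | zero => rfl
  | succ s => simp only [jx, je]; rw [ha s]

/-- The composition of two series of symbols. -/
def starSeq (u v : ℕ → O) (r : ℕ) : O :=
  ∑ i ∈ antidiagonal r, ∑ j ∈ antidiagonal i.2, S.star j.1 (u i.1) (v j.2)

/-- Associativity of the composition of series, with `J + κ` as the leftmost factor. -/
lemma starSeq_jx_left (κ : ℂ) (a v : ℕ → O) :
    S.starSeq (S.jx κ a) v = S.jx κ (S.starSeq a v) := by
  -- `B k a` collects the terms of the composition of `a` with the series `v` that have total index
  -- `k`; the claim then only uses linearity of `B` and the relation `h1`.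
  set B : ℕ → O → O := fun k a => ∑ j ∈ antidiagonal k, S.star j.1 a (v j.2) with hB
  have hadd : ∀ k a b, B k (a + b) = B k a + B k b := fun k a b => by
    simp [hB, sum_add_distrib]
  have hsmul : ∀ k (c : ℂ) a, B k (c • a) = c • B k a := fun k c a => by
    simp [hB, smul_sum]
  have h0 : ∀ a, B 0 (S.J * a) = S.J * B 0 a := fun a => by simp [hB, star_zero, mul_assoc]
  have h1 : ∀ k a, B (k + 1) (S.J * a) + B k (S.Ex a) = S.J * B (k + 1) a + S.Ex (B k a) := by
    intro k a
    simp only [hB, Finset.Nat.sum_antidiagonal_succ, star_zero, map_sum, mul_add, mul_sum]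
    rw [add_assoc, add_assoc, mul_assoc, ← sum_add_distrib, ← sum_add_distrib]
    congr 1
    exact sum_congr rfl fun j _ => S.star_J_left j.1 a (v j.2)
  have hs : ∀ u r, S.starSeq u v r = ∑ i ∈ antidiagonal r, B i.2 (u i.1) := fun u r => rfl
  clear_value B
  funext r
  cases r with
  | zero => simp [hs, jx, h0]
  | succ r =>
    rw [jx, hs, hs, hs, Finset.Nat.sum_antidiagonal_succ]
    simp only [jx, hadd, hsmul, sum_add_distrib]
    rw [← add_assoc, ← Finset.Nat.sum_antidiagonal_succ (f := fun i => B i.2 (S.J * a i.1)),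
      Finset.Nat.sum_antidiagonal_succ', Finset.Nat.sum_antidiagonal_succ', h0, mul_add, mul_sum,
      map_sum, smul_sum]
    have := sum_congr rfl fun (i : ℕ × ℕ) (_ : i ∈ antidiagonal r) => h1 i.2 (a i.1)
    simp only [sum_add_distrib] at this
    rw [add_assoc, ← add_assoc (∑ i ∈ antidiagonal r, B (i.2 + 1) (S.J * a i.1)), this]
    abel

lemma starSeq_je_right (κ : ℂ) (u b : ℕ → O) :
    S.starSeq u (S.je κ b) = S.je κ (S.starSeq u b) := by
  set B : ℕ → O → O := fun k b => ∑ j ∈ antidiagonal k, S.star j.1 (u j.2) b with hB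
  have hadd : ∀ k a b, B k (a + b) = B k a + B k b := fun k a b => by
    simp [hB, sum_add_distrib]
  have hsmul : ∀ k (c : ℂ) a, B k (c • a) = c • B k a := fun k c a => by
    simp [hB, smul_sum]
  have h0 : ∀ a, B 0 (S.J * a) = S.J * B 0 a := fun a => by
    simp [hB, star_zero, mul_left_comm]
  have h1 : ∀ k a, B (k + 1) (S.J * a) + B k (S.E a) = S.J * B (k + 1) a + S.E (B k a) := by
    intro k a
    simp only [hB, Finset.Nat.sum_antidiagonal_succ, star_zero, map_sum, mul_add, mul_sum]
    rw [add_assoc, add_assoc, mul_left_comm, ← sum_add_distrib, ← sum_add_distrib]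
    congr 1
    exact sum_congr rfl fun j _ => S.star_J_right j.1 (u j.2) a
  -- The triple sum is reordered so that the second series is the outer one.
  have hs : ∀ v r, S.starSeq u v r = ∑ i ∈ antidiagonal r, B i.2 (v i.1) := fun v r =>
    sum_antidiagonal_triple r fun s q s' => S.star q (u s) (v s')
  clear_value B
  funext r
  cases r with
  | zero => simp [hs, je, h0]
  | succ r =>
    rw [je, hs, hs, hs, Finset.Nat.sum_antidiagonal_succ]
    simp only [je, hadd, hsmul, sum_add_distrib]
    rw [← add_assoc, ← Finset.Nat.sum_antidiagonal_succ (f := fun i => B i.2 (S.J * b i.1)),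
      Finset.Nat.sum_antidiagonal_succ', Finset.Nat.sum_antidiagonal_succ', h0, mul_add, mul_sum,
      map_sum, smul_sum]
    have := sum_congr rfl fun (i : ℕ × ℕ) (_ : i ∈ antidiagonal r) => h1 i.2 (b i.1)
    simp only [sum_add_distrib] at this
    rw [add_assoc, ← add_assoc (∑ i ∈ antidiagonal r, B (i.2 + 1) (S.J * b i.1)), this]
    abel

lemma starSeq_congr {u u' v v' : ℕ → O} {r : ℕ} (hu : ∀ s ≤ r, u s = u' s)
    (hv : ∀ s ≤ r, v s = v' s) : S.starSeq u v r = S.starSeq u' v' r := by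
  refine sum_congr rfl fun i hi => sum_congr rfl fun j hj => ?_
  rw [HasAntidiagonal.mem_antidiagonal] at hi hj
  rw [hu _ (by omega), hv _ (by omega)]

variable {S} in
lemma Inv.of_starSeq {u v : ℕ → O} (hu : ∀ s, S.Inv (u s)) (hv : ∀ s, S.Inv (v s)) (r : ℕ) :
    S.Inv (S.starSeq u v r) :=
  Inv.sum fun i _ => Inv.sum fun j _ => (hu i.1).star (hv j.2) j.1

/-- The series `Δ^s σ_s(c + 2 E) f`. -/
def lapSeq (c : ℂ) (σ : ℕ → ℂ[X]) (f : O) (s : ℕ) : O := (S.lap ^ s) (aeval (S.Y c) (σ s) f)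

variable {S} in
lemma Inv.of_lapSeq {f : O} (hf : S.Inv f) (c : ℂ) (σ : ℕ → ℂ[X]) (s : ℕ) :
    S.Inv (S.lapSeq c σ f s) := (hf.poly c (σ s)).lap_pow s

/-- The weight `κ = (c + 1) / 2` is that of half-densities; with it `E + κ` becomes `(Y + 1) / 2`,
so that its shifts contribute only odd numbers. -/
lemma Y_half (c : ℂ) (f : O) :
    S.E f + ((c + 1) / 2) • f = aeval (S.Y c) (C (1 / 2 : ℂ) * (X + C 1)) f := by
  simp only [map_mul, aeval_C, map_add, aeval_X, Module.End.mul_apply, Module.algebraMap_end_apply,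
    LinearMap.add_apply, Y_apply]
  module

-- Passing `J` through `lap^(s+1) σ_(s+1)(Y)` leaves the multiple of `J` and a commutator term. The
-- recursion `hσ` says exactly that this term is `E + κ` applied to the preceding member of the
-- series for `g`, with the argument of `σ` shifted by two.
variable {S} in
lemma Inv.lapSeq_J_mul {c : ℂ} (hc : (Fintype.card ι : ℂ) = c + 1) {p : ℕ} {σ : ℕ → ℂ[X]}
    (hσ : ∀ s < p, C ((s : ℂ) + 1) * (X - C (s + 1 : ℂ)) * σ (s + 1) =
      C (1 / 2 : ℂ) * (X - C (2 * s + 1 : ℂ)) * σ s) {g : O} (hg : S.Inv g) {s : ℕ} (hs : s ≤ p) :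
    S.lapSeq c σ (S.J * g) s =
      S.je ((c + 1) / 2) (S.lapSeq c (fun s => (σ s).comp (X + C 2)) g) s := by
  cases s with
  | zero => simp [lapSeq, je, aeval_Y_J_mul]
  | succ s =>
    rw [lapSeq, aeval_Y_J_mul, (hg.poly c _).lap_pow_J_mul' hc, je, lapSeq]
    congr 1
    rw [lapSeq, Y_half, ← Module.End.mul_apply (aeval (S.Y c) (X + C _)), ← map_mul, ← map_smul,
      aeval_Y_lap_pow, ← Module.End.mul_apply, ← map_mul, ← LinearMap.smul_apply, ← map_smul,
      aeval_Y_lap_pow]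
    congr 2
    -- The recursion is read at `Y + 2 + 2 s`: the `2` comes from passing `J`, the `2 s` from
    -- passing `lap^s`.
    have h := congrArg (fun q => (q.comp (X + C 2)).comp (X + C (2 * s : ℂ))) (hσ s (by omega))
    simp only [mul_comp, sub_comp, X_comp, C_comp, add_comp, smul_comp] at h ⊢
    rw [smul_eq_C_mul, ← mul_assoc]
    convert h using 2
    · congr 1
      simp only [C_add, C_sub, C_mul, C_1, show (C (2 : ℂ) : ℂ[X]) = 2 from rfl]
      ring
    · congr 1
      simp only [C_add, C_mul, C_1, show (C (2 : ℂ) : ℂ[X]) = 2 from rfl]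
      ring

-- The counterpart for the outer operator: the commutator term of `τ_(s+1)(Y) lap^(s+1)` with `J`
-- cancels the term `τ_s(Y) lap^s (E + κ)` because of `hτ`, and only multiples of `J` survive.
variable {S} in
lemma exists_sum_lap_je {c : ℂ} (hc : (Fintype.card ι : ℂ) = c + 1) {p : ℕ} {τ : ℕ → ℂ[X]}
    (hτ : ∀ s < p, C ((s : ℂ) + 1) * (X + C (s + 1 : ℂ)) * τ (s + 1) =
      - (C (1 / 2 : ℂ) * (X + C (2 * s + 1 : ℂ)) * τ s)) {k : ℕ → O} (hk : ∀ r, S.Inv (k r)) :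
    ∃ w, ∑ i ∈ antidiagonal p, aeval (S.Y c) (τ i.1) ((S.lap ^ i.1) (S.je ((c + 1) / 2) k i.2)) =
      S.J * w := by
  cases p with
  | zero => exact ⟨aeval (S.Y c) ((τ 0).comp (X + C 2)) (k 0), by simp [je, aeval_Y_J_mul]⟩
  | succ p =>
    have h1 : ∑ i ∈ antidiagonal (p + 1),
        aeval (S.Y c) (τ i.1) ((S.lap ^ i.1) (S.je ((c + 1) / 2) k i.2)) =
        ∑ i ∈ antidiagonal (p + 1), aeval (S.Y c) (τ i.1) ((S.lap ^ i.1) (S.J * k i.2)) +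
        ∑ i ∈ antidiagonal p, aeval (S.Y c) (τ i.1) ((S.lap ^ i.1)
          (S.E (k i.2) + ((c + 1) / 2) • k i.2)) := by
      simp only [Finset.Nat.sum_antidiagonal_succ', je, map_add, sum_add_distrib, map_smul]
      abel
    rw [h1, Finset.Nat.sum_antidiagonal_succ]
    simp only [(hk _).lap_pow_J_mul hc, Y_half, map_add (aeval (S.Y c) _), sum_add_distrib,
      aeval_Y_J_mul, aeval_Y_lap_pow, pow_zero, Module.End.one_apply]
    refine ⟨aeval (S.Y c) ((τ 0).comp (X + C 2)) (k (p + 1)) + ∑ i ∈ antidiagonal p,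
      aeval (S.Y c) ((τ (i.1 + 1)).comp (X + C 2)) ((S.lap ^ (i.1 + 1)) (k i.2)), ?_⟩
    rw [mul_add S.J, mul_sum, add_assoc, add_assoc, add_right_inj, add_eq_left, ← sum_add_distrib]
    refine sum_eq_zero fun i hi => ?_
    rw [HasAntidiagonal.mem_antidiagonal] at hi
    generalize (S.lap ^ i.1) (k i.2) = w
    rw [map_smul, ← Module.End.mul_apply, ← Module.End.mul_apply, ← map_mul, ← map_mul,
      ← LinearMap.smul_apply, ← map_smul, ← LinearMap.add_apply, ← map_add]
    convert LinearMap.zero_apply _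
    rw [← map_zero (aeval (R := ℂ) (S.Y c))]
    congr 1
    simp only [mul_comp, X_comp, C_comp, add_comp, smul_eq_C_mul]
    have h := hτ i.1 (by omega)
    have e : C (2 * (i.1 : ℂ) + 1) = (C (2 * (i.1 : ℂ)) + C 1 : ℂ[X]) := by rw [← C_add]
    rw [e] at h
    linear_combination h

/-- The bidifferential operator `∑ τ_s(Y) Δ^s (∑ star q (Δ^a σ_a(Y) f) (Δ^b σ_b(Y) h))`, summed
over `s + q + a + b = p`, with `Y = c + 2 E`. -/
def bidiff (c : ℂ) (p : ℕ) (σ τ : ℕ → ℂ[X]) : O →ₗ[ℂ] O →ₗ[ℂ] O :=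
  ∑ i ∈ antidiagonal p, ∑ j ∈ antidiagonal i.2, ∑ k ∈ antidiagonal j.2,
    ((S.star k.1).compl₁₂ (S.lap ^ j.1 * aeval (S.Y c) (σ j.1))
      (S.lap ^ k.2 * aeval (S.Y c) (σ k.2))).compr₂ (aeval (S.Y c) (τ i.1) * S.lap ^ i.1)

lemma bidiff_apply (c : ℂ) (p : ℕ) (σ τ : ℕ → ℂ[X]) (f h : O) :
    S.bidiff c p σ τ f h = ∑ i ∈ antidiagonal p, aeval (S.Y c) (τ i.1)
      ((S.lap ^ i.1) (S.starSeq (S.lapSeq c σ f) (S.lapSeq c σ h) i.2)) := by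
  simp only [bidiff, LinearMap.sum_apply, starSeq, map_sum]
  rfl

variable {S} in
/-- The operator descends to `J = 0` in its first argument. -/
theorem bidiff_J_left {c : ℂ} (hc : (Fintype.card ι : ℂ) = c + 1) {p : ℕ} {σ τ : ℕ → ℂ[X]}
    (hσ : ∀ s < p, C ((s : ℂ) + 1) * (X - C (s + 1 : ℂ)) * σ (s + 1) =
      C (1 / 2 : ℂ) * (X - C (2 * s + 1 : ℂ)) * σ s)
    (hτ : ∀ s < p, C ((s : ℂ) + 1) * (X + C (s + 1 : ℂ)) * τ (s + 1) =
      - (C (1 / 2 : ℂ) * (X + C (2 * s + 1 : ℂ)) * τ s))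
    {g h : O} (hg : S.Inv g) (hh : S.Inv h) : ∃ w, S.bidiff c p σ τ (S.J * g) h = S.J * w := by
  set a := S.lapSeq c (fun s => (σ s).comp (X + C 2)) g
  have ha : ∀ s, S.Inv (a s) := fun s => hg.of_lapSeq c _ s
  have hk : ∀ r, S.Inv (S.starSeq a (S.lapSeq c σ h) r) := Inv.of_starSeq ha (hh.of_lapSeq c σ)
  obtain ⟨w, hw⟩ := exists_sum_lap_je hc hτ hk
  refine ⟨w, ?_⟩
  rw [bidiff_apply, ← hw]
  refine sum_congr rfl fun i hi => ?_
  rw [HasAntidiagonal.mem_antidiagonal] at hi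
  -- The factor `J + κ` enters as a right composition, becomes a left one by invariance, leaves the
  -- product by associativity, and becomes a right one again for `exists_sum_lap_je`.
  rw [← jx_eq_je _ hk, ← starSeq_jx_left, jx_eq_je _ ha, S.starSeq_congr (v' := S.lapSeq c σ h)
    (fun s hs => hg.lapSeq_J_mul hc hσ (by omega)) fun _ _ => rfl]

variable {S} in
/-- The operator descends to `J = 0` in its second argument. -/
theorem bidiff_J_right {c : ℂ} (hc : (Fintype.card ι : ℂ) = c + 1) {p : ℕ} {σ τ : ℕ → ℂ[X]}
    (hσ : ∀ s < p, C ((s : ℂ) + 1) * (X - C (s + 1 : ℂ)) * σ (s + 1) =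
      C (1 / 2 : ℂ) * (X - C (2 * s + 1 : ℂ)) * σ s)
    (hτ : ∀ s < p, C ((s : ℂ) + 1) * (X + C (s + 1 : ℂ)) * τ (s + 1) =
      - (C (1 / 2 : ℂ) * (X + C (2 * s + 1 : ℂ)) * τ s))
    {g h : O} (hg : S.Inv g) (hh : S.Inv h) : ∃ w, S.bidiff c p σ τ h (S.J * g) = S.J * w := by
  set a := S.lapSeq c (fun s => (σ s).comp (X + C 2)) g
  have ha : ∀ s, S.Inv (a s) := fun s => hg.of_lapSeq c _ s
  have hk : ∀ r, S.Inv (S.starSeq (S.lapSeq c σ h) a r) := Inv.of_starSeq (hh.of_lapSeq c σ) ha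
  obtain ⟨w, hw⟩ := exists_sum_lap_je hc hτ hk
  refine ⟨w, ?_⟩
  rw [bidiff_apply, ← hw]
  refine sum_congr rfl fun i hi => ?_
  rw [HasAntidiagonal.mem_antidiagonal] at hi
  -- In the second argument the factor is already on the outer right side, so no change of side is
  -- needed.
  rw [← starSeq_je_right, S.starSeq_congr (u' := S.lapSeq c σ h) (fun _ _ => rfl)
    fun s hs => hg.lapSeq_J_mul hc hσ (by omega)]

end Darboux

/-! ### The coefficients -/

/-- The coefficients of the quantization of symbols of degree `D` in terms of divergences. -/
def quantCoeff (c D : ℂ) (s : ℕ) : ℂ :=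
  ∏ r ∈ range s, (D - (r + 1) + (c + 1) / 2) / ((r + 1) * (c + 2 * D - (r + 1)))

/-- The coefficients of the inverse of the quantization, `D` being the degree of the result. -/
def symbCoeff (c D : ℂ) (s : ℕ) : ℂ :=
  ∏ r ∈ range s, -(D + r + (c + 1) / 2) / ((r + 1) * (c + 2 * D + (r + 1)))

lemma quantCoeff_zero (c D : ℂ) : quantCoeff c D 0 = 1 := by simp [quantCoeff]

lemma symbCoeff_zero (c D : ℂ) : symbCoeff c D 0 = 1 := by simp [symbCoeff]

lemma cast_add_one_ne_zero' (r : ℕ) : (r : ℂ) + 1 ≠ 0 := by exact_mod_cast Nat.succ_ne_zero r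

lemma quantCoeff_succ {c D : ℂ} {s : ℕ} (h : c + 2 * D - (s + 1) ≠ 0) :
    ((s : ℂ) + 1) * (c + 2 * D - (s + 1)) * quantCoeff c D (s + 1) =
      (D - (s + 1) + (c + 1) / 2) * quantCoeff c D s := by
  rw [quantCoeff, prod_range_succ, ← quantCoeff]
  have := cast_add_one_ne_zero' s
  field_simp

lemma symbCoeff_succ {c D : ℂ} {s : ℕ} (h : c + 2 * D + (s + 1) ≠ 0) :
    ((s : ℂ) + 1) * (c + 2 * D + (s + 1)) * symbCoeff c D (s + 1) =
      -(D + s + (c + 1) / 2) * symbCoeff c D s := by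
  rw [symbCoeff, prod_range_succ, ← symbCoeff]
  have := cast_add_one_ne_zero' s
  field_simp

/-- Compares coefficients for the neighbouring degrees `D` and `D - 1`, whereas `quantCoeff_succ`
keeps the degree fixed. Both kinds of shift occur in the ratio of consecutive summands in
`sum_quantCoeff_symbCoeff`. -/
lemma quantCoeff_shift {c D : ℂ} {s : ℕ} (h : ∀ r ≤ s + 1, c + 2 * D - (r + 1) ≠ 0) :
    ((s : ℂ) + 1) * (c + 2 * D - 1) * (c + 2 * D - 2) * quantCoeff c D (s + 1) =
      (D - 1 + (c + 1) / 2) * (c + 2 * D - s - 2) * quantCoeff c (D - 1) s := by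
  induction s with
  | zero =>
    have := quantCoeff_succ (c := c) (D := D) (s := 0) (h 0 (by omega))
    simp only [quantCoeff_zero, zero_add, CharP.cast_eq_zero] at this ⊢
    linear_combination (c + 2 * D - 2) * this
  | succ s ih =>
    have h1 := quantCoeff_succ (c := c) (D := D) (s := s + 1) (h (s + 1) (by omega))
    have h2 := h (s + 2) (by omega)
    have h2' : c + 2 * (D - 1) - (s + 1) ≠ 0 := by
      push_cast at h2
      convert h2 using 1; ring
    have h3 := quantCoeff_succ (c := c) (D := D - 1) (s := s) h2'
    have ih := ih fun r hr => h r (by omega)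
    have h4 := h (s + 1) (by omega)
    push_cast at h1 h3 h4 ⊢
    have e : ((s : ℂ) + 1) * (c + 2 * D - (s + 1 + 1)) ≠ 0 :=
      mul_ne_zero (cast_add_one_ne_zero' s) h4
    refine mul_left_cancel₀ e ?_
    linear_combination (c + 2 * D - 1) * (c + 2 * D - 2) * (s + 1) * h1 +
      (D - (s + 1 + 1) + (c + 1) / 2) * ih -
      (D - 1 + (c + 1) / 2) * (c + 2 * D - s - 2) * h3

lemma symbCoeff_shift {c D : ℂ} {s : ℕ} (h : ∀ r : ℕ, r ≤ s + 1 → c + 2 * D + (r - 1) ≠ 0) :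
    ((s : ℂ) + 1) * (c + 2 * D - 1) * (c + 2 * D) * symbCoeff c (D - 1) (s + 1) =
      -(D - 1 + (c + 1) / 2) * (c + 2 * D + s) * symbCoeff c D s := by
  induction s with
  | zero =>
    have h0 := h 0 (by omega)
    have := symbCoeff_succ (c := c) (D := D - 1) (s := 0)
      (by convert h0 using 1; push_cast; ring)
    simp only [symbCoeff_zero, zero_add, CharP.cast_eq_zero] at this ⊢
    linear_combination (c + 2 * D) * this
  | succ s ih =>
    have h1 := h (s + 1) (by omega)
    have h2 := h (s + 2) (by omega)
    have h3 := symbCoeff_succ (c := c) (D := D - 1) (s := s + 1)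
      (by convert h1 using 1; push_cast; ring)
    have h4 := symbCoeff_succ (c := c) (D := D) (s := s)
      (by convert h2 using 1; push_cast; ring)
    have ih := ih fun r hr => h r (by omega)
    push_cast at h1 h3 h4 ⊢
    have e : ((s : ℂ) + 1) * (c + 2 * D + s) ≠ 0 :=
      mul_ne_zero (cast_add_one_ne_zero' s) (by convert h1 using 1; ring)
    refine mul_left_cancel₀ e ?_
    linear_combination (c + 2 * D - 1) * (c + 2 * D) * (s + 1) * h3 -
      (D + s + (c + 1) / 2) * ih + (D - 1 + (c + 1) / 2) * (c + 2 * D + s) * h4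

/-- The two series of divergences, from quantized to standard ordered symbols and back, are inverse
to each other. Here `e` is the degree of the standard symbol, `i.2` the loss of degree in the way
back and `i.1` that in the quantization. -/
lemma sum_quantCoeff_symbCoeff {n e m : ℕ} (hn : 1 ≤ n) (hm : 1 ≤ m) (hme : m ≤ e) :
    ∑ i ∈ antidiagonal m, quantCoeff n ((e : ℂ) - i.2) i.1 * symbCoeff n ((e : ℂ) - i.2) i.2 = 0 := by
  set t : ℕ → ℂ := fun k => quantCoeff n ((e : ℂ) - k) (m - k) * symbCoeff n ((e : ℂ) - k) k with ht
  set x : ℂ := n + 2 * e with hx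
  -- The summand is hypergeometric: the ratio of `t (k + 1)` to `t k` is rational in `k`.
  have hstep : ∀ k < m, ((k : ℂ) + 1) * (x - 2 * k) * (x - m - k - 1) * t (k + 1) =
      -((m : ℂ) - k) * (x - 2 * k - 2) * (x - k) * t k := by
    intro k hk
    obtain ⟨s, rfl⟩ : ∃ s, m = s + k + 1 := ⟨m - k - 1, by omega⟩
    obtain ⟨D, rfl⟩ : ∃ D, e = D + k := ⟨e - k, by omega⟩
    have hD : 1 ≤ D := by omega
    have h1 := quantCoeff_shift (c := (n : ℂ)) (D := D) (s := s) (fun r hr => by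
      have : ((n : ℂ) + 2 * D - (r + 1)) = ((n + 2 * D - (r + 1) : ℕ) : ℂ) := by
        rw [Nat.cast_sub (by omega)]; push_cast; ring
      rw [this]
      exact_mod_cast (by omega : n + 2 * D - (r + 1) ≠ 0))
    have h2 := symbCoeff_shift (c := (n : ℂ)) (D := D) (s := k) (fun r hr => by
      have : ((n : ℂ) + 2 * D + (r - 1)) = ((n + 2 * D + r - 1 : ℕ) : ℂ) := by
        rw [Nat.cast_sub (by omega)]; push_cast; ring
      rw [this]
      exact_mod_cast (by omega : n + 2 * D + r - 1 ≠ 0))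
    have e1 : s + k + 1 - k = s + 1 := by omega
    have e2 : s + k + 1 - (k + 1) = s := by omega
    simp only [ht, hx, e1, e2]
    push_cast
    have e3 : (D : ℂ) + k - k = D := by ring
    have e4 : (D : ℂ) + k - (k + 1) = D - 1 := by ring
    rw [e3, e4]
    have n1 : (n : ℂ) + 2 * D - 1 ≠ 0 := by
      have : ((n : ℂ) + 2 * D - 1) = ((n + 2 * D - 1 : ℕ) : ℂ) := by
        rw [Nat.cast_sub (by omega)]; push_cast; ring
      rw [this]
      exact_mod_cast (by omega : n + 2 * D - 1 ≠ 0)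
    have n2 : (D : ℂ) - 1 + (n + 1) / 2 ≠ 0 := by
      intro h
      apply n1
      linear_combination 2 * h
    refine mul_left_cancel₀ (mul_ne_zero n1 n2) ?_
    linear_combination (-(k + 1) * (n + 2 * D - 1) * (n + 2 * D) *
      symbCoeff n ((D : ℂ) - 1) (k + 1)) * h1 +
      ((s + 1) * (n + 2 * D - 1) * (n + 2 * D - 2) * quantCoeff n (D : ℂ) (s + 1)) * h2
  -- The partial sums have a closed form with a factor `m - K`, so the full sum, at `K = m`,
  -- vanishes.
  have hsum : ∀ K ≤ m, (m : ℂ) * (x - 2 * K) * ∑ k ∈ range (K + 1), t k =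
      ((m : ℂ) - K) * (x - K) * t K := by
    intro K hK
    induction K with
    | zero => simp
    | succ K ih =>
      have ih := ih (by omega)
      have hs := hstep K (by omega)
      have n1 : x - 2 * K ≠ 0 := by
        have : x - 2 * K = ((n + 2 * (e - K) : ℕ) : ℂ) := by
          push_cast [Nat.cast_sub (show K ≤ e by omega)]; rw [hx]; ring
        rw [this]
        exact_mod_cast (by omega : n + 2 * (e - K) ≠ 0)
      rw [sum_range_succ]
      push_cast
      refine mul_left_cancel₀ n1 ?_
      linear_combination (x - 2 * (K + 1)) * ih + hs
  have hfin := hsum m le_rfl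
  rw [sub_self, zero_mul, zero_mul] at hfin
  rw [← Finset.Nat.sum_antidiagonal_swap, Finset.Nat.sum_antidiagonal_eq_sum_range_succ_mk]
  simp only [Prod.swap]
  have n1 : x - 2 * m ≠ 0 := by
    have : x - 2 * m = ((n + 2 * (e - m) : ℕ) : ℂ) := by
      push_cast [Nat.cast_sub hme]; rw [hx]; ring
    rw [this]
    exact_mod_cast (by omega : n + 2 * (e - m) ≠ 0)
  exact (mul_eq_zero.1 hfin).resolve_left (mul_ne_zero (by exact_mod_cast (by omega : m ≠ 0)) n1)

/-- `∏_{i ≤ p/2} (X/2 - i)` times the `s`-th coefficient of the quantization, as a polynomial in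
`X = c + 2 D`. -/
def sig (p s : ℕ) : ℂ[X] :=
  C (1 / (2 ^ s * s.factorial * 2 ^ (s / 2)) : ℂ) *
    (∏ r ∈ Ico ((s + 1) / 2) s, (X - C (2 * (r : ℂ) + 1))) *
    ∏ i ∈ Ico (s / 2) (p / 2), (C (1 / 2 : ℂ) * X - C ((i : ℂ) + 1))

/-- This is the recursion of `quantCoeff`. The denominators `X - (r + 1)` with `r + 1` odd are
absorbed by the numerators; those with `r + 1` even are taken from the product of the `X / 2 - i`.
This is why `[p / 2]` factors suffice. -/
lemma sig_succ {p s : ℕ} (hs : s < p) :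
    C ((s : ℂ) + 1) * (X - C (s + 1 : ℂ)) * sig p (s + 1) =
      C (1 / 2 : ℂ) * (X - C (2 * s + 1 : ℂ)) * sig p s := by
  have hs1 := cast_add_one_ne_zero' s
  have hf : (s.factorial : ℂ) ≠ 0 := by exact_mod_cast s.factorial_ne_zero
  -- For `s = 2 k` the factor `X - (s + 1)` completes the product of odd factors; for `s = 2 k + 1`
  -- it is twice the factor `X / 2 - (k + 1)` which leaves the second product.
  obtain ⟨k, rfl | rfl⟩ : ∃ k, s = 2 * k ∨ s = 2 * k + 1 := ⟨s / 2, by omega⟩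
  · have e1 : (2 * k + 1) / 2 = k := by omega
    have e2 : (2 * k + 1 + 1) / 2 = k + 1 := by omega
    have e3 : 2 * k / 2 = k := by omega
    simp only [sig, e1, e2, e3]
    have hp : (X - C (2 * (k : ℂ) + 1)) * ∏ r ∈ Ico (k + 1) (2 * k + 1), (X - C (2 * (r : ℂ) + 1)) =
        (∏ r ∈ Ico k (2 * k), (X - C (2 * (r : ℂ) + 1))) *
          (X - C (2 * ((2 * k : ℕ) : ℂ) + 1)) := by
      rw [← prod_Ico_succ_top (by omega), prod_eq_prod_Ico_succ_bot (show k < 2 * k + 1 by omega)]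
    have hc : C (((2 * k : ℕ) : ℂ) + 1) *
        C (1 / (2 ^ (2 * k + 1) * (2 * k + 1).factorial * 2 ^ k) : ℂ) =
        C (1 / 2 : ℂ) * C (1 / (2 ^ (2 * k) * (2 * k).factorial * 2 ^ k) : ℂ) := by
      rw [← C_mul, ← C_mul]
      congr 1
      rw [Nat.factorial_succ]
      push_cast at hs1 ⊢
      field_simp
      ring
    push_cast at hp hc ⊢
    linear_combination (X - C (2 * (k : ℂ) + 1)) * (∏ r ∈ Ico (k + 1) (2 * k + 1), (X - C (2 * (r : ℂ) + 1))) *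
      (∏ i ∈ Ico k (p / 2), (C (1 / 2 : ℂ) * X - C ((i : ℂ) + 1))) * hc + C (1 / 2 : ℂ) * C (1 / (2 ^ (2 * k) * (2 * k).factorial * 2 ^ k) : ℂ) *
      (∏ i ∈ Ico k (p / 2), (C (1 / 2 : ℂ) * X - C ((i : ℂ) + 1))) * hp
  · have e1 : (2 * k + 1) / 2 = k := by omega
    have e2 : (2 * k + 1 + 1) / 2 = k + 1 := by omega
    have e3 : (2 * k + 1 + 1 + 1) / 2 = k + 1 := by omega
    simp only [sig, e1, e2, e3]
    have hp : ∏ r ∈ Ico (k + 1) (2 * k + 1 + 1), (X - C (2 * (r : ℂ) + 1)) =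
        (∏ r ∈ Ico (k + 1) (2 * k + 1), (X - C (2 * (r : ℂ) + 1))) *
          (X - C (2 * ((2 * k + 1 : ℕ) : ℂ) + 1)) := by
      rw [← prod_Ico_succ_top (by omega)]
    have hq : ∏ i ∈ Ico k (p / 2), (C (1 / 2 : ℂ) * X - C ((i : ℂ) + 1)) =
        (C (1 / 2 : ℂ) * X - C ((k : ℂ) + 1)) *
          ∏ i ∈ Ico (k + 1) (p / 2), (C (1 / 2 : ℂ) * X - C ((i : ℂ) + 1)) := by
      rw [prod_eq_prod_Ico_succ_bot (by omega)]
    have hc : C (((2 * k + 1 : ℕ) : ℂ) + 1) *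
        C (1 / (2 ^ (2 * k + 1 + 1) * (2 * k + 1 + 1).factorial * 2 ^ (k + 1)) : ℂ) =
        C (1 / 2 : ℂ) * C (1 / 2 : ℂ) *
          C (1 / (2 ^ (2 * k + 1) * (2 * k + 1).factorial * 2 ^ k) : ℂ) := by
      rw [← C_mul, ← C_mul, ← C_mul]
      congr 1
      rw [Nat.factorial_succ (2 * k + 1)]
      push_cast at hs1 ⊢
      field_simp
      ring
    have hx : X - C (((2 * k + 1 : ℕ) : ℂ) + 1) =
        C 2 * (C (1 / 2 : ℂ) * X - C ((k : ℂ) + 1)) := by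
      rw [mul_sub, ← mul_assoc, ← C_mul, ← C_mul]
      norm_num
      rw [show (C (2 : ℂ) : ℂ[X]) = 2 from rfl]
      ring
    have h2 : C (1 / 2 : ℂ) * C 2 = (1 : ℂ[X]) := by rw [← C_mul]; norm_num
    rw [hp, hq, hx]
    linear_combination (C 2 * (C (1 / 2 : ℂ) * X - C ((k : ℂ) + 1)) * (∏ r ∈ Ico (k + 1) (2 * k + 1), (X - C (2 * (r : ℂ) + 1))) *
          (X - C (2 * ((2 * k + 1 : ℕ) : ℂ) + 1)) * ∏ i ∈ Ico (k + 1) (p / 2), (C (1 / 2 : ℂ) * X - C ((i : ℂ) + 1))) * hc +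
       (C (1 / 2 : ℂ) * C (1 / (2 ^ (2 * k + 1) * (2 * k + 1).factorial * 2 ^ k) : ℂ) *
        (C (1 / 2 : ℂ) * X - C ((k : ℂ) + 1)) * (∏ r ∈ Ico (k + 1) (2 * k + 1), (X - C (2 * (r : ℂ) + 1))) *
          (X - C (2 * ((2 * k + 1 : ℕ) : ℂ) + 1)) * ∏ i ∈ Ico (k + 1) (p / 2), (C (1 / 2 : ℂ) * X - C ((i : ℂ) + 1))) * h2

/-- The polynomials for the inverse of the quantization: the reflections of `sig p s`. -/
def tau (p s : ℕ) : ℂ[X] := C ((-1) ^ (s + p / 2) : ℂ) * (sig p s).comp (-X)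

/-- Substituting `-X` in `sig_succ` reverses the shifts; the sign `(-1)^s` in `tau` accounts for the
minus sign in the recursion of `symbCoeff`. -/
lemma tau_succ {p s : ℕ} (hs : s < p) :
    C ((s : ℂ) + 1) * (X + C (s + 1 : ℂ)) * tau p (s + 1) =
      - (C (1 / 2 : ℂ) * (X + C (2 * s + 1 : ℂ)) * tau p s) := by
  have h := congrArg (fun q => q.comp (-X)) (sig_succ hs)
  simp only [mul_comp, sub_comp, X_comp, C_comp] at h
  have e : (C ((-1) ^ (s + 1 + p / 2) : ℂ) : ℂ[X]) = - C ((-1) ^ (s + p / 2) : ℂ) := by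
    rw [← C_neg]; congr 1; ring
  rw [tau, tau, e]
  linear_combination C ((-1) ^ (s + p / 2) : ℂ) * h

lemma sig_zero (p : ℕ) : sig p 0 = ∏ i ∈ range (p / 2), (C (1 / 2 : ℂ) * X - C ((i : ℂ) + 1)) := by
  rw [sig, range_eq_Ico]
  simp

/-- The sign `(-1)^(p / 2)` in `tau` is there to make this the product for `T_p`, just as `sig_zero`
is the one for `S_p`, under `X = n + 2 d`. -/
lemma tau_zero (p : ℕ) : tau p 0 = ∏ i ∈ range (p / 2), (C (1 / 2 : ℂ) * X + C ((i : ℂ) + 1)) := by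
  rw [tau, sig_zero, Polynomial.prod_comp, zero_add]
  have h : (C ((-1) ^ (p / 2) : ℂ) : ℂ[X]) = ∏ i ∈ range (p / 2), (-1) := by simp
  rw [h, ← prod_mul_distrib]
  refine prod_congr rfl fun i _ => ?_
  simp
  ring

/-- Both sides satisfy the same recursion in `s`. The bound `s ≤ d` keeps the factors `n + 2 d - r`
away from zero; larger `s` are not needed, since `lap^s` then kills symbols of degree `d`. -/
lemma sig_eval {n p d s : ℕ} (hs : s ≤ p) (hd : s ≤ d) :
    (sig p s).eval ((n : ℂ) + 2 * d) = quantCoeff n d s * (sig p 0).eval ((n : ℂ) + 2 * d) := by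
  induction s with
  | zero => simp [quantCoeff_zero]
  | succ s ih =>
    have ih := ih (by omega) (by omega)
    have h1 := congrArg (fun q => q.eval ((n : ℂ) + 2 * d)) (sig_succ (show s < p by omega))
    simp only [eval_mul, eval_sub, eval_C, eval_X] at h1
    have hne : (n : ℂ) + 2 * d - (s + 1) ≠ 0 := by
      have : ((n : ℂ) + 2 * d - (s + 1)) = ((n + 2 * d - (s + 1) : ℕ) : ℂ) := by
        rw [Nat.cast_sub (by omega)]; push_cast; ring
      rw [this]
      exact_mod_cast (by omega : n + 2 * d - (s + 1) ≠ 0)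
    have h2 := quantCoeff_succ hne
    refine mul_left_cancel₀ (mul_ne_zero (cast_add_one_ne_zero' s) hne) ?_
    linear_combination h1 + (1 / 2) * (n + 2 * d - (2 * s + 1)) * ih -
      (sig p 0).eval ((n : ℂ) + 2 * d) * h2

lemma tau_eval {n p d s : ℕ} (hs : s ≤ p) :
    (tau p s).eval ((n : ℂ) + 2 * d) = symbCoeff n d s * (tau p 0).eval ((n : ℂ) + 2 * d) := by
  induction s with
  | zero => simp [symbCoeff_zero]
  | succ s ih =>
    have ih := ih (by omega)
    have h1 := congrArg (fun q => q.eval ((n : ℂ) + 2 * d)) (tau_succ (show s < p by omega))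
    simp only [eval_mul, eval_add, eval_neg, eval_C, eval_X] at h1
    have hne : (n : ℂ) + 2 * d + (s + 1) ≠ 0 := by
      exact_mod_cast (by omega : n + 2 * d + (s + 1) ≠ 0)
    have h2 := symbCoeff_succ hne
    refine mul_left_cancel₀ (mul_ne_zero (cast_add_one_ne_zero' s) hne) ?_
    linear_combination h1 - (1 / 2) * (n + 2 * d + (2 * s + 1)) * ih -
      (tau p 0).eval ((n : ℂ) + 2 * d) * h2

/-! ### The quantization in coordinates -/

namespace Darboux

variable {ι : Type} [Fintype ι] [DecidableEq ι] {O : Type} [CommRing O] [Algebra ℂ O]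
  (S : Darboux ι O)

/-- The operator quantizing a symbol of degree `d`, in coordinates. -/
def quantOp (c : ℂ) (d : ℕ) : O →ₗ[ℂ] O →ₗ[ℂ] O :=
  ∑ i ∈ antidiagonal d, quantCoeff c d i.1 • (S.star i.2).comp (S.lap ^ i.1)

lemma quantOp_apply (c : ℂ) (d : ℕ) (f F : O) :
    S.quantOp c d f F =
      ∑ i ∈ antidiagonal d, quantCoeff c d i.1 • S.star i.2 ((S.lap ^ i.1) f) F := by
  simp [quantOp]

lemma E_lap_pow {f : O} {z : ℂ} (hf : S.E f = z • f) (s : ℕ) :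
    S.E ((S.lap ^ s) f) = (z - s) • (S.lap ^ s) f := by
  induction s with
  | zero => simpa
  | succ s ih =>
    rw [pow_succ', Module.End.mul_apply]
    have := S.lap_E ((S.lap ^ s) f)
    rw [ih, map_smul] at this
    push_cast
    rw [eq_sub_of_add_eq this.symm]
    module

lemma E_star_degree {f g : O} {y z : ℂ} (hf : S.E f = y • f) (hg : S.E g = z • g) (q : ℕ) :
    S.E (S.star q f g) = (y + z - q) • S.star q f g := by
  rw [E_star, hf, hg, map_smul, map_smul, LinearMap.smul_apply]
  module

lemma E_quantOp {c : ℂ} {d : ℕ} {f F : O} (hf : S.E f = (d : ℂ) • f) (hF : S.E F = 0) :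
    S.E (S.quantOp c d f F) = 0 := by
  rw [quantOp_apply, map_sum]
  refine sum_eq_zero fun i hi => ?_
  rw [HasAntidiagonal.mem_antidiagonal] at hi
  rw [map_smul, S.E_star_degree (S.E_lap_pow hf i.1) (hF.trans (zero_smul ℂ F).symm), ← hi]
  push_cast
  rw [show ((i.1 : ℂ) + i.2 - i.1 + 0 - i.2) = 0 by ring, zero_smul, smul_zero]

/-- The quantization in homogeneous coordinates only depends on the symbol modulo `J`, up to
multiples of `J`. -/
theorem quantOp_J {c : ℂ} (hc : (Fintype.card ι : ℂ) = c + 1) {d : ℕ}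
    (hd : ∀ s < d, c + 2 * d - (s + 1) ≠ 0) {g F : O} (hg : S.Inv g)
    (hE' : S.E g = ((d : ℂ) - 1) • g)
    (hF : S.Ex F = -((c + 1) / 2) • F) : ∃ w, S.quantOp c d (S.J * g) F = S.J * w := by
  set a : ℕ → O := fun s => quantCoeff c d s • (S.lap ^ s) g with ha
  have hai : ∀ s, S.Inv (a s) := fun s => (hg.lap_pow s).smul _
  have hu : ∀ s ≤ d, quantCoeff c d s • (S.lap ^ s) (S.J * g) = S.jx ((c + 1) / 2) a s := by
    intro s hs
    rw [jx_eq_je _ hai]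
    cases s with
    | zero => simp [ha, je]
    | succ s =>
      have h1 := quantCoeff_succ (hd s (by omega))
      rw [hg.lap_pow_J_mul hc, je, smul_add, ha]
      congr 1
      · rw [mul_smul_comm]
      · have h2 := S.E_lap_pow hE' s
        rw [aeval_Y_X_add, Y_apply]
        simp only [map_smul]
        rw [h2]
        simp only [smul_smul, ← add_smul]
        congr 1
        linear_combination h1
  -- The density is treated as a series concentrated in index zero, so that associativity for series
  -- applies to it.
  have hs := S.starSeq_jx_left ((c + 1) / 2) a (fun s => if s = 0 then F else 0)
  have key : ∀ (u : ℕ → O) (r : ℕ), S.starSeq u (fun s => if s = 0 then F else 0) r =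
      ∑ i ∈ antidiagonal r, S.star i.2 (u i.1) F := by
    intro u r
    refine sum_congr rfl fun i _ => ?_
    rw [Finset.sum_eq_single (i.2, 0)]
    · simp
    · rintro ⟨b, k⟩ hb hne
      rw [HasAntidiagonal.mem_antidiagonal] at hb
      have : k ≠ 0 := by rintro rfl; apply hne; simp at hb; simp [hb]
      simp [this]
    · intro h; exact absurd (by simp) h
  have h3 : S.quantOp c d (S.J * g) F =
      S.jx ((c + 1) / 2) (S.starSeq a (fun s => if s = 0 then F else 0)) d := by
    rw [← hs, key, quantOp_apply]
    refine sum_congr rfl fun i hi => ?_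
    rw [HasAntidiagonal.mem_antidiagonal] at hi
    rw [← hu _ (by omega), map_smul, LinearMap.smul_apply]
  rw [h3]
  cases d with
  | zero => exact ⟨_, rfl⟩
  | succ d =>
    refine ⟨S.starSeq a (fun s => if s = 0 then F else 0) (d + 1), ?_⟩
    -- The remaining term is `Ex + (c + 1) / 2` applied to an expression of weight exactly `-(c + 1)
    -- / 2` in `x`, so it vanishes.
    rw [jx, add_eq_left, key, map_sum, smul_sum, ← sum_add_distrib]
    refine sum_eq_zero fun i hi => ?_
    rw [HasAntidiagonal.mem_antidiagonal] at hi
    have h4 : S.Ex (a i.1) = ((d : ℂ) - i.1) • a i.1 := by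
      rw [hai i.1, ha]
      simp only [map_smul]
      rw [S.E_lap_pow hE' i.1, smul_comm]
      push_cast
      rw [add_sub_cancel_right]
    rw [Ex_star, h4, hF, map_smul (S.star i.2 (a i.1)) (-((c + 1) / 2)),
      map_smul (S.star i.2) ((d : ℂ) - i.1) (a i.1), LinearMap.smul_apply]
    have hi' : (d : ℂ) = i.1 + i.2 := by rw [← hi]; push_cast; rfl
    rw [hi']
    module

/-- There is nothing of negative degree along the fibres. -/
def NoNeg : Prop := ∀ (A : ℕ) (h : O), S.E h = (-((A : ℂ) + 1)) • h → h = 0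

variable {S}

/-- More than `A` derivatives along the fibre of something of degree `A` would have negative degree.
-/
lemma NoNeg.star_eq_zero (hS : S.NoNeg) {A q : ℕ} (hA : A < q) {a : O} (ha : S.E a = (A : ℂ) • a)
    (b : O) : S.star q a b = 0 := by
  induction q generalizing A a b with
  | zero => omega
  | succ q ih =>
    apply star_ext (q := q)
    rw [star_succ, smul_zero]
    refine sum_eq_zero fun k _ => ?_
    have h1 : S.E (S.dξ k a) = ((A : ℂ) - 1) • S.dξ k a := by
      have := S.dξ_E k a
      rw [ha, Derivation.map_smul] at this
      rw [eq_sub_of_add_eq this.symm]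
      module
    cases A with
    | zero =>
      rw [hS 0 (S.dξ k a) (by rw [h1]; simp)]
      simp
    | succ A =>
      refine ih (A := A) (by omega) ?_ _
      rw [h1]; push_cast; simp

lemma NoNeg.lap_pow_eq_zero (hS : S.NoNeg) {A s : ℕ} (hs : A < s) {f : O}
    (hf : S.E f = (A : ℂ) • f) : (S.lap ^ s) f = 0 := by
  refine hS (s - A - 1) _ ?_
  rw [S.E_lap_pow hf]
  congr 1
  rw [Nat.cast_sub (by omega), Nat.cast_sub (by omega)]
  push_cast
  ring

/-- Associativity in total degree `A + B`: any other splitting of the index takes more than `B`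
fibre derivatives of `b` or more than `A` of `a`, hence contributes zero. -/
lemma NoNeg.star_star (hS : S.NoNeg) {A B : ℕ} {a b F : O} (ha : S.E a = (A : ℂ) • a)
    (hb : S.E b = (B : ℂ) • b) : S.star A a (S.star B b F) =
      ∑ i ∈ antidiagonal (A + B), S.star i.2 (S.star i.1 a b) F := by
  rw [star_assoc, Finset.sum_eq_single (B, A)]
  · rintro ⟨q, q'⟩ h hne
    rw [HasAntidiagonal.mem_antidiagonal] at h
    simp only at h ⊢
    rcases lt_trichotomy q B with hq | hq | hq
    · exact hS.star_eq_zero (by omega) ha _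
    · subst hq
      exact absurd (by rw [show q' = A by omega]) hne
    · rw [hS.star_eq_zero hq hb, map_zero]
  · intro h
    rw [HasAntidiagonal.mem_antidiagonal] at h
    exact absurd (Nat.add_comm B A) h

/-- Composition of quantized operators, in terms of standard ordered symbols. -/
theorem NoNeg.quantOp_comp (hS : S.NoNeg) (c : ℂ) {j k : ℕ} {f g F : O}
    (hf : S.E f = (j : ℂ) • f) (hg : S.E g = (k : ℂ) • g) :
    S.quantOp c j f (S.quantOp c k g F) = ∑ i ∈ antidiagonal (j + k),
      S.star i.2 (S.starSeq (fun s => quantCoeff c j s • (S.lap ^ s) f)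
        (fun s => quantCoeff c k s • (S.lap ^ s) g) i.1) F := by
  have h1 : S.quantOp c j f (S.quantOp c k g F) = ∑ a ∈ antidiagonal j, ∑ b ∈ antidiagonal k,
      ∑ i ∈ antidiagonal (a.2 + b.2), (quantCoeff c j a.1 * quantCoeff c k b.1) •
        S.star i.2 (S.star i.1 ((S.lap ^ a.1) f) ((S.lap ^ b.1) g)) F := by
    rw [quantOp_apply]
    refine sum_congr rfl fun a ha => ?_
    rw [HasAntidiagonal.mem_antidiagonal] at ha
    rw [quantOp_apply, map_sum, smul_sum]
    refine sum_congr rfl fun b hb => ?_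
    rw [HasAntidiagonal.mem_antidiagonal] at hb
    rw [map_smul, smul_smul, ← smul_sum, hS.star_star]
    · rw [S.E_lap_pow hf, ← ha]; push_cast; congr 1; ring
    · rw [S.E_lap_pow hg, ← hb]; push_cast; congr 1; ring
  have h2 : ∑ i ∈ antidiagonal (j + k),
      S.star i.2 (S.starSeq (fun s => quantCoeff c j s • (S.lap ^ s) f)
        (fun s => quantCoeff c k s • (S.lap ^ s) g) i.1) F =
      ∑ i ∈ antidiagonal (j + k), ∑ a ∈ antidiagonal i.1, ∑ b ∈ antidiagonal a.2,
        (quantCoeff c j a.1 * quantCoeff c k b.2) •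
        S.star i.2 (S.star b.1 ((S.lap ^ a.1) f) ((S.lap ^ b.2) g)) F := by
    simp only [starSeq, map_sum, LinearMap.sum_apply, map_smul, LinearMap.smul_apply, smul_smul]
    simp only [mul_comm]
  rw [h1, h2]
  simp only [sum_sigma']
  symm
  -- The right side has additional terms with more divergences than the degree of `f` or of `g`.
  -- They are zero, and the remaining ones correspond bijectively to the terms of `h1`.
  rw [← sum_filter_of_ne (p := fun t : (Σ _ : ℕ × ℕ, Σ _ : ℕ × ℕ, ℕ × ℕ) =>
    t.2.1.1 ≤ j ∧ t.2.2.2 ≤ k)]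
  · refine sum_nbij' (fun t => ⟨(t.2.1.1, j - t.2.1.1), (t.2.2.2, k - t.2.2.2), (t.2.2.1, t.1.2)⟩)
      (fun t => ⟨(t.1.1 + t.2.1.1 + t.2.2.1, t.2.2.2), (t.1.1, t.2.2.1 + t.2.1.1),
        (t.2.2.1, t.2.1.1)⟩) ?_ ?_ ?_ ?_ ?_
    · rintro ⟨⟨i1, i2⟩, ⟨a1, a2⟩, ⟨b1, b2⟩⟩; simp; omega
    · rintro ⟨⟨i1, i2⟩, ⟨a1, a2⟩, ⟨b1, b2⟩⟩; simp; omega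
    · rintro ⟨⟨i1, i2⟩, ⟨a1, a2⟩, ⟨b1, b2⟩⟩; simp; omega
    · rintro ⟨⟨i1, i2⟩, ⟨a1, a2⟩, ⟨b1, b2⟩⟩; simp; omega
    · rintro ⟨⟨i1, i2⟩, ⟨a1, a2⟩, ⟨b1, b2⟩⟩; simp
  · rintro ⟨⟨i1, i2⟩, ⟨a1, a2⟩, ⟨b1, b2⟩⟩ _ hne
    by_contra hcon
    apply hne
    simp only at hcon ⊢
    rcases not_and_or.1 hcon with h | h
    · rw [hS.lap_pow_eq_zero (by omega) hf]; simp
    · rw [hS.lap_pow_eq_zero (by omega : k < b2) hg]; simp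

variable (S)

/-- Standard ordered symbols in terms of quantized ones. -/
theorem sum_quantOp_symbCoeff {n : ℕ} (hn : 1 ≤ n) (M : ℕ) (h : ℕ → O) (F : O) :
    ∑ i ∈ antidiagonal M, S.quantOp n i.2 (∑ k ∈ antidiagonal i.1,
      symbCoeff n i.2 k.1 • (S.lap ^ k.1) (h k.2)) F =
      ∑ i ∈ antidiagonal M, S.star i.2 (h i.1) F := by
  have h1 : ∑ i ∈ antidiagonal M, S.quantOp n i.2 (∑ k ∈ antidiagonal i.1,
      symbCoeff n i.2 k.1 • (S.lap ^ k.1) (h k.2)) F =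
      ∑ i ∈ antidiagonal M, ∑ k ∈ antidiagonal i.1, ∑ a ∈ antidiagonal i.2,
        (quantCoeff n i.2 a.1 * symbCoeff n i.2 k.1) • S.star a.2 ((S.lap ^ (a.1 + k.1)) (h k.2)) F := by
    refine sum_congr rfl fun i _ => ?_
    rw [map_sum, LinearMap.sum_apply]
    refine sum_congr rfl fun k _ => ?_
    rw [map_smul, LinearMap.smul_apply, quantOp_apply, smul_sum]
    refine sum_congr rfl fun a _ => ?_
    rw [smul_smul, mul_comm, pow_add, Module.End.mul_apply]
  -- Each term is expanded by inserting the sums of `sum_quantCoeff_symbCoeff`, which are `1` for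
  -- `k.1 = 0` and `0` otherwise. Both sides are then the same sum over three extra indices.
  have h2 : ∑ i ∈ antidiagonal M, S.star i.2 (h i.1) F =
      ∑ i ∈ antidiagonal M, ∑ k ∈ antidiagonal i.2, ∑ a ∈ antidiagonal k.1,
        (quantCoeff n ((i.2 : ℂ) - a.2) a.1 * symbCoeff n ((i.2 : ℂ) - a.2) a.2) •
          S.star k.2 ((S.lap ^ k.1) (h i.1)) F := by
    refine sum_congr rfl fun i _ => ?_
    rw [Finset.sum_eq_single (0, i.2)]
    · simp [quantCoeff_zero, symbCoeff_zero]
    · rintro ⟨k1, k2⟩ hk hne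
      rw [HasAntidiagonal.mem_antidiagonal] at hk
      simp only at hk
      have hk1 : 1 ≤ k1 := by
        rcases Nat.eq_zero_or_pos k1 with rfl | h
        · exact absurd (by rw [← hk, zero_add]) hne
        · exact h
      rw [← sum_smul, sum_quantCoeff_symbCoeff hn hk1 (by omega), zero_smul]
    · intro h; exact absurd (by simp) h
  rw [h1, h2]
  simp only [sum_sigma']
  refine sum_nbij' (fun t => ⟨(t.2.1.2, t.2.1.1 + t.2.2.1 + t.2.2.2),
      (t.2.2.1 + t.2.1.1, t.2.2.2), (t.2.2.1, t.2.1.1)⟩)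
    (fun t => ⟨(t.1.1 + t.2.2.2, t.2.1.2 + t.2.2.1), (t.2.2.2, t.1.1), (t.2.2.1, t.2.1.2)⟩)
    ?_ ?_ ?_ ?_ ?_
  · rintro ⟨⟨i1, i2⟩, ⟨a1, a2⟩, ⟨b1, b2⟩⟩; simp; omega
  · rintro ⟨⟨i1, i2⟩, ⟨a1, a2⟩, ⟨b1, b2⟩⟩; simp; omega
  · rintro ⟨⟨i1, i2⟩, ⟨a1, a2⟩, ⟨b1, b2⟩⟩; simp; omega
  · rintro ⟨⟨i1, i2⟩, ⟨a1, a2⟩, ⟨b1, b2⟩⟩; simp; omega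
  · rintro ⟨⟨i1, i2⟩, ⟨a1, a2⟩, ⟨b1, b2⟩⟩ ht
    simp at ht ⊢
    have e : ((a1 : ℂ) + b1 + b2 - a1) = i2 := by rw [← ht.2.2]; push_cast; ring
    rw [e]

/-- The bidifferential operator on symbols, through the coefficients of the quantization. -/
theorem bidiff_eq (hS : S.NoNeg) {n p j k : ℕ} (hp : p ≤ j + k) {f g : O}
    (hf : S.E f = (j : ℂ) • f) (hg : S.E g = (k : ℂ) • g) :
    S.bidiff n p (sig p) (tau p) f g = ((sig p 0).eval ((n : ℂ) + 2 * j) *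
      (sig p 0).eval ((n : ℂ) + 2 * k) * (tau p 0).eval ((n : ℂ) + 2 * (j + k - p : ℕ))) •
      ∑ i ∈ antidiagonal p, symbCoeff n (j + k - p : ℕ) i.1 • (S.lap ^ i.1)
        (S.starSeq (fun s => quantCoeff n j s • (S.lap ^ s) f)
          (fun s => quantCoeff n k s • (S.lap ^ s) g) i.2) := by
  have ha : ∀ (q : ℂ[X]) (z : ℂ) (f : O), S.E f = z • f →
      aeval (S.Y n) q f = q.eval ((n : ℂ) + 2 * z) • f := by
    intro q z f hf
    have : S.Y n f = ((n : ℂ) + 2 * z) • f := by rw [Y_apply, hf]; module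
    induction q using Polynomial.induction_on' with
    | add p q hp hq => simp [hp, hq, add_smul]
    | monomial m a =>
      have hm : ∀ m : ℕ, (S.Y n ^ m) f = ((n : ℂ) + 2 * z) ^ m • f := by
        intro m
        induction m with
        | zero => simp
        | succ m ih => rw [pow_succ', Module.End.mul_apply, ih, map_smul, this, smul_smul]; rfl
      simp [aeval_monomial, hm, smul_smul, mul_comm]
  have hL : ∀ {j : ℕ} {f : O}, S.E f = (j : ℂ) • f → ∀ s ≤ p, S.lapSeq n (sig p) f s =
      (sig p 0).eval ((n : ℂ) + 2 * j) • quantCoeff n j s • (S.lap ^ s) f := by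
    intro j f hf s hs
    rw [lapSeq, ha _ _ _ hf, map_smul]
    -- For `s > j` the quotient `quantCoeff` may have a zero denominator, but then `lap^s f = 0`.
    rcases le_or_gt s j with h | h
    · rw [sig_eval hs h, smul_smul, mul_comm]
    · rw [hS.lap_pow_eq_zero h hf]; simp
  rw [bidiff_apply, smul_sum]
  refine sum_congr rfl fun i hi => ?_
  rw [HasAntidiagonal.mem_antidiagonal] at hi
  rw [S.starSeq_congr (r := i.2) (fun s hs => hL hf s (by omega))
    (fun s hs => hL hg s (by omega))]
  set w := S.starSeq (fun s => quantCoeff (n : ℂ) j s • (S.lap ^ s) f)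
          (fun s => quantCoeff (n : ℂ) k s • (S.lap ^ s) g) i.2 with hw
  have h1 : S.starSeq (fun s => (sig p 0).eval ((n : ℂ) + 2 * j) •
      quantCoeff (n : ℂ) j s • (S.lap ^ s) f) (fun s => (sig p 0).eval ((n : ℂ) + 2 * k) •
        quantCoeff (n : ℂ) k s • (S.lap ^ s) g) i.2 = ((sig p 0).eval ((n : ℂ) + 2 * j) *
      (sig p 0).eval ((n : ℂ) + 2 * k)) • w := by
    rw [hw]
    simp only [starSeq, smul_sum, map_smul (S.star _) (eval _ _), LinearMap.smul_apply,
      map_smul (S.star _ _) (eval _ _), mul_smul]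
  have hEw : S.E w = ((j : ℂ) + k - i.2) • w := by
    rw [hw, starSeq, map_sum, smul_sum]
    refine sum_congr rfl fun a ha => ?_
    rw [map_sum, smul_sum]
    refine sum_congr rfl fun b hb => ?_
    rw [HasAntidiagonal.mem_antidiagonal] at ha hb
    simp only [map_smul, LinearMap.smul_apply]
    rw [S.E_star_degree (S.E_lap_pow hf _) (S.E_lap_pow hg _), ← ha, ← hb]
    push_cast
    simp only [smul_smul]
    congr 1
    ring
  rw [h1, map_smul, map_smul, ha _ _ _ (S.E_lap_pow hEw i.1)]
  have e : (n : ℂ) + 2 * ((j : ℂ) + k - i.2 - i.1) = (n : ℂ) + 2 * ((j + k - p : ℕ) : ℂ) := by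
    rw [Nat.cast_sub hp, ← hi]; push_cast; ring
  rw [e, tau_eval (by omega), smul_smul, smul_smul]
  congr 1
  ring

lemma E_bidiff {n p j k : ℕ} {f g : O} (hf : S.E f = (j : ℂ) • f) (hg : S.E g = (k : ℂ) • g)
    (σ τ : ℕ → ℂ[X]) :
    S.E (S.bidiff n p σ τ f g) = ((j : ℂ) + k - p) • S.bidiff n p σ τ f g := by
  have hY : ∀ (q : ℂ[X]) (z : ℂ) (f : O), S.E f = z • f →
      S.E (aeval (S.Y n) q f) = z • aeval (S.Y n) q f := by
    intro q z f hf
    rw [← map_smul, ← hf]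
    refine (aeval_intertwine (T := S.E) (fun f => ?_) q f).symm
    simp [Y_apply]
  rw [bidiff_apply, map_sum, smul_sum]
  refine sum_congr rfl fun i hi => ?_
  rw [HasAntidiagonal.mem_antidiagonal] at hi
  refine hY _ _ _ ?_
  have hw : S.E (S.starSeq (S.lapSeq n σ f) (S.lapSeq n σ g) i.2) =
      ((j : ℂ) + k - i.2) • S.starSeq (S.lapSeq n σ f) (S.lapSeq n σ g) i.2 := by
    rw [starSeq, map_sum, smul_sum]
    refine sum_congr rfl fun a ha => ?_
    rw [map_sum, smul_sum]
    refine sum_congr rfl fun b hb => ?_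
    rw [HasAntidiagonal.mem_antidiagonal] at ha hb
    simp only [lapSeq]
    rw [S.E_star_degree (S.E_lap_pow (hY _ _ _ hf) _) (S.E_lap_pow (hY _ _ _ hg) _), ← ha, ← hb]
    push_cast
    congr 1
    ring
  rw [S.E_lap_pow hw, ← hi]
  push_cast
  congr 1
  ring

/-! ### Principal symbols -/

/-- The derivation `∑ ∂f/∂x_a ∂/∂ξ_a`. -/
def nab (f : O) : Module.End ℂ O := ∑ a, LinearMap.mulLeft ℂ (S.dx a f) * (S.dξ a).toLinearMap

lemma nab_apply (f b : O) : S.nab f b = ∑ a, S.dx a f * S.dξ a b := by simp [nab]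

/-- Each of the `m` factors vanishing at the point must absorb a derivative. Fewer than `m`
derivatives give zero; with exactly `m`, every factor takes one, and the paired fibre derivatives
act on `b` as `nab f`. -/
lemma eval_star_pow (ev : O →ₐ[ℂ] ℂ) {f : O} (hf : ∀ a, S.dξ a f = 0) (h0 : ev f = 0) (m : ℕ) :
    (∀ q < m, ∀ b F : O, ev (S.star q b (f ^ m * F)) = 0) ∧
    ∀ b F : O, ev (S.star m b (f ^ m * F)) = ev ((S.nab f ^ m) b) * ev F := by
  induction m with
  | zero => simp [star_zero]
  | succ m ih =>
    have key : ∀ q ≤ m + 1, ∀ b F : O, ev (S.star q b (f ^ (m + 1) * F)) =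
        if q = m + 1 then ev (S.star m (S.nab f b) (f ^ m * F)) else 0 := by
      intro q hq b F
      rw [pow_succ', mul_assoc, S.star_mul_of_dξ_eq_zero hf, map_sum]
      have h1 : S.star 1 b f = S.nab f b := by
        rw [star_one, nab_apply]; exact sum_congr rfl fun a _ => mul_comm _ _
      split_ifs with h
      · subst h
        rw [Finset.sum_eq_single (1, m), h1]
        · rintro ⟨i, l⟩ hi hne
          rw [HasAntidiagonal.mem_antidiagonal] at hi
          simp only at hi ⊢
          rcases Nat.eq_zero_or_pos i with rfl | hi0
          · rw [star_zero, mul_comm b f, S.star_mul_left hf, map_mul, h0, zero_mul]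
          · refine ih.1 l ?_ _ _
            by_contra hl
            exact hne (by rw [show i = 1 by omega, show l = m by omega])
        · intro h; exact absurd (by simp; omega) h
      · refine sum_eq_zero fun i hi => ?_
        rw [HasAntidiagonal.mem_antidiagonal] at hi
        rcases Nat.eq_zero_or_pos i.1 with h3 | hi0
        · rw [h3, star_zero, mul_comm b f, S.star_mul_left hf, map_mul, h0, zero_mul]
        · exact ih.1 i.2 (by omega) _ _
    refine ⟨fun q hq b F => ?_, fun b F => ?_⟩
    · rw [key q (by omega), if_neg (by omega)]
    · rw [key _ le_rfl, if_pos rfl, ih.2, pow_succ, Module.End.mul_apply]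

/-- Only the term without divergences has enough derivatives, so the principal symbol does not
depend on the other coefficients. -/
lemma eval_quantOp_pow (ev : O →ₐ[ℂ] ℂ) (c : ℂ) {f : O} (hf : ∀ a, S.dξ a f = 0) (h0 : ev f = 0)
    (d : ℕ) (b F : O) :
    ev (S.quantOp c d b (f ^ d * F)) = ev ((S.nab f ^ d) b) * ev F := by
  rw [quantOp_apply, map_sum, Finset.sum_eq_single (0, d)]
  · simp only [quantCoeff_zero, one_smul, pow_zero, Module.End.one_apply]
    exact (S.eval_star_pow ev hf h0 d).2 b F
  · rintro ⟨s, q⟩ hi hne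
    rw [HasAntidiagonal.mem_antidiagonal] at hi
    simp only at hi ⊢
    rw [map_smul, (S.eval_star_pow ev hf h0 d).1 q, smul_zero]
    by_contra hq
    exact hne (by rw [show s = 0 by omega, show q = d by omega])
  · intro h; exact absurd (by simp) h

end Darboux

/-! ### Calculus of differential operators -/

section DiffOp

variable {O : Type*} [CommRing O] {M N P : Type*} [AddCommGroup M] [Module O M] [AddCommGroup N]
  [Module O N] [AddCommGroup P] [Module O P]

lemma isDiffOp_const_zero (k : ℕ) : IsDiffOp O k (fun _ : M => (0 : N)) := by
  induction k with
  | zero => intro f s; simp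
  | succ k ih => intro f; simpa using ih

lemma IsDiffOp.add {k : ℕ} {D D' : M → N} (h : IsDiffOp O k D) (h' : IsDiffOp O k D') :
    IsDiffOp O k (fun s => D s + D' s) := by
  induction k generalizing D D' with
  | zero => intro f s; simp only [h f s, h' f s, smul_add]
  | succ k ih =>
    intro f
    convert ih (h f) (h' f) using 2
    rw [smul_add, add_sub_add_comm]

lemma IsDiffOp.sum {κ : Type*} (t : Finset κ) {k : ℕ} {D : κ → M → N}
    (h : ∀ i ∈ t, IsDiffOp O k (D i)) : IsDiffOp O k (fun s => ∑ i ∈ t, D i s) := by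
  classical
  induction t using Finset.induction_on with
  | empty => simpa using isDiffOp_const_zero k
  | insert i t hi ih =>
    simp only [sum_insert hi]
    exact (h i (mem_insert_self _ _)).add (ih fun j hj => h j (mem_insert_of_mem hj))

lemma IsDiffOp.smul {k : ℕ} {D : M → N} (c : O) (h : IsDiffOp O k D) :
    IsDiffOp O k (fun s => c • D s) := by
  induction k generalizing D with
  | zero => intro f s; simp only [h f s]; rw [smul_comm]
  | succ k ih =>
    intro f
    convert ih (h f) using 2
    rw [smul_sub, smul_comm]

lemma IsDiffOp.sub {k : ℕ} {D D' : M → N} (h : IsDiffOp O k D) (h' : IsDiffOp O k D') :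
    IsDiffOp O k (fun s => D s - D' s) := by
  have := h.add (h'.smul (-1))
  simpa [sub_eq_add_neg] using this

lemma IsDiffOp.succ {k : ℕ} {D : M → N} (h : IsDiffOp O k D) : IsDiffOp O (k + 1) D := by
  induction k generalizing D with
  | zero =>
    intro f
    have : (fun s => D (f • s) - f • D s) = fun _ => 0 := by funext s; rw [h f s, sub_self]
    rw [this]
    exact isDiffOp_const_zero 0
  | succ k ih => exact fun f => ih (h f)

lemma IsDiffOp.mono {k l : ℕ} {D : M → N} (h : IsDiffOp O k D) (hkl : k ≤ l) : IsDiffOp O l D :=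
  Nat.le_induction h (fun _ _ h => h.succ) l hkl

lemma IsDiffOp.comp {k l : ℕ} {D : N → P} {D' : M → N} (hD : ∀ a b, D (a - b) = D a - D b)
    (h : IsDiffOp O k D) (h' : IsDiffOp O l D') : IsDiffOp O (k + l) (fun s => D (D' s)) := by
  obtain ⟨m, hm⟩ : ∃ m, m = k + l := ⟨_, rfl⟩
  -- The commutator with a function acts on a composition by the Leibniz rule; each of the two terms
  -- has one order less in total.
  have key : ∀ (D : N → P) (D' : M → N), (∀ a b, D (a - b) = D a - D b) → ∀ f : O,
      (fun s => D (D' (f • s)) - f • D (D' s)) =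
      fun s => D (D' (f • s) - f • D' s) + (D (f • D' s) - f • D (D' s)) := by
    intro D D' hD f; funext s; rw [hD]; abel
  induction m generalizing k l D D' with
  | zero =>
    obtain ⟨rfl, rfl⟩ : k = 0 ∧ l = 0 := by omega
    intro f s
    simp only
    rw [h' f s, h f]
  | succ m ih =>
    rw [← hm]
    intro f
    rw [key D D' hD]
    refine IsDiffOp.add ?_ ?_
    · cases l with
      | zero =>
        have : (fun s => D (D' (f • s) - f • D' s)) = fun _ => 0 := by
          funext s
          rw [h' f s, hD, sub_self]
        rw [this]; exact isDiffOp_const_zero _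
      | succ l => exact (ih hD h (h' f) (by omega)).mono (by omega)
    · cases k with
      | zero =>
        have : (fun s => D (f • D' s) - f • D (D' s)) = fun _ => 0 := by
          funext s
          rw [h f, sub_self]
        rw [this]; exact isDiffOp_const_zero _
      | succ k =>
        exact (ih (D := fun s => D (f • s) - f • D s)
          (fun a b => by simp only [smul_sub, hD]; abel) (h f) h' (by omega)).mono (by omega)

/-- Differential operators can be recognized through jointly injective localizations. -/
lemma IsDiffOp.of_family {κ : Type*} {Oi : κ → Type*} {Mi Ni : κ → Type*}
    [∀ i, CommRing (Oi i)] [∀ i, AddCommGroup (Mi i)] [∀ i, Module (Oi i) (Mi i)]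
    [∀ i, AddCommGroup (Ni i)] [∀ i, Module (Oi i) (Ni i)]
    (ρ : ∀ i, O → Oi i) (r : ∀ i, M → Mi i) (s : ∀ i, N → Ni i)
    (hr : ∀ i f m, r i (f • m) = ρ i f • r i m) (hs : ∀ i f m, s i (f • m) = ρ i f • s i m)
    (hsub : ∀ i a b, s i (a - b) = s i a - s i b) (hinj : ∀ a b, (∀ i, s i a = s i b) → a = b)
    {k : ℕ} {D : M → N} {D' : ∀ i, Mi i → Ni i} (hD : ∀ i m, s i (D m) = D' i (r i m))
    (h : ∀ i, IsDiffOp (Oi i) k (D' i)) : IsDiffOp O k D := by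
  induction k generalizing D D' with
  | zero =>
    intro f m
    refine hinj _ _ fun i => ?_
    rw [hD, hr, h i, hs, hD]
  | succ k ih =>
    intro f
    refine ih (D' := fun i m => D' i (ρ i f • m) - ρ i f • D' i m) (fun i m => ?_)
      fun i => h i (ρ i f)
    simp only [hsub, hs, hD, hr]

lemma isDiffOp_id : IsDiffOp O 0 (fun f : O => f) := fun _ _ => rfl

lemma isDiffOp_mul_left (f : O) : IsDiffOp O 0 (fun g : O => f * g) := fun _ _ => mul_left_comm _ _ _

lemma isDiffOp_mul_right (g : O) : IsDiffOp O 0 (fun f : O => f * g) := fun _ _ => mul_assoc _ _ _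

lemma IsDiffOp.csmul [Algebra ℂ O] {k : ℕ} {D : O → O} (h : IsDiffOp O k D) (c : ℂ) :
    IsDiffOp O k (fun f => c • D f) := by
  have := h.smul (algebraMap ℂ O c)
  simpa [Algebra.smul_def] using this

end DiffOp

/-! ### Orders of the operators in coordinates -/

namespace Darboux

section Order

variable {ι : Type} [Fintype ι] [DecidableEq ι] {O : Type} [CommRing O] [Algebra ℂ O]
  (S : Darboux ι O)

lemma isDiffOp_derivation (d : Derivation ℂ O O) : IsDiffOp O 1 (fun f => d f) := by
  intro f g s
  simp only [smul_eq_mul, Derivation.leibniz]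
  ring

lemma isDiffOp_E : IsDiffOp O 1 (fun f => S.E f) := by
  simp only [E_apply]
  exact IsDiffOp.sum _ fun a _ => (isDiffOp_derivation (S.dξ a)).smul (S.ξ a)

lemma isDiffOp_lap : IsDiffOp O 2 (fun f => S.lap f) := by
  simp only [lap_apply]
  exact IsDiffOp.sum _ fun a _ => IsDiffOp.comp (k := 1) (l := 1) (D := S.dx a) (D' := S.dξ a)
    (map_sub _) (isDiffOp_derivation _) (isDiffOp_derivation _)

lemma isDiffOp_lap_pow (s : ℕ) : IsDiffOp O (2 * s) (fun f => (S.lap ^ s) f) := by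
  induction s with
  | zero => exact isDiffOp_id
  | succ s ih =>
    have := IsDiffOp.comp (D := S.lap) (map_sub _) S.isDiffOp_lap ih
    simpa only [pow_succ', Module.End.mul_apply, mul_add, add_comm, mul_one] using this

lemma isDiffOp_aeval_Y (c : ℂ) (q : ℂ[X]) :
    IsDiffOp O q.natDegree (fun f => aeval (S.Y c) q f) := by
  have hY : ∀ m : ℕ, IsDiffOp O m (fun f => (S.Y c ^ m) f) := by
    intro m
    induction m with
    | zero => exact isDiffOp_id
    | succ m ih =>
      have hY1 : IsDiffOp O 1 (fun f => S.Y c f) := by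
        simp only [Y_apply]
        exact (IsDiffOp.csmul (IsDiffOp.mono (isDiffOp_id (O := O)) zero_le_one) c).add
          (IsDiffOp.csmul S.isDiffOp_E 2)
      have := IsDiffOp.comp (D := S.Y c) (map_sub _) hY1 ih
      simpa only [pow_succ', Module.End.mul_apply, add_comm] using this
  simp only [aeval_eq_sum_range, LinearMap.sum_apply, LinearMap.smul_apply]
  exact IsDiffOp.sum _ fun m hm =>
    IsDiffOp.csmul ((hY m).mono (by simpa [Nat.lt_succ_iff] using hm)) _

lemma isDiffOp_star (q : ℕ) :
    (∀ f, IsDiffOp O q (fun g => S.star q f g)) ∧ ∀ g, IsDiffOp O q (fun f => S.star q f g) := by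
  induction q with
  | zero =>
    simp only [star_zero]
    exact ⟨isDiffOp_mul_left, isDiffOp_mul_right⟩
  | succ q ih =>
    have hq : ∀ f g, S.star (q + 1) f g =
        ((q : ℂ) + 1)⁻¹ • ∑ a, S.star q (S.dξ a f) (S.dx a g) := by
      intro f g
      rw [← star_succ, smul_smul, inv_mul_cancel₀ (by exact_mod_cast Nat.succ_ne_zero q), one_smul]
    simp only [hq]
    exact ⟨fun f => IsDiffOp.csmul (IsDiffOp.sum _ fun a _ => IsDiffOp.comp
        (D := S.star q (S.dξ a f)) (map_sub _) (ih.1 _) (isDiffOp_derivation (S.dx a))) _,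
      fun g => IsDiffOp.csmul (IsDiffOp.sum _ fun a _ => IsDiffOp.comp
        (D := fun f => S.star q f (S.dx a g)) (fun _ _ => by simp) (ih.2 _)
        (isDiffOp_derivation (S.dξ a))) _⟩

lemma isDiffOp_quantOp (c : ℂ) (d : ℕ) (f : O) : IsDiffOp O d (fun F => S.quantOp c d f F) := by
  simp only [quantOp_apply]
  refine IsDiffOp.sum _ fun i hi => IsDiffOp.csmul (((S.isDiffOp_star i.2).1 _).mono ?_) _
  rw [HasAntidiagonal.mem_antidiagonal] at hi
  omega

/-- The operator `bidiff` has an order that does not depend on the algebra. -/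
lemma isBidiffOfOrder_bidiff (c : ℂ) (p : ℕ) (σ τ : ℕ → ℂ[X]) :
    IsBidiffOfOrder ((∑ s ∈ range (p + 1), (τ s).natDegree) + 2 * p + (p + (2 * p +
      ∑ s ∈ range (p + 1), (σ s).natDegree))) (S.bidiff c p σ τ) := by
  have hL : ∀ s ≤ p, IsDiffOp O (2 * p + ∑ s ∈ range (p + 1), (σ s).natDegree)
      (fun f => S.lapSeq c σ f s) := by
    intro s hs
    have h1 := IsDiffOp.comp (D := S.lap ^ s) (map_sub _) (S.isDiffOp_lap_pow s)
      (S.isDiffOp_aeval_Y c (σ s))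
    have h2 : (σ s).natDegree ≤ ∑ s ∈ range (p + 1), (σ s).natDegree :=
      single_le_sum (f := fun s => (σ s).natDegree) (fun _ _ => Nat.zero_le _)
        (mem_range.2 (by omega))
    exact h1.mono (by omega)
  have hT : ∀ i ∈ antidiagonal p, IsDiffOp O ((∑ s ∈ range (p + 1), (τ s).natDegree) + 2 * p)
      (fun f => aeval (S.Y c) (τ i.1) ((S.lap ^ i.1) f)) := by
    intro i hi
    rw [HasAntidiagonal.mem_antidiagonal] at hi
    have h1 := IsDiffOp.comp (D := aeval (S.Y c) (τ i.1)) (map_sub _)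
      (S.isDiffOp_aeval_Y c (τ i.1)) (S.isDiffOp_lap_pow i.1)
    have h2 : (τ i.1).natDegree ≤ ∑ s ∈ range (p + 1), (τ s).natDegree :=
      single_le_sum (f := fun s => (τ s).natDegree) (fun _ _ => Nat.zero_le _)
        (mem_range.2 (by omega))
    exact h1.mono (by omega)
  simp only [IsBidiffOfOrder, bidiff_apply]
  refine ⟨fun f => IsDiffOp.sum _ fun i hi => IsDiffOp.comp (D := fun f =>
      aeval (S.Y c) (τ i.1) ((S.lap ^ i.1) f)) (fun _ _ => by simp) (hT i hi) ?_,
    fun g => IsDiffOp.sum _ fun i hi => IsDiffOp.comp (D := fun f =>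
      aeval (S.Y c) (τ i.1) ((S.lap ^ i.1) f)) (fun _ _ => by simp) (hT i hi) ?_⟩
  · refine IsDiffOp.sum _ fun j hj => IsDiffOp.sum _ fun k hk => ?_
    rw [HasAntidiagonal.mem_antidiagonal] at hi hj hk
    exact IsDiffOp.comp (D := S.star k.1 _) (map_sub _)
      (((S.isDiffOp_star k.1).1 _).mono (by omega)) (hL _ (by omega))
  · refine IsDiffOp.sum _ fun j hj => IsDiffOp.sum _ fun k hk => ?_
    rw [HasAntidiagonal.mem_antidiagonal] at hi hj hk
    exact IsDiffOp.comp (D := fun f => S.star k.1 f _) (fun _ _ => by simp)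
      (((S.isDiffOp_star k.1).2 _).mono (by omega)) (hL _ (by omega))

end Order

/-! ### Naturality -/

section Naturality

variable {ι ι' : Type} [Fintype ι] [DecidableEq ι] [Fintype ι'] [DecidableEq ι']
  {O O' : Type} [CommRing O] [Algebra ℂ O] [CommRing O'] [Algebra ℂ O']
  {S : Darboux ι O} {S' : Darboux ι' O'}

/-- Linear maps between function algebras compatible with all the operators in use. -/
structure Compat (S : Darboux ι O) (S' : Darboux ι' O') (θ : O →ₗ[ℂ] O') : Prop where
  E : ∀ f, S'.E (θ f) = θ (S.E f)
  lap : ∀ f, S'.lap (θ f) = θ (S.lap f)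
  star : ∀ q f g, S'.star q (θ f) (θ g) = θ (S.star q f g)

lemma lap_pow_intertwine {θ : O →ₗ[ℂ] O'} (h : ∀ f, S'.lap (θ f) = θ (S.lap f)) (s : ℕ) (f : O) :
    (S'.lap ^ s) (θ f) = θ ((S.lap ^ s) f) := by
  induction s with
  | zero => rfl
  | succ s ih => rw [pow_succ', Module.End.mul_apply, ih, h, pow_succ', Module.End.mul_apply]

lemma Compat.bidiff {θ : O →ₗ[ℂ] O'} (h : Compat S S' θ) (c : ℂ) (p : ℕ) (σ τ : ℕ → ℂ[X])
    (f g : O) : S'.bidiff c p σ τ (θ f) (θ g) = θ (S.bidiff c p σ τ f g) := by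
  have hY : ∀ (q : ℂ[X]) f, aeval (S'.Y c) q (θ f) = θ (aeval (S.Y c) q f) := fun q f =>
    aeval_intertwine (fun f => by simp only [Y_apply, map_add, map_smul, h.E]) q f
  have hL : ∀ f, S'.lapSeq c σ (θ f) = fun s => θ (S.lapSeq c σ f s) := fun f => by
    funext s; rw [lapSeq, hY, lap_pow_intertwine h.lap]; rfl
  simp only [bidiff_apply, map_sum, hL, starSeq, h.star, lap_pow_intertwine h.lap, hY]

lemma Compat.quantOp {θ θ' : O →ₗ[ℂ] O'} (h : Compat S S' θ)
    (hs : ∀ q f g, S'.star q (θ f) (θ' g) = θ' (S.star q f g)) (c : ℂ) (d : ℕ) (f g : O) :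
    S'.quantOp c d (θ f) (θ' g) = θ' (S.quantOp c d f g) := by
  simp only [quantOp_apply, map_sum, map_smul, lap_pow_intertwine h.lap, hs]

/-- Compatibility with linear changes of coordinates. -/
lemma compat_of_linear {θ : O →ₐ[ℂ] O'} {A B : ι' → ι → ℂ}
    (hx : ∀ a f, S'.dx a (θ f) = ∑ b, A a b • θ (S.dx b f))
    (hξ : ∀ a f, S'.dξ a (θ f) = ∑ b, B a b • θ (S.dξ b f))
    (hAB : ∀ b c, ∑ a, A a b * B a c = if b = c then 1 else 0)
    (hB : ∀ c, ∑ a, B a c • S'.ξ a = θ (S.ξ c)) : Compat S S' θ.toLinearMap where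
  E f := by
    simp only [AlgHom.toLinearMap_apply, E_apply, hξ, map_sum, map_mul, ← hB, mul_sum, sum_mul]
    rw [sum_comm]
    simp only [mul_smul_comm, smul_mul_assoc]
  lap f := by
    simp only [AlgHom.toLinearMap_apply, lap_apply, hξ, map_sum, Derivation.map_smul, hx, smul_sum,
      smul_smul]
    rw [sum_comm]
    simp only [sum_comm (s := (univ : Finset ι')) (t := (univ : Finset ι)), ← sum_smul]
    have : ∀ b c, ∑ a, B a b * A a c = if c = b then 1 else 0 := fun b c => by
      rw [← hAB]; exact sum_congr rfl fun _ _ => mul_comm _ _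
    simp [this]
  star q := by
    simp only [AlgHom.toLinearMap_apply]
    induction q with
    | zero => intro f g; simp [star_zero]
    | succ q ih =>
      intro f g
      apply star_ext (q := q)
      rw [star_succ, ← map_smul θ, star_succ, map_sum]
      simp only [hx, hξ, map_sum, LinearMap.sum_apply, map_smul, LinearMap.smul_apply, ih, smul_sum,
        smul_smul]
      rw [sum_comm]
      simp only [sum_comm (s := (univ : Finset ι')) (t := (univ : Finset ι)), ← sum_smul, hAB]
      simp

/-- The only nonconstant coefficients in `bidiff` are the `ξ_a` inside `E`. A derivation killing
them and commuting with the partial derivatives satisfies the Leibniz rule; it is applied to the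
parameter of `slide`. -/
lemma deriv_bidiff (d : Derivation ℂ O O) (h1 : ∀ a f, d (S.dx a f) = S.dx a (d f))
    (h2 : ∀ a f, d (S.dξ a f) = S.dξ a (d f)) (h3 : ∀ a, d (S.ξ a) = 0) (c : ℂ) (p : ℕ)
    (σ τ : ℕ → ℂ[X]) (f g : O) : d (S.bidiff c p σ τ f g) =
      S.bidiff c p σ τ (d f) g + S.bidiff c p σ τ f (d g) := by
  have hE : ∀ f, S.E (d f) = d (S.E f) := fun f => by
    simp only [E_apply, map_sum, Derivation.leibniz, h3, h2, mul_zero, add_zero, smul_eq_mul]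
  have hl : ∀ f, S.lap (d f) = d (S.lap f) := fun f => by
    simp only [lap_apply, map_sum, h1, h2]
  have hY : ∀ (q : ℂ[X]) f, d (aeval (S.Y c) q f) = aeval (S.Y c) q (d f) := fun q f =>
    (aeval_intertwine (T := d.toLinearMap) (fun f => by
      simp only [Y_apply, map_add, map_smul, Derivation.coeFn_coe, hE]) q f).symm
  have hL : ∀ s f, d ((S.lap ^ s) f) = (S.lap ^ s) (d f) := fun s f =>
    (lap_pow_intertwine (S := S) (S' := S) (θ := d.toLinearMap) hl s f).symm
  simp only [bidiff_apply, map_sum, hY, hL, starSeq, S.deriv_star d h1 h2, lapSeq, map_add,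
    sum_add_distrib]

lemma deriv_quantOp (e : Derivation ℂ O O) (h1 : ∀ a f, e (S.dx a f) = S.dx a (e f))
    (h2 : ∀ a f, e (S.dξ a f) = S.dξ a (e f)) (c : ℂ) (d : ℕ) (f g : O) :
    e (S.quantOp c d f g) = S.quantOp c d (e f) g + S.quantOp c d f (e g) := by
  have hl : ∀ f, S.lap (e f) = e (S.lap f) := fun f => by
    simp only [lap_apply, map_sum, h1, h2]
  have hL : ∀ s f, e ((S.lap ^ s) f) = (S.lap ^ s) (e f) := fun s f =>
    (lap_pow_intertwine (S := S) (S' := S) (θ := e.toLinearMap) hl s f).symm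
  simp only [quantOp_apply, map_sum, Derivation.map_smul, hL, S.deriv_star e h1 h2, smul_add,
    sum_add_distrib]

lemma compat_of_commute {S' : Darboux ι O'} {θ : O →ₐ[ℂ] O'}
    (hx : ∀ a f, S'.dx a (θ f) = θ (S.dx a f)) (hξ : ∀ a f, S'.dξ a (θ f) = θ (S.dξ a f))
    (h : ∀ c, S'.ξ c = θ (S.ξ c)) : Compat S S' θ.toLinearMap :=
  compat_of_linear (A := fun a b => if a = b then 1 else 0) (B := fun a b => if a = b then 1 else 0)
    (fun a f => by simp [hx]) (fun a f => by simp [hξ]) (fun b c => by simp [eq_comm]) (fun c => by simp [h])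

end Naturality

section Affine

variable {n : ℕ} {O O' : Type} [CommRing O] [Algebra ℂ O] [CommRing O'] [Algebra ℂ O']
  {S : Darboux (Fin n) O} {S' : Darboux (Fin (n + 1)) O'} (i : Fin (n + 1)) {θ : O →ₐ[ℂ] O'}
  {y y' : O'}

/-- Passage from affine to homogeneous coordinates, where `y` is the `i`-th homogeneous coordinate
and `y'` its inverse. -/
structure Homogenize (S : Darboux (Fin n) O) (S' : Darboux (Fin (n + 1)) O') (i : Fin (n + 1))
    (θ : O →ₐ[ℂ] O') (y y' : O') : Prop where
  mul_inv : y * y' = 1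
  dξ_y : ∀ a, S'.dξ a y = 0
  dξ_y' : ∀ a, S'.dξ a y' = 0
  dx_y : ∀ k, S'.dx (i.succAbove k) y = 0
  dx_y' : ∀ k, S'.dx (i.succAbove k) y' = 0
  dξ_i : ∀ f, S'.dξ i (θ f) = 0
  dξ : ∀ k f, S'.dξ (i.succAbove k) (θ f) = y * θ (S.dξ k f)
  dx : ∀ k f, S'.dx (i.succAbove k) (θ f) = y' * θ (S.dx k f)
  ξ : ∀ k, S'.ξ (i.succAbove k) * y = θ (S.ξ k)

variable {i}

/-- Functions of the affine coordinates do not involve `ξ_i`, so the `i`-th pair of derivatives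
drops out; in the others the factor `y` of `∂/∂ξ` cancels the factor `y'` of `∂/∂x`. The multiplier
`m` leaves room for the homogeneity factor of a half-density. -/
lemma Homogenize.star_mul (h : Homogenize S S' i θ y y') {m : O'} (hm : ∀ a, S'.dξ a m = 0)
    (hm' : ∀ k, S'.dx (i.succAbove k) m = 0) (q : ℕ) (f g : O) :
    S'.star q (θ f) (m * θ g) = m * θ (S.star q f g) := by
  induction q generalizing m f g with
  | zero => simp only [star_zero, map_mul]; ring
  | succ q ih =>
    apply star_ext (q := q)
    rw [star_succ, Fin.sum_univ_succAbove _ i, h.dξ_i, map_zero, LinearMap.zero_apply, zero_add,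
      ← mul_smul_comm, ← map_smul θ, star_succ, map_sum, mul_sum]
    refine sum_congr rfl fun k _ => ?_
    have e : S'.dx (i.succAbove k) (m * θ g) = (m * y') * θ (S.dx k g) := by
      rw [Derivation.leibniz, hm', smul_zero, add_zero, smul_eq_mul, h.dx, mul_assoc]
    rw [e, h.dξ, S'.star_mul_left h.dξ_y, ih, ← mul_assoc, mul_left_comm, h.mul_inv, mul_one]
    · intro a; rw [Derivation.leibniz, hm, h.dξ_y']; simp
    · intro a; rw [Derivation.leibniz, hm', h.dx_y']; simp

lemma Homogenize.compat (h : Homogenize S S' i θ y y') : Compat S S' θ.toLinearMap where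
  E f := by
    simp only [AlgHom.toLinearMap_apply, E_apply, map_sum, map_mul, ← h.ξ]
    rw [Fin.sum_univ_succAbove _ i, h.dξ_i, mul_zero, zero_add]
    exact sum_congr rfl fun k _ => by rw [h.dξ, mul_assoc]
  lap f := by
    simp only [AlgHom.toLinearMap_apply, lap_apply, map_sum]
    rw [Fin.sum_univ_succAbove _ i, h.dξ_i, map_zero, zero_add]
    refine sum_congr rfl fun k _ => ?_
    rw [h.dξ, Derivation.leibniz, h.dx_y, smul_zero, add_zero, smul_eq_mul, h.dx, ← mul_assoc,
      h.mul_inv, one_mul]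
  star q f g := by
    have := h.star_mul (m := 1) (by simp) (by simp) q f g
    simpa using this

lemma Homogenize.quantOp (h : Homogenize S S' i θ y y') {m : O'} (hm : ∀ a, S'.dξ a m = 0)
    (hm' : ∀ k, S'.dx (i.succAbove k) m = 0) (c : ℂ) (d : ℕ) (f g : O) :
    S'.quantOp c d (θ f) (m * θ g) = m * θ (S.quantOp c d f g) :=
  h.compat.quantOp (θ' := LinearMap.mulLeft ℂ m ∘ₗ θ.toLinearMap) (fun q f g => h.star_mul hm hm' q f g)
    c d f g

end Affine

/-! ### Linear vector fields -/

section Lie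

variable {ι : Type} [Fintype ι] [DecidableEq ι] {O : Type} [CommRing O] [Algebra ℂ O]
  (S : Darboux ι O)

/-- The derivation `∑ X_ab (ξ_a ∂/∂ξ_b - x_b ∂/∂x_a)`. -/
def lie (X : ι → ι → ℂ) : Derivation ℂ O O :=
  ∑ a, ∑ b, X a b • (S.ξ a • S.dξ b - S.x b • S.dx a)

lemma lie_apply (X : ι → ι → ℂ) (f : O) :
    S.lie X f = ∑ a, ∑ b, X a b • (S.ξ a * S.dξ b f - S.x b * S.dx a f) := by
  simp only [lie]
  have : ∀ (s : Finset ι) (d : ι → Derivation ℂ O O), (∑ a ∈ s, d a) f = ∑ a ∈ s, d a f := by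
    intro s d
    have h := map_sum (Derivation.coeFnAddMonoidHom (R := ℂ) (A := O) (M := O)) d s
    have h' := congrFun h f
    rwa [Finset.sum_apply] at h'
  simp [this]

variable (X : ι → ι → ℂ)

lemma dx_lie (c : ι) (f : O) :
    S.dx c (S.lie X f) = S.lie X (S.dx c f) - ∑ a, X a c • S.dx a f := by
  simp only [lie_apply, map_sum, Derivation.map_smul, map_sub, Derivation.leibniz, S.dx_ξ, S.dx_x,
    smul_eq_mul, S.dx_dx c, S.dx_dξ c, mul_zero, add_zero, ← sum_sub_distrib]
  refine sum_congr rfl fun a _ => ?_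
  rw [eq_sub_iff_add_eq, ← sub_eq_zero, add_sub_right_comm, ← sum_sub_distrib]
  have : ∀ b, X a b • (S.ξ a * S.dξ b (S.dx c f) - (S.x b * S.dx a (S.dx c f) + S.dx a f *
      if c = b then 1 else 0)) - X a b • (S.ξ a * S.dξ b (S.dx c f) - S.x b * S.dx a (S.dx c f)) =
      - if c = b then X a b • S.dx a f else 0 := by
    intro b
    rw [← smul_sub]
    split_ifs <;> simp
  simp only [this]
  simp

lemma dξ_lie (c : ι) (f : O) :
    S.dξ c (S.lie X f) = S.lie X (S.dξ c f) + ∑ b, X c b • S.dξ b f := by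
  simp only [lie_apply, map_sum, Derivation.map_smul, map_sub, Derivation.leibniz, S.dξ_ξ, S.dξ_x,
    smul_eq_mul, S.dξ_dξ c, ← S.dx_dξ _ c, mul_zero, add_zero]
  rw [← sub_eq_iff_eq_add', ← sum_sub_distrib, Finset.sum_eq_single c]
  · rw [← sum_sub_distrib]
    refine sum_congr rfl fun b _ => ?_
    rw [← smul_sub]
    simp
  · intro a _ hne
    simp [hne.symm]
  · simp

lemma lie_ξ (c : ι) : S.lie X (S.ξ c) = ∑ a, X a c • S.ξ a := by
  simp [lie_apply, S.dξ_ξ, S.dx_ξ]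

lemma lie_x (c : ι) : S.lie X (S.x c) = -∑ b, X c b • S.x b := by
  rw [lie_apply, Finset.sum_eq_single c]
  · simp [S.dξ_x, S.dx_x]
  · intro a _ hne; simp [S.dξ_x, S.dx_x, hne]
  · simp

lemma lie_star (q : ℕ) (f g : O) :
    S.lie X (S.star q f g) = S.star q (S.lie X f) g + S.star q f (S.lie X g) := by
  induction q generalizing f g with
  | zero => simp only [star_zero, Derivation.leibniz, smul_eq_mul]; ring
  | succ q ih =>
    apply star_ext (q := q)
    rw [← Derivation.map_smul, smul_add, star_succ, star_succ, star_succ, map_sum]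
    simp only [ih, dx_lie, dξ_lie, map_add, map_sub, LinearMap.add_apply, sum_add_distrib,
      sum_sub_distrib, map_sum, LinearMap.sum_apply, map_smul, LinearMap.smul_apply]
    rw [sum_comm (f := fun a b => X b a • S.star q (S.dξ a f) (S.dx b g))]
    abel

lemma lie_E (f : O) : S.lie X (S.E f) = S.E (S.lie X f) := by
  simp only [E_apply, map_sum, Derivation.leibniz, smul_eq_mul, lie_ξ, dξ_lie, mul_add,
    sum_add_distrib, mul_sum]
  congr 1
  rw [sum_comm]
  simp only [mul_smul_comm]
  exact sum_congr rfl fun _ _ => sum_congr rfl fun _ _ => by rw [mul_comm]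

lemma lie_Ex (f : O) : S.lie X (S.Ex f) = S.Ex (S.lie X f) := by
  simp only [Ex_apply, map_sum, Derivation.leibniz, smul_eq_mul, lie_x, dx_lie, mul_sub,
    sum_add_distrib, sum_sub_distrib, mul_sum, mul_neg, sum_neg_distrib]
  rw [sub_eq_add_neg]
  congr 2
  rw [sum_comm]
  simp only [mul_smul_comm]
  exact sum_congr rfl fun _ _ => sum_congr rfl fun _ _ => by rw [mul_comm]

/-- The commutators with `∂/∂x_a` and `∂/∂ξ_a` are given by dual matrices with opposite signs, so
they cancel in `lap`. -/
lemma lie_lap (f : O) : S.lie X (S.lap f) = S.lap (S.lie X f) := by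
  simp only [lap_apply, map_sum, dξ_lie, map_add, dx_lie, sum_add_distrib, sum_sub_distrib,
    Derivation.map_smul]
  rw [sum_comm (f := fun a b => X b a • S.dx b (S.dξ a f))]
  abel

lemma lie_quantOp (c : ℂ) (d : ℕ) (f F : O) :
    S.lie X (S.quantOp c d f F) = S.quantOp c d (S.lie X f) F + S.quantOp c d f (S.lie X F) := by
  have h : ∀ s f, S.lie X ((S.lap ^ s) f) = (S.lap ^ s) (S.lie X f) := fun s f =>
    (lap_pow_intertwine (S := S) (S' := S) (θ := (S.lie X).toLinearMap)
      (fun f => (S.lie_lap X f).symm) s f).symm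
  simp only [quantOp_apply, map_sum, Derivation.map_smul, lie_star, h, smul_add, sum_add_distrib]

variable {S} in
lemma Inv.lie {f : O} (hf : S.Inv f) : S.Inv (S.lie X f) := by
  unfold Inv at *
  rw [← lie_Ex, hf, lie_E]

lemma lie_single (a b : ι) (f : O) :
    S.lie (Pi.single a (Pi.single b 1)) f = S.ξ a * S.dξ b f - S.x b * S.dx a f := by
  rw [lie_apply, Finset.sum_eq_single a, Finset.sum_eq_single b]
  · simp
  · intro c _ h; simp [h]
  · simp
  · intro c _ h; simp [h]
  · simp

variable {S} in
lemma Inv.lie_one {f : O} (hf : S.Inv f) (c : ℂ) :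
    S.lie (fun a b => if a = b then c else 0) f = 0 := by
  rw [lie_apply]
  have : ∀ a b, (if a = b then c else 0) • (S.ξ a * S.dξ b f - S.x b * S.dx a f) =
      if a = b then c • (S.ξ a * S.dξ b f - S.x b * S.dx a f) else 0 := by
    intro a b; split_ifs <;> simp
  simp only [this, sum_ite_eq, mem_univ, if_true, ← smul_sum, sum_sub_distrib]
  rw [← E_apply, ← Ex_apply, hf, sub_self, smul_zero]

variable {S} in
/-- The Casimir operator of the linear vector fields. -/
lemma Inv.casimir {c : ℂ} (hc : (Fintype.card ι : ℂ) = c + 1) {f : O} (hf : S.Inv f) :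
    ∑ a, ∑ b, S.lie (Pi.single a (Pi.single b 1)) (S.lie (Pi.single b (Pi.single a 1)) f) =
      (2 : ℂ) • (S.E (S.E f) + c • S.E f) - (2 : ℂ) • (S.J * S.lap f) := by
  have hEE : S.E (S.E f) = ∑ a, ∑ b, S.ξ a * (S.ξ b * S.dξ b (S.dξ a f)) + S.E f := by
    rw [E_apply S (S.E f)]
    simp only [dξ_E, mul_add, sum_add_distrib]
    rw [← E_apply]
    simp only [E_apply, mul_sum]
  have hXX : S.Ex (S.Ex f) = ∑ a, ∑ b, S.x a * (S.x b * S.dx b (S.dx a f)) + S.Ex f := by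
    rw [Ex_apply S (S.Ex f)]
    simp only [dx_Ex, mul_add, sum_add_distrib]
    rw [← Ex_apply]
    simp only [Ex_apply, mul_sum]
  have hJ : S.J * S.lap f = ∑ a, ∑ b, S.x a * S.ξ a * S.dx b (S.dξ b f) := by
    rw [lap_apply, J, sum_mul_sum]
  have key : ∀ a b, S.lie (Pi.single a (Pi.single b 1)) (S.lie (Pi.single b (Pi.single a 1)) f) =
      S.ξ a * (S.ξ b * S.dξ b (S.dξ a f)) + S.ξ a * S.dξ a f
        + (S.x b * (S.x a * S.dx a (S.dx b f)) + S.x b * S.dx b f)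
        - (S.x a * S.ξ a * S.dx b (S.dξ b f) + S.x b * S.ξ b * S.dx a (S.dξ a f)) := by
    intro a b
    simp only [lie_single, map_sub, Derivation.leibniz, smul_eq_mul, S.dξ_ξ, S.dξ_x, S.dx_x, S.dx_ξ,
      if_true, mul_zero, mul_one, S.dx_dξ]
    ring
  have h5 : ∑ a, ∑ b, S.x b * (S.x a * S.dx a (S.dx b f)) =
      ∑ a, ∑ b, S.x a * (S.x b * S.dx b (S.dx a f)) := sum_comm
  have h6 : ∑ a, ∑ b, S.x b * S.ξ b * S.dx a (S.dξ a f) =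
      ∑ a, ∑ b, S.x a * S.ξ a * S.dx b (S.dξ b f) := sum_comm
  have h7 : ∀ g : ι → O, ∑ a, ∑ _b : ι, g a = (Fintype.card ι : ℂ) • ∑ a, g a := by
    intro g
    simp only [sum_const, smul_sum, Nat.cast_smul_eq_nsmul]; rfl
  have h8 : ∑ _a : ι, ∑ b, S.x b * S.dx b f = (Fintype.card ι : ℂ) • ∑ a, S.x a * S.dx a f := by
    rw [sum_const, Nat.cast_smul_eq_nsmul]; rfl
  simp only [key, sum_add_distrib, sum_sub_distrib, h5, h6, h8]
  rw [h7, ← hJ, ← E_apply, ← Ex_apply, ← sub_eq_of_eq_add hEE, ← sub_eq_of_eq_add hXX, hc]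
  have hf' : S.Ex (S.E f) = S.E (S.E f) := by rw [Ex_E, hf]
  rw [hf, hf']
  module

end Lie

end Darboux

/-! ### Algebras of smooth functions on open sets -/

lemma hasDerivAt_line {𝕜 E : Type*} [RCLike 𝕜] [NormedAddCommGroup E] [NormedSpace 𝕜 E]
    (w v : E) : HasDerivAt (fun t : 𝕜 => w + t • v) v 0 := by
  simpa using ((hasDerivAt_id (0 : 𝕜)).smul_const v).const_add w

section Sm

/-- Extension by zero of a function on a subset. -/
def extZero {E : Type*} {Ω : Set E} (f : Ω → ℂ) (w : E) : ℂ :=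
  open Classical in if h : w ∈ Ω then f ⟨w, h⟩ else 0

lemma extZero_of_mem {E : Type*} {Ω : Set E} (f : Ω → ℂ) {w : E} (h : w ∈ Ω) :
    extZero f w = f ⟨w, h⟩ := dif_pos h

lemma extZero_coe {E : Type*} {Ω : Set E} (f : Ω → ℂ) (w : Ω) : extZero f w = f w :=
  dif_pos w.2

lemma extZero_eventuallyEq {E : Type*} [TopologicalSpace E] {Ω : Opens E} {f : Ω → ℂ} {F : E → ℂ}
    (h : ∀ w : Ω, f w = F w) {w : E} (hw : w ∈ Ω) : extZero f =ᶠ[nhds w] F := by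
  filter_upwards [Ω.isOpen.mem_nhds hw] with v hv
  rw [extZero_of_mem f hv, h]

variable (𝕜 : Type) [RCLike 𝕜] [NormedAlgebra 𝕜 ℂ] {E E' : Type} [NormedAddCommGroup E]
  [NormedSpace 𝕜 E] [NormedAddCommGroup E'] [NormedSpace 𝕜 E']

/-- Complex valued functions on an open set, smooth over `𝕜`. -/
def Sm (Ω : Opens E) : Subalgebra ℂ (Ω → ℂ) where
  carrier := {f | ∀ w ∈ Ω, ContDiffAt 𝕜 ∞ (extZero f) w}
  mul_mem' := by
    intro f g hf hg w hw
    refine ((hf w hw).mul (hg w hw)).congr_of_eventuallyEq (extZero_eventuallyEq (fun v => ?_) hw)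
    simp [extZero_coe]
  add_mem' := by
    intro f g hf hg w hw
    refine ((hf w hw).add (hg w hw)).congr_of_eventuallyEq (extZero_eventuallyEq (fun v => ?_) hw)
    simp [extZero_coe]
  algebraMap_mem' c w hw := (contDiffAt_const (c := c)).congr_of_eventuallyEq
    (extZero_eventuallyEq (F := fun _ => c) (fun v => rfl) hw)

namespace Sm

variable {𝕜} {Ω : Opens E} {Ω' : Opens E'}

instance (Ω : Opens E) : CommRing (Sm 𝕜 Ω) := (Sm 𝕜 Ω).toCommRing

instance (Ω : Opens E) : Algebra ℂ (Sm 𝕜 Ω) := (Sm 𝕜 Ω).algebra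

instance (Ω : Opens E) : Module ℂ (Sm 𝕜 Ω) := Algebra.toModule

instance (Ω : Opens E) : SMul ℂ (Sm 𝕜 Ω) := Algebra.toSMul

@[ext] lemma ext {f g : Sm 𝕜 Ω} (h : ∀ w : Ω, f.1 w = g.1 w) : f = g := Subtype.ext (funext h)

lemma add_apply (f g : Sm 𝕜 Ω) (w : Ω) : (f + g).1 w = f.1 w + g.1 w := rfl

lemma sub_apply (f g : Sm 𝕜 Ω) (w : Ω) : (f - g).1 w = f.1 w - g.1 w := rfl

lemma mul_apply (f g : Sm 𝕜 Ω) (w : Ω) : (f * g).1 w = f.1 w * g.1 w := rfl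

lemma neg_apply (f : Sm 𝕜 Ω) (w : Ω) : (-f).1 w = -f.1 w := rfl

lemma smul_apply (c : ℂ) (f : Sm 𝕜 Ω) (w : Ω) : (c • f).1 w = c * f.1 w := rfl

/-- A smooth function on an open set as an element of `Sm`. -/
def of (F : E → ℂ) (hF : ∀ w ∈ Ω, ContDiffAt 𝕜 ∞ F w) : Sm 𝕜 Ω :=
  ⟨fun w => F w, fun w hw => (hF w hw).congr_of_eventuallyEq
    (extZero_eventuallyEq (fun _ => rfl) hw)⟩

@[simp] lemma of_apply (F : E → ℂ) (hF : ∀ w ∈ Ω, ContDiffAt 𝕜 ∞ F w) (w : Ω) :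
    (of F hF).1 w = F w := rfl

lemma differentiableAt (f : Sm 𝕜 Ω) {w : E} (hw : w ∈ Ω) :
    DifferentiableAt 𝕜 (extZero f.1) w := (f.2 w hw).differentiableAt (by simp)

lemma contDiffAt_dir (f : Sm 𝕜 Ω) (v : E) {w : E} (hw : w ∈ Ω) :
    ContDiffAt 𝕜 ∞ (fun w => fderiv 𝕜 (extZero f.1) w v) w :=
  ((f.2 w hw).fderiv_right (m := ∞) (by simp)).clm_apply contDiffAt_const

/-- Directional derivative. -/
def d (v : E) : Derivation ℂ (Sm 𝕜 Ω) (Sm 𝕜 Ω) :=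
  Derivation.mk'
    { toFun := fun f => of (fun w => fderiv 𝕜 (extZero f.1) w v) fun w hw => contDiffAt_dir f v hw
      map_add' := fun f g => by
        ext w
        have h : extZero (f + g).1 = extZero f.1 + extZero g.1 := by
          funext x; by_cases hx : x ∈ Ω <;> simp [extZero, hx]
        change fderiv 𝕜 (extZero (f + g).1) w v =
          fderiv 𝕜 (extZero f.1) w v + fderiv 𝕜 (extZero g.1) w v
        rw [h, fderiv_add (Sm.differentiableAt f w.2) (Sm.differentiableAt g w.2)]
        rfl
      map_smul' := fun c f => by
        ext w
        have h : extZero (c • f).1 = fun x => c * extZero f.1 x := by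
          funext x; by_cases hx : x ∈ Ω <;> simp [extZero, hx]
        change fderiv 𝕜 (extZero (c • f).1) w v = c * fderiv 𝕜 (extZero f.1) w v
        rw [h, fderiv_const_mul (Sm.differentiableAt f w.2)]
        rfl } fun f g => by
    ext w
    have h : extZero (f * g).1 = extZero f.1 * extZero g.1 := by
      funext x; by_cases hx : x ∈ Ω <;> simp [extZero, hx]
    change fderiv 𝕜 (extZero (f * g).1) w v =
      f.1 w * fderiv 𝕜 (extZero g.1) w v + g.1 w * fderiv 𝕜 (extZero f.1) w v
    rw [h, fderiv_mul (Sm.differentiableAt f w.2) (Sm.differentiableAt g w.2), extZero_coe, extZero_coe]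
    rfl

lemma d_apply (v : E) (f : Sm 𝕜 Ω) (w : Ω) : (d v f).1 w = fderiv 𝕜 (extZero f.1) w v := rfl

lemma d_apply_of_eq {f : Sm 𝕜 Ω} {F : E → ℂ} (h : ∀ w : Ω, f.1 w = F w) (v : E) (w : Ω) :
    (d v f).1 w = fderiv 𝕜 F w v := by
  rw [d_apply, (extZero_eventuallyEq h w.2).fderiv_eq]

lemma hasDerivAt_comp (f : Sm 𝕜 Ω) {c : 𝕜 → E} {t : 𝕜} {v : E} (hc : HasDerivAt c v t)
    (hw : c t ∈ Ω) : HasDerivAt (fun s => extZero f.1 (c s)) ((d v f).1 ⟨c t, hw⟩) t :=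
  (Sm.differentiableAt f hw).hasFDerivAt.comp_hasDerivAt t hc

lemma d_add (v v' : E) (f : Sm 𝕜 Ω) : d (v + v') f = d v f + d v' f := by
  ext w; exact map_add _ _ _

lemma d_smul (c : 𝕜) (v : E) (f : Sm 𝕜 Ω) (w : Ω) :
    (d (c • v) f).1 w = algebraMap 𝕜 ℂ c * (d v f).1 w := by
  rw [d_apply, map_smul, Algebra.smul_def]; rfl

lemma d_sum {κ : Type*} (s : Finset κ) (c : κ → 𝕜) (v : κ → E) (f : Sm 𝕜 Ω) (w : Ω) :
    (d (∑ k ∈ s, c k • v k) f).1 w = ∑ k ∈ s, algebraMap 𝕜 ℂ (c k) * (d (v k) f).1 w := by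
  rw [d_apply, map_sum]
  exact sum_congr rfl fun k _ => d_smul _ _ _ _

lemma d_comm (v v' : E) (f : Sm 𝕜 Ω) : d v (d v' f) = d v' (d v f) := by
  ext w
  have hs := (f.2 w w.2).isSymmSndFDerivAt (by
    rw [minSmoothness_of_isRCLikeNormedField]; exact WithTop.coe_le_coe.2 le_top)
  have h : ∀ a b : E, (d a (d b f)).1 w = fderiv 𝕜 (fderiv 𝕜 (extZero f.1)) w a b := by
    intro a b
    rw [d_apply_of_eq (F := fun w => fderiv 𝕜 (extZero f.1) w b) (fun _ => rfl),
      fderiv_clm_apply (((f.2 w w.2).fderiv_right (m := ∞) (by simp)).differentiableAt (by simp))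
        (differentiableAt_const b)]
    simp
  rw [h, h]
  exact hs v v'

/-- A coordinate as a complex valued function. -/
def coord (l : E →L[𝕜] 𝕜) : Sm 𝕜 Ω :=
  of (fun w => algebraMap 𝕜 ℂ (l w)) fun _ _ => ((algebraMapCLM 𝕜 ℂ).comp l).contDiff.contDiffAt

@[simp] lemma coord_apply (l : E →L[𝕜] 𝕜) (w : Ω) :
    (coord l : Sm 𝕜 Ω).1 w = algebraMap 𝕜 ℂ (l w) := rfl

lemma d_coord (v : E) (l : E →L[𝕜] 𝕜) :
    d v (coord l : Sm 𝕜 Ω) = algebraMap ℂ _ (algebraMap 𝕜 ℂ (l v)) := by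
  ext w
  rw [d_apply_of_eq (F := (algebraMapCLM 𝕜 ℂ).comp l) (fun _ => rfl), ContinuousLinearMap.fderiv]
  rfl

/-- Evaluation at a point. -/
def ev (w : Ω) : Sm 𝕜 Ω →ₐ[ℂ] ℂ := (Pi.evalAlgHom ℂ (fun _ : Ω => ℂ) w).comp (Sm 𝕜 Ω).val

@[simp] lemma ev_apply (w : Ω) (f : Sm 𝕜 Ω) : ev w f = f.1 w := rfl

/-- Pullback along a smooth map. -/
def pull (h : E → E') (hm : ∀ w ∈ Ω, h w ∈ Ω') (hs : ∀ w ∈ Ω, ContDiffAt 𝕜 ∞ h w) :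
    Sm 𝕜 Ω' →ₐ[ℂ] Sm 𝕜 Ω where
  toFun F := of (fun w => extZero F.1 (h w)) fun w hw => (F.2 _ (hm w hw)).comp w (hs w hw)
  map_one' := by ext w; exact extZero_of_mem _ (hm w w.2)
  map_zero' := by ext w; exact extZero_of_mem _ (hm w w.2)
  map_mul' F G := by
    ext w
    simp only [of_apply, MulMemClass.coe_mul, Pi.mul_apply, extZero_of_mem _ (hm w w.2)]
  map_add' F G := by
    ext w
    simp only [of_apply, Subalgebra.coe_add, Pi.add_apply, extZero_of_mem _ (hm w w.2)]
  commutes' c := by ext w; exact extZero_of_mem _ (hm w w.2)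

lemma pull_apply (h : E → E') (hm : ∀ w ∈ Ω, h w ∈ Ω') (hs : ∀ w ∈ Ω, ContDiffAt 𝕜 ∞ h w)
    (F : Sm 𝕜 Ω') (w : Ω) : (pull h hm hs F).1 w = F.1 ⟨h w, hm w w.2⟩ := extZero_of_mem _ _

/-- A chain rule that only needs the derivative of `h` along one line. Every change of coordinates
is thereby reduced to a computation in one variable. -/
lemma d_pull {h : E → E'} {hm : ∀ w ∈ Ω, h w ∈ Ω'} {hs : ∀ w ∈ Ω, ContDiffAt 𝕜 ∞ h w}
    (F : Sm 𝕜 Ω') (w : Ω) {v : E} {v' : E'} (hv : HasDerivAt (fun t : 𝕜 => h (w + t • v)) v' 0) :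
    (d v (pull h hm hs F)).1 w = (d v' F).1 ⟨h w, hm w w.2⟩ := by
  have h1 : HasFDerivAt h (fderiv 𝕜 h w) w := ((hs w w.2).differentiableAt (by simp)).hasFDerivAt
  have h2 : fderiv 𝕜 h w v = v' := by
    have h3 : HasFDerivAt h (fderiv 𝕜 h w) (w.1 + (0 : 𝕜) • v) := by simpa using h1
    exact (h3.comp_hasDerivAt 0 (hasDerivAt_line _ _)).unique hv
  rw [d_apply_of_eq (F := fun w => extZero F.1 (h w)) (fun _ => rfl), d_apply, ← h2]
  exact congrArg (fun L : E →L[𝕜] ℂ => L v)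
    ((Sm.differentiableAt F (hm w w.2)).hasFDerivAt.comp (w : E) h1).fderiv

/-- Restriction to a smaller open set. -/
def res {Ω₁ : Opens E} (h : Ω ≤ Ω₁) : Sm 𝕜 Ω₁ →ₐ[ℂ] Sm 𝕜 Ω :=
  pull id (fun _ hw => h hw) fun _ _ => contDiffAt_id

lemma res_apply {Ω₁ : Opens E} (h : Ω ≤ Ω₁) (F : Sm 𝕜 Ω₁) (w : Ω) :
    (res h F).1 w = F.1 ⟨w, h w.2⟩ := pull_apply _ _ _ _ _

lemma d_res {Ω₁ : Opens E} (h : Ω ≤ Ω₁) (v : E) (F : Sm 𝕜 Ω₁) : d v (res h F) = res h (d v F) := by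
  ext w
  rw [res_apply]
  exact d_pull F w (hasDerivAt_line _ _)

end Sm

/-! ### Canonical coordinates on open sets -/

/-- Vectors and linear forms giving part of a system of canonical coordinates. -/
structure Frame (ι : Type) [DecidableEq ι] (E : Type) [NormedAddCommGroup E] [NormedSpace 𝕜 E] where
  ex : ι → E
  eξ : ι → E
  lx : ι → E →L[𝕜] 𝕜
  lξ : ι → E →L[𝕜] 𝕜
  lx_ex : ∀ a b, lx b (ex a) = if a = b then 1 else 0
  lx_eξ : ∀ a b, lx b (eξ a) = 0
  lξ_ex : ∀ a b, lξ b (ex a) = 0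
  lξ_eξ : ∀ a b, lξ b (eξ a) = if a = b then 1 else 0

namespace Frame

variable {𝕜} {ι : Type} [Fintype ι] [DecidableEq ι]

/-- The coordinates and derivations on an open set given by a frame. -/
def darboux (B : Frame 𝕜 ι E) (Ω : Opens E) : Darboux ι (Sm 𝕜 Ω) where
  dx a := Sm.d (B.ex a)
  dξ a := Sm.d (B.eξ a)
  x a := Sm.coord (B.lx a)
  ξ a := Sm.coord (B.lξ a)
  dx_dx _ _ _ := Sm.d_comm _ _ _
  dx_dξ _ _ _ := Sm.d_comm _ _ _
  dξ_dξ _ _ _ := Sm.d_comm _ _ _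
  dx_x a b := by rw [Sm.d_coord, B.lx_ex]; split_ifs <;> simp
  dx_ξ a b := by rw [Sm.d_coord, B.lξ_ex]; simp
  dξ_x a b := by rw [Sm.d_coord, B.lx_eξ]; simp
  dξ_ξ a b := by rw [Sm.d_coord, B.lξ_eξ]; split_ifs <;> simp

variable (B : Frame 𝕜 ι E) {Ω : Opens E}

lemma E_apply (f : Sm 𝕜 Ω) (w : Ω) :
    ((B.darboux Ω).E f).1 w = (Sm.d (∑ a, B.lξ a w • B.eξ a) f).1 w := by
  rw [Sm.d_sum, Darboux.E_apply, ← Sm.ev_apply w, map_sum]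
  rfl

lemma Ex_apply (f : Sm 𝕜 Ω) (w : Ω) :
    ((B.darboux Ω).Ex f).1 w = (Sm.d (∑ a, B.lx a w • B.ex a) f).1 w := by
  rw [Sm.d_sum, Darboux.Ex_apply, ← Sm.ev_apply w, map_sum]
  rfl

lemma J_apply (w : Ω) :
    ((B.darboux Ω).J).1 w = algebraMap 𝕜 ℂ (∑ a, B.lx a w * B.lξ a w) := by
  rw [Darboux.J, ← Sm.ev_apply w, map_sum, map_sum]
  refine sum_congr rfl fun a _ => ?_
  rw [map_mul, map_mul]
  rfl

lemma compat_res {Ω₁ : Opens E} (h : Ω ≤ Ω₁) :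
    Darboux.Compat (B.darboux Ω₁) (B.darboux Ω) (Sm.res h).toLinearMap :=
  Darboux.compat_of_commute (fun _ _ => Sm.d_res h _ _) (fun _ _ => Sm.d_res h _ _) fun c => by
    ext w; rw [Sm.res_apply]; rfl

/-- The coordinates `x, ξ` on `𝕜^ι × 𝕜^ι`. -/
def std (𝕜 : Type) [RCLike 𝕜] (ι : Type) [Fintype ι] [DecidableEq ι] :
    Frame 𝕜 ι ((ι → 𝕜) × (ι → 𝕜)) where
  ex a := (Pi.single a 1, 0)
  eξ a := (0, Pi.single a 1)
  lx a := (ContinuousLinearMap.proj a).comp (ContinuousLinearMap.fst 𝕜 _ _)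
  lξ a := (ContinuousLinearMap.proj a).comp (ContinuousLinearMap.snd 𝕜 _ _)
  lx_ex a b := by simp [Pi.single_apply, eq_comm]
  lx_eξ a b := by simp
  lξ_ex a b := by simp
  lξ_eξ a b := by simp [Pi.single_apply, eq_comm]

/-- A frame on a factor. -/
def prod (B : Frame 𝕜 ι E) (E' : Type) [NormedAddCommGroup E'] [NormedSpace 𝕜 E'] :
    Frame 𝕜 ι (E × E') where
  ex a := (B.ex a, 0)
  eξ a := (B.eξ a, 0)
  lx a := (B.lx a).comp (ContinuousLinearMap.fst 𝕜 _ _)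
  lξ a := (B.lξ a).comp (ContinuousLinearMap.fst 𝕜 _ _)
  lx_ex a b := B.lx_ex a b
  lx_eξ a b := B.lx_eξ a b
  lξ_ex a b := B.lξ_ex a b
  lξ_eξ a b := B.lξ_eξ a b

end Frame

end Sm

/-! ### Deformation onto the cone `x · ξ = 0` -/

section Cone

namespace Darboux

variable {ι : Type} [Fintype ι] [DecidableEq ι] {O O' : Type} [CommRing O] [Algebra ℂ O]
  [CommRing O'] [Algebra ℂ O'] {S : Darboux ι O} {S' : Darboux ι O'}

lemma E_inv_x {j : ι} {y : O} (h : S.x j * y = 1) : S.E y = 0 := by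
  have h1 : S.E (S.x j * y) = 0 := by
    rw [h, E_apply]; simp
  rw [E_mul, show S.E (S.x j) = 0 by simp [E_apply, S.dξ_x], zero_mul, zero_add] at h1
  calc S.E y = (S.x j * y) * S.E y := by rw [h, one_mul]
    _ = y * (S.x j * S.E y) := by ring
    _ = 0 := by rw [h1, mul_zero]

lemma Ex_inv_x {j : ι} {y : O} (h : S.x j * y = 1) : S.Ex y = -y := by
  have h1 : S.Ex (S.x j * y) = 0 := by
    rw [h, Ex_apply]; simp
  rw [Ex_mul, show S.Ex (S.x j) = S.x j by simp [Ex_apply, S.dx_x]] at h1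
  rw [h] at h1
  calc S.Ex y = (S.x j * y) * S.Ex y := by rw [h, one_mul]
    _ = y * (1 + S.x j * S.Ex y) - y := by ring
    _ = -y := by rw [h1, mul_zero, zero_sub]

lemma inv_neg_mul {j : ι} {y p : O} (h : S.x j * y = 1) (hp : S.Ex p = S.E p + p) :
    S.Inv (-(y * p)) := by
  unfold Inv
  rw [map_neg, map_neg, E_mul, E_inv_x h, Ex_mul, Ex_inv_x h, hp]
  ring

lemma E_neg_mul {j : ι} {y p : O} (h : S.x j * y = 1) {z : ℂ} (hp : S.E p = z • p) :
    S.E (-(y * p)) = z • -(y * p) := by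
  rw [map_neg, E_mul, E_inv_x h, zero_mul, zero_add, hp, mul_smul_comm, smul_neg]

lemma Ex_sub_E_dξ (S : Darboux ι O) {F : O} (hF : S.Inv F) {j : ι} :
    S.Ex (S.dξ j F) - S.E (S.dξ j F) = S.dξ j F := by
  rw [← S.dξ_Ex, show S.Ex F = S.E F from hF, S.dξ_E, add_sub_cancel_left]

lemma E_dξ (S : Darboux ι O) {F : O} {z : ℂ} (hF : S.E F = z • F) {j : ι} :
    S.E (S.dξ j F) = (z - 1) • S.dξ j F := by
  have := S.dξ_E j F
  rw [hF, Derivation.map_smul] at this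
  rw [sub_smul, one_smul, this, add_sub_cancel_right]

end Darboux

variable {𝕜 : Type} [RCLike 𝕜] [NormedAlgebra 𝕜 ℂ] {ι : Type} [Fintype ι] [DecidableEq ι]

lemma Frame.E_std {Ω : Opens ((ι → 𝕜) × (ι → 𝕜))} (f : Sm 𝕜 Ω) (w : Ω) :
    (((Frame.std 𝕜 ι).darboux Ω).E f).1 w = (Sm.d (0, w.1.2) f).1 w := by
  have e : ∑ a, (Frame.std 𝕜 ι).lξ a w.1 • (Frame.std 𝕜 ι).eξ a = (0, w.1.2) := by
    refine Prod.ext ?_ ?_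
    · simp [Frame.std, Prod.fst_sum]
    · funext k; simp [Frame.std, Prod.snd_sum, Finset.sum_apply, Pi.single_apply]
  rw [Frame.E_apply, e]

lemma Frame.Ex_std {Ω : Opens ((ι → 𝕜) × (ι → 𝕜))} (f : Sm 𝕜 Ω) (w : Ω) :
    (((Frame.std 𝕜 ι).darboux Ω).Ex f).1 w = (Sm.d (w.1.1, 0) f).1 w := by
  have e : ∑ a, (Frame.std 𝕜 ι).lx a w.1 • (Frame.std 𝕜 ι).ex a = (w.1.1, 0) := by
    refine Prod.ext ?_ ?_
    · funext k; simp [Frame.std, Prod.fst_sum, Finset.sum_apply, Pi.single_apply]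
    · simp [Frame.std, Prod.snd_sum]
  rw [Frame.Ex_apply, e]

lemma Frame.E_std_prod {Ω : Opens (((ι → 𝕜) × (ι → 𝕜)) × 𝕜)} (f : Sm 𝕜 Ω) (w : Ω) :
    ((((Frame.std 𝕜 ι).prod 𝕜).darboux Ω).E f).1 w = (Sm.d ((0, w.1.1.2), 0) f).1 w := by
  have e : ∑ a, ((Frame.std 𝕜 ι).prod 𝕜).lξ a w.1 • ((Frame.std 𝕜 ι).prod 𝕜).eξ a = ((0, w.1.1.2), 0) := by
    refine Prod.ext (Prod.ext ?_ ?_) ?_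
    · simp [Frame.std, Frame.prod, Prod.fst_sum]
    · funext k
      simp [Frame.std, Frame.prod, Prod.fst_sum, Prod.snd_sum, Finset.sum_apply, Pi.single_apply]
    · simp [Frame.std, Frame.prod, Prod.snd_sum]
  rw [Frame.E_apply, e]

lemma Frame.Ex_std_prod {Ω : Opens (((ι → 𝕜) × (ι → 𝕜)) × 𝕜)} (f : Sm 𝕜 Ω) (w : Ω) :
    ((((Frame.std 𝕜 ι).prod 𝕜).darboux Ω).Ex f).1 w = (Sm.d ((w.1.1.1, 0), 0) f).1 w := by
  have e : ∑ a, ((Frame.std 𝕜 ι).prod 𝕜).lx a w.1 • ((Frame.std 𝕜 ι).prod 𝕜).ex a = ((w.1.1.1, 0), 0) := by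
    refine Prod.ext (Prod.ext ?_ ?_) ?_
    · funext k
      simp [Frame.std, Frame.prod, Prod.fst_sum, Finset.sum_apply, Pi.single_apply]
    · simp [Frame.std, Frame.prod, Prod.fst_sum, Prod.snd_sum]
    · simp [Frame.std, Frame.prod, Prod.snd_sum]
  rw [Frame.Ex_apply, e]

/-- The path of length `w.2` towards the cone `ξ · x = 0` in the direction of `ξ_j`. -/
def slide (j : ι) (w : ((ι → 𝕜) × (ι → 𝕜)) × 𝕜) : (ι → 𝕜) × (ι → 𝕜) :=
  (w.1.1, w.1.2 - (w.2 * (w.1.1 ⬝ᵥ w.1.2) * (w.1.1 j)⁻¹) • Pi.single j 1)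

lemma slide_zero (j : ι) (v : (ι → 𝕜) × (ι → 𝕜)) : slide j (v, 0) = v := by simp [slide]

lemma slide_cone (j : ι) {v : (ι → 𝕜) × (ι → 𝕜)} (h : v.1 ⬝ᵥ v.2 = 0) (s : 𝕜) :
    slide j (v, s) = v := by simp [slide, h]

lemma slide_mem_cone {j : ι} {v : (ι → 𝕜) × (ι → 𝕜)} (h : v.1 j ≠ 0) :
    (slide j (v, 1)).1 ⬝ᵥ (slide j (v, 1)).2 = 0 := by
  simp only [slide, one_mul, dotProduct_sub, dotProduct_smul, dotProduct_single, smul_eq_mul,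
    mul_one]
  field_simp
  ring

lemma contDiffAt_slide {j : ι} {w : ((ι → 𝕜) × (ι → 𝕜)) × 𝕜} (h : w.1.1 j ≠ 0) :
    ContDiffAt 𝕜 ∞ (slide j) w := by
  have hi : ContDiffAt 𝕜 ∞ (fun w : ((ι → 𝕜) × (ι → 𝕜)) × 𝕜 => (w.1.1 j)⁻¹) w :=
    ContDiffAt.inv (by fun_prop) h
  have hd : ContDiffAt 𝕜 ∞ (fun w : ((ι → 𝕜) × (ι → 𝕜)) × 𝕜 => w.1.1 ⬝ᵥ w.1.2) w := by
    simp only [dotProduct]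
    fun_prop
  unfold slide
  refine ContDiffAt.prodMk (by fun_prop) (ContDiffAt.sub (by fun_prop) ?_)
  exact ContDiffAt.smul ((contDiffAt_snd.mul hd).mul hi) contDiffAt_const

variable {Ω : Opens ((ι → 𝕜) × (ι → 𝕜))} {j : ι}

/-- The domain of definition of functions pulled back by `slide`. -/
def slideDom (Ω : Opens ((ι → 𝕜) × (ι → 𝕜))) {j : ι} (hΩ : ∀ v ∈ Ω, v.1 j ≠ 0) :
    Opens (((ι → 𝕜) × (ι → 𝕜)) × 𝕜) where
  carrier := {w | w.1 ∈ Ω ∧ slide j w ∈ Ω}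
  is_open' := by
    rw [isOpen_iff_eventually]
    rintro w ⟨h1, h2⟩
    exact (continuousAt_fst.eventually (Ω.isOpen.mem_nhds h1)).and
      ((contDiffAt_slide (hΩ _ h1)).continuousAt.eventually (Ω.isOpen.mem_nhds h2))

variable (hΩ : ∀ v ∈ Ω, v.1 j ≠ 0)

/-- Pullback by `slide`. -/
def slidePull : Sm 𝕜 Ω →ₐ[ℂ] Sm 𝕜 (slideDom Ω hΩ) :=
  Sm.pull (slide j) (fun _ hw => hw.2) fun _ hw => contDiffAt_slide (hΩ _ hw.1)

lemma slidePull_apply (F : Sm 𝕜 Ω) (w : slideDom Ω hΩ) :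
    (slidePull hΩ F).1 w = F.1 ⟨slide j w, w.2.2⟩ := Sm.pull_apply _ _ _ _ _

/-- For fixed `x` and parameter, `slide` is linear in `ξ`. -/
lemma slidePull_E (F : Sm 𝕜 Ω) :
    (((Frame.std 𝕜 ι).prod 𝕜).darboux (slideDom Ω hΩ)).E (slidePull hΩ F) =
      slidePull hΩ (((Frame.std 𝕜 ι).darboux Ω).E F) := by
  ext w
  rw [Frame.E_std_prod, slidePull_apply, Frame.E_std]
  refine Sm.d_pull F w ?_
  have : (fun t : 𝕜 => slide j (w.1 + t • ((0, w.1.1.2), 0))) =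
      fun t => slide j w.1 + t • ((0 : ι → 𝕜), (slide j w.1).2) := by
    funext t
    refine Prod.ext (by simp [slide]) ?_
    simp only [slide, Prod.fst_add, Prod.snd_add, Prod.smul_fst, Prod.smul_snd, smul_zero, add_zero,
      dotProduct_add, dotProduct_smul, smul_sub, smul_smul, smul_eq_mul]
    module
  rw [this]
  exact hasDerivAt_line _ _

/-- `slide` commutes with the scalings `(x, ξ) ↦ (t x, t⁻¹ ξ)`, whose generator is `Ex - E`. -/
lemma slidePull_Ex_sub_E (F : Sm 𝕜 Ω) :
    (((Frame.std 𝕜 ι).prod 𝕜).darboux (slideDom Ω hΩ)).Ex (slidePull hΩ F) -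
      (((Frame.std 𝕜 ι).prod 𝕜).darboux (slideDom Ω hΩ)).E (slidePull hΩ F) =
      slidePull hΩ (((Frame.std 𝕜 ι).darboux Ω).Ex F - ((Frame.std 𝕜 ι).darboux Ω).E F) := by
  ext w
  have h1 : ∀ G : Sm 𝕜 Ω, ∀ v : Ω, (((Frame.std 𝕜 ι).darboux Ω).Ex G -
      ((Frame.std 𝕜 ι).darboux Ω).E G).1 v = (Sm.d (v.1.1, -v.1.2) G).1 v := by
    intro G v
    have e : ((v.1.1, -v.1.2) : (ι → 𝕜) × (ι → 𝕜)) = (v.1.1, 0) + (-1 : 𝕜) • (0, v.1.2) := by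
      ext <;> simp
    rw [e, Sm.d_add]
    rw [Sm.sub_apply, Sm.add_apply, Frame.Ex_std, Frame.E_std, Sm.d_smul]
    simp [sub_eq_add_neg]
  have h2 : ∀ (G : Sm 𝕜 (slideDom Ω hΩ)) (v : slideDom Ω hΩ),
      ((((Frame.std 𝕜 ι).prod 𝕜).darboux (slideDom Ω hΩ)).Ex G -
      (((Frame.std 𝕜 ι).prod 𝕜).darboux (slideDom Ω hΩ)).E G).1 v =
      (Sm.d ((v.1.1.1, -v.1.1.2), 0) G).1 v := by
    intro G v
    have e : (((v.1.1.1, -v.1.1.2), 0) : ((ι → 𝕜) × (ι → 𝕜)) × 𝕜) =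
        ((v.1.1.1, 0), 0) + (-1 : 𝕜) • ((0, v.1.1.2), 0) := by
      ext <;> simp
    rw [e, Sm.d_add]
    rw [Sm.sub_apply, Sm.add_apply, Frame.Ex_std_prod, Frame.E_std_prod, Sm.d_smul]
    simp [sub_eq_add_neg]
  rw [h2, slidePull_apply, h1]
  refine Sm.d_pull F w ?_
  have hx := hΩ _ w.2.1
  -- The curve multiplies `x` by `1 + t` and `ξ` by `1 - t`, so the correction `(x · ξ) / x_j` is
  -- multiplied by `1 - t` as soon as `1 + t ≠ 0`.
  have : (fun t : 𝕜 => slide j (w.1 + t • ((w.1.1.1, -w.1.1.2), 0))) =ᶠ[nhds 0]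
      fun t => slide j w.1 + t • ((slide j w.1).1, -(slide j w.1).2) := by
    have ht : ∀ᶠ t : 𝕜 in nhds 0, 1 + t ≠ 0 := by
      have : ContinuousAt (fun t : 𝕜 => 1 + t) 0 := by fun_prop
      exact this.eventually_ne (by simp)
    filter_upwards [ht] with t ht
    refine Prod.ext (by simp [slide]) ?_
    funext k
    simp only [slide, Prod.fst_add, Prod.snd_add, Prod.smul_fst, Prod.smul_snd,
      dotProduct_add, dotProduct_smul, add_dotProduct, smul_dotProduct, dotProduct_neg, neg_sub,
      smul_eq_mul, Pi.add_apply, Pi.sub_apply, Pi.smul_apply, Pi.neg_apply]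
    have e : w.1.1.1 j + t * w.1.1.1 j = (1 + t) * w.1.1.1 j := by ring
    rw [e, mul_inv]
    field_simp
    ring
  exact (hasDerivAt_line _ _).congr_of_eventuallyEq this

lemma slidePull_dξ_Ex {F : Sm 𝕜 Ω} (hF : ((Frame.std 𝕜 ι).darboux Ω).Inv F) :
    (((Frame.std 𝕜 ι).prod 𝕜).darboux (slideDom Ω hΩ)).Ex (slidePull hΩ (((Frame.std 𝕜 ι).darboux Ω).dξ j F)) =
      (((Frame.std 𝕜 ι).prod 𝕜).darboux (slideDom Ω hΩ)).E (slidePull hΩ (((Frame.std 𝕜 ι).darboux Ω).dξ j F)) +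
      slidePull hΩ (((Frame.std 𝕜 ι).darboux Ω).dξ j F) := by
  have h1 := slidePull_Ex_sub_E hΩ (((Frame.std 𝕜 ι).darboux Ω).dξ j F)
  rw [((Frame.std 𝕜 ι).darboux Ω).Ex_sub_E_dξ hF] at h1
  exact eq_add_of_sub_eq' h1

lemma slidePull_dξ_E {F : Sm 𝕜 Ω} {z : ℂ} (hF : ((Frame.std 𝕜 ι).darboux Ω).E F = z • F) :
    (((Frame.std 𝕜 ι).prod 𝕜).darboux (slideDom Ω hΩ)).E (slidePull hΩ (((Frame.std 𝕜 ι).darboux Ω).dξ j F)) =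
      (z - 1) • slidePull hΩ (((Frame.std 𝕜 ι).darboux Ω).dξ j F) := by
  rw [slidePull_E, ((Frame.std 𝕜 ι).darboux Ω).E_dξ hF]
  exact map_smul (slidePull hΩ).toLinearMap _ _

/-- The inverse of the coordinate `x_j`. -/
def slideInv : Sm 𝕜 (slideDom Ω hΩ) :=
  Sm.of (fun w => algebraMap 𝕜 ℂ (w.1.1 j)⁻¹) (fun w hw =>
    (algebraMapCLM 𝕜 ℂ).contDiff.contDiffAt.comp w
      (ContDiffAt.inv (by fun_prop) (hΩ _ hw.1)))

lemma mul_slideInv : (((Frame.std 𝕜 ι).prod 𝕜).darboux (slideDom Ω hΩ)).x j * slideInv hΩ = 1 := by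
  ext w
  change algebraMap 𝕜 ℂ (w.1.1.1 j) * algebraMap 𝕜 ℂ (w.1.1.1 j)⁻¹ = 1
  rw [← map_mul, mul_inv_cancel₀ (hΩ _ w.2.1), map_one]

/-- Derivative in the direction of the parameter of `slide`. -/
lemma d_slidePull (F : Sm 𝕜 Ω) : Sm.d (0, 1) (slidePull hΩ F) =
    (((Frame.std 𝕜 ι).prod 𝕜).darboux (slideDom Ω hΩ)).J *
      -(slideInv hΩ * slidePull hΩ (((Frame.std 𝕜 ι).darboux Ω).dξ j F)) := by
  ext w
  have hd : HasDerivAt (fun t : 𝕜 => slide j (w.1 + t • (0, 1)))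
      ((-((w.1.1.1 ⬝ᵥ w.1.1.2) * (w.1.1.1 j)⁻¹)) • ((0 : ι → 𝕜), Pi.single j 1)) 0 := by
    have : (fun t : 𝕜 => slide j (w.1 + t • (0, 1))) = fun t => slide j w.1 +
        t • ((-((w.1.1.1 ⬝ᵥ w.1.1.2) * (w.1.1.1 j)⁻¹)) • ((0 : ι → 𝕜), Pi.single j 1)) := by
      funext t
      refine Prod.ext (by simp [slide]) ?_
      simp only [slide, Prod.fst_add, Prod.snd_add, Prod.smul_fst, Prod.smul_snd, smul_zero,
        add_zero, smul_eq_mul, mul_one]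
      module
    rw [this]
    exact hasDerivAt_line _ _
  have hJ : (((Frame.std 𝕜 ι).prod 𝕜).darboux (slideDom Ω hΩ)).J.1 w =
    algebraMap 𝕜 ℂ (w.1.1.1 ⬝ᵥ w.1.1.2) := Frame.J_apply _ w
  have hyw : (slideInv hΩ).1 w = algebraMap 𝕜 ℂ (w.1.1.1 j)⁻¹ := rfl
  have hpw : (slidePull hΩ (((Frame.std 𝕜 ι).darboux Ω).dξ j F)).1 w =
    (Sm.d (0, Pi.single j 1) F).1 ⟨slide j w, w.2.2⟩ := slidePull_apply hΩ _ w
  have h1 : (Sm.d (0, 1) (slidePull hΩ F)).1 w = _ := Sm.d_pull F w hd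
  rw [h1, Sm.d_smul, Sm.mul_apply, Sm.neg_apply, Sm.mul_apply, hJ, hyw, hpw, map_neg, map_mul]
  ring

/-- The derivative in the direction of the parameter of `slide` is a multiple of `J`. -/
lemma exists_deriv_slidePull {F : Sm 𝕜 Ω} (hF : ((Frame.std 𝕜 ι).darboux Ω).Inv F) :
    ∃ g : Sm 𝕜 (slideDom Ω hΩ), (((Frame.std 𝕜 ι).prod 𝕜).darboux (slideDom Ω hΩ)).Inv g ∧
      (∀ z : ℂ, ((Frame.std 𝕜 ι).darboux Ω).E F = z • F →
        (((Frame.std 𝕜 ι).prod 𝕜).darboux (slideDom Ω hΩ)).E g = (z - 1) • g) ∧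
      Sm.d (0, 1) (slidePull hΩ F) = (((Frame.std 𝕜 ι).prod 𝕜).darboux (slideDom Ω hΩ)).J * g :=
  ⟨_, Darboux.inv_neg_mul (mul_slideInv hΩ) (slidePull_dξ_Ex hΩ hF),
    fun _ hz => Darboux.E_neg_mul (mul_slideInv hΩ) (slidePull_dξ_E hΩ hz), d_slidePull hΩ F⟩

/-- The slice of `slideDom` at parameter `1`. -/
def slideOne : Opens ((ι → 𝕜) × (ι → 𝕜)) where
  carrier := {v | (v, (1 : 𝕜)) ∈ slideDom Ω hΩ}
  is_open' := (slideDom Ω hΩ).isOpen.preimage (by fun_prop)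

lemma one_mem_slideDom (v : (ι → 𝕜) × (ι → 𝕜)) (hv : v ∈ slideOne hΩ) :
    (v, (1 : 𝕜)) ∈ slideDom Ω hΩ := hv

lemma slideOne_le : slideOne hΩ ≤ Ω := fun _ hv => hv.1

/-- Restriction to parameter `s`. -/
def slicePull {Ω₀ : Opens ((ι → 𝕜) × (ι → 𝕜))} {Ω' : Opens (((ι → 𝕜) × (ι → 𝕜)) × 𝕜)} (s : 𝕜)
    (h : ∀ v ∈ Ω₀, (v, s) ∈ Ω') : Sm 𝕜 Ω' →ₐ[ℂ] Sm 𝕜 Ω₀ :=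
  Sm.pull (fun v => (v, s)) h fun _ _ => by fun_prop

lemma slicePull_apply {Ω₀ : Opens ((ι → 𝕜) × (ι → 𝕜))} {Ω' : Opens (((ι → 𝕜) × (ι → 𝕜)) × 𝕜)}
    (s : 𝕜) (h : ∀ v ∈ Ω₀, (v, s) ∈ Ω') (F : Sm 𝕜 Ω') (v : Ω₀) :
    (slicePull s h F).1 v = F.1 ⟨(v, s), h v v.2⟩ := Sm.pull_apply _ _ _ _ _

lemma compat_slicePull {Ω₀ : Opens ((ι → 𝕜) × (ι → 𝕜))} {Ω' : Opens (((ι → 𝕜) × (ι → 𝕜)) × 𝕜)}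
    (s : 𝕜) (h : ∀ v ∈ Ω₀, (v, s) ∈ Ω') : Darboux.Compat (((Frame.std 𝕜 ι).prod 𝕜).darboux Ω')
      ((Frame.std 𝕜 ι).darboux Ω₀) (slicePull s h).toLinearMap := by
  have key : ∀ (v : (ι → 𝕜) × (ι → 𝕜)) (F : Sm 𝕜 Ω'),
      Sm.d v (slicePull s h F) = slicePull s h (Sm.d (v, 0) F) := by
    intro v F
    ext w
    rw [slicePull_apply]
    refine Sm.d_pull F w ?_
    have : (fun t : 𝕜 => ((w.1 + t • v, s) : ((ι → 𝕜) × (ι → 𝕜)) × 𝕜)) =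
        fun t => (w.1, s) + t • (v, (0 : 𝕜)) := by
      funext t; simp
    rw [this]
    exact hasDerivAt_line _ _
  refine Darboux.compat_of_commute (fun a F => key _ F) (fun a F => key _ F) fun c => ?_
  ext w
  rw [slicePull_apply]
  rfl

/-- Functions independent of the parameter. -/
def fstPull : Sm 𝕜 Ω →ₐ[ℂ] Sm 𝕜 (slideDom Ω hΩ) :=
  Sm.pull Prod.fst (fun _ hw => hw.1) fun _ _ => by fun_prop

lemma fstPull_apply (F : Sm 𝕜 Ω) (w : slideDom Ω hΩ) :
    (fstPull hΩ F).1 w = F.1 ⟨w.1.1, w.2.1⟩ := Sm.pull_apply _ _ _ _ _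

lemma d_fstPull (v : (ι → 𝕜) × (ι → 𝕜)) (s : 𝕜) (F : Sm 𝕜 Ω) :
    Sm.d (v, s) (fstPull hΩ F) = fstPull hΩ (Sm.d v F) := by
  ext w
  rw [fstPull_apply]
  exact Sm.d_pull F w (hasDerivAt_line _ _)

lemma d_param_fstPull (F : Sm 𝕜 Ω) : Sm.d (0, 1) (fstPull hΩ F) = 0 := by
  rw [d_fstPull]
  have : Sm.d 0 F = 0 := by ext w; exact map_zero _
  rw [this, map_zero]

lemma fstPull_E (F : Sm 𝕜 Ω) :
    (((Frame.std 𝕜 ι).prod 𝕜).darboux (slideDom Ω hΩ)).E (fstPull hΩ F) =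
      fstPull hΩ (((Frame.std 𝕜 ι).darboux Ω).E F) := by
  ext w
  rw [Frame.E_std_prod, d_fstPull, fstPull_apply, fstPull_apply, Frame.E_std]

lemma fstPull_Ex (F : Sm 𝕜 Ω) :
    (((Frame.std 𝕜 ι).prod 𝕜).darboux (slideDom Ω hΩ)).Ex (fstPull hΩ F) =
      fstPull hΩ (((Frame.std 𝕜 ι).darboux Ω).Ex F) := by
  ext w
  rw [Frame.Ex_std_prod, d_fstPull, fstPull_apply, fstPull_apply, Frame.Ex_std]

lemma fstPull_inv {F : Sm 𝕜 Ω} (hF : ((Frame.std 𝕜 ι).darboux Ω).Inv F) :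
    (((Frame.std 𝕜 ι).prod 𝕜).darboux (slideDom Ω hΩ)).Inv (fstPull hΩ F) := by
  unfold Darboux.Inv
  rw [fstPull_E, fstPull_Ex, hF]

lemma mem_slideDom_of_cone {v : (ι → 𝕜) × (ι → 𝕜)} (hv : v ∈ Ω) (hc : v.1 ⬝ᵥ v.2 = 0) (s : 𝕜) :
    (v, s) ∈ slideDom Ω hΩ := by
  refine ⟨hv, ?_⟩
  rwa [slide_cone j hc]

lemma zero_mem_slideDom (v : (ι → 𝕜) × (ι → 𝕜)) (hv : v ∈ Ω) : (v, (0 : 𝕜)) ∈ slideDom Ω hΩ := by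
  refine ⟨hv, ?_⟩
  rwa [slide_zero]

/-- A function whose derivative along the parameter vanishes on the cone is constant there. -/
lemma eq_of_d_eq_J_mul {G w : Sm 𝕜 (slideDom Ω hΩ)}
    (h : Sm.d (0, 1) G = (((Frame.std 𝕜 ι).prod 𝕜).darboux (slideDom Ω hΩ)).J * w) {v : (ι → 𝕜) × (ι → 𝕜)}
    (hv : v ∈ Ω) (hc : v.1 ⬝ᵥ v.2 = 0) (s t : 𝕜) :
    G.1 ⟨(v, s), mem_slideDom_of_cone hΩ hv hc s⟩ =
      G.1 ⟨(v, t), mem_slideDom_of_cone hΩ hv hc t⟩ := by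
  have hd : ∀ r : 𝕜, HasDerivAt (fun r => extZero G.1 (v, r)) 0 r := by
    intro r
    have hl : HasDerivAt (fun r : 𝕜 => (v, r)) (0, 1) r :=
      (hasDerivAt_const r v).prodMk (hasDerivAt_id r)
    have := Sm.hasDerivAt_comp G hl (mem_slideDom_of_cone hΩ hv hc r)
    rw [h] at this
    convert this using 1
    rw [Sm.mul_apply, Frame.J_apply]
    change 0 = algebraMap 𝕜 ℂ (v.1 ⬝ᵥ v.2) * _
    rw [hc, map_zero, zero_mul]
  have := is_const_of_deriv_eq_zero (f := fun r : 𝕜 => extZero G.1 (v, r)) (fun r => (hd r).differentiableAt)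
    (fun r => (hd r).deriv) s t
  simpa only [extZero_of_mem _ (mem_slideDom_of_cone hΩ hv hc _)] using this

/-- A natural operator which preserves multiples of `J` only depends on the restriction of invariant
functions to the cone. -/
theorem eq_on_cone_of_natural {F F' : Sm 𝕜 Ω} (hF' : ((Frame.std 𝕜 ι).darboux Ω).Inv F')
    (hFF' : ∀ v, ∀ hv : v ∈ Ω, ∀ hv' : slide j (v, 1) ∈ Ω, F.1 ⟨v, hv⟩ = F'.1 ⟨_, hv'⟩)
    (Φ : Sm 𝕜 Ω → Sm 𝕜 Ω) (Φt : Sm 𝕜 (slideDom Ω hΩ) → Sm 𝕜 (slideDom Ω hΩ))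
    (Φo : Sm 𝕜 (slideOne hΩ) → Sm 𝕜 (slideOne hΩ))
    (hd : ∀ f, Sm.d (0, 1) (Φt f) = Φt (Sm.d (0, 1) f))
    (hJ : ∀ g, (((Frame.std 𝕜 ι).prod 𝕜).darboux (slideDom Ω hΩ)).Inv g →
      (∀ z : ℂ, ((Frame.std 𝕜 ι).darboux Ω).E F' = z • F' →
        (((Frame.std 𝕜 ι).prod 𝕜).darboux (slideDom Ω hΩ)).E g = (z - 1) • g) →
      ∃ w, Φt ((((Frame.std 𝕜 ι).prod 𝕜).darboux (slideDom Ω hΩ)).J * g) =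
        (((Frame.std 𝕜 ι).prod 𝕜).darboux (slideDom Ω hΩ)).J * w)
    (h0 : ∀ f, slicePull 0 (zero_mem_slideDom hΩ) (Φt f) =
      Φ (slicePull 0 (zero_mem_slideDom hΩ) f))
    (h1 : ∀ f, slicePull 1 (one_mem_slideDom hΩ) (Φt f) = Φo (slicePull 1 (one_mem_slideDom hΩ) f))
    (hr : ∀ f, Sm.res (slideOne_le hΩ) (Φ f) = Φo (Sm.res (slideOne_le hΩ) f))
    {v : (ι → 𝕜) × (ι → 𝕜)} (hv : v ∈ Ω) (hc : v.1 ⬝ᵥ v.2 = 0) :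
    (Φ F).1 ⟨v, hv⟩ = (Φ F').1 ⟨v, hv⟩ := by
  obtain ⟨g, hg, hg', hgJ⟩ := exists_deriv_slidePull hΩ hF'
  obtain ⟨w, hw⟩ := hJ g hg hg'
  -- Along the deformation the value on the cone is constant. At parameter `0` it is the value of `Φ
  -- F'`, at parameter `1` that of `Φ F`.
  have hconst := eq_of_d_eq_J_mul hΩ (G := Φt (slidePull hΩ F')) (w := w)
    (by rw [hd, hgJ, hw]) hv hc 0 1
  have e0 : slicePull 0 (zero_mem_slideDom hΩ) (slidePull hΩ F') = F' := by
    ext u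
    rw [slicePull_apply, slidePull_apply]
    exact congrArg F'.1 (Subtype.ext (slide_zero j u.1))
  have e1 : slicePull 1 (one_mem_slideDom hΩ) (slidePull hΩ F') =
      Sm.res (slideOne_le hΩ) F := by
    ext u
    rw [slicePull_apply, slidePull_apply, Sm.res_apply]
    exact (hFF' _ u.2.1 u.2.2).symm
  have hv1 : v ∈ slideOne hΩ := mem_slideDom_of_cone hΩ hv hc 1
  have r0 : (Φ F').1 ⟨v, hv⟩ = (Φt (slidePull hΩ F')).1 ⟨(v, 0), mem_slideDom_of_cone hΩ hv hc 0⟩ := by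
    rw [← e0, ← h0, slicePull_apply, e0]
  have r1 : (Φ F).1 ⟨v, hv⟩ = (Φt (slidePull hΩ F')).1 ⟨(v, 1), mem_slideDom_of_cone hΩ hv hc 1⟩ := by
    have := Sm.res_apply (slideOne_le hΩ) (Φ F) ⟨v, hv1⟩
    rw [hr, ← e1, ← h1, slicePull_apply] at this
    exact this.symm
  rw [r0, r1, hconst]

end Cone

/-! ### Changes of charts and linear automorphisms -/

section ChartChange

variable {𝕜 : Type} [RCLike 𝕜] [NormedAlgebra 𝕜 ℂ]

section

variable {ι : Type} [Fintype ι] [DecidableEq ι] {Ω : Opens ((ι → 𝕜) × (ι → 𝕜))} {j : ι}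

lemma Sm.d_zero (f : Sm 𝕜 Ω) : Sm.d 0 f = 0 := by ext w; exact map_zero _

lemma d_param_ξ (Ω' : Opens (((ι → 𝕜) × (ι → 𝕜)) × 𝕜)) (c : ι) :
    Sm.d (0, 1) ((((Frame.std 𝕜 ι).prod 𝕜).darboux Ω').ξ c) = 0 := by
  change Sm.d (0, 1) (Sm.coord _) = 0
  rw [Sm.d_coord]
  change algebraMap ℂ _ (algebraMap 𝕜 ℂ 0) = 0
  rw [map_zero, map_zero]

lemma d_param_dx (Ω' : Opens (((ι → 𝕜) × (ι → 𝕜)) × 𝕜)) (c : ι) (f : Sm 𝕜 Ω') :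
    Sm.d (0, 1) ((((Frame.std 𝕜 ι).prod 𝕜).darboux Ω').dx c f) =
      (((Frame.std 𝕜 ι).prod 𝕜).darboux Ω').dx c (Sm.d (0, 1) f) := Sm.d_comm _ _ _

lemma d_param_dξ (Ω' : Opens (((ι → 𝕜) × (ι → 𝕜)) × 𝕜)) (c : ι) (f : Sm 𝕜 Ω') :
    Sm.d (0, 1) ((((Frame.std 𝕜 ι).prod 𝕜).darboux Ω').dξ c f) =
      (((Frame.std 𝕜 ι).prod 𝕜).darboux Ω').dξ c (Sm.d (0, 1) f) := Sm.d_comm _ _ _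

variable (hΩ : ∀ v ∈ Ω, v.1 j ≠ 0)

lemma slicePull_zero_fstPull (H : Sm 𝕜 Ω) :
    slicePull 0 (zero_mem_slideDom hΩ) (fstPull hΩ H) = H := by
  ext u; rw [slicePull_apply, fstPull_apply]

lemma slicePull_one_fstPull (H : Sm 𝕜 Ω) :
    slicePull 1 (one_mem_slideDom hΩ) (fstPull hΩ H) = Sm.res (slideOne_le hΩ) H := by
  ext u; rw [slicePull_apply, fstPull_apply, Sm.res_apply]

/-- The deformation principle with the second argument held fixed; the preservation of multiples of
`J` is `bidiff_J_left`. -/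
lemma bidiff_eq_on_cone_left (hΩ : ∀ v ∈ Ω, v.1 j ≠ 0) {c : ℂ} (hc : (Fintype.card ι : ℂ) = c + 1) (p : ℕ) {F F' H : Sm 𝕜 Ω}
    (hF' : ((Frame.std 𝕜 ι).darboux Ω).Inv F') (hH : ((Frame.std 𝕜 ι).darboux Ω).Inv H)
    (hFF' : ∀ v, ∀ hv : v ∈ Ω, ∀ hv' : slide j (v, 1) ∈ Ω, F.1 ⟨v, hv⟩ = F'.1 ⟨_, hv'⟩)
    {v : (ι → 𝕜) × (ι → 𝕜)} (hv : v ∈ Ω) (hv0 : v.1 ⬝ᵥ v.2 = 0) :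
    (((Frame.std 𝕜 ι).darboux Ω).bidiff c p (sig p) (tau p) F H).1 ⟨v, hv⟩ =
      (((Frame.std 𝕜 ι).darboux Ω).bidiff c p (sig p) (tau p) F' H).1 ⟨v, hv⟩ := by
  refine eq_on_cone_of_natural hΩ hF' hFF'
    (fun f => ((Frame.std 𝕜 ι).darboux Ω).bidiff c p (sig p) (tau p) f H)
    (fun f => (((Frame.std 𝕜 ι).prod 𝕜).darboux (slideDom Ω hΩ)).bidiff c p (sig p) (tau p) f
      (fstPull hΩ H))
    (fun f => ((Frame.std 𝕜 ι).darboux (slideOne hΩ)).bidiff c p (sig p) (tau p) f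
      (Sm.res (slideOne_le hΩ) H)) (fun f => ?_) (fun g hg _ => ?_) (fun f => ?_) (fun f => ?_)
    (fun f => ?_) hv hv0
  · rw [Darboux.deriv_bidiff (S := ((Frame.std 𝕜 ι).prod 𝕜).darboux (slideDom Ω hΩ)) (Sm.d (0, 1))
      (d_param_dx _) (d_param_dξ _) (d_param_ξ _), d_param_fstPull, map_zero, add_zero]
  · exact Darboux.bidiff_J_left hc (fun s hs => sig_succ hs) (fun s hs => tau_succ hs) hg
      (fstPull_inv hΩ hH)
  · have := (compat_slicePull 0 (zero_mem_slideDom hΩ)).bidiff c p (sig p) (tau p) f (fstPull hΩ H)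
    simp only [AlgHom.toLinearMap_apply, slicePull_zero_fstPull] at this
    exact this.symm
  · have := (compat_slicePull 1 (one_mem_slideDom hΩ)).bidiff c p (sig p) (tau p) f (fstPull hΩ H)
    simp only [AlgHom.toLinearMap_apply, slicePull_one_fstPull] at this
    exact this.symm
  · exact ((Frame.compat_res (Frame.std 𝕜 ι) (slideOne_le hΩ)).bidiff c p _ _ f H).symm

lemma bidiff_eq_on_cone_right (hΩ : ∀ v ∈ Ω, v.1 j ≠ 0) {c : ℂ} (hc : (Fintype.card ι : ℂ) = c + 1) (p : ℕ)
    {F F' H : Sm 𝕜 Ω}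
    (hF' : ((Frame.std 𝕜 ι).darboux Ω).Inv F') (hH : ((Frame.std 𝕜 ι).darboux Ω).Inv H)
    (hFF' : ∀ v, ∀ hv : v ∈ Ω, ∀ hv' : slide j (v, 1) ∈ Ω, F.1 ⟨v, hv⟩ = F'.1 ⟨_, hv'⟩)
    {v : (ι → 𝕜) × (ι → 𝕜)} (hv : v ∈ Ω) (hv0 : v.1 ⬝ᵥ v.2 = 0) :
    (((Frame.std 𝕜 ι).darboux Ω).bidiff c p (sig p) (tau p) H F).1 ⟨v, hv⟩ =
      (((Frame.std 𝕜 ι).darboux Ω).bidiff c p (sig p) (tau p) H F').1 ⟨v, hv⟩ := by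
  refine eq_on_cone_of_natural hΩ hF' hFF'
    (fun f => ((Frame.std 𝕜 ι).darboux Ω).bidiff c p (sig p) (tau p) H f)
    (fun f => (((Frame.std 𝕜 ι).prod 𝕜).darboux (slideDom Ω hΩ)).bidiff c p (sig p) (tau p)
      (fstPull hΩ H) f)
    (fun f => ((Frame.std 𝕜 ι).darboux (slideOne hΩ)).bidiff c p (sig p) (tau p)
      (Sm.res (slideOne_le hΩ) H) f) (fun f => ?_) (fun g hg _ => ?_) (fun f => ?_) (fun f => ?_)
    (fun f => ?_) hv hv0
  · rw [Darboux.deriv_bidiff (S := ((Frame.std 𝕜 ι).prod 𝕜).darboux (slideDom Ω hΩ)) (Sm.d (0, 1))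
      (d_param_dx _) (d_param_dξ _) (d_param_ξ _), d_param_fstPull, map_zero, LinearMap.zero_apply, zero_add]
  · exact Darboux.bidiff_J_right hc (fun s hs => sig_succ hs) (fun s hs => tau_succ hs) hg
      (fstPull_inv hΩ hH)
  · have := (compat_slicePull 0 (zero_mem_slideDom hΩ)).bidiff c p (sig p) (tau p) (fstPull hΩ H) f
    simp only [AlgHom.toLinearMap_apply, slicePull_zero_fstPull] at this
    exact this.symm
  · have := (compat_slicePull 1 (one_mem_slideDom hΩ)).bidiff c p (sig p) (tau p) (fstPull hΩ H) f
    simp only [AlgHom.toLinearMap_apply, slicePull_one_fstPull] at this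
    exact this.symm
  · exact ((Frame.compat_res (Frame.std 𝕜 ι) (slideOne_le hΩ)).bidiff c p _ _ H f).symm

/-- The deformation principle for the quantization. The weight of `G` is needed for `quantOp_J`, and
`hd` says that no denominator of the coefficients vanishes. -/
lemma quantOp_eq_on_cone (hΩ : ∀ v ∈ Ω, v.1 j ≠ 0) {c : ℂ} (hc : (Fintype.card ι : ℂ) = c + 1) {d : ℕ}
    (hd : ∀ s < d, c + 2 * d - (s + 1) ≠ 0) {F F' G : Sm 𝕜 Ω}
    (hF' : ((Frame.std 𝕜 ι).darboux Ω).Inv F')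
    (hF'd : ((Frame.std 𝕜 ι).darboux Ω).E F' = (d : ℂ) • F')
    (hG : ((Frame.std 𝕜 ι).darboux Ω).Ex G = -((c + 1) / 2) • G)
    (hFF' : ∀ v, ∀ hv : v ∈ Ω, ∀ hv' : slide j (v, 1) ∈ Ω, F.1 ⟨v, hv⟩ = F'.1 ⟨_, hv'⟩)
    {v : (ι → 𝕜) × (ι → 𝕜)} (hv : v ∈ Ω) (hv0 : v.1 ⬝ᵥ v.2 = 0) :
    (((Frame.std 𝕜 ι).darboux Ω).quantOp c d F G).1 ⟨v, hv⟩ =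
      (((Frame.std 𝕜 ι).darboux Ω).quantOp c d F' G).1 ⟨v, hv⟩ := by
  refine eq_on_cone_of_natural hΩ hF' hFF'
    (fun f => ((Frame.std 𝕜 ι).darboux Ω).quantOp c d f G)
    (fun f => (((Frame.std 𝕜 ι).prod 𝕜).darboux (slideDom Ω hΩ)).quantOp c d f (fstPull hΩ G))
    (fun f => ((Frame.std 𝕜 ι).darboux (slideOne hΩ)).quantOp c d f (Sm.res (slideOne_le hΩ) G))
    (fun f => ?_) (fun g hg hgE => ?_) (fun f => ?_) (fun f => ?_) (fun f => ?_) hv hv0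
  · rw [Darboux.deriv_quantOp (S := ((Frame.std 𝕜 ι).prod 𝕜).darboux (slideDom Ω hΩ)) (Sm.d (0, 1))
      (d_param_dx _) (d_param_dξ _),
      d_param_fstPull, map_zero, add_zero]
  · refine Darboux.quantOp_J _ hc hd hg (hgE _ hF'd) ?_
    rw [fstPull_Ex, hG]
    exact map_smul (fstPull hΩ).toLinearMap _ _
  · have := (compat_slicePull 0 (zero_mem_slideDom hΩ)).quantOp
      (compat_slicePull 0 (zero_mem_slideDom hΩ)).star c d f (fstPull hΩ G)
    simp only [AlgHom.toLinearMap_apply, slicePull_zero_fstPull] at this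
    exact this.symm
  · have := (compat_slicePull 1 (one_mem_slideDom hΩ)).quantOp
      (compat_slicePull 1 (one_mem_slideDom hΩ)).star c d f (fstPull hΩ G)
    simp only [AlgHom.toLinearMap_apply, slicePull_one_fstPull] at this
    exact this.symm
  · exact ((Frame.compat_res (Frame.std 𝕜 ι) (slideOne_le hΩ)).quantOp
      (Frame.compat_res (Frame.std 𝕜 ι) (slideOne_le hΩ)).star c d f G).symm

lemma Frame.Ex_sub_E_std (f : Sm 𝕜 Ω) (w : Ω) : (((Frame.std 𝕜 ι).darboux Ω).Ex f -
    ((Frame.std 𝕜 ι).darboux Ω).E f).1 w = (Sm.d (w.1.1, -w.1.2) f).1 w := by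
  have e : ((w.1.1, -w.1.2) : (ι → 𝕜) × (ι → 𝕜)) = (w.1.1, 0) + (-1 : 𝕜) • (0, w.1.2) := by
    ext <;> simp
  rw [e, Sm.d_add, Sm.sub_apply, Sm.add_apply, Frame.Ex_std, Frame.E_std, Sm.d_smul]
  simp [sub_eq_add_neg]

lemma Frame.inv_iff {f : Sm 𝕜 Ω} : ((Frame.std 𝕜 ι).darboux Ω).Inv f ↔
    ∀ w : Ω, (Sm.d (w.1.1, -w.1.2) f).1 w = 0 := by
  unfold Darboux.Inv
  rw [← sub_eq_zero]
  constructor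
  · intro h w
    rw [← Frame.Ex_sub_E_std, h]; rfl
  · intro h
    ext w
    rw [Frame.Ex_sub_E_std, h]; rfl

end

variable {n : ℕ}

/-- The action of a linear automorphism on pairs `(x, ξ)`. -/
def pairAct (g : GL (Fin (n + 1)) 𝕜) (v : (Fin (n + 1) → 𝕜) × (Fin (n + 1) → 𝕜)) :
    (Fin (n + 1) → 𝕜) × (Fin (n + 1) → 𝕜) :=
  (g.val.mulVec v.1, Matrix.vecMul v.2 (g⁻¹ : GL (Fin (n + 1)) 𝕜).val)

lemma pairAct_cone (g : GL (Fin (n + 1)) 𝕜) {v : (Fin (n + 1) → 𝕜) × (Fin (n + 1) → 𝕜)}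
    (h : v.1 ⬝ᵥ v.2 = 0) : (pairAct g v).1 ⬝ᵥ (pairAct g v).2 = 0 := by
  rw [dotProduct_comm] at h ⊢
  change Matrix.vecMul v.2 (g⁻¹ : GL (Fin (n + 1)) 𝕜).val ⬝ᵥ g.val.mulVec v.1 = 0
  rw [Matrix.dotProduct_mulVec, Matrix.vecMul_vecMul, ← Units.val_mul, inv_mul_cancel]
  simpa using h

lemma pairAct_line (g : GL (Fin (n + 1)) 𝕜) (w v : (Fin (n + 1) → 𝕜) × (Fin (n + 1) → 𝕜)) (t : 𝕜) :
    pairAct g (w + t • v) = pairAct g w + t • pairAct g v := by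
  refine Prod.ext ?_ ?_
  · simp [pairAct, Matrix.mulVec_add, Matrix.mulVec_smul]
  · simp [pairAct, Matrix.add_vecMul, Matrix.smul_vecMul]

lemma contDiff_pairAct (g : GL (Fin (n + 1)) 𝕜) : ContDiff 𝕜 ∞ (pairAct g) := by
  unfold pairAct
  refine ContDiff.prodMk ?_ ?_
  · refine contDiff_pi.2 fun a => ?_
    simp only [Matrix.mulVec, dotProduct]
    fun_prop
  · refine contDiff_pi.2 fun a => ?_
    simp only [Matrix.vecMul, dotProduct]
    fun_prop

section Act

variable (g : GL (Fin (n + 1)) 𝕜) {Ω Ω' : Opens ((Fin (n + 1) → 𝕜) × (Fin (n + 1) → 𝕜))}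
  (hm : ∀ v ∈ Ω, pairAct g v ∈ Ω')

/-- Pullback by a linear automorphism. -/
def actPull : Sm 𝕜 Ω' →ₐ[ℂ] Sm 𝕜 Ω :=
  Sm.pull (pairAct g) hm fun _ _ => (contDiff_pairAct g).contDiffAt

lemma actPull_apply (F : Sm 𝕜 Ω') (w : Ω) :
    (actPull g hm F).1 w = F.1 ⟨pairAct g w, hm w w.2⟩ := Sm.pull_apply _ _ _ _ _

lemma d_actPull (F : Sm 𝕜 Ω') (v : (Fin (n + 1) → 𝕜) × (Fin (n + 1) → 𝕜)) (w : Ω) :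
    (Sm.d v (actPull g hm F)).1 w = (Sm.d (pairAct g v) F).1 ⟨pairAct g w, hm w w.2⟩ := by
  refine Sm.d_pull F w ?_
  simp only [pairAct_line]
  exact hasDerivAt_line _ _

lemma actPull_inv {F : Sm 𝕜 Ω'} (hF : ((Frame.std 𝕜 (Fin (n + 1))).darboux Ω').Inv F) :
    ((Frame.std 𝕜 (Fin (n + 1))).darboux Ω).Inv (actPull g hm F) := by
  rw [Frame.inv_iff] at hF ⊢
  intro w
  rw [d_actPull]
  have : pairAct g (w.1.1, -w.1.2) = ((pairAct g w.1).1, -(pairAct g w.1).2) := by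
    simp [pairAct, Matrix.neg_vecMul]
  rw [this]
  exact hF ⟨pairAct g w, hm w w.2⟩

lemma compat_actPull : Darboux.Compat ((Frame.std 𝕜 (Fin (n + 1))).darboux Ω')
    ((Frame.std 𝕜 (Fin (n + 1))).darboux Ω) (actPull g hm).toLinearMap := by
  refine Darboux.compat_of_linear (A := fun a b => algebraMap 𝕜 ℂ (g.val b a))
    (B := fun a b => algebraMap 𝕜 ℂ ((g⁻¹ : GL (Fin (n + 1)) 𝕜).val a b)) (fun a F => ?_)
    (fun a F => ?_) (fun b c => ?_) (fun c => ?_)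
  · ext w
    have e : pairAct g ((Frame.std 𝕜 (Fin (n + 1))).ex a) =
        ∑ b, g.val b a • (Frame.std 𝕜 (Fin (n + 1))).ex b := by
      refine Prod.ext ?_ ?_
      · funext k; simp [pairAct, Frame.std, Prod.fst_sum, Finset.sum_apply, Pi.single_apply]
      · simp [pairAct, Frame.std, Prod.snd_sum]
    rw [← Sm.ev_apply w, ← Sm.ev_apply w, map_sum]
    refine (d_actPull g hm F _ w).trans ?_
    rw [e, Sm.d_sum]
    refine sum_congr rfl fun b _ => ?_
    rw [map_smul, Sm.ev_apply, actPull_apply]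
    rfl
  · ext w
    have e : pairAct g ((Frame.std 𝕜 (Fin (n + 1))).eξ a) =
        ∑ b, (g⁻¹ : GL (Fin (n + 1)) 𝕜).val a b • (Frame.std 𝕜 (Fin (n + 1))).eξ b := by
      refine Prod.ext ?_ ?_
      · simp [pairAct, Frame.std, Prod.fst_sum]
      · funext k
        simp only [pairAct, Frame.std, Prod.snd_sum, Finset.sum_apply, Matrix.single_one_vecMul]
        simp [Pi.single_apply]
    rw [← Sm.ev_apply w, ← Sm.ev_apply w, map_sum]
    refine (d_actPull g hm F _ w).trans ?_
    rw [e, Sm.d_sum]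
    refine sum_congr rfl fun b _ => ?_
    rw [map_smul, Sm.ev_apply, actPull_apply]
    rfl
  · have h : (g.val * (g⁻¹ : GL (Fin (n + 1)) 𝕜).val) b c = (1 : Matrix _ _ 𝕜) b c := by
      rw [← Units.val_mul, mul_inv_cancel]; rfl
    rw [Matrix.mul_apply, Matrix.one_apply] at h
    simp only [← map_mul, ← map_sum]
    rw [h]
    split_ifs <;> simp
  · ext w
    rw [← Sm.ev_apply w, map_sum, actPull_apply]
    change ∑ a, _ * algebraMap 𝕜 ℂ (w.1.2 a) = algebraMap 𝕜 ℂ (Matrix.vecMul w.1.2 _ c)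
    simp only [Matrix.vecMul, dotProduct, map_sum, map_mul]
    exact sum_congr rfl fun a _ => mul_comm _ _

end Act

section Affine

/-- Affine coordinates of a point of the cotangent bundle from homogeneous ones. -/
def affPt (i : Fin (n + 1)) (v : (Fin (n + 1) → 𝕜) × (Fin (n + 1) → 𝕜)) :
    (Fin n → 𝕜) × (Fin n → 𝕜) :=
  (fun k => (v.1 i)⁻¹ * v.1 (i.succAbove k), fun k => v.1 i * v.2 (i.succAbove k))

lemma contDiffAt_affPt {i : Fin (n + 1)} {v : (Fin (n + 1) → 𝕜) × (Fin (n + 1) → 𝕜)}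
    (h : v.1 i ≠ 0) : ContDiffAt 𝕜 ∞ (affPt i) v := by
  have hi : ContDiffAt 𝕜 ∞ (fun w : (Fin (n + 1) → 𝕜) × (Fin (n + 1) → 𝕜) => (w.1 i)⁻¹) v :=
    ContDiffAt.inv (by fun_prop) h
  unfold affPt
  refine ContDiffAt.prodMk (contDiffAt_pi.2 fun k => hi.mul (by fun_prop)) (by fun_prop)

/-- `slide i` only moves `ξ_i`, the one covector coordinate which `affPt i` ignores. -/
lemma affPt_slide (i : Fin (n + 1)) (v : (Fin (n + 1) → 𝕜) × (Fin (n + 1) → 𝕜)) :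
    affPt i (slide i (v, 1)) = affPt i v := by
  refine Prod.ext ?_ ?_
  · funext k; simp [affPt, slide]
  · funext k; simp [affPt, slide, Fin.succAbove_ne]

variable (i : Fin (n + 1)) {Ω : Opens ((Fin (n + 1) → 𝕜) × (Fin (n + 1) → 𝕜))}
  {U : Opens ((Fin n → 𝕜) × (Fin n → 𝕜))} (hi : ∀ v ∈ Ω, v.1 i ≠ 0)
  (hm : ∀ v ∈ Ω, affPt i v ∈ U)

/-- Functions of the affine coordinates as functions of the homogeneous ones. -/
def affPull : Sm 𝕜 U →ₐ[ℂ] Sm 𝕜 Ω :=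
  Sm.pull (affPt i) hm fun v hv => contDiffAt_affPt (hi v hv)

lemma affPull_apply (F : Sm 𝕜 U) (w : Ω) :
    (affPull i hi hm F).1 w = F.1 ⟨affPt i w, hm w w.2⟩ := Sm.pull_apply _ _ _ _ _

lemma affPull_inv (F : Sm 𝕜 U) :
    ((Frame.std 𝕜 (Fin (n + 1))).darboux Ω).Inv (affPull i hi hm F) := by
  rw [Frame.inv_iff]
  intro w
  have hw := hi w w.2
  rw [affPull, Sm.d_pull (v' := 0) F w, Sm.d_zero]
  · rfl
  · have h : (fun t : 𝕜 => affPt i (w.1 + t • (w.1.1, -w.1.2))) =ᶠ[nhds 0]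
        fun t => ((affPt i w.1).1, (1 - t * t) • (affPt i w.1).2) := by
      have ht : ∀ᶠ t : 𝕜 in nhds 0, 1 + t ≠ 0 := by
        have : ContinuousAt (fun t : 𝕜 => 1 + t) 0 := by fun_prop
        exact this.eventually_ne (by simp)
      filter_upwards [ht] with t ht
      refine Prod.ext ?_ ?_
      · funext k
        simp only [affPt, Prod.fst_add, Prod.smul_fst, Pi.add_apply, Pi.smul_apply, smul_eq_mul]
        rw [show w.1.1 i + t * w.1.1 i = (1 + t) * w.1.1 i by ring, mul_inv]
        field_simp
      · funext k
        simp only [affPt, Prod.fst_add, Prod.smul_fst, Prod.snd_add, Prod.smul_snd, Pi.add_apply,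
          Pi.smul_apply, smul_eq_mul, Pi.neg_apply]
        ring
    refine HasDerivAt.congr_of_eventuallyEq ?_ h
    have h2 : HasDerivAt (fun t : 𝕜 => (1 - t * t) • (affPt i w.1).2) 0 0 := by
      have : HasDerivAt (fun t : 𝕜 => 1 - t * t) 0 0 := by
        simpa using ((hasDerivAt_id (0 : 𝕜)).mul (hasDerivAt_id (0 : 𝕜))).const_sub 1
      simpa using this.smul_const (affPt i w.1).2
    exact (hasDerivAt_const _ _).prodMk h2

/-- The inverse of the `i`-th homogeneous coordinate. -/
def invCoord : Sm 𝕜 Ω :=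
  Sm.of (fun w => algebraMap 𝕜 ℂ (w.1 i)⁻¹) (fun w hw =>
    (algebraMapCLM 𝕜 ℂ).contDiff.contDiffAt.comp w (ContDiffAt.inv (by fun_prop) (hi _ hw)))

lemma mul_invCoord :
    ((Frame.std 𝕜 (Fin (n + 1))).darboux Ω).x i * invCoord i hi = 1 := by
  ext w
  change algebraMap 𝕜 ℂ (w.1.1 i) * algebraMap 𝕜 ℂ (w.1.1 i)⁻¹ = 1
  rw [← map_mul, mul_inv_cancel₀ (hi _ w.2), map_one]

lemma derivation_inv_eq_zero {O : Type*} [CommRing O] [Algebra ℂ O] (D : Derivation ℂ O O) {y y' : O}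
    (h : y * y' = 1) (hy : D y = 0) : D y' = 0 := by
  have h1 : D (y * y') = 0 := by rw [h]; simp
  rw [Derivation.leibniz, hy, smul_zero, add_zero, smul_eq_mul] at h1
  calc D y' = (y * y') * D y' := by rw [h, one_mul]
    _ = y' * (y * D y') := by ring
    _ = 0 := by rw [h1, mul_zero]

lemma homogenize_affPull : Darboux.Homogenize ((Frame.std 𝕜 (Fin n)).darboux U)
    ((Frame.std 𝕜 (Fin (n + 1))).darboux Ω) i (affPull i hi hm)
    (((Frame.std 𝕜 (Fin (n + 1))).darboux Ω).x i) (invCoord i hi) where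
  mul_inv := mul_invCoord i hi
  dξ_y a := Darboux.dξ_x _ _ _
  dξ_y' a := derivation_inv_eq_zero _ (mul_invCoord i hi) (Darboux.dξ_x _ _ _)
  dx_y k := by rw [Darboux.dx_x, if_neg (Fin.succAbove_ne i k)]
  dx_y' k := derivation_inv_eq_zero _ (mul_invCoord i hi)
    (by rw [Darboux.dx_x, if_neg (Fin.succAbove_ne i k)])
  dξ_i F := by
    ext w
    have h := Sm.d_pull (hm := hm) (hs := fun v hv => contDiffAt_affPt (hi v hv)) (v' := 0)
      (v := (0, Pi.single i 1)) F w (by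
        have : (fun t : 𝕜 => affPt i (w.1 + t • (0, Pi.single i 1))) = fun _ => affPt i w.1 := by
          funext t
          refine Prod.ext ?_ ?_ <;> funext k <;> simp [affPt]
        rw [this]
        exact hasDerivAt_const _ _)
    rw [Sm.d_zero] at h
    exact h
  dξ k F := by
    ext w
    have h := Sm.d_pull (hm := hm) (hs := fun v hv => contDiffAt_affPt (hi v hv))
      (v := (0, Pi.single (i.succAbove k) 1)) (v' := (w.1.1 i) • (0, Pi.single k 1)) F w (by
        have : (fun t : 𝕜 => affPt i (w.1 + t • (0, Pi.single (i.succAbove k) 1))) =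
            fun t => affPt i w.1 + t • ((w.1.1 i) • ((0 : Fin n → 𝕜), Pi.single k 1)) := by
          funext t
          refine Prod.ext ?_ ?_ <;> funext l
          · simp [affPt]
          · simp [affPt, Pi.single_apply, mul_add]; split_ifs <;> ring
        rw [this]
        exact hasDerivAt_line _ _)
    rw [Sm.d_smul] at h
    rw [Sm.mul_apply, affPull_apply]
    exact h
  dx k F := by
    ext w
    have h := Sm.d_pull (hm := hm) (hs := fun v hv => contDiffAt_affPt (hi v hv))
      (v := (Pi.single (i.succAbove k) 1, 0)) (v' := (w.1.1 i)⁻¹ • (Pi.single k 1, 0)) F w (by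
        have : (fun t : 𝕜 => affPt i (w.1 + t • (Pi.single (i.succAbove k) 1, 0))) =
            fun t => affPt i w.1 + t • ((w.1.1 i)⁻¹ • ((Pi.single k 1 : Fin n → 𝕜), 0)) := by
          funext t
          refine Prod.ext ?_ ?_ <;> funext l
          · simp [affPt, Pi.single_apply, mul_add, (Fin.succAbove_ne i k).symm]; split_ifs <;> ring
          · simp [affPt, Pi.single_apply, (Fin.succAbove_ne i k).symm]
        rw [this]
        exact hasDerivAt_line _ _)
    rw [Sm.d_smul] at h
    rw [Sm.mul_apply, affPull_apply]
    exact h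
  ξ k := by
    ext w
    rw [Sm.mul_apply, affPull_apply]
    change algebraMap 𝕜 ℂ (w.1.2 (i.succAbove k)) * algebraMap 𝕜 ℂ (w.1.1 i) =
      algebraMap 𝕜 ℂ (w.1.1 i * w.1.2 (i.succAbove k))
    rw [map_mul, mul_comm]

end Affine

/-- The domain on which two affine charts, related by a linear automorphism, are compared. -/
def overlap (g : GL (Fin (n + 1)) 𝕜) (i j : Fin (n + 1))
    (U U' : Opens ((Fin n → 𝕜) × (Fin n → 𝕜))) :
    Opens ((Fin (n + 1) → 𝕜) × (Fin (n + 1) → 𝕜)) where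
  carrier := {v | (v.1 j ≠ 0 ∧ (pairAct g v).1 i ≠ 0) ∧ affPt j v ∈ U ∧ affPt i (pairAct g v) ∈ U'}
  is_open' := by
    rw [isOpen_iff_eventually]
    rintro v ⟨⟨h1, h2⟩, h3, h4⟩
    have hg := (contDiff_pairAct g).continuous
    have c1 : ContinuousAt (fun v : (Fin (n + 1) → 𝕜) × (Fin (n + 1) → 𝕜) => v.1 j) v := by fun_prop
    have c2 : ContinuousAt (fun v : (Fin (n + 1) → 𝕜) × (Fin (n + 1) → 𝕜) => (pairAct g v).1 i) v :=
      ((continuous_apply i).comp (continuous_fst.comp hg)).continuousAt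
    exact ((c1.eventually_ne h1).and (c2.eventually_ne h2)).and
      (((contDiffAt_affPt h1).continuousAt.eventually (U.isOpen.mem_nhds h3)).and
      ((ContinuousAt.comp (f := pairAct g) (g := affPt i) (contDiffAt_affPt h2).continuousAt
        hg.continuousAt).eventually (U'.isOpen.mem_nhds h4)))

/-- Points in homogeneous coordinates over a chart domain. -/
def overChart (i : Fin (n + 1)) (U : Opens ((Fin n → 𝕜) × (Fin n → 𝕜))) :
    Opens ((Fin (n + 1) → 𝕜) × (Fin (n + 1) → 𝕜)) where
  carrier := {v | v.1 i ≠ 0 ∧ affPt i v ∈ U}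
  is_open' := by
    rw [isOpen_iff_eventually]
    rintro v ⟨h1, h3⟩
    have c1 : ContinuousAt (fun v : (Fin (n + 1) → 𝕜) × (Fin (n + 1) → 𝕜) => v.1 i) v := by fun_prop
    exact (c1.eventually_ne h1).and
      ((contDiffAt_affPt h1).continuousAt.eventually (U.isOpen.mem_nhds h3))

section Main

section

variable {g : GL (Fin (n + 1)) 𝕜} {i j : Fin (n + 1)} {U U' : Opens ((Fin n → 𝕜) × (Fin n → 𝕜))}
  {v : (Fin (n + 1) → 𝕜) × (Fin (n + 1) → 𝕜)}

lemma overChart_ne (hv : v ∈ overChart i U) : v.1 i ≠ 0 := hv.1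

lemma overChart_mem (hv : v ∈ overChart i U) : affPt i v ∈ U := hv.2

lemma overlap_ne (hv : v ∈ overlap g i j U U') : v.1 j ≠ 0 := hv.1.1

lemma overlap_mem (hv : v ∈ overlap g i j U U') : affPt j v ∈ U := hv.2.1

lemma overlap_act (hv : v ∈ overlap g i j U U') : pairAct g v ∈ overChart i U' :=
  ⟨hv.1.2, hv.2.2⟩

end

variable (g : GL (Fin (n + 1)) 𝕜) (i j : Fin (n + 1))
    {U U' : Opens ((Fin n → 𝕜) × (Fin n → 𝕜))}

/-- A function in a chart and a function in another one, translated by `g`, agree on the cone. -/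
def ChartEq (f : Sm 𝕜 U) (f' : Sm 𝕜 U') : Prop :=
  ∀ v, ∀ h : v ∈ overlap g i j U U', v.1 ⬝ᵥ v.2 = 0 →
    f.1 ⟨affPt j v, h.2.1⟩ = f'.1 ⟨affPt i (pairAct g v), h.2.2⟩

/-- A function in the second chart in homogeneous coordinates. -/
def farPull : Sm 𝕜 U' →ₐ[ℂ] Sm 𝕜 (overlap g i j U U') :=
  (actPull g (Ω := overlap g i j U U') (Ω' := overChart i U') (fun _ => overlap_act)).comp
    (affPull i (Ω := overChart i U') (fun _ => overChart_ne) (fun _ => overChart_mem))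

/-- A function in the first chart in homogeneous coordinates. -/
def nearPull : Sm 𝕜 U →ₐ[ℂ] Sm 𝕜 (overlap g i j U U') :=
  affPull j (Ω := overlap g i j U U') (fun _ => overlap_ne) (fun _ => overlap_mem)

lemma farPull_apply (f' : Sm 𝕜 U') (w : overlap g i j U U') :
    (farPull g i j f').1 w = f'.1 ⟨affPt i (pairAct g w), w.2.2.2⟩ := by
  exact (actPull_apply g (fun _ => overlap_act) _ w).trans (affPull_apply i
    (Ω := overChart i U') (fun _ => overChart_ne) (fun _ => overChart_mem) f' ⟨_, overlap_act w.2⟩)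

lemma nearPull_apply (f : Sm 𝕜 U) (w : overlap g i j U U') :
    (nearPull g i j f).1 w = f.1 ⟨affPt j w, w.2.2.1⟩ := affPull_apply _ _ _ _ _

lemma farPull_inv (f' : Sm 𝕜 U') : ((Frame.std 𝕜 (Fin (n + 1))).darboux
    (overlap g i j U U')).Inv (farPull g i j f') :=
  actPull_inv g (Ω := overlap g i j U U') (Ω' := overChart i U') (fun _ => overlap_act)
    (affPull_inv i (Ω := overChart i U') (fun _ => overChart_ne) (fun _ => overChart_mem) f')

lemma nearPull_inv (f : Sm 𝕜 U) : ((Frame.std 𝕜 (Fin (n + 1))).darboux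
    (overlap g i j U U')).Inv (nearPull g i j f) := affPull_inv _ _ _ _

variable {i j g}

/-- The pullback from chart `j` takes the same value at `v` and at its retraction to the cone, and
at the latter point the comparison of the two charts is available. -/
lemma ChartEq.slide {f : Sm 𝕜 U} {f' : Sm 𝕜 U'} (h : ChartEq g i j f f') :
    ∀ v, ∀ hv : v ∈ overlap g i j U U', ∀ hv' : slide j (v, 1) ∈ overlap g i j U U',
      (nearPull g i j f).1 ⟨v, hv⟩ = (farPull g i j f').1 ⟨_, hv'⟩ := by
  intro v hv hv'
  rw [nearPull_apply, farPull_apply, ← h _ hv' (slide_mem_cone hv.1.1)]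
  exact congrArg f.1 (Subtype.ext (affPt_slide j v).symm)

/-- The bidifferential operator does not depend on the chart and is invariant. -/
theorem ChartEq.bidiff (p : ℕ) {f h : Sm 𝕜 U} {f' h' : Sm 𝕜 U'} (hf : ChartEq g i j f f')
    (hh : ChartEq g i j h h') :
    ChartEq g i j (((Frame.std 𝕜 (Fin n)).darboux U).bidiff n p (sig p) (tau p) f h)
      (((Frame.std 𝕜 (Fin n)).darboux U').bidiff n p (sig p) (tau p) f' h') := by
  intro v hv hc
  have hN : (Fintype.card (Fin (n + 1)) : ℂ) = n + 1 := by simp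
  -- The arguments are exchanged one at a time, through the mixed expression with the far form of
  -- `f` and the near form of `h`.
  have e1 := bidiff_eq_on_cone_left (Ω := overlap g i j U U') (j := j) (fun _ => overlap_ne) hN p (farPull_inv g i j f')
    (nearPull_inv g i j h) hf.slide hv hc
  have e2 := bidiff_eq_on_cone_right (Ω := overlap g i j U U') (j := j) (fun _ => overlap_ne) hN p (farPull_inv g i j h')
    (farPull_inv g i j f') hh.slide hv hc
  -- Naturality identifies the operator upstairs with the chart operators: `n1` for the near chart,
  -- `n2` and `n3` for the far chart followed by `g`.
  have n1 := (homogenize_affPull j (Ω := overlap g i j U U') (fun _ => overlap_ne)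
    (fun _ => overlap_mem)).compat.bidiff n p (sig p) (tau p) f h
  have n2 := (homogenize_affPull i (Ω := overChart i U') (fun _ => overChart_ne)
    (fun _ => overChart_mem)).compat.bidiff n p (sig p) (tau p) f' h'
  have n3 := (compat_actPull g (Ω := overlap g i j U U') (Ω' := overChart i U')
    (fun _ => overlap_act)).bidiff n p (sig p) (tau p)
      (affPull i (Ω := overChart i U') (fun _ => overChart_ne) (fun _ => overChart_mem) f')
      (affPull i (Ω := overChart i U') (fun _ => overChart_ne) (fun _ => overChart_mem) h')
  simp only [AlgHom.toLinearMap_apply] at n1 n2 n3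
  rw [n2] at n3
  have r1 := nearPull_apply g i j (U' := U')
    (((Frame.std 𝕜 (Fin n)).darboux U).bidiff n p (sig p) (tau p) f h) ⟨v, hv⟩
  have r2 := farPull_apply g i j (U := U)
    (((Frame.std 𝕜 (Fin n)).darboux U').bidiff n p (sig p) (tau p) f' h') ⟨v, hv⟩
  rw [← r1, ← r2]
  refine (congrArg (fun F => F.1 ⟨v, hv⟩) n1).symm.trans ?_
  refine e1.trans (e2.trans ?_)
  exact congrArg (fun F => F.1 ⟨v, hv⟩) n3

end Main

end ChartChange

/-! ### Half-densities in homogeneous coordinates and the invariance of the quantization -/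

section RealDensities

variable {n : ℕ}

/-- The homogeneity factor of half-densities. -/
def densW (n : ℕ) (t : ℝ) : ℂ := ((|t| ^ (-(1 / 2 * ((n : ℝ) + 1))) : ℝ) : ℂ)

lemma densW_mul (n : ℕ) (s t : ℝ) : densW n (s * t) = densW n s * densW n t := by
  rw [densW, abs_mul, Real.mul_rpow (abs_nonneg _) (abs_nonneg _), Complex.ofReal_mul]
  rfl

lemma densW_ne_zero (n : ℕ) {t : ℝ} (ht : t ≠ 0) : densW n t ≠ 0 := by
  rw [densW, Complex.ofReal_ne_zero]
  exact (Real.rpow_pos_of_pos (abs_pos.2 ht) _).ne'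

@[simp] lemma densW_one (n : ℕ) : densW n 1 = 1 := by simp [densW]

lemma contDiffAt_densW (n : ℕ) {t : ℝ} (ht : t ≠ 0) : ContDiffAt ℝ ∞ (densW n) t := by
  refine Complex.ofRealCLM.contDiff.contDiffAt.comp t ?_
  exact (contDiffAt_abs ht).rpow_const_of_ne (abs_pos.2 ht).ne'

lemma hasDerivAt_densW (n : ℕ) : HasDerivAt (fun t : ℝ => densW n (1 + t)) (-(((n : ℂ) + 1) / 2)) 0 := by
  have h1 : HasDerivAt (fun t : ℝ => (1 + t) ^ (-(1 / 2 * ((n : ℝ) + 1))))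
      (-(((n : ℝ) + 1) / 2)) 0 := by
    have := ((hasDerivAt_id' (0 : ℝ)).const_add 1).rpow_const (p := -(1 / 2 * ((n : ℝ) + 1)))
      (Or.inl (by simp))
    convert this using 1
    rw [add_zero, Real.one_rpow]
    ring
  have h2 : (fun t : ℝ => densW n (1 + t)) =ᶠ[nhds 0]
      fun t => (((1 + t) ^ (-(1 / 2 * ((n : ℝ) + 1))) : ℝ) : ℂ) := by
    filter_upwards [lt_mem_nhds (show (-1 : ℝ) < 0 by norm_num)] with t ht
    rw [densW, abs_of_pos (by linarith)]
  have h3 := h1.ofReal_comp.congr_of_eventuallyEq h2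
  have e : ((-(((n : ℝ) + 1) / 2) : ℝ) : ℂ) = -(((n : ℂ) + 1) / 2) := by push_cast; rfl
  rw [← e]
  exact h3

/-- For `s < d` the number is `n + d + (d - s - 1)` with `d ≥ 1`, hence positive. -/
lemma quant_ne_zero (n d : ℕ) : ∀ s < d, (n : ℂ) + 2 * d - (s + 1) ≠ 0 := by
  intro s hs h
  have : ((n + (d + (d - (s + 1))) : ℕ) : ℂ) = 0 := by
    rw [← h]
    push_cast [Nat.cast_sub (Nat.succ_le_of_lt hs)]
    ring
  have := Nat.cast_eq_zero.1 this
  omega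

/-- A function on the base in a chart. -/
def baseFn (b : (Fin n → ℝ) → ℂ) (hb : ContDiff ℝ ∞ b) :
    Sm ℝ (⊤ : Opens ((Fin n → ℝ) × (Fin n → ℝ))) :=
  Sm.of (fun w => b w.1) fun _ _ => hb.contDiffAt.comp _ contDiffAt_fst

/-- The homogeneity factor `|x_j|^(-(n+1)/2)`. -/
def densFactor {Ω : Opens ((Fin (n + 1) → ℝ) × (Fin (n + 1) → ℝ))} (j : Fin (n + 1))
    (hj : ∀ v ∈ Ω, v.1 j ≠ 0) : Sm ℝ Ω :=
  Sm.of (fun v => densW n (v.1 j)) fun v hv =>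
    ContDiffAt.comp (g := densW n) (f := fun v : (Fin (n + 1) → ℝ) × (Fin (n + 1) → ℝ) => v.1 j) v
      (contDiffAt_densW n (hj v hv)) (by fun_prop)

lemma Sm.d_eq_zero_of_line {E : Type} [NormedAddCommGroup E] [NormedSpace ℝ E] {Ω : Opens E}
    {f : Sm ℝ Ω} {F : E → ℂ} (hf : ∀ w : Ω, f.1 w = F w) {w : Ω} {v : E}
    (h : ∀ t : ℝ, F (w + t • v) = F w) : (Sm.d v f).1 w = 0 := by
  have h0 : w.1 + (0 : ℝ) • v ∈ Ω := by simp
  have h1 := Sm.hasDerivAt_comp f (hasDerivAt_line (𝕜 := ℝ) w.1 v) h0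
  have h2 : (fun s : ℝ => extZero f.1 (w.1 + s • v)) =ᶠ[nhds 0] fun _ => F w := by
    have hc : ContinuousAt (fun s : ℝ => w.1 + s • v) 0 := by fun_prop
    filter_upwards [hc.eventually (Ω.isOpen.mem_nhds h0)] with s hs
    rw [extZero_of_mem _ hs, hf, h]
  have h3 := h1.unique ((hasDerivAt_const (0 : ℝ) (F w)).congr_of_eventuallyEq h2)
  have e : (⟨w.1 + (0 : ℝ) • v, h0⟩ : Ω) = w := Subtype.ext (by simp)
  rwa [e] at h3

section

variable {Ω : Opens ((Fin (n + 1) → ℝ) × (Fin (n + 1) → ℝ))} (j : Fin (n + 1))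
  (hj : ∀ v ∈ Ω, v.1 j ≠ 0)
  (hm : ∀ v ∈ Ω, affPt j v ∈ (⊤ : Opens ((Fin n → ℝ) × (Fin n → ℝ))))

lemma dξ_densFactor (a : Fin (n + 1)) :
    ((Frame.std ℝ (Fin (n + 1))).darboux Ω).dξ a (densFactor j hj) = 0 := by
  ext w
  exact Sm.d_eq_zero_of_line (F := fun v : (Fin (n + 1) → ℝ) × (Fin (n + 1) → ℝ) => densW n (v.1 j))
    (fun _ => rfl) (fun t => by simp [Frame.std])

lemma dx_densFactor (k : Fin n) :
    ((Frame.std ℝ (Fin (n + 1))).darboux Ω).dx (j.succAbove k) (densFactor j hj) = 0 := by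
  ext w
  exact Sm.d_eq_zero_of_line (F := fun v : (Fin (n + 1) → ℝ) × (Fin (n + 1) → ℝ) => densW n (v.1 j))
    (fun _ => rfl) (fun t => by simp [Frame.std, (Fin.succAbove_ne j k).symm])

/-- A half-density in homogeneous coordinates. -/
def densPull (b : (Fin n → ℝ) → ℂ) (hb : ContDiff ℝ ∞ b) : Sm ℝ Ω :=
  densFactor j hj * affPull j hj hm (baseFn b hb)

lemma densPull_apply (b : (Fin n → ℝ) → ℂ) (hb : ContDiff ℝ ∞ b) (w : Ω) :
    (densPull j hj hm b hb).1 w = densW n (w.1.1 j) * b (affPt j w.1).1 := by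
  rw [densPull, Sm.mul_apply, affPull_apply]
  rfl

/-- Euler's relation for the homogeneity `|x_j|^(-(n+1)/2)`. This is exactly the weight required by
`quantOp_J` for `c = n`. -/
lemma Ex_densPull (b : (Fin n → ℝ) → ℂ) (hb : ContDiff ℝ ∞ b) :
    ((Frame.std ℝ (Fin (n + 1))).darboux Ω).Ex (densPull j hj hm b hb) =
      -(((n : ℂ) + 1) / 2) • densPull j hj hm b hb := by
  ext w
  rw [Frame.Ex_std, Sm.smul_apply]
  have h0 : w.1 + (0 : ℝ) • (w.1.1, 0) ∈ Ω := by simp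
  have h1 := Sm.hasDerivAt_comp (densPull j hj hm b hb) (hasDerivAt_line (𝕜 := ℝ) w.1 (w.1.1, 0)) h0
  have h2 : (fun s : ℝ => extZero (densPull j hj hm b hb).1 (w.1 + s • (w.1.1, 0))) =ᶠ[nhds 0]
      fun s => densW n (1 + s) * (densPull j hj hm b hb).1 w := by
    have hc : ContinuousAt (fun s : ℝ => w.1 + s • (w.1.1, (0 : Fin (n + 1) → ℝ))) 0 := by fun_prop
    filter_upwards [hc.eventually (Ω.isOpen.mem_nhds h0),
      lt_mem_nhds (show (-1 : ℝ) < 0 by norm_num)] with s hs hs1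
    rw [extZero_of_mem _ hs, densPull_apply, densPull_apply, ← mul_assoc, ← densW_mul]
    have hs2 : (1 + s) ≠ 0 := by linarith
    have ha : (affPt j (w.1 + s • (w.1.1, (0 : Fin (n + 1) → ℝ)))).1 = (affPt j w.1).1 := by
      funext k
      simp only [affPt, Prod.fst_add, Prod.smul_fst, Pi.add_apply, Pi.smul_apply, smul_eq_mul]
      have := hj _ w.2
      rw [show w.1.1 j + s * w.1.1 j = (1 + s) * w.1.1 j by ring, mul_inv]
      field_simp
    simp only [ha]
    congr 2
    simp
    ring
  have h3 := h1.unique (((hasDerivAt_densW n).mul_const ((densPull j hj hm b hb).1 w)).congr_of_eventuallyEq h2)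
  have e : (⟨w.1 + (0 : ℝ) • (w.1.1, 0), h0⟩ : Ω) = w := Subtype.ext (by simp)
  rwa [e] at h3

lemma quantOp_densPull (d : ℕ) (f : Sm ℝ (⊤ : Opens ((Fin n → ℝ) × (Fin n → ℝ))))
    (b : (Fin n → ℝ) → ℂ) (hb : ContDiff ℝ ∞ b) :
    ((Frame.std ℝ (Fin (n + 1))).darboux Ω).quantOp n d
      (affPull j hj hm f) (densPull j hj hm b hb) =
    densFactor j hj * affPull j hj hm
      (((Frame.std ℝ (Fin n)).darboux ⊤).quantOp n d f (baseFn b hb)) :=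
  (homogenize_affPull j hj hm).quantOp (dξ_densFactor j hj) (dx_densFactor j hj) n d f
    (baseFn b hb)

end

lemma farPull_E {𝕜 : Type} [RCLike 𝕜] [NormedAlgebra 𝕜 ℂ] (g : GL (Fin (n + 1)) 𝕜)
    (i j : Fin (n + 1)) {U U' : Opens ((Fin n → 𝕜) × (Fin n → 𝕜))} {f' : Sm 𝕜 U'} {z : ℂ}
    (hE : ((Frame.std 𝕜 (Fin n)).darboux U').E f' = z • f') :
    ((Frame.std 𝕜 (Fin (n + 1))).darboux (overlap g i j U U')).E (farPull g i j f') =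
      z • farPull g i j f' := by
  have h1 := (compat_actPull g (Ω := overlap g i j U U') (Ω' := overChart i U')
    (fun _ => overlap_act)).E (affPull i (Ω := overChart i U') (fun _ => overChart_ne)
      (fun _ => overChart_mem) f')
  have h2 := (homogenize_affPull i (U := U') (Ω := overChart i U') (fun _ => overChart_ne)
    (fun _ => overChart_mem)).compat.E f'
  simp only [AlgHom.toLinearMap_apply] at h1 h2
  refine h1.trans ?_
  rw [h2, hE]
  exact map_smul (farPull g i j).toLinearMap z f'

set_option maxHeartbeats 1000000 in
/-- The quantization does not depend on the chart and is equivariant. -/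
theorem ChartEq.quantOp {g : GL (Fin (n + 1)) ℝ} {i j : Fin (n + 1)} {d : ℕ}
    {f f' : Sm ℝ (⊤ : Opens ((Fin n → ℝ) × (Fin n → ℝ)))} (hf : ChartEq g i j f f')
    (hE : ((Frame.std ℝ (Fin n)).darboux ⊤).E f' = (d : ℂ) • f')
    {b b' : (Fin n → ℝ) → ℂ} (hb : ContDiff ℝ ∞ b) (hb' : ContDiff ℝ ∞ b')
    (hbb : ∀ v : (Fin (n + 1) → ℝ) × (Fin (n + 1) → ℝ), v.1 j ≠ 0 → (pairAct g v).1 i ≠ 0 →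
      densW n (v.1 j) * b (affPt j v).1 =
        densW n ((pairAct g v).1 i) * b' (affPt i (pairAct g v)).1)
    {v : (Fin (n + 1) → ℝ) × (Fin (n + 1) → ℝ)} (hj : v.1 j ≠ 0) (hi : (pairAct g v).1 i ≠ 0)
    (hc : v.1 ⬝ᵥ v.2 = 0) :
    densW n (v.1 j) * (((Frame.std ℝ (Fin n)).darboux ⊤).quantOp n d f (baseFn b hb)).1
      ⟨affPt j v, trivial⟩ =
    densW n ((pairAct g v).1 i) * (((Frame.std ℝ (Fin n)).darboux ⊤).quantOp n d f'
      (baseFn b' hb')).1 ⟨affPt i (pairAct g v), trivial⟩ := by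
  have hv : v ∈ overlap g i j (⊤ : Opens ((Fin n → ℝ) × (Fin n → ℝ))) ⊤ :=
    ⟨⟨hj, hi⟩, trivial, trivial⟩
  have hN : (Fintype.card (Fin (n + 1)) : ℂ) = n + 1 := by simp
  -- In homogeneous coordinates the two local expressions of the density are the same function up to
  -- `g`, so only the symbol has to be exchanged on the cone.
  have hG : densPull (Ω := overlap g i j ⊤ ⊤) j (fun _ => overlap_ne) (fun _ => overlap_mem) b hb =
      actPull g (fun _ => overlap_act)
        (densPull (Ω := overChart i ⊤) i (fun _ => overChart_ne) (fun _ => overChart_mem) b' hb') := by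
    ext w
    rw [actPull_apply, densPull_apply, densPull_apply]
    exact hbb w.1 w.2.1.1 w.2.1.2
  have hfE := farPull_E (U := ⊤) g i j hE
  have e1 := quantOp_eq_on_cone (Ω := overlap g i j ⊤ ⊤) (j := j) (fun _ => overlap_ne) hN
    (quant_ne_zero n d) (farPull_inv g i j f') hfE (Ex_densPull j (fun _ => overlap_ne) (fun _ => overlap_mem) b hb)
    hf.slide hv hc
  have n1 := quantOp_densPull (Ω := overlap g i j ⊤ ⊤) j (fun _ => overlap_ne) (fun _ => overlap_mem) d f b hb
  have n2 := quantOp_densPull (Ω := overChart i ⊤) i (fun _ => overChart_ne) (fun _ => overChart_mem) d f' b' hb'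
  have n3 := (compat_actPull g (Ω := overlap g i j ⊤ ⊤) (Ω' := overChart i ⊤)
    (fun _ => overlap_act)).quantOp (compat_actPull g (Ω := overlap g i j ⊤ ⊤)
      (Ω' := overChart i ⊤) (fun _ => overlap_act)).star n d
      (affPull i (fun _ => overChart_ne) (fun _ => overChart_mem) f')
      (densPull (Ω := overChart i ⊤) i (fun _ => overChart_ne) (fun _ => overChart_mem) b' hb')
  simp only [AlgHom.toLinearMap_apply] at n3
  rw [n2, ← hG] at n3
  have r1 : (densFactor (Ω := overlap g i j ⊤ ⊤) j (fun _ => overlap_ne) *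
      affPull (U := ⊤) j (fun _ => overlap_ne) (fun _ => overlap_mem)
      (((Frame.std ℝ (Fin n)).darboux ⊤).quantOp n d f (baseFn b hb))).1 ⟨v, hv⟩ = _ :=
    congrArg (densW n (v.1 j) * ·) (affPull_apply (U := ⊤) (Ω := overlap g i j ⊤ ⊤) j
      (fun _ => overlap_ne) (fun _ => overlap_mem) _ ⟨v, hv⟩)
  refine r1.symm.trans ?_
  rw [← n1]
  refine e1.trans ((congrArg (fun F => F.1 ⟨v, hv⟩) n3).trans ?_)
  rw [actPull_apply, Sm.mul_apply, affPull_apply]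
  rfl

end RealDensities

namespace Darboux

variable {ι : Type} [Fintype ι] [DecidableEq ι] {O : Type} [CommRing O] [Algebra ℂ O]
  (S : Darboux ι O)

lemma E_nab {f b : O} {y : ℂ} (hf : ∀ a, S.dξ a f = 0) (hb : S.E b = (y + 1) • b) :
    S.E (S.nab f b) = y • S.nab f b := by
  have h0 : ∀ a, S.E (S.dx a f) = 0 := by
    intro a
    rw [E_apply]
    refine sum_eq_zero fun k _ => ?_
    rw [← S.dx_dξ, hf, map_zero, mul_zero]
  rw [nab_apply, map_sum, smul_sum]
  refine sum_congr rfl fun a _ => ?_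
  rw [E_mul, h0, zero_mul, zero_add, S.E_dξ hb, Algebra.mul_smul_comm, add_sub_cancel_right]

end Darboux

/-! ### Points of the cotangent bundle and their coordinates -/

section Points

variable {𝕜 : Type} [RCLike 𝕜] [NormedAlgebra 𝕜 ℂ] {n : ℕ}

/-- Homogeneous coordinates of a point given in an affine chart. -/
def homPt (i : Fin (n + 1)) (w : (Fin n → 𝕜) × (Fin n → 𝕜)) :
    (Fin (n + 1) → 𝕜) × (Fin (n + 1) → 𝕜) :=
  (i.insertNth (1 : 𝕜) w.1, i.insertNth (-(w.2 ⬝ᵥ w.1)) w.2)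

@[simp] lemma homPt_fst_self (i : Fin (n + 1)) (w : (Fin n → 𝕜) × (Fin n → 𝕜)) :
    (homPt i w).1 i = 1 := by simp [homPt]

lemma homPt_cone (i : Fin (n + 1)) (w : (Fin n → 𝕜) × (Fin n → 𝕜)) :
    (homPt i w).1 ⬝ᵥ (homPt i w).2 = 0 := by
  simp [homPt, dotProduct, Fin.sum_univ_succAbove _ i, mul_comm]

@[simp] lemma affPt_homPt (i : Fin (n + 1)) (w : (Fin n → 𝕜) × (Fin n → 𝕜)) :
    affPt i (homPt i w) = w := by
  refine Prod.ext ?_ ?_ <;> funext k <;> simp [affPt, homPt]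

/-- The covector with given homogeneous coordinates. -/
def conePt (v : (Fin (n + 1) → 𝕜) × (Fin (n + 1) → 𝕜)) (h0 : v.1 ≠ 0) (hc : v.1 ⬝ᵥ v.2 = 0) :
    CotP 𝕜 n := Quotient.mk (cotSetoid 𝕜 n) ⟨v, h0, (dotProduct_comm _ _).trans hc⟩

lemma ne_zero_of_apply {v : (Fin (n + 1) → 𝕜) × (Fin (n + 1) → 𝕜)} {i : Fin (n + 1)}
    (hi : v.1 i ≠ 0) : v.1 ≠ 0 := fun h => hi (by rw [h]; rfl)

lemma conePt_eq_cotChart {v : (Fin (n + 1) → 𝕜) × (Fin (n + 1) → 𝕜)} {i : Fin (n + 1)}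
    (hi : v.1 i ≠ 0) (hc : v.1 ⬝ᵥ v.2 = 0) :
    conePt v (ne_zero_of_apply hi) hc = cotChart i (affPt i v).1 (affPt i v).2 := by
  apply Quotient.sound
  refine ⟨(Units.mk0 _ hi)⁻¹, ?_, ?_⟩
  · funext k
    refine Fin.succAboveCases i ?_ (fun j => ?_) k <;> simp [affPt, hi]
  · simp only [dotProduct, Fin.sum_univ_succAbove _ i] at hc
    funext k
    refine Fin.succAboveCases i ?_ (fun j => ?_) k
    · have : ∀ k, v.1 i * v.2 (i.succAbove k) * ((v.1 i)⁻¹ * v.1 (i.succAbove k))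
          = v.1 (i.succAbove k) * v.2 (i.succAbove k) := fun k => by field_simp
      simp [affPt, dotProduct, this]
      linear_combination -hc
    · simp [affPt]

lemma affPt_eq_of_conePt_eq {v : (Fin (n + 1) → 𝕜) × (Fin (n + 1) → 𝕜)} {i : Fin (n + 1)}
    {w : (Fin n → 𝕜) × (Fin n → 𝕜)} {h0 : v.1 ≠ 0} {hc : v.1 ⬝ᵥ v.2 = 0}
    (h : conePt v h0 hc = cotChart i w.1 w.2) : v.1 i ≠ 0 ∧ affPt i v = w := by
  obtain ⟨t, h1, h2⟩ := Quotient.exact h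
  simp only at h1 h2
  have ht : (t : 𝕜) * v.1 i = 1 := by simpa using (congrFun h1 i).symm
  have hi : v.1 i ≠ 0 := right_ne_zero_of_mul_eq_one ht
  have hi' : (t : 𝕜) = (v.1 i)⁻¹ := eq_inv_of_mul_eq_one_left ht
  refine ⟨hi, Prod.ext ?_ ?_⟩ <;> funext k
  · have := congrFun h1 (i.succAbove k)
    simp [hi'] at this
    simp [affPt, this]
  · have := congrFun h2 (i.succAbove k)
    simp [hi'] at this
    simp [affPt, this]

lemma homPt_ne_zero (i : Fin (n + 1)) (w : (Fin n → 𝕜) × (Fin n → 𝕜)) : (homPt i w).1 ≠ 0 :=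
  ne_zero_of_apply (i := i) (by simp)

lemma cotChart_eq_conePt (i : Fin (n + 1)) (w : (Fin n → 𝕜) × (Fin n → 𝕜)) :
    cotChart i w.1 w.2 = conePt (homPt i w) (homPt_ne_zero i w) (homPt_cone i w) := rfl

lemma cotAct_conePt (g : GL (Fin (n + 1)) 𝕜) (v : (Fin (n + 1) → 𝕜) × (Fin (n + 1) → 𝕜))
    (h0 : v.1 ≠ 0) (hc : v.1 ⬝ᵥ v.2 = 0) : cotAct g (conePt v h0 hc) =
      conePt (pairAct g v) (nzAct g ⟨v.1, h0⟩).2 (pairAct_cone g hc) := rfl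

@[simp] lemma pairAct_one (v : (Fin (n + 1) → 𝕜) × (Fin (n + 1) → 𝕜)) : pairAct 1 v = v := by
  simp [pairAct]

lemma cotAct_cotChart_affPt (g : GL (Fin (n + 1)) 𝕜) {i j : Fin (n + 1)}
    {v : (Fin (n + 1) → 𝕜) × (Fin (n + 1) → 𝕜)} (hj : v.1 j ≠ 0) (hi : (pairAct g v).1 i ≠ 0)
    (hc : v.1 ⬝ᵥ v.2 = 0) : cotAct g (cotChart j (affPt j v).1 (affPt j v).2) =
      cotChart i (affPt i (pairAct g v)).1 (affPt i (pairAct g v)).2 := by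
  rw [← conePt_eq_cotChart hj hc, cotAct_conePt, ← conePt_eq_cotChart hi (pairAct_cone g hc)]

lemma exists_conePt (m : CotP 𝕜 n) : ∃ v h0 hc, m = conePt v h0 hc := by
  induction m using Quotient.inductionOn with
  | _ v => exact ⟨v.1, v.2.1, (dotProduct_comm _ _).trans v.2.2, rfl⟩

/-- Functions given in the charts and compatible on the overlaps define a function. -/
lemma exists_glue (S : Set (CotP 𝕜 n)) (c : Fin (n + 1) → (Fin n → 𝕜) × (Fin n → 𝕜) → ℂ)
    (h : ∀ i j v, v.1 j ≠ 0 → v.1 i ≠ 0 → v.1 ⬝ᵥ v.2 = 0 →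
      cotChart j (affPt j v).1 (affPt j v).2 ∈ S → c j (affPt j v) = c i (affPt i v)) :
    ∃ F : CotP 𝕜 n → ℂ, ∀ i w, cotChart i w.1 w.2 ∈ S → F (cotChart i w.1 w.2) = c i w := by
  choose I U X hm using fun m : CotP 𝕜 n => exists_cotChart m
  refine ⟨fun m => c (I m) (U m, X m), fun i w hw => ?_⟩
  have h1 := hm (cotChart i w.1 w.2)
  obtain ⟨h2, h3⟩ := affPt_eq_of_conePt_eq (w := (U _, X _)) ((cotChart_eq_conePt i w).symm.trans h1)
  change c _ (U _, X _) = _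
  rw [← h3, ← h _ i (homPt i w) (by simp) h2 (homPt_cone i w) (by simpa using hw), affPt_homPt]

end Points

/-! ### Smooth functions on the real cotangent bundle in charts -/

section RealCharts

variable {n : ℕ}

/-- Smooth functions on a chart of the cotangent bundle. -/
abbrev Ch (n : ℕ) := Sm ℝ (⊤ : Opens ((Fin n → ℝ) × (Fin n → ℝ)))

/-- The canonical coordinates on a chart. -/
abbrev chD (n : ℕ) : Darboux (Fin n) (Ch n) := (Frame.std ℝ (Fin n)).darboux ⊤

/-- The point of a chart with given coordinates. -/
abbrev chPt (w : (Fin n → ℝ) × (Fin n → ℝ)) : (⊤ : Opens ((Fin n → ℝ) × (Fin n → ℝ))) :=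
  ⟨w, trivial⟩

/-- A smooth function in a chart. -/
def toChart (i : Fin (n + 1)) : SmoothT n →ₐ[ℂ] Ch n where
  toFun f := Sm.of (fun w => f.1 (cotChart i w.1 w.2)) fun _ _ => (f.2 i).contDiffAt
  map_one' := rfl
  map_mul' _ _ := rfl
  map_zero' := rfl
  map_add' _ _ := rfl
  commutes' _ := rfl

lemma toChart_apply (i : Fin (n + 1)) (f : SmoothT n) (w) :
    (toChart i f).1 w = f.1 (cotChart i w.1.1 w.1.2) := rfl

lemma toChart_ext {f g : SmoothT n} (h : ∀ i, toChart i f = toChart i g) : f = g := by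
  apply Subtype.ext
  funext m
  obtain ⟨i, u, ξ, rfl⟩ := exists_cotChart m
  exact congrArg (fun F : Ch n => F.1 (chPt (u, ξ))) (h i)

lemma toChart_smul (i : Fin (n + 1)) (c : ℂ) (f : SmoothT n) :
    toChart i (c • f) = c • toChart i f := rfl

lemma contDiff_of_ch (f : Ch n) : ContDiff ℝ ∞ (fun w => f.1 (chPt w)) := by
  rw [contDiff_iff_contDiffAt]
  intro w
  refine (f.2 w trivial).congr_of_eventuallyEq (Filter.Eventually.of_forall fun v => ?_)
  exact (extZero_of_mem f.1 (Opens.mem_top v)).symm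

lemma chartEq_toChart {g : GL (Fin (n + 1)) ℝ} {f f' : SmoothT n}
    (h : ∀ m, f'.1 (cotAct g m) = f.1 m) (i j : Fin (n + 1)) :
    ChartEq g i j (toChart j f) (toChart i f') := by
  intro v hv hc
  rw [toChart_apply, toChart_apply, ← cotAct_cotChart_affPt g hv.1.1 hv.1.2 hc, h]

lemma chartEq_one_toChart (f : SmoothT n) (i j : Fin (n + 1)) :
    ChartEq 1 i j (toChart j f) (toChart i f) := by
  refine chartEq_toChart (fun m => ?_) i j
  obtain ⟨v, h0, hc, rfl⟩ := exists_conePt m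
  simp only [cotAct_conePt, pairAct_one]

lemma chartEq_translate {g : GL (Fin (n + 1)) ℝ} {f f' : SmoothT n}
    (h : ∀ i j, ChartEq g i j (toChart j f) (toChart i f')) (m : CotP ℝ n) :
    f'.1 (cotAct g m) = f.1 m := by
  obtain ⟨v, h0, hc, rfl⟩ := exists_conePt m
  obtain ⟨j, hj⟩ := Function.ne_iff.1 h0
  obtain ⟨i, hi⟩ := Function.ne_iff.1 (nzAct g ⟨v.1, h0⟩).2
  have := h i j v ⟨⟨hj, hi⟩, trivial, trivial⟩ hc
  rw [toChart_apply, toChart_apply, ← cotAct_cotChart_affPt g hj hi hc] at this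
  rw [conePt_eq_cotChart hj hc]
  exact this.symm

lemma exists_toChart_eq {c : Fin (n + 1) → Ch n} (h : ∀ i j, ChartEq 1 i j (c j) (c i)) :
    ∃ F : SmoothT n, ∀ i, toChart i F = c i := by
  obtain ⟨F, hF⟩ := exists_glue Set.univ (fun i w => (c i).1 (chPt w)) (fun i j v hj hi hc _ => by
    have := h i j v ⟨⟨hj, by simpa using hi⟩, trivial, trivial⟩ hc
    simpa only [pairAct_one] using this)
  refine ⟨⟨F, fun i => ?_⟩, fun i => Sm.ext fun w => hF i w.1 trivial⟩
  simp only [hF _ _ (Set.mem_univ _)]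
  exact contDiff_of_ch (c i)

lemma toChart_euler (i : Fin (n + 1)) (f : SmoothT n) :
    toChart i (euler f) = (chD n).E (toChart i f) := by
  ext w
  rw [Frame.E_std, Sm.d_apply_of_eq (F := fun w => f.1 (cotChart i w.1 w.2)) (fun _ => rfl)]
  exact (euler_aux f i w).deriv

/-! ### Homogeneous functions in a chart -/

lemma ch_hasDerivAt_line (f : Ch n) (w v : (Fin n → ℝ) × (Fin n → ℝ)) (t : ℝ) :
    HasDerivAt (fun s : ℝ => f.1 (chPt (w + s • v))) ((Sm.d v f).1 (chPt (w + t • v))) t := by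
  have hc : HasDerivAt (fun s : ℝ => w + s • v) v t := by
    simpa using ((hasDerivAt_id t).smul_const v).const_add w
  refine (Sm.hasDerivAt_comp f hc trivial).congr_of_eventuallyEq
    (Filter.Eventually.of_forall fun s => ?_)
  exact (extZero_of_mem f.1 (Opens.mem_top _)).symm

/-- By Euler's relation `s^(A+1) h(u, s ξ)` has zero derivative in `s`, and it vanishes at `s = 0`;
smoothness across the zero section is essential. -/
lemma ch_noNeg (n : ℕ) : (chD n).NoNeg := by
  intro A h hE
  ext w
  obtain ⟨⟨u, ξ⟩, _⟩ := w
  have hd : ∀ t : ℝ, HasDerivAt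
      (fun s : ℝ => (s : ℂ) ^ (A + 1) * h.1 (chPt ((u, 0) + s • (0, ξ)))) 0 t := by
    intro t
    have h1 : HasDerivAt (fun s : ℝ => (s : ℂ)) 1 t := Complex.ofRealCLM.hasDerivAt
    have h2 := (h1.pow (A + 1)).mul (ch_hasDerivAt_line h (u, 0) (0, ξ) t)
    refine HasDerivAt.congr_deriv h2 ?_
    have h3 := congrArg (fun F : Ch n => F.1 (chPt ((u, 0) + t • (0, ξ)))) hE
    simp only [Frame.E_std, Sm.smul_apply] at h3
    have e : ((0 : Fin n → ℝ), (chPt ((u, 0) + t • ((0 : Fin n → ℝ), ξ))).1.2) = t • (0, ξ) := by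
      simp
    rw [e, Sm.d_smul] at h3
    rw [Complex.coe_algebraMap] at h3
    rw [Nat.add_sub_cancel, mul_one, Pi.pow_apply, pow_succ, Nat.cast_succ]
    linear_combination ((t : ℂ) ^ A) * h3
  have hc := is_const_of_deriv_eq_zero (fun t => (hd t).differentiableAt) (fun t => (hd t).deriv) 1 0
  simpa using hc

lemma ch_const_of_dξ {f : Ch n} (h : ∀ a, (chD n).dξ a f = 0) (u ξ ξ' : Fin n → ℝ) :
    f.1 (chPt (u, ξ)) = f.1 (chPt (u, ξ')) := by
  have hv : ∀ w, (Sm.d (0, ξ - ξ') f).1 (chPt w) = 0 := by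
    intro w
    have e : ((0 : Fin n → ℝ), ξ - ξ') =
        ∑ a, (ξ - ξ') a • (Frame.std ℝ (Fin n)).eξ a := by
      refine Prod.ext ?_ ?_
      · simp [Frame.std, Prod.fst_sum]
      · funext k
        simp [Frame.std, Prod.snd_sum, Finset.sum_apply, Pi.single_apply]
    rw [e, Sm.d_sum]
    refine sum_eq_zero fun a _ => ?_
    have : (Sm.d ((Frame.std ℝ (Fin n)).eξ a) f).1 (chPt w) = 0 :=
      congrArg (fun F : Ch n => F.1 (chPt w)) (h a)
    rw [this, mul_zero]
  have hd := fun t => (hv _) ▸ ch_hasDerivAt_line f (u, ξ') (0, ξ - ξ') t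
  simpa using is_const_of_deriv_eq_zero (fun t => (hd t).differentiableAt) (fun t => (hd t).deriv) 1 0

/-- A fibre derivative of a function of degree `0` has degree `-1`. -/
lemma ch_dξ_eq_zero {f : Ch n} (h : (chD n).E f = 0) (a : Fin n) : (chD n).dξ a f = 0 := by
  refine ch_noNeg n 0 _ ?_
  rw [(chD n).E_dξ (z := 0) (by rw [h, zero_smul])]
  simp

/-- Euler's relation writes `(d + 1) f` as `∑ ξ_a ∂f/∂ξ_a`, and the derivatives are polynomial of
degree `d` by induction. -/
lemma ch_exists_polynomial {d : ℕ} {f : Ch n} (h : (chD n).E f = (d : ℂ) • f) (u : Fin n → ℝ) :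
    ∃ P : MvPolynomial (Fin n) ℂ, P.IsHomogeneous d ∧
      ∀ ξ, f.1 (chPt (u, ξ)) = MvPolynomial.eval (fun k => (ξ k : ℂ)) P := by
  induction d generalizing f with
  | zero =>
    refine ⟨MvPolynomial.C (f.1 (chPt (u, 0))), MvPolynomial.isHomogeneous_C _ _, fun ξ => ?_⟩
    rw [MvPolynomial.eval_C]
    exact ch_const_of_dξ (ch_dξ_eq_zero (by simpa using h)) u ξ 0
  | succ d ih =>
    choose P hP hP' using fun a => ih (f := (chD n).dξ a f) (by
      rw [(chD n).E_dξ h]; push_cast; congr 1; ring)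
    refine ⟨MvPolynomial.C ((d : ℂ) + 1)⁻¹ * ∑ a, MvPolynomial.X a * P a, ?_, fun ξ => ?_⟩
    · have h1 : (∑ a, MvPolynomial.X a * P a).IsHomogeneous (1 + d) :=
        MvPolynomial.IsHomogeneous.sum _ _ _ fun a _ =>
          (MvPolynomial.isHomogeneous_X ℂ a).mul (hP a)
      rw [add_comm d]
      simpa using (MvPolynomial.isHomogeneous_C (Fin n) ((d : ℂ) + 1)⁻¹).mul h1
    · have h1 := congrArg (Sm.ev (chPt (u, ξ))) h
      rw [Darboux.E_apply, map_sum, map_smul] at h1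
      simp only [map_mul, MvPolynomial.eval_C, map_sum, MvPolynomial.eval_X]
      have h2 : ∑ a, (ξ a : ℂ) * MvPolynomial.eval (fun k => (ξ k : ℂ)) (P a) =
          ((d : ℂ) + 1) * f.1 (chPt (u, ξ)) := by
        rw [Nat.cast_succ] at h1
        refine Eq.trans (sum_congr rfl fun a _ => ?_) h1
        rw [← hP' a, map_mul]
        rfl
      rw [h2, inv_mul_cancel_left₀ (Nat.cast_add_one_ne_zero d)]

/-- A smooth homogeneous function is automatically polynomial along the fibres, so membership
becomes an eigenvalue equation that can be checked in charts. -/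
lemma mem_polDeg_iff {d : ℕ} {f : SmoothT n} : f ∈ PolDeg n d ↔ euler f = (d : ℂ) • f := by
  refine ⟨euler_polDeg, fun h i u => ch_exists_polynomial (f := toChart i f) ?_ u⟩
  rw [← toChart_euler, h, toChart_smul]

lemma E_toChart {d : ℕ} {f : SmoothT n} (hf : f ∈ PolDeg n d) (i : Fin (n + 1)) :
    (chD n).E (toChart i f) = (d : ℂ) • toChart i f := by
  rw [← toChart_euler, euler_polDeg hf, toChart_smul]

lemma mem_polDeg_of_E {d : ℕ} {f : SmoothT n}
    (h : ∀ i, (chD n).E (toChart i f) = (d : ℂ) • toChart i f) : f ∈ PolDeg n d :=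
  mem_polDeg_iff.2 (toChart_ext fun i => by rw [toChart_euler, h, toChart_smul])

/-- Iterating the derivation along the fibre direction of a covector. -/
lemma ch_nab_pow {d : ℕ} {b f : Ch n} (hb : (chD n).E b = (d : ℂ) • b)
    (hf : ∀ a, (chD n).dξ a f = 0) (u ξ : Fin n → ℝ) (c : Fin n → ℝ)
    (hc : ∀ a ξ, ((chD n).dx a f).1 (chPt (u, ξ)) = (c a : ℂ)) :
    (((chD n).nab f ^ d) b).1 (chPt (u, ξ)) = (d.factorial : ℂ) * b.1 (chPt (u, c)) := by
  induction d generalizing b with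
  | zero =>
    simpa using ch_const_of_dξ (ch_dξ_eq_zero (by simpa using hb)) u ξ c
  | succ d ih =>
    have hE := (chD n).E_nab (y := d) hf (by rw [hb, Nat.cast_succ])
    rw [pow_succ, Module.End.mul_apply, ih hE, Nat.factorial_succ]
    have h1 := congrArg (Sm.ev (chPt (u, c))) hb
    rw [Darboux.E_apply, map_sum, map_smul, Nat.cast_succ] at h1
    have h2 : ((chD n).nab f b).1 (chPt (u, c)) = ((d : ℂ) + 1) * b.1 (chPt (u, c)) := by
      refine Eq.trans ?_ h1
      rw [Darboux.nab_apply, ← Sm.ev_apply, map_sum]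
      refine sum_congr rfl fun a _ => ?_
      rw [map_mul, map_mul, Sm.ev_apply, hc]
      rfl
    rw [h2]
    push_cast
    ring

end RealCharts

/-! ### Graded structure of the symbol space -/

section Graded

variable {n : ℕ}

lemma lsum_components (φ : Pol n) :
    DFinsupp.lsum ℕ (fun d => (PolDeg n d).subtype) (components φ) = φ.1 :=
  ((Submodule.mem_iSup_iff_exists_dfinsupp (PolDeg n) φ.1).1 φ.2).choose_spec

lemma components_eq {φ : Pol n} {x : Π₀ d, PolDeg n d}
    (h : DFinsupp.lsum ℕ (fun d => (PolDeg n d).subtype) x = φ.1) : components φ = x :=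
  polDeg_indep.dfinsupp_lsum_injective ((lsum_components φ).trans h.symm)

/-- The homogeneous components, as a linear map. -/
def componentsL (n : ℕ) : Pol n →ₗ[ℂ] Π₀ d, PolDeg n d where
  toFun := components
  map_add' φ ψ := components_eq (by rw [map_add, lsum_components, lsum_components]; rfl)
  map_smul' c φ := components_eq (by
    have h : ∀ x : Π₀ d, PolDeg n d, DFinsupp.lsum ℕ (fun d => (PolDeg n d).subtype) (c • x) =
        c • DFinsupp.lsum ℕ (fun d => (PolDeg n d).subtype) x := fun x =>
      map_smul (DFinsupp.lsum ℂ fun d => (PolDeg n d).subtype) c x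
    rw [RingHom.id_apply, h, lsum_components]
    rfl)

/-- A homogeneous element of the symbol space. -/
abbrev toPol {d : ℕ} (f : PolDeg n d) : Pol n := ⟨f.1, le_iSup (PolDeg n) d f.2⟩

lemma componentsL_toPol {d : ℕ} (f : PolDeg n d) :
    componentsL n (toPol f) = DFinsupp.single d f :=
  components_eq (by rw [DFinsupp.lsum_single]; rfl)

lemma comp_toPol {d : ℕ} (f : PolDeg n d) (e : ℕ) :
    comp e (toPol f) = if d = e then toPol f else 0 := by
  apply Subtype.ext
  have h : (componentsL n (toPol f)) e = _ := congrArg (fun x : Π₀ d, PolDeg n d => x e)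
    (componentsL_toPol f)
  change ((componentsL n (toPol f)) e).1 = _
  rw [h, DFinsupp.single_apply]
  split_ifs with hd
  · subst hd; rfl
  · rfl

lemma comp_add (e : ℕ) (φ ψ : Pol n) : comp e (φ + ψ) = comp e φ + comp e ψ :=
  Subtype.ext (congrArg (fun x : Π₀ d, PolDeg n d => (x e).1) (map_add (componentsL n) φ ψ))

lemma comp_sum {κ : Type*} (s : Finset κ) (e : ℕ) (φ : κ → Pol n) :
    comp e (∑ k ∈ s, φ k) = ∑ k ∈ s, comp e (φ k) := by
  have h0 : comp e (0 : Pol n) = 0 :=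
    Subtype.ext (congrArg (fun x : Π₀ d, PolDeg n d => (x e).1) (map_zero (componentsL n)))
  exact map_sum (AddMonoidHom.mk' (comp e) (comp_add e)) φ s

lemma comp_eq_toPol (d : ℕ) (φ : Pol n) : comp d φ = toPol (components φ d) := rfl

open Classical in
lemma sum_comp (φ : Pol n) : ∑ d ∈ (components φ).support, comp d φ = φ := by
  apply Subtype.ext
  refine Eq.trans ?_ (lsum_components φ)
  rw [DFinsupp.lsum_apply_apply, DFinsupp.sumAddHom_apply, DFinsupp.sum]
  exact map_sum (Pol n).subtype _ _

lemma pol_induction {P : Pol n → Prop} (h0 : P 0) (hadd : ∀ φ ψ, P φ → P ψ → P (φ + ψ))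
    (hom : ∀ (d : ℕ) (f : PolDeg n d), P (toPol f)) (φ : Pol n) : P φ := by
  classical
  rw [← sum_comp φ]
  exact Finset.sum_induction _ P hadd h0 fun d _ => hom d _

lemma pol_hom_ext {M : Type*} [AddCommMonoid M] [Module ℂ M] {A B : Pol n →ₗ[ℂ] M}
    (h : ∀ (d : ℕ) (f : PolDeg n d), A (toPol f) = B (toPol f)) : A = B :=
  LinearMap.ext fun φ => pol_induction (P := fun φ => A φ = B φ) (by rw [map_zero, map_zero])
    (fun φ ψ h1 h2 => by rw [map_add, map_add, h1, h2]) h φ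

/-- The linear map given on each homogeneous component. -/
def polLift {M : Type*} [AddCommGroup M] [Module ℂ M] (A : ∀ d, PolDeg n d →ₗ[ℂ] M) :
    Pol n →ₗ[ℂ] M := (DFinsupp.lsum ℂ A).comp (componentsL n)

lemma polLift_toPol {M : Type*} [AddCommGroup M] [Module ℂ M] (A : ∀ d, PolDeg n d →ₗ[ℂ] M)
    {d : ℕ} (f : PolDeg n d) : polLift A (toPol f) = A d f := by
  rw [polLift, LinearMap.comp_apply, componentsL_toPol, DFinsupp.lsum_single]

/-- The operator acting by scalars on the homogeneous components. -/
def diagOp (n : ℕ) (c : ℕ → ℂ) : Module.End ℂ (Pol n) :=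
  polLift fun d => c d • Submodule.inclusion (le_iSup (PolDeg n) d)

lemma diagOp_toPol (c : ℕ → ℂ) {d : ℕ} (f : PolDeg n d) :
    diagOp n c (toPol f) = c d • toPol f := polLift_toPol _ f

lemma diagOp_mul (c c' : ℕ → ℂ) : diagOp n c * diagOp n c' = diagOp n (c * c') :=
  pol_hom_ext fun d f => by
    rw [Module.End.mul_apply, diagOp_toPol, diagOp_toPol, map_smul, diagOp_toPol, smul_smul,
      mul_comm, Pi.mul_apply]

lemma diagOp_one : diagOp n 1 = 1 := pol_hom_ext fun d f => by rw [diagOp_toPol]; simp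

lemma diagOp_list_prod {κ : Type*} (l : List κ) (c : κ → ℕ → ℂ) :
    (l.map fun k => diagOp n (c k)).prod = diagOp n (l.map c).prod := by
  induction l with
  | nil => exact diagOp_one.symm
  | cons a l ih => simp [ih, diagOp_mul]

lemma isUnit_diagOp {c : ℕ → ℂ} (h : ∀ d, c d ≠ 0) :
    IsUnit (diagOp n c) ∧ Ring.inverse (diagOp n c) = diagOp n c⁻¹ := by
  have h1 : c * c⁻¹ = 1 := funext fun d => mul_inv_cancel₀ (h d)
  have e1 : diagOp n c * diagOp n c⁻¹ = 1 := by rw [diagOp_mul, h1, diagOp_one]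
  have e2 : diagOp n c⁻¹ * diagOp n c = 1 := by rw [diagOp_mul, mul_comm, h1, diagOp_one]
  exact ⟨⟨⟨_, _, e1, e2⟩, rfl⟩, Ring.inverse_unit (⟨_, _, e1, e2⟩ : (Module.End ℂ (Pol n))ˣ)⟩

lemma eulerShift_eq (r : ℂ) : eulerShift n r = diagOp n fun d => d + r :=
  pol_hom_ext fun d f => by
    have h : eulerPol n (toPol f) = (d : ℂ) • toPol f := Subtype.ext (euler_polDeg f.2)
    rw [diagOp_toPol, add_smul, ← h]
    rfl

lemma prod_range_map_apply (m : ℕ) (c : ℕ → ℕ → ℂ) (d : ℕ) :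
    ((List.range m).map c).prod d = ∏ i ∈ range m, c i d := by
  induction m with
  | zero => rfl
  | succ m ih => rw [List.range_succ, List.map_append, List.prod_append, prod_range_succ,
      Pi.mul_apply, ih]; simp

/-- The eigenvalues of `T_p`. -/
def eigT (n p d : ℕ) : ℂ := (tau p 0).eval ((n : ℂ) + 2 * d)

/-- The eigenvalues of `S_p`. -/
def eigS (n p d : ℕ) : ℂ := (sig p 0).eval ((n : ℂ) + 2 * d)

lemma opT_eq (n p : ℕ) : opT n p = diagOp n (eigT n p) := by
  simp only [opT, eulerShift_eq, diagOp_list_prod]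
  congr 1
  funext d
  rw [prod_range_map_apply, eigT, tau_zero, eval_prod]
  refine prod_congr rfl fun i _ => ?_
  simp
  ring

lemma opS_eq (n p : ℕ) : opS n p = diagOp n (eigS n p) := by
  simp only [opS, eulerShift_eq, diagOp_list_prod]
  congr 1
  funext d
  rw [prod_range_map_apply, eigS, sig_zero, eval_prod]
  refine prod_congr rfl fun i _ => ?_
  simp
  ring

/-- Parity: a vanishing factor would make the odd number `n + 2 d` equal to `2 (i + 1)`. -/
lemma eigS_ne_zero (hn : Odd n) (p d : ℕ) : eigS n p d ≠ 0 := by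
  rw [eigS, sig_zero, eval_prod, prod_ne_zero_iff]
  intro i _ h
  obtain ⟨m, rfl⟩ := hn
  simp at h
  have h' : ((2 * m + 1 + 2 * d : ℕ) : ℂ) = ((2 * (i + 1) : ℕ) : ℂ) := by
    push_cast
    linear_combination 2 * h
  have := Nat.cast_injective h'
  omega

lemma eigT_ne_zero (n p d : ℕ) : eigT n p d ≠ 0 := by
  rw [eigT, tau_zero, eval_prod, prod_ne_zero_iff]
  intro i _ h
  simp at h
  have h' : ((n + 2 * d + 2 * (i + 1) : ℕ) : ℂ) = ((0 : ℕ) : ℂ) := by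
    push_cast
    linear_combination 2 * h
  have := Nat.cast_injective h'
  omega

end Graded

/-! ### The invariant bidifferential operator on the real cotangent bundle -/

section RealBidiff

variable {n : ℕ}

/-- The operator in a chart. -/
abbrev chBidiff (n p : ℕ) : Ch n →ₗ[ℂ] Ch n →ₗ[ℂ] Ch n := (chD n).bidiff n p (sig p) (tau p)

/-- The chart operators glue by `ChartEq.bidiff` for `g = 1`; bilinearity is inherited from the
charts. -/
lemma exists_realBidiff (n p : ℕ) : ∃ Z : SmoothT n →ₗ[ℂ] SmoothT n →ₗ[ℂ] SmoothT n,
    ∀ i f g, toChart i (Z f g) = chBidiff n p (toChart i f) (toChart i g) := by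
  choose Z hZ using fun f g : SmoothT n => exists_toChart_eq
    (c := fun i => chBidiff n p (toChart i f) (toChart i g)) fun i j =>
      (chartEq_one_toChart f i j).bidiff p (chartEq_one_toChart g i j)
  refine ⟨LinearMap.mk₂ ℂ Z ?_ ?_ ?_ ?_, fun i f g => hZ f g i⟩
  · exact fun f f' g => toChart_ext fun i => by simp only [map_add, hZ, LinearMap.add_apply]
  · exact fun c f g => toChart_ext fun i => by
      simp only [hZ, map_smul, LinearMap.smul_apply]
  · exact fun f g g' => toChart_ext fun i => by simp only [map_add, hZ]
  · exact fun c f g => toChart_ext fun i => by simp only [hZ, map_smul]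

/-- The invariant bidifferential operator `Z_p`. -/
def realBidiff (n p : ℕ) : SmoothT n →ₗ[ℂ] SmoothT n →ₗ[ℂ] SmoothT n :=
  (exists_realBidiff n p).choose

lemma toChart_realBidiff (p : ℕ) (i : Fin (n + 1)) (f g : SmoothT n) :
    toChart i (realBidiff n p f g) = chBidiff n p (toChart i f) (toChart i g) :=
  (exists_realBidiff n p).choose_spec i f g

lemma isDiffOp_of_toChart {k : ℕ} {D : SmoothT n → SmoothT n} {D' : Fin (n + 1) → Ch n → Ch n}
    (hD : ∀ i f, toChart i (D f) = D' i (toChart i f)) (h : ∀ i, IsDiffOp (Ch n) k (D' i)) :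
    IsDiffOp (SmoothT n) k D :=
  IsDiffOp.of_family (Oi := fun _ : Fin (n + 1) => Ch n) (Mi := fun _ => Ch n) (Ni := fun _ => Ch n)
    (fun i => toChart i) (fun i => toChart i) (fun i => toChart i)
    (fun _ _ _ => rfl) (fun _ _ _ => rfl) (fun _ _ _ => rfl) (fun _ _ h => toChart_ext h) hD h

/-- A bound for the order of the operator in a chart. -/
def bidiffOrder (p : ℕ) : ℕ := (∑ s ∈ range (p + 1), (tau p s).natDegree) + 2 * p +
  (p + (2 * p + ∑ s ∈ range (p + 1), (sig p s).natDegree))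

lemma isBidiff_realBidiff (n p : ℕ) : IsBidiff (realBidiff n p) := by
  refine ⟨bidiffOrder p, fun φ => ?_, fun ψ => ?_⟩
  · exact isDiffOp_of_toChart (fun i ψ => toChart_realBidiff p i φ ψ) fun i =>
      ((chD n).isBidiffOfOrder_bidiff n p (sig p) (tau p)).1 (toChart i φ)
  · exact isDiffOp_of_toChart (fun i φ => toChart_realBidiff p i φ ψ) fun i =>
      ((chD n).isBidiffOfOrder_bidiff n p (sig p) (tau p)).2 (toChart i ψ)

lemma isSLRInvariant_realBidiff (n p : ℕ) : IsSLRInvariant (realBidiff n p) := by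
  intro g f f' h h' hf hh
  refine chartEq_translate fun i j => ?_
  rw [toChart_realBidiff, toChart_realBidiff]
  exact (chartEq_toChart hf i j).bidiff p (chartEq_toChart hh i j)

lemma realBidiff_mem {p j k : ℕ} (hp : p ≤ j + k) {f g : SmoothT n} (hf : f ∈ PolDeg n j)
    (hg : g ∈ PolDeg n k) : realBidiff n p f g ∈ PolDeg n (j + k - p) := by
  refine mem_polDeg_of_E fun i => ?_
  rw [toChart_realBidiff, Darboux.E_bidiff _ (E_toChart hf i) (E_toChart hg i), Nat.cast_sub hp]
  push_cast
  rfl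

/-- The value would have negative degree along the fibres. -/
lemma realBidiff_eq_zero {p j k : ℕ} (hp : j + k < p) {f g : SmoothT n} (hf : f ∈ PolDeg n j)
    (hg : g ∈ PolDeg n k) : realBidiff n p f g = 0 := by
  refine toChart_ext fun i => ?_
  rw [map_zero, toChart_realBidiff]
  refine ch_noNeg n (p - (j + k) - 1) _ ?_
  rw [Darboux.E_bidiff _ (E_toChart hf i) (E_toChart hg i)]
  congr 1
  rw [Nat.cast_sub (by omega), Nat.cast_sub (by omega)]
  push_cast
  ring

end RealBidiff

/-! ### Germs of smooth functions -/

section Hadamard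

open MeasureTheory

variable {E : Type} [NormedAddCommGroup E] [NormedSpace ℝ E]

/-- The integral is a convolution, evaluated at `0`, of the indicator of `(0, 1]` with a function
depending smoothly on the parameter `w`. -/
lemma contDiff_integral_unit {f : E × ℝ → ℂ} (hf : ContDiff ℝ ∞ f) :
    ContDiff ℝ ∞ (fun w => ∫ t in (0 : ℝ)..1, f (w, t)) := by
  -- The bump supplies the compact support required for the convolution; being `1` on `[-2, 2]`, it
  -- does not alter the integral.
  let χ : ContDiffBump (0 : ℝ) := ⟨2, 3, by norm_num, by norm_num⟩
  have hχ : ContDiff ℝ ∞ χ := χ.contDiff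
  have h1 : LocallyIntegrable ((Set.Ioc (0 : ℝ) 1).indicator fun _ => (1 : ℝ)) volume :=
    ((integrable_indicator_iff measurableSet_Ioc).2 (by simp)).locallyIntegrable
  have h2 := contDiffOn_convolution_right_with_param_comp (𝕜 := ℝ) (n := ⊤) (μ := volume)
    (ContinuousLinearMap.lsmul ℝ ℝ) (s := (Set.univ : Set E)) (v := fun _ => (0 : ℝ))
    contDiffOn_const (g := fun w t => χ t • f (w, -t)) isOpen_univ χ.hasCompactSupport
    (fun w t _ ht => by
      rw [image_eq_zero_of_notMem_tsupport ht, zero_smul]) h1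
    (ContDiff.contDiffOn ((hχ.comp contDiff_snd).smul
      (hf.comp (contDiff_fst.prodMk contDiff_snd.neg))))
  rw [contDiffOn_univ] at h2
  convert h2 using 2 with w
  rw [intervalIntegral.integral_of_le zero_le_one, ← integral_indicator measurableSet_Ioc]
  refine integral_congr_ae (Filter.Eventually.of_forall fun t => ?_)
  by_cases ht : t ∈ Set.Ioc (0 : ℝ) 1
  · have : χ (-t) = 1 := χ.one_of_mem_closedBall (by
      have h2 : χ.rIn = 2 := rfl
      rw [Metric.mem_closedBall, Real.dist_eq, h2]
      simp only [sub_zero, abs_neg, abs_of_pos ht.1]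
      linarith [ht.2])
    simp [ht, this]
  · simp [ht]

/-- Hadamard's lemma. -/
lemma exists_hadamard {κ : Type*} [Fintype κ] {e : κ → E} {l : κ → E →L[ℝ] ℝ}
    (hel : ∀ v, ∑ a, l a v • e a = v) {f : E → ℂ} (hf : ContDiff ℝ ∞ f) (w₀ : E) :
    ∃ g : κ → E → ℂ, (∀ a, ContDiff ℝ ∞ (g a)) ∧ (∀ a, g a w₀ = fderiv ℝ f w₀ (e a)) ∧
      ∀ w, f w = f w₀ + ∑ a, (l a (w - w₀) : ℂ) * g a w := by
  have hs : ∀ v, ContDiff ℝ ∞ fun p : E × ℝ => fderiv ℝ f (w₀ + p.2 • (p.1 - w₀)) v := fun v =>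
    ((hf.fderiv_right (m := ∞) (by simp)).comp (contDiff_const.add
      (contDiff_snd.smul (contDiff_fst.sub contDiff_const)))).clm_apply contDiff_const
  refine ⟨fun a w => ∫ t in (0 : ℝ)..1, fderiv ℝ f (w₀ + t • (w - w₀)) (e a),
    fun a => contDiff_integral_unit (hs (e a)), fun a => by simp, fun w => ?_⟩
  have hc : ∀ v, Continuous fun t : ℝ => fderiv ℝ f (w₀ + t • (w - w₀)) v := fun v =>
    (hs v).continuous.comp (continuous_const.prodMk continuous_id)
  have hd : ∀ t : ℝ, HasDerivAt (fun t : ℝ => f (w₀ + t • (w - w₀)))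
      (fderiv ℝ f (w₀ + t • (w - w₀)) (w - w₀)) t := fun t =>
    ((hf.differentiable (by simp)) _).hasFDerivAt.comp_hasDerivAt t
      (by simpa using ((hasDerivAt_id t).smul_const (w - w₀)).const_add w₀)
  have hi := intervalIntegral.integral_eq_sub_of_hasDerivAt (a := 0) (b := 1) (fun t _ => hd t)
    ((hc _).intervalIntegrable _ _)
  rw [one_smul, zero_smul, add_zero, add_sub_cancel] at hi
  rw [← sub_eq_iff_eq_add', ← hi]
  have h3 : ∀ t : ℝ, fderiv ℝ f (w₀ + t • (w - w₀)) (w - w₀) =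
      ∑ a, (l a (w - w₀) : ℂ) * fderiv ℝ f (w₀ + t • (w - w₀)) (e a) := by
    intro t
    generalize fderiv ℝ f (w₀ + t • (w - w₀)) = A
    conv_lhs => rw [← hel (w - w₀)]
    rw [map_sum]
    exact sum_congr rfl fun a _ => by rw [map_smul]; simp
  simp only [h3]
  rw [intervalIntegral.integral_finsetSum (f := fun a t => (l a (w - w₀) : ℂ) *
    fderiv ℝ f (w₀ + t • (w - w₀)) (e a)) fun a _ =>
    (continuous_const.mul (hc _)).intervalIntegrable _ _]
  exact sum_congr rfl fun a _ => intervalIntegral.integral_const_mul _ _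

end Hadamard

section Germs

variable {n : ℕ}

open Filter Topology

lemma contDiff_homPt (j : Fin (n + 1)) : ContDiff ℝ ∞
    (homPt j : (Fin n → ℝ) × (Fin n → ℝ) → (Fin (n + 1) → ℝ) × (Fin (n + 1) → ℝ)) := by
  refine ContDiff.prodMk (contDiff_pi.2 fun k => ?_) (contDiff_pi.2 fun k => ?_)
  · refine Fin.succAboveCases j ?_ (fun l => ?_) k
    · simpa [homPt] using contDiff_const
    · simp only [Fin.insertNth_apply_succAbove]; fun_prop
  · refine Fin.succAboveCases j ?_ (fun l => ?_) k
    · simp only [Fin.insertNth_apply_same, dotProduct]; fun_prop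
    · simp only [Fin.insertNth_apply_succAbove]; fun_prop

/-- A function with bounded support in a chart extends by zero to a smooth function. -/
lemma exists_extend {i : Fin (n + 1)} {k : (Fin n → ℝ) × (Fin n → ℝ) → ℂ} (hk : ContDiff ℝ ∞ k)
    {R : ℝ} (hR : ∀ w, k w ≠ 0 → ‖w‖ ≤ R) : ∃ f : SmoothT n,
      (∀ w, f.1 (cotChart i w.1 w.2) = k w) ∧
      ∀ m, f.1 m ≠ 0 → ∃ w, k w ≠ 0 ∧ m = cotChart i w.1 w.2 := by
  classical
  let F : CotP ℝ n → ℂ := fun m =>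
    if h : ∃ w : (Fin n → ℝ) × (Fin n → ℝ), m = cotChart i w.1 w.2 then k h.choose else 0
  have hF : ∀ v h0 hc, F (conePt v h0 hc) = if v.1 i ≠ 0 then k (affPt i v) else 0 := by
    intro v h0 hc
    split_ifs with hi
    · have hex : ∃ w : (Fin n → ℝ) × (Fin n → ℝ), conePt v h0 hc = cotChart i w.1 w.2 :=
        ⟨_, conePt_eq_cotChart hi hc⟩
      simp only [F, dif_pos hex]
      exact congrArg k (affPt_eq_of_conePt_eq hex.choose_spec).2.symm
    · exact dif_neg fun ⟨w, hw⟩ => hi (affPt_eq_of_conePt_eq hw).1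
  have hF' : ∀ j (w : (Fin n → ℝ) × (Fin n → ℝ)), F (cotChart j w.1 w.2) =
      if (homPt j w).1 i ≠ 0 then k (affPt i (homPt j w)) else 0 := fun j w => by
    rw [cotChart_eq_conePt, hF]
  refine ⟨⟨F, fun j => contDiff_iff_contDiffAt.2 fun w => ?_⟩, fun w => ?_, fun m hm => ?_⟩
  · simp only [hF']
    have hcont : ContinuousAt (fun w : (Fin n → ℝ) × (Fin n → ℝ) => (homPt j w).1 i) w :=
      ((continuous_apply i).comp (contDiff_homPt j).continuous.fst).continuousAt
    by_cases hw : (homPt j w).1 i ≠ 0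
    · refine (hk.contDiffAt.comp w ((contDiffAt_affPt hw).comp w
        (contDiff_homPt j).contDiffAt)).congr_of_eventuallyEq ?_
      filter_upwards [hcont.eventually_ne hw] with v hv
      rw [if_pos hv]
      rfl
    · rw [not_not] at hw
      refine (contDiffAt_const (c := 0)).congr_of_eventuallyEq ?_
      have hji : j ≠ i := fun h => by rw [← h, homPt_fst_self] at hw; exact one_ne_zero hw
      obtain ⟨l, hl⟩ := Fin.exists_succAbove_eq hji
      -- At a point outside chart `i` the coordinate `x_i` tends to zero while `x_j = 1`, so the
      -- affine coordinate `x_j / x_i` exceeds the bound `R` on the support; the extension vanishes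
      -- nearby.
      have hc2 : ContinuousAt (fun w : (Fin n → ℝ) × (Fin n → ℝ) => R * |(homPt j w).1 i|) w :=
        continuousAt_const.mul hcont.abs
      have hlt := hc2.eventually (gt_mem_nhds (show R * |(homPt j w).1 i| < 1 by simp [hw]))
      filter_upwards [hlt] with v hv
      split_ifs with hv0
      · by_contra hne
        have h1 := (norm_le_pi_norm _ l).trans ((norm_fst_le _).trans (hR _ hne))
        have h2 : (affPt i (homPt j v)).1 l = ((homPt j v).1 i)⁻¹ := by
          simp [affPt, hl]
        rw [h2, norm_inv, Real.norm_eq_abs, inv_le_iff_one_le_mul₀ (abs_pos.2 hv0)] at h1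
        linarith
      · rfl
  · change F _ = _
    rw [hF', if_pos (by simp), affPt_homPt]
  · obtain ⟨v, h0, hc, rfl⟩ := exists_conePt m
    change F _ ≠ 0 at hm
    rw [hF] at hm
    split_ifs at hm with hi
    · exact ⟨_, hm, conePt_eq_cotChart hi hc⟩
    · exact absurd rfl hm

/-- Every germ of smooth function comes from a global function with small support. -/
lemma exists_germ (i : Fin (n + 1)) {w₀ : (Fin n → ℝ) × (Fin n → ℝ)}
    {V : Set ((Fin n → ℝ) × (Fin n → ℝ))} (hV : V ∈ 𝓝 w₀) {c : (Fin n → ℝ) × (Fin n → ℝ) → ℂ}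
    (hc : ∀ w ∈ V, ContDiffAt ℝ ∞ c w) : ∃ f : SmoothT n,
      (∀ᶠ w in 𝓝 w₀, f.1 (cotChart i w.1 w.2) = c w) ∧
      ∀ m, f.1 m ≠ 0 → ∃ w ∈ V, m = cotChart i w.1 w.2 := by
  obtain ⟨r, hr, hrV⟩ := Metric.mem_nhds_iff.1 hV
  let b : ContDiffBump w₀ := ⟨r / 3, r / 2, by positivity, by linarith⟩
  have hb : ∀ w ∈ tsupport b, w ∈ V := fun w hw => hrV (by
    rw [b.tsupport_eq] at hw
    have hw' : dist w w₀ ≤ r / 2 := hw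
    exact lt_of_le_of_lt hw' (by linarith))
  have hk : ContDiff ℝ ∞ fun w => (b w : ℂ) * c w := by
    refine contDiff_iff_contDiffAt.2 fun w => ?_
    by_cases hw : w ∈ tsupport b
    · exact (Complex.ofRealCLM.contDiff.contDiffAt.comp w b.contDiffAt).mul (hc w (hb w hw))
    · refine (contDiffAt_const (c := 0)).congr_of_eventuallyEq ?_
      filter_upwards [(isClosed_tsupport b).isOpen_compl.mem_nhds hw] with v hv
      rw [image_eq_zero_of_notMem_tsupport hv]
      simp
  have hs : ∀ w, (b w : ℂ) * c w ≠ 0 → w ∈ tsupport b := fun w hw =>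
    subset_tsupport b fun h => hw (by rw [h]; simp)
  obtain ⟨R, hR⟩ := b.hasCompactSupport.isBounded.exists_norm_le
  obtain ⟨f, hf1, hf2⟩ := exists_extend (i := i) hk (fun w hw => hR w (hs w hw))
  refine ⟨f, ?_, fun m hm => ?_⟩
  · filter_upwards [b.eventuallyEq_one] with w hw
    rw [hf1, hw]
    simp
  · obtain ⟨w, hw, h⟩ := hf2 m hm
    exact ⟨w, hb w (hs w hw), h⟩

/-- Evaluation at a point of the cotangent bundle. -/
def evT (m : CotP ℝ n) : SmoothT n →ₐ[ℂ] ℂ := (Pi.evalAlgHom ℂ _ m).comp (SmoothT n).val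

lemma evT_apply (m : CotP ℝ n) (f : SmoothT n) : evT m f = f.1 m := rfl

lemma mem_ker_evT {m : CotP ℝ n} {f : SmoothT n} : f ∈ RingHom.ker (evT m) ↔ f.1 m = 0 := Iff.rfl

/-- With a cutoff `χ` that is `1` at the point and supported where `f` vanishes, `f = (1 - χ) f` is
a product of two functions vanishing at the point. -/
lemma mem_sq_of_germ_zero {i : Fin (n + 1)} {w₀ : (Fin n → ℝ) × (Fin n → ℝ)} {f : SmoothT n}
    (h : ∀ᶠ w in 𝓝 w₀, f.1 (cotChart i w.1 w.2) = 0) :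
    f ∈ RingHom.ker (evT (cotChart i w₀.1 w₀.2)) ^ 2 := by
  obtain ⟨χ, h1, h2⟩ := exists_germ i h (c := fun _ => 1) fun _ _ => contDiffAt_const
  have hf : f = (1 - χ) * f := by
    apply Subtype.ext
    funext m
    change f.1 m = (1 - χ.1 m) * f.1 m
    by_cases hm : χ.1 m = 0
    · rw [hm]; ring
    · obtain ⟨w, hw, rfl⟩ := h2 m hm
      rw [hw, mul_zero]
  rw [hf, pow_two]
  refine Ideal.mul_mem_mul ?_ h.self_of_nhds
  rw [mem_ker_evT]
  change 1 - χ.1 _ = 0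
  rw [h1.self_of_nhds, sub_self]

lemma sum_frame (v : (Fin n → ℝ) × (Fin n → ℝ)) :
    ∑ a : Fin n ⊕ Fin n, (Sum.elim (Frame.std ℝ (Fin n)).lx (Frame.std ℝ (Fin n)).lξ a) v •
      (Sum.elim (Frame.std ℝ (Fin n)).ex (Frame.std ℝ (Fin n)).eξ a) = v := by
  rw [Fintype.sum_sum_type]
  refine Prod.ext ?_ ?_ <;> funext k <;>
    simp [Frame.std, Prod.fst_sum, Prod.snd_sum, Finset.sum_apply, Pi.single_apply]

/-- Functions vanishing to second order at a point. -/
lemma mem_sq {i : Fin (n + 1)} {w₀ : (Fin n → ℝ) × (Fin n → ℝ)} {f : SmoothT n}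
    (h0 : f.1 (cotChart i w₀.1 w₀.2) = 0)
    (h1 : ∀ v, (Sm.d v (toChart i f)).1 (chPt w₀) = 0) :
    f ∈ RingHom.ker (evT (cotChart i w₀.1 w₀.2)) ^ 2 := by
  obtain ⟨g, hg, hg0, hfg⟩ := exists_hadamard sum_frame (f.2 i) w₀
  choose G hG _ using fun a => exists_germ i (w₀ := w₀) Filter.univ_mem
    (fun w _ => (hg a).contDiffAt (x := w))
  choose L hL _ using fun a : Fin n ⊕ Fin n => exists_germ i (w₀ := w₀) Filter.univ_mem
    (c := fun w => ((Sum.elim (Frame.std ℝ (Fin n)).lx (Frame.std ℝ (Fin n)).lξ a) (w - w₀) : ℂ))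
    (fun w _ => Complex.ofRealCLM.contDiff.contDiffAt.comp w ((ContinuousLinearMap.contDiff
      (Sum.elim (Frame.std ℝ (Fin n)).lx (Frame.std ℝ (Fin n)).lξ a)).contDiffAt.comp w
        (contDiffAt_id.sub contDiffAt_const)))
  have hz : f - ∑ a, L a * G a ∈ RingHom.ker (evT (cotChart i w₀.1 w₀.2)) ^ 2 := by
    refine mem_sq_of_germ_zero ?_
    filter_upwards [eventually_all.2 hG, eventually_all.2 hL] with w h2 h3
    rw [← evT_apply, map_sub, map_sum, evT_apply, hfg w, h0, zero_add, sub_eq_zero]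
    refine sum_congr rfl fun a _ => ?_
    rw [map_mul, evT_apply, evT_apply, h2, h3]
  rw [← sub_add_cancel f (∑ a, L a * G a)]
  refine Ideal.add_mem _ hz (Ideal.sum_mem _ fun a _ => ?_)
  rw [pow_two]
  refine Ideal.mul_mem_mul ?_ ?_
  · rw [mem_ker_evT, (hL a).self_of_nhds]
    simp
  · rw [mem_ker_evT, (hG a).self_of_nhds, hg0]
    have := h1 (Sum.elim (Frame.std ℝ (Fin n)).ex (Frame.std ℝ (Fin n)).eξ a)
    rwa [Sm.d_apply_of_eq (F := fun w => f.1 (cotChart i w.1 w.2)) (fun _ => rfl)] at this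

end Germs

/-! ### Differential operators and powers of ideals -/

section Powers

variable {O : Type*} [CommRing O]

/-- A differential operator of order `k` maps `𝔪^(k+1)` into `𝔪`. -/
lemma IsDiffOp.eval_pow {M N A : Type*} [AddCommGroup M] [Module O M] [AddCommGroup N] [Module O N]
    [AddCommGroup A] {𝔪 : Ideal O} (e : N →+ A) (he : ∀ f ∈ 𝔪, ∀ s, e (f • s) = 0) {k : ℕ}
    {D : M → N} (h : IsDiffOp O k D) (hD : ∀ a b, D (a + b) = D a + D b) {g : O}
    (hg : g ∈ 𝔪 ^ (k + 1)) (s : M) : e (D (g • s)) = 0 := by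
  induction k generalizing D g s with
  | zero =>
    rw [zero_add, pow_one] at hg
    rw [h g s, he g hg]
  | succ k ih =>
    rw [pow_succ'] at hg
    refine Submodule.mul_induction_on hg (fun a ha b hb => ?_) (fun a b ha hb => ?_)
    · have h1 := ih (h a) (fun x y => by simp only [smul_add, hD]; abel) hb s
      rw [map_sub, he a ha, sub_zero] at h1
      rwa [mul_smul]
    · rw [add_smul, hD, map_add, ha, hb, add_zero]

variable [Algebra ℂ O]

/-- Approximation to first order implies approximation to every order, because products of
approximations approximate products: `hC` corrects an element of `𝔪^k` modulo `𝔪^(k+1)`, and the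
corrections are added up. -/
lemma exists_sub_mem_pow {𝔪 : Ideal O} {R : Subalgebra ℂ O} (h : ∀ f, ∃ r ∈ R, f - r ∈ 𝔪 ^ 2)
    (k : ℕ) (f : O) : ∃ r ∈ R, f - r ∈ 𝔪 ^ k := by
  have hC : ∀ k, ∀ f ∈ 𝔪 ^ k, ∃ r ∈ R, f - r ∈ 𝔪 ^ (k + 1) := by
    intro k
    induction k with
    | zero =>
      intro f _
      obtain ⟨r, hr, h2⟩ := h f
      exact ⟨r, hr, Ideal.pow_le_pow_right (by norm_num) h2⟩
    | succ k ih =>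
      intro f hf
      rw [pow_succ'] at hf
      refine Submodule.mul_induction_on hf (fun a ha b hb => ?_) (fun a b ha hb => ?_)
      · obtain ⟨r, hr, h2⟩ := h a
        obtain ⟨r', hr', h3⟩ := ih b hb
        refine ⟨r * r', R.mul_mem hr hr', ?_⟩
        -- The approximation `r'` inherits the vanishing order of `b`; otherwise `(a - r) r'` would
        -- not be small enough.
        have hb' : r' ∈ 𝔪 ^ k := by
          have := Ideal.sub_mem _ hb (Ideal.pow_le_pow_right (Nat.le_succ k) h3)
          rwa [sub_sub_cancel] at this
        have e : a * b - r * r' = a * (b - r') + (a - r) * r' := by ring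
        rw [e]
        refine Ideal.add_mem _ ?_ ?_
        · rw [pow_succ']; exact Ideal.mul_mem_mul ha h3
        · rw [show k + 1 + 1 = 2 + k by ring, pow_add]; exact Ideal.mul_mem_mul h2 hb'
      · obtain ⟨r, hr, h2⟩ := ha
        obtain ⟨r', hr', h3⟩ := hb
        exact ⟨r + r', R.add_mem hr hr', by rw [add_sub_add_comm]; exact Ideal.add_mem _ h2 h3⟩
  induction k with
  | zero => exact ⟨0, R.zero_mem, by simp⟩
  | succ k ih =>
    obtain ⟨r, hr, h2⟩ := ih
    obtain ⟨r', hr', h3⟩ := hC k _ h2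
    exact ⟨r + r', R.add_mem hr hr', by rwa [← sub_sub]⟩

end Powers

/-! ### Differential operators and the momentum algebra -/

section Momentum

variable {n : ℕ}

/-- The function `ξ_a x_b`. -/
def mu (a b : Fin (n + 1)) : SmoothT n :=
  ⟨Quotient.lift (fun v : CotPair ℝ n => ((v.1.2 a * v.1.1 b : ℝ) : ℂ)) (by
    rintro v w ⟨t, h1, h2⟩
    simp only [h1, h2, Pi.smul_apply, smul_eq_mul, Units.val_inv_eq_inv_val]
    congr 1
    field_simp), fun i => by
    have h := contDiff_homPt (n := n) i
    have h1 := contDiff_pi.1 (contDiff_fst.comp h) b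
    have h2 := contDiff_pi.1 (contDiff_snd.comp h) a
    exact Complex.ofRealCLM.contDiff.comp (h2.mul h1)⟩

lemma mu_conePt (a b : Fin (n + 1)) (v : (Fin (n + 1) → ℝ) × (Fin (n + 1) → ℝ)) (h0 : v.1 ≠ 0)
    (hc : v.1 ⬝ᵥ v.2 = 0) : (mu a b).1 (conePt v h0 hc) = ((v.2 a * v.1 b : ℝ) : ℂ) := rfl

/-- `ξ_a x_b` is the momentum of an elementary matrix. Subtracting a multiple of the identity makes
the matrix traceless without changing the function, since `ξ · x = 0`. -/
lemma mu_mem (a b : Fin (n + 1)) : mu a b ∈ momentumAlg n := by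
  refine Algebra.subset_adjoin ⟨Matrix.single a b 1 -
    ((if a = b then 1 else 0) / (n + 1 : ℝ)) • 1, ?_, fun v => ?_⟩
  · rw [Matrix.trace_sub, Matrix.trace_smul, Matrix.trace_one]
    have : (n : ℝ) + 1 ≠ 0 := by positivity
    split_ifs with h
    · subst h; simp [this]
    · simp [Matrix.trace_single_eq_of_ne _ _ _ h]
  · change ((v.1.2 a * v.1.1 b : ℝ) : ℂ) = _
    rw [Matrix.sub_mulVec, dotProduct_sub, Matrix.smul_mulVec, Matrix.one_mulVec, dotProduct_smul,
      v.2.2, smul_zero, sub_zero]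
    congr 1
    simp [dotProduct, Matrix.single_mulVec, Function.update_apply]

lemma toChart_mu_self (i : Fin (n + 1)) (k : Fin n) :
    toChart i (mu (i.succAbove k) i) = (chD n).ξ k := by
  ext w
  rw [toChart_apply, cotChart_eq_conePt, mu_conePt]
  simp [homPt]
  rfl

lemma toChart_mu (i : Fin (n + 1)) (k l : Fin n) :
    toChart i (mu (i.succAbove k) (i.succAbove l)) = (chD n).ξ k * (chD n).x l := by
  ext w
  rw [toChart_apply, cotChart_eq_conePt, mu_conePt]
  simp [homPt]
  rfl

lemma ch_d_x (v : (Fin n → ℝ) × (Fin n → ℝ)) (l : Fin n) (w) :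
    (Sm.d v ((chD n).x l)).1 w = (v.1 l : ℂ) := by
  change (Sm.d v (Sm.coord _)).1 _ = _
  rw [Sm.d_coord]
  rfl

lemma ch_d_ξ (v : (Fin n → ℝ) × (Fin n → ℝ)) (l : Fin n) (w) :
    (Sm.d v ((chD n).ξ l)).1 w = (v.2 l : ℂ) := by
  change (Sm.d v (Sm.coord _)).1 _ = _
  rw [Sm.d_coord]
  rfl

lemma ch_d_eq_sum (v : (Fin n → ℝ) × (Fin n → ℝ)) (F : Ch n) (w) :
    (Sm.d v F).1 w = ∑ l, (v.1 l : ℂ) * ((chD n).dx l F).1 w +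
      ∑ l, (v.2 l : ℂ) * ((chD n).dξ l F).1 w := by
  conv_lhs => rw [← sum_frame v, Sm.d_sum, Fintype.sum_sum_type]
  rfl

lemma derivation_sub_const {O : Type*} [CommRing O] [Algebra ℂ O] (D : Derivation ℂ O O) (f g : O)
    (c : ℂ) : D (f - (algebraMap ℂ O c + g)) = D f - D g := by
  rw [map_sub, map_add, Derivation.map_algebraMap, zero_add]

set_option maxHeartbeats 1000000 in
/-- Off the zero section, the differentials of momentum functions span. -/
lemma exists_momentum_sub_mem_sq {i : Fin (n + 1)} {w : (Fin n → ℝ) × (Fin n → ℝ)} (hw : w.2 ≠ 0)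
    (f : SmoothT n) : ∃ r ∈ momentumAlg n, f - r ∈ RingHom.ker (evT (cotChart i w.1 w.2)) ^ 2 := by
  obtain ⟨c, hc⟩ := Function.ne_iff.1 hw
  have hc' : (w.2 c : ℂ) ≠ 0 := Complex.ofReal_ne_zero.2 hc
  -- In the chart, `mu (i.succAbove k) i` is `ξ_k`, and `ξ_c x_l - x_l(w) ξ_c` has differential
  -- `ξ_c(w) dx_l` at `w`. Division by the nonzero number `ξ_c(w)` yields every `dx_l`, so `q` has
  -- the differential of `f` at `w`.
  let q := ∑ k, ((chD n).dξ k (toChart i f)).1 (chPt w) • mu (i.succAbove k) i +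
    ∑ l, (((chD n).dx l (toChart i f)).1 (chPt w) / (w.2 c : ℂ)) •
      (mu (i.succAbove c) (i.succAbove l) - (w.1 l : ℂ) • mu (i.succAbove c) i)
  have hq : q ∈ momentumAlg n := by
    refine Subalgebra.add_mem _ (Subalgebra.sum_mem _ fun k _ => Subalgebra.smul_mem _ (mu_mem _ _) _)
      (Subalgebra.sum_mem _ fun l _ => Subalgebra.smul_mem _ (Subalgebra.sub_mem _ (mu_mem _ _)
        (Subalgebra.smul_mem _ (mu_mem _ _) _)) _)
  have hev : ∀ (D : Derivation ℂ (Ch n) (Ch n)), Sm.ev (chPt w) (D (toChart i q)) =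
      ∑ k, ((chD n).dξ k (toChart i f)).1 (chPt w) * (D ((chD n).ξ k)).1 (chPt w) +
      ∑ l, ((chD n).dx l (toChart i f)).1 (chPt w) * (D ((chD n).x l)).1 (chPt w) := by
    intro D
    simp only [q, map_add, map_sum, Derivation.map_smul, map_sub, map_smul, toChart_mu_self,
      toChart_mu, Derivation.leibniz, smul_eq_mul, map_mul, Sm.ev_apply]
    congr 1
    refine sum_congr rfl fun l _ => ?_
    have h1 : ((chD n).ξ c).1 (chPt w) = (w.2 c : ℂ) := rfl
    have h2 : ((chD n).x l).1 (chPt w) = (w.1 l : ℂ) := rfl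
    rw [h1, h2]
    field_simp
    ring
  refine ⟨algebraMap ℂ _ (f.1 (cotChart i w.1 w.2) - q.1 (cotChart i w.1 w.2)) + q,
    Subalgebra.add_mem _ (Subalgebra.algebraMap_mem _ _) hq, mem_sq ?_ fun v => ?_⟩
  · rw [← evT_apply, map_sub, map_add, AlgHom.commutes, evT_apply, evT_apply]
    simp
  · have e : toChart i (f - (algebraMap ℂ _ (f.1 (cotChart i w.1 w.2) -
        q.1 (cotChart i w.1 w.2)) + q)) = toChart i f - (algebraMap ℂ _ (f.1 (cotChart i w.1 w.2) -
        q.1 (cotChart i w.1 w.2)) + toChart i q) := rfl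
    rw [e, derivation_sub_const (Sm.d v), Sm.sub_apply, sub_eq_zero]
    refine (ch_d_eq_sum v _ _).trans (Eq.trans ?_ (hev (Sm.d v)).symm)
    simp only [ch_d_x, ch_d_ξ]
    rw [add_comm]
    congr 1 <;> exact sum_congr rfl fun l _ => mul_comm _ _

/-- The value of an operator of order `k` at a point depends only on `f` modulo `𝔪^(k+1)`, and off
the zero section `f` agrees with a momentum function to that order. The zero section is reached by
continuity along a fibre, which has nonzero covectors as `n ≥ 1`. -/
lemma diffOp_eq_zero_of_momentum (hn : 1 ≤ n) {k : ℕ} {D : SmoothT n →ₗ[ℂ] SmoothT n}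
    (hD : IsDiffOp (SmoothT n) k (fun f => D f)) (h : ∀ r ∈ momentumAlg n, D r = 0)
    (f : SmoothT n) : D f = 0 := by
  have h1 : ∀ i (w : (Fin n → ℝ) × (Fin n → ℝ)), w.2 ≠ 0 → (D f).1 (cotChart i w.1 w.2) = 0 := by
    intro i w hw
    obtain ⟨r, hr, h2⟩ := exists_sub_mem_pow (exists_momentum_sub_mem_sq (i := i) hw) (k + 1) f
    have h3 := hD.eval_pow (𝔪 := RingHom.ker (evT (cotChart i w.1 w.2)))
      (evT (cotChart i w.1 w.2)).toRingHom.toAddMonoidHom (fun g hg s => by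
        change evT _ (g * s) = 0
        rw [map_mul, show evT _ g = 0 from hg, zero_mul]) (map_add D) h2 1
    have h4 : D ((f - r) • (1 : SmoothT n)) = D f := by
      rw [smul_eq_mul, mul_one, map_sub, h r hr, sub_zero]
    rw [h4] at h3
    exact h3
  refine toChart_ext fun i => Sm.ext fun w => ?_
  obtain ⟨⟨u, ξ⟩, _⟩ := w
  by_cases hξ : ξ = 0
  · subst hξ
    have hc : Continuous fun t : ℝ =>
        (toChart i (D f)).1 (chPt (u, t • (1 : Fin n → ℝ))) :=
      (contDiff_of_ch (toChart i (D f))).continuous.comp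
        (continuous_const.prodMk (continuous_id.smul continuous_const))
    have h0 : ∀ t ∈ ({0}ᶜ : Set ℝ),
        (toChart i (D f)).1 (chPt (u, t • (1 : Fin n → ℝ))) = 0 := fun t ht =>
      h1 i (u, t • (1 : Fin n → ℝ)) fun h => ht (by simpa using congrFun h ⟨0, hn⟩)
    have := hc.ext_on (dense_compl_singleton (0 : ℝ)) continuous_const h0
    simpa using congrFun this 0
  · exact h1 i (u, ξ) hξ

/-- The arguments are freed one after the other: first arbitrary `f` against momentum `g`, then
arbitrary `g`. -/
lemma bidiff_ext (hn : 1 ≤ n) {Z Z' : SmoothT n →ₗ[ℂ] SmoothT n →ₗ[ℂ] SmoothT n} (hZ : IsBidiff Z)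
    (hZ' : IsBidiff Z') (h : ∀ f ∈ momentumAlg n, ∀ g ∈ momentumAlg n, Z f g = Z' f g) : Z = Z' := by
  obtain ⟨k, hk⟩ := hZ
  obtain ⟨l, hl⟩ := hZ'
  have h1 : ∀ g ∈ momentumAlg n, ∀ f, Z f g = Z' f g := by
    intro g hg f
    have := diffOp_eq_zero_of_momentum hn (D := Z.flip g - Z'.flip g)
      (((hk.2 g).mono (le_max_left k l)).sub ((hl.2 g).mono (le_max_right k l)))
      (fun r hr => sub_eq_zero.2 (h r hr g hg)) f
    exact sub_eq_zero.1 this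
  refine LinearMap.ext fun f => LinearMap.ext fun g => sub_eq_zero.1 ?_
  exact diffOp_eq_zero_of_momentum hn (D := Z f - Z' f)
    (((hk.1 f).mono (le_max_left k l)).sub ((hl.1 f).mono (le_max_right k l)))
    (fun r hr => sub_eq_zero.2 (h1 r hr f)) g

lemma euler_mul (f g : SmoothT n) : euler (f * g) = euler f * g + f * euler g := by
  refine toChart_ext fun i => ?_
  simp only [toChart_euler, map_mul, map_add, Darboux.E_mul]

lemma pol_mul_mem {f g : SmoothT n} (hf : f ∈ Pol n) (hg : g ∈ Pol n) : f * g ∈ Pol n := by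
  refine pol_induction (P := fun φ => φ.1 * g ∈ Pol n) ?_ (fun φ ψ h1 h2 => ?_) (fun d φ => ?_)
    ⟨f, hf⟩
  · change (0 : SmoothT n) * g ∈ _
    rw [zero_mul]; exact Submodule.zero_mem _
  · change (φ.1 + ψ.1) * g ∈ _
    rw [add_mul]; exact Submodule.add_mem _ h1 h2
  refine pol_induction (P := fun ψ => φ.1 * ψ.1 ∈ Pol n) ?_ (fun ψ ψ' h1 h2 => ?_) (fun e ψ => ?_)
    ⟨g, hg⟩
  · change φ.1 * (0 : SmoothT n) ∈ _
    rw [mul_zero]; exact Submodule.zero_mem _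
  · change φ.1 * (ψ.1 + ψ'.1) ∈ _
    rw [mul_add]; exact Submodule.add_mem _ h1 h2
  refine le_iSup (PolDeg n) (d + e) (mem_polDeg_iff.2 ?_)
  rw [euler_mul, euler_polDeg φ.2, euler_polDeg ψ.2]
  push_cast
  rw [Algebra.smul_mul_assoc, Algebra.mul_smul_comm, add_smul]

lemma momentum_generator_mem {f : SmoothT n} {X : Matrix (Fin (n + 1)) (Fin (n + 1)) ℝ}
    (hf : ∀ v : CotPair ℝ n, f.1 (Quotient.mk (cotSetoid ℝ n) v) =
      ((v.1.2 ⬝ᵥ X.mulVec v.1.1 : ℝ) : ℂ)) : f ∈ PolDeg n 1 := by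
  refine mem_polDeg_iff.2 (Subtype.ext (funext fun m => ?_))
  change deriv (fun t : ℝ => f.1 (dil t m)) 1 = ((1 : ℕ) : ℂ) * f.1 m
  have h : (fun t : ℝ => f.1 (dil t m)) = fun t : ℝ => (t : ℂ) * f.1 m := by
    funext t
    induction m using Quotient.inductionOn with
    | _ v =>
    change f.1 (Quotient.mk (cotSetoid ℝ n) _) = _
    rw [hf, hf, smul_dotProduct, smul_eq_mul, Complex.ofReal_mul]
  rw [h]
  have h1 : HasDerivAt (fun t : ℝ => (t : ℂ)) 1 1 := Complex.ofRealCLM.hasDerivAt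
  simpa using (h1.mul_const (f.1 m)).deriv

lemma momentumAlg_stable {f : SmoothT n} (hf : f ∈ momentumAlg n) :
    f ∈ Pol n ∧ euler f ∈ momentumAlg n := by
  -- Membership of `f` itself is carried along, because the Leibniz rule for `euler (f * g)` needs
  -- the undifferentiated factors.
  have key : f ∈ Pol n ∧ euler f ∈ momentumAlg n ∧ f ∈ momentumAlg n := by
    induction hf using Algebra.adjoin_induction with
    | mem f hf =>
      have hm : f ∈ momentumAlg n := Algebra.subset_adjoin hf
      obtain ⟨X, hX, h⟩ := hf
      have h1 := momentum_generator_mem h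
      refine ⟨le_iSup (PolDeg n) 1 h1, ?_, hm⟩
      rw [euler_polDeg h1]
      exact Subalgebra.smul_mem _ hm _
    | algebraMap c =>
      have h1 : algebraMap ℂ (SmoothT n) c ∈ PolDeg n 0 := fun i u =>
        ⟨MvPolynomial.C c, MvPolynomial.isHomogeneous_C _ _, fun ξ => by simp⟩
      refine ⟨le_iSup (PolDeg n) 0 h1, ?_, Subalgebra.algebraMap_mem _ _⟩
      rw [euler_polDeg h1]
      exact Subalgebra.smul_mem _ (Subalgebra.algebraMap_mem _ _) _
    | add f g _ _ h1 h2 =>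
      rw [map_add]
      exact ⟨Submodule.add_mem _ h1.1 h2.1, Subalgebra.add_mem _ h1.2.1 h2.2.1,
        Subalgebra.add_mem _ h1.2.2 h2.2.2⟩
    | mul f g _ _ h1 h2 =>
      rw [euler_mul]
      exact ⟨pol_mul_mem h1.1 h2.1, Subalgebra.add_mem _ (Subalgebra.mul_mem _ h1.2.1 h2.2.2)
        (Subalgebra.mul_mem _ h1.2.2 h2.2.1), Subalgebra.mul_mem _ h1.2.2 h2.2.2⟩
  exact ⟨key.1, key.2.1⟩

/-- `S_p` preserves the momentum algebra, so hypotheses on `S_p⁻¹ φ` with `φ` in it can be tested on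
all its elements by inserting `S_p φ`. -/
lemma opS_mem_momentumAlg (p : ℕ) {φ : Pol n} (hφ : φ.1 ∈ momentumAlg n) :
    (opS n p φ).1 ∈ momentumAlg n := by
  have h1 : ∀ (l : List ℂ) (φ : Pol n), φ.1 ∈ momentumAlg n →
      ((l.map fun r => eulerShift n r).prod φ).1 ∈ momentumAlg n := by
    intro l
    induction l with
    | nil => exact fun φ h => h
    | cons r l ih =>
      intro φ h
      rw [List.map_cons, List.prod_cons, Module.End.mul_apply]
      exact Subalgebra.add_mem _ (momentumAlg_stable (ih φ h)).2 (Subalgebra.smul_mem _ (ih φ h) _)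
  have := h1 ((List.range (p / 2)).map fun i : ℕ => ((n : ℂ) / 2 - (i + 1))) φ hφ
  rwa [List.map_map] at this

end Momentum

/-! ### Half-densities in charts -/

section HalfDensities

variable {n : ℕ}

instance {lam : ℝ} : Module (SmoothP n) (Dens lam n) where
  one_smul _ := Subtype.ext (funext fun _ => one_mul _)
  mul_smul _ _ _ := Subtype.ext (funext fun _ => mul_assoc _ _ _)
  smul_zero _ := Subtype.ext (funext fun _ => mul_zero _)
  smul_add := dens_smul_add
  add_smul _ _ _ := Subtype.ext (funext fun _ => add_mul _ _ _)
  zero_smul _ := Subtype.ext (funext fun _ => zero_mul _)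

/-- Half-densities on the real projective space. -/
abbrev HD (n : ℕ) := Dens (1 / 2) n

/-- A function on the base in a chart. -/
def pChart (i : Fin (n + 1)) : SmoothP n →ₐ[ℂ] Ch n where
  toFun f := baseFn (fun u => f.1 (projChart i u)) (f.2 i)
  map_one' := rfl
  map_mul' _ _ := rfl
  map_zero' := rfl
  map_add' _ _ := rfl
  commutes' _ := rfl

/-- A half-density in a chart. -/
def densChart (i : Fin (n + 1)) : HD n →ₗ[ℂ] Ch n where
  toFun F := baseFn (fun u => F.1 (nzChart i u)) (F.2.2 i)
  map_add' _ _ := rfl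
  map_smul' _ _ := rfl

lemma densChart_apply (i : Fin (n + 1)) (F : HD n) (w) :
    (densChart i F).1 w = F.1 (nzChart i w.1.1) := rfl

lemma densChart_smul (i : Fin (n + 1)) (f : SmoothP n) (F : HD n) :
    densChart i (f • F) = pChart i f * densChart i F := rfl

lemma dens_eq (F : HD n) {i : Fin (n + 1)} {v : (Fin (n + 1) → ℝ) × (Fin (n + 1) → ℝ)}
    (hi : v.1 i ≠ 0) : F.1 ⟨v.1, ne_zero_of_apply hi⟩ =
      densW n (v.1 i) * F.1 (nzChart i (affPt i v).1) := by
  refine F.2.1 (v.1 i) _ _ ?_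
  funext k
  refine Fin.succAboveCases i ?_ (fun j => ?_) k <;> simp [nzChart, affPt, hi]

lemma densChart_ext {F G : HD n} (h : ∀ i, densChart i F = densChart i G) : F = G := by
  apply Subtype.ext
  funext x
  obtain ⟨i, hi⟩ := Function.ne_iff.1 x.2
  have h1 := congrArg (fun f : Ch n => f.1 (chPt (affPt i (x.1, 0)))) (h i)
  exact (dens_eq F (v := (x.1, 0)) hi).trans ((congrArg _ h1).trans
    (dens_eq G (v := (x.1, 0)) hi).symm)

lemma dξ_baseFn {b : (Fin n → ℝ) → ℂ} (hb : ContDiff ℝ ∞ b) (a : Fin n) :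
    (chD n).dξ a (baseFn b hb) = 0 := by
  ext w
  exact Sm.d_eq_zero_of_line (F := fun w : (Fin n → ℝ) × (Fin n → ℝ) => b w.1)
    (fun _ => rfl) (fun t => by simp [Frame.std])

lemma E_eq_zero_of_dξ {f : Ch n} (h : ∀ a, (chD n).dξ a f = 0) : (chD n).E f = 0 := by
  rw [Darboux.E_apply]
  exact sum_eq_zero fun a _ => by rw [h, mul_zero]

lemma affPt_fst_smul {i : Fin (n + 1)} {x y : Fin (n + 1) → ℝ} {t : ℝ} (ht : t ≠ 0) (h : y = t • x)
    (ξ ξ' : Fin (n + 1) → ℝ) : (affPt i (y, ξ)).1 = (affPt i (x, ξ')).1 := by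
  funext k
  simp only [affPt, h, Pi.smul_apply, smul_eq_mul, mul_inv]
  field_simp

/-- The half-density is evaluated in a chosen chart at the zero covector, which is harmless since `c
i` is constant along the fibres. The weighted compatibility makes the choice of the chart immaterial
and gives the homogeneity. -/
lemma exists_densChart_eq {c : Fin (n + 1) → Ch n} (hξ : ∀ i a, (chD n).dξ a (c i) = 0)
    (h : ∀ i j v, v.1 j ≠ 0 → v.1 i ≠ 0 → v.1 ⬝ᵥ v.2 = 0 →
      densW n (v.1 j) * (c j).1 (chPt (affPt j v)) = densW n (v.1 i) * (c i).1 (chPt (affPt i v))) :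
    ∃ G : HD n, ∀ i, densChart i G = c i := by
  have hex : ∀ x : NZ ℝ n, ∃ i, x.1 i ≠ 0 := fun x => Function.ne_iff.1 x.2
  choose I hI using hex
  have h0 : ∀ x : Fin (n + 1) → ℝ, x ⬝ᵥ (0 : Fin (n + 1) → ℝ) = 0 := fun x => dotProduct_zero x
  have hc : ∀ i u, densW n ((nzChart i u).1 (I (nzChart i u))) * (c (I (nzChart i u))).1
      (chPt (affPt (I (nzChart i u)) ((nzChart i u).1, 0))) = (c i).1 (chPt (u, 0)) := by
    intro i u
    rw [h i (I (nzChart i u)) ((nzChart i u).1, 0) (hI (nzChart i u)) (by simp [nzChart]) (h0 _)]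
    have e : affPt i ((nzChart i u).1, (0 : Fin (n + 1) → ℝ)) = (u, 0) := by
      refine Prod.ext ?_ ?_ <;> funext k <;> simp [affPt, nzChart]
    rw [e]
    simp [nzChart]
  refine ⟨⟨fun x => densW n (x.1 (I x)) * (c (I x)).1 (chPt (affPt (I x) (x.1, 0))),
    fun t x y hxy => ?_, fun i => ?_⟩, fun i => Sm.ext fun w => (hc i w.1.1).trans ?_⟩
  · have ht : t ≠ 0 := fun h0 => y.2 (by simp [hxy, h0])
    have hx : y.1 (I x) = t * x.1 (I x) := by rw [hxy]; rfl
    have hx0 : y.1 (I x) ≠ 0 := by rw [hx]; exact mul_ne_zero ht (hI x)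
    refine (h (I x) (I y) (y.1, 0) (hI y) hx0 (h0 _)).trans ?_
    simp only
    rw [hx, densW_mul, mul_assoc]
    have e : affPt (I x) (y.1, (0 : Fin (n + 1) → ℝ)) = affPt (I x) (x.1, 0) :=
      Prod.ext (affPt_fst_smul ht hxy _ _) (by funext k; simp [affPt])
    rw [e]
    rfl
  · simp only [hc]
    exact (contDiff_of_ch (c i)).comp (contDiff_id.prodMk contDiff_const)
  · exact ch_const_of_dξ (hξ i) _ _ _

/-! ### The quantization of homogeneous symbols -/

/-- The quantization in a chart. -/
abbrev chQuant (n d : ℕ) : Ch n →ₗ[ℂ] Ch n →ₗ[ℂ] Ch n := (chD n).quantOp n d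

lemma chQuant_translate {g : GL (Fin (n + 1)) ℝ} {i j : Fin (n + 1)} {d : ℕ} {φ φ' : SmoothT n}
    (hφ : ∀ m, φ'.1 (cotAct g m) = φ.1 m) (hd : φ' ∈ PolDeg n d) {F F' : HD n}
    (hF : ∀ x, F'.1 (nzAct g x) = F.1 x) {v : (Fin (n + 1) → ℝ) × (Fin (n + 1) → ℝ)}
    (hj : v.1 j ≠ 0) (hi : (pairAct g v).1 i ≠ 0) (hc : v.1 ⬝ᵥ v.2 = 0) :
    densW n (v.1 j) * (chQuant n d (toChart j φ) (densChart j F)).1 (chPt (affPt j v)) =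
    densW n ((pairAct g v).1 i) * (chQuant n d (toChart i φ') (densChart i F')).1
      (chPt (affPt i (pairAct g v))) := by
  refine (chartEq_toChart hφ i j).quantOp (E_toChart hd i) (b := fun u => F.1 (nzChart j u))
    (b' := fun u => F'.1 (nzChart i u)) (F.2.2 j) (F'.2.2 i) (fun v hj hi => ?_) hj hi hc
  rw [← dens_eq F hj, ← dens_eq F' hi]
  exact (hF ⟨v.1, ne_zero_of_apply hj⟩).symm

lemma E_densChart (F : HD n) (i : Fin (n + 1)) : (chD n).E (densChart i F) = 0 :=
  E_eq_zero_of_dξ (dξ_baseFn (F.2.2 i))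

/-- The terms of the quantization applied to a function of the base have fibre degree zero, so the
result is again a function of the base. -/
lemma dξ_chQuant {d : ℕ} {φ : SmoothT n} (hφ : φ ∈ PolDeg n d) (F : HD n) (i : Fin (n + 1))
    (a : Fin n) : (chD n).dξ a (chQuant n d (toChart i φ) (densChart i F)) = 0 :=
  ch_dξ_eq_zero ((chD n).E_quantOp (E_toChart hφ i) (E_densChart F i)) a

lemma cotAct_one {𝕜 : Type} [RCLike 𝕜] [NormedAlgebra 𝕜 ℂ] (m : CotP 𝕜 n) : cotAct 1 m = m := by
  obtain ⟨v, h0, hc, rfl⟩ := exists_conePt m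
  simp only [cotAct_conePt, pairAct_one]

lemma nzAct_one (x : NZ ℝ n) : nzAct 1 x = x := Subtype.ext (by simp [nzAct])

lemma exists_quantDeg (n d : ℕ) : ∃ Q : PolDeg n d →ₗ[ℂ] Module.End ℂ (HD n),
    ∀ i φ F, densChart i (Q φ F) = chQuant n d (toChart i φ.1) (densChart i F) := by
  have hex : ∀ (φ : PolDeg n d) (F : HD n), ∃ G : HD n, ∀ i,
      densChart i G = chQuant n d (toChart i φ.1) (densChart i F) := by
    intro φ F
    refine exists_densChart_eq (fun i a => dξ_chQuant φ.2 F i a) fun i j v hj hi hc => ?_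
    have := chQuant_translate (g := 1) (i := i) (j := j) (φ := φ.1) (φ' := φ.1) (fun m => by
      rw [cotAct_one]) φ.2 (F := F) (F' := F) (fun x => by rw [nzAct_one]) hj (by simpa using hi) hc
    simpa only [pairAct_one] using this
  choose Q hQ using hex
  refine ⟨LinearMap.mk₂ ℂ Q ?_ ?_ ?_ ?_, fun i φ F => hQ φ F i⟩
  · exact fun f f' g => densChart_ext fun i => by
      rw [map_add, hQ, hQ, hQ, ← LinearMap.add_apply, ← map_add]; rfl
  · exact fun c f g => densChart_ext fun i => by
      rw [map_smul, hQ, hQ, ← LinearMap.smul_apply, ← map_smul]; rfl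
  · exact fun f g g' => densChart_ext fun i => by simp only [map_add, hQ]
  · exact fun c f g => densChart_ext fun i => by simp only [hQ, map_smul]

/-- The quantization of homogeneous symbols. -/
def quantDeg (n d : ℕ) : PolDeg n d →ₗ[ℂ] Module.End ℂ (HD n) := (exists_quantDeg n d).choose

lemma densChart_quantDeg {d : ℕ} (i : Fin (n + 1)) (φ : PolDeg n d) (F : HD n) :
    densChart i (quantDeg n d φ F) = chQuant n d (toChart i φ.1) (densChart i F) :=
  (exists_quantDeg n d).choose_spec i φ F

lemma quantDeg_translate {g : GL (Fin (n + 1)) ℝ} {d : ℕ} {φ φ' : PolDeg n d}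
    (hφ : ∀ m, φ'.1.1 (cotAct g m) = φ.1.1 m) {F F' : HD n}
    (hF : ∀ x, F'.1 (nzAct g x) = F.1 x) (x : NZ ℝ n) :
    (quantDeg n d φ' F').1 (nzAct g x) = (quantDeg n d φ F).1 x := by
  obtain ⟨j, hj⟩ := Function.ne_iff.1 x.2
  obtain ⟨i, hi⟩ := Function.ne_iff.1 (nzAct g x).2
  have h := chQuant_translate hφ φ'.2 hF (v := (x.1, 0)) hj hi (dotProduct_zero _)
  rw [← densChart_quantDeg, ← densChart_quantDeg, densChart_apply, densChart_apply] at h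
  exact (dens_eq _ (v := pairAct g (x.1, 0)) hi).trans
    (h.symm.trans (dens_eq _ (v := (x.1, 0)) hj).symm)

lemma isDensOp_quantDeg {d : ℕ} (φ : PolDeg n d) : IsDensOp d (quantDeg n d φ) :=
  IsDiffOp.of_family (Oi := fun _ : Fin (n + 1) => Ch n) (Mi := fun _ => Ch n) (Ni := fun _ => Ch n)
    (fun i => pChart i) (fun i => densChart i) (fun i => densChart i)
    (fun _ _ _ => rfl) (fun _ _ _ => rfl) (fun _ _ _ => rfl) (fun _ _ h => densChart_ext h)
    (fun i F => densChart_quantDeg i φ F) fun i => (chD n).isDiffOp_quantOp n d (toChart i φ.1)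

/-- Evaluation on `f^d F` leaves the `d`-fold derivative of `φ` in the direction of `df` along the
fibre, which by homogeneity is `d!` times the value of `φ` at `df`. -/
lemma hasSymbol_quantDeg {d : ℕ} (φ : PolDeg n d) : HasSymbol d (quantDeg n d φ) φ.1 := by
  refine ⟨isDensOp_quantDeg φ, fun f i u F hre h0 => ?_⟩
  have h1 : (quantDeg n d φ (f ^ d • F)).1 (nzChart i u) =
      Sm.ev (chPt (u, 0)) (chQuant n d (toChart i φ.1) (pChart i f ^ d * densChart i F)) := by
    rw [← map_pow, ← densChart_smul, ← densChart_quantDeg]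
    rfl
  rw [h1, (chD n).eval_quantOp_pow (Sm.ev (chPt (u, 0))) n (f := pChart i f)
    (dξ_baseFn _) h0 d (toChart i φ.1) (densChart i F)]
  congr 1
  refine ch_nab_pow (E_toChart φ.2 i) (dξ_baseFn _) u 0 _ fun a ξ => ?_
  have hd : DifferentiableAt ℝ (fun u' : Fin n → ℝ => f.1 (projChart i u')) u :=
    (f.2 i).differentiable (by simp) u
  have h2 : (fun w : (Fin n → ℝ) × (Fin n → ℝ) => f.1 (projChart i w.1)) =
      fun w => (((f.1 (projChart i w.1)).re : ℝ) : ℂ) := by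
    funext w
    exact Complex.ext rfl (by simp [hre])
  have h3 : DifferentiableAt ℝ (fun u' : Fin n → ℝ => (f.1 (projChart i u')).re) u :=
    Complex.reCLM.differentiableAt.comp u hd
  have h4 : HasFDerivAt (fun w : (Fin n → ℝ) × (Fin n → ℝ) => (((f.1 (projChart i w.1)).re : ℝ) : ℂ))
      (Complex.ofRealCLM.comp ((fderiv ℝ (fun u' => (f.1 (projChart i u')).re) u).comp
        (ContinuousLinearMap.fst ℝ _ _))) (u, ξ) :=
    Complex.ofRealCLM.hasFDerivAt.comp _ (HasFDerivAt.comp (u, ξ) (g := fun u' : Fin n → ℝ =>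
      (f.1 (projChart i u')).re) h3.hasFDerivAt hasFDerivAt_fst)
  refine (Sm.d_apply_of_eq (F := fun w => f.1 (projChart i w.1)) (fun _ => rfl) _ _).trans ?_
  rw [h2, h4.fderiv]
  rfl

end HalfDensities

/-! ### Infinitesimal actions -/

section Infinitesimal

variable {n : ℕ}

lemma hasDerivAt_mexp (X : Matrix (Fin (n + 1)) (Fin (n + 1)) ℝ) {F : Type} [NormedAddCommGroup F]
    [NormedSpace ℝ F] (L : Matrix (Fin (n + 1)) (Fin (n + 1)) ℝ →ₗ[ℝ] F) :
    HasDerivAt (fun t : ℝ => L (NormedSpace.exp (t • X))) (L X) 0 := by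
  let _ : NormedRing (Matrix (Fin (n + 1)) (Fin (n + 1)) ℝ) := Matrix.linftyOpNormedRing
  let _ : NormedAlgebra ℝ (Matrix (Fin (n + 1)) (Fin (n + 1)) ℝ) := Matrix.linftyOpNormedAlgebra
  have h := hasDerivAt_exp_smul_const (𝕂 := ℝ) X 0
  rw [zero_smul, NormedSpace.exp_zero, one_mul] at h
  exact (L.toContinuousLinearMap.hasFDerivAt).comp_hasDerivAt 0 h

lemma hasDerivAt_pairAct_expFlow (X : Matrix (Fin (n + 1)) (Fin (n + 1)) ℝ)
    (v : (Fin (n + 1) → ℝ) × (Fin (n + 1) → ℝ)) :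
    HasDerivAt (fun t => pairAct (expFlow X t) v) (-X.mulVec v.1, Matrix.vecMul v.2 X) 0 := by
  have h1 := hasDerivAt_mexp (-X) ((Matrix.mulVecBilin ℝ ℝ).flip v.1)
  have h2 := hasDerivAt_mexp X (Matrix.vecMulBilin ℝ ℝ v.2)
  simp only [smul_neg, LinearMap.flip_apply, Matrix.mulVecBilin_apply, Matrix.neg_mulVec,
    Matrix.vecMulBilin_apply] at h1 h2
  exact h1.prodMk h2

@[simp] lemma expFlow_zero (X : Matrix (Fin (n + 1)) (Fin (n + 1)) ℝ) : expFlow X 0 = 1 := by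
  ext a b
  simp [expFlow, NormedSpace.exp_zero]

/-- The Lie derivative along a linear vector field, in homogeneous coordinates. -/
abbrev lieR {Ω : Opens ((Fin (n + 1) → ℝ) × (Fin (n + 1) → ℝ))}
    (X : Matrix (Fin (n + 1)) (Fin (n + 1)) ℝ) : Derivation ℂ (Sm ℝ Ω) (Sm ℝ Ω) :=
  ((Frame.std ℝ (Fin (n + 1))).darboux Ω).lie fun a b => (X a b : ℂ)

section

variable {Ω : Opens ((Fin (n + 1) → ℝ) × (Fin (n + 1) → ℝ))}
  (X : Matrix (Fin (n + 1)) (Fin (n + 1)) ℝ)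

lemma lieR_apply (f : Sm ℝ Ω) (w : Ω) :
    (lieR X f).1 w = (Sm.d (-X.mulVec w.1.1, Matrix.vecMul w.1.2 X) f).1 w := by
  have e : (-X.mulVec w.1.1, Matrix.vecMul w.1.2 X) =
      ∑ p : Fin (n + 1) × Fin (n + 1), X p.1 p.2 • (w.1.2 p.1 • (Frame.std ℝ (Fin (n + 1))).eξ p.2 +
        (-w.1.1 p.2) • (Frame.std ℝ (Fin (n + 1))).ex p.1) := by
    rw [Fintype.sum_prod_type]
    refine Prod.ext ?_ ?_ <;> funext k
    · simp [Frame.std, Prod.fst_sum, Finset.sum_apply, Pi.single_apply, Matrix.mulVec, dotProduct,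
        ← sum_neg_distrib]
      rw [sum_comm]
      simp
    · simp [Frame.std, Prod.snd_sum, Finset.sum_apply, Pi.single_apply, Matrix.vecMul, dotProduct,
        mul_comm]
  rw [e, Sm.d_sum, Fintype.sum_prod_type, Darboux.lie_apply, ← Sm.ev_apply, map_sum]
  refine sum_congr rfl fun a _ => ?_
  rw [map_sum]
  refine sum_congr rfl fun b _ => ?_
  rw [map_smul, Sm.d_add, Sm.add_apply, Sm.d_smul, Sm.d_smul, map_sub, map_mul, map_mul, smul_eq_mul]
  simp only [Sm.ev_apply, Complex.coe_algebraMap, Complex.ofReal_neg, neg_mul, ← sub_eq_add_neg]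
  rfl

lemma hasDerivAt_flow (f : Sm ℝ Ω) {v : (Fin (n + 1) → ℝ) × (Fin (n + 1) → ℝ)} (hv : v ∈ Ω) :
    HasDerivAt (fun t => extZero f.1 (pairAct (expFlow X t) v)) ((lieR X f).1 ⟨v, hv⟩) 0 := by
  have h0 : pairAct (expFlow X 0) v = v := by simp
  have h1 := Sm.hasDerivAt_comp f (hasDerivAt_pairAct_expFlow X v) (by rw [h0]; exact hv)
  rw [lieR_apply]
  convert h1 using 3
  exact h0.symm

end

/-- Functions of the homogeneous coordinates over a chart. -/
abbrev Hom (n : ℕ) (i : Fin (n + 1)) :=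
  Sm ℝ (overChart i (⊤ : Opens ((Fin n → ℝ) × (Fin n → ℝ))))

/-- The homogeneous coordinates over a chart. -/
abbrev homD (n : ℕ) (i : Fin (n + 1)) : Darboux (Fin (n + 1)) (Hom n i) :=
  (Frame.std ℝ (Fin (n + 1))).darboux (overChart i ⊤)

lemma mem_overChart {i : Fin (n + 1)} {v : (Fin (n + 1) → ℝ) × (Fin (n + 1) → ℝ)}
    (hi : v.1 i ≠ 0) : v ∈ overChart i (⊤ : Opens ((Fin n → ℝ) × (Fin n → ℝ))) := ⟨hi, trivial⟩

/-- A function in homogeneous coordinates. -/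
def homT (i : Fin (n + 1)) : SmoothT n →ₐ[ℂ] Hom n i :=
  (affPull i (fun _ => overChart_ne) fun _ => overChart_mem).comp (toChart i)

lemma homT_apply (i : Fin (n + 1)) (f : SmoothT n) {v : (Fin (n + 1) → ℝ) × (Fin (n + 1) → ℝ)}
    (hi : v.1 i ≠ 0) (hc : v.1 ⬝ᵥ v.2 = 0) :
    (homT i f).1 ⟨v, mem_overChart hi⟩ = f.1 (conePt v (ne_zero_of_apply hi) hc) := by
  rw [conePt_eq_cotChart hi hc]
  exact affPull_apply i (fun _ => overChart_ne) (fun _ => overChart_mem) _ ⟨v, mem_overChart hi⟩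

/-- A half-density in homogeneous coordinates. -/
def homDens (i : Fin (n + 1)) (F : HD n) : Hom n i :=
  densPull i (fun _ => overChart_ne) (fun _ => overChart_mem) (fun u => F.1 (nzChart i u)) (F.2.2 i)

lemma homDens_apply (i : Fin (n + 1)) (F : HD n) {v : (Fin (n + 1) → ℝ) × (Fin (n + 1) → ℝ)}
    (hi : v.1 i ≠ 0) :
    (homDens i F).1 ⟨v, mem_overChart hi⟩ = F.1 ⟨v.1, ne_zero_of_apply hi⟩ := by
  rw [dens_eq F hi]
  exact densPull_apply _ _ _ _ _ _

lemma eventually_flow_ne (X : Matrix (Fin (n + 1)) (Fin (n + 1)) ℝ) {i : Fin (n + 1)}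
    {v : (Fin (n + 1) → ℝ) × (Fin (n + 1) → ℝ)} (hi : v.1 i ≠ 0) :
    ∀ᶠ t in nhds 0, (pairAct (expFlow X t) v).1 i ≠ 0 := by
  have h := (hasDerivAt_pairAct_expFlow X v).continuousAt
  have h1 : ContinuousAt (fun t => (pairAct (expFlow X t) v).1 i) 0 :=
    (continuous_apply i).continuousAt.comp (continuous_fst.continuousAt.comp h)
  exact h1.eventually_ne (by simpa using hi)

/-- Identifies the infinitesimal action with the explicit derivation `lieR` upstairs: the flow
preserves the cone and stays in the chart for small times. -/
lemma hasDerivAt_cotAct (X : Matrix (Fin (n + 1)) (Fin (n + 1)) ℝ) (f : SmoothT n) {i : Fin (n + 1)}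
    {v : (Fin (n + 1) → ℝ) × (Fin (n + 1) → ℝ)} (hi : v.1 i ≠ 0) (hc : v.1 ⬝ᵥ v.2 = 0) :
    HasDerivAt (fun t => f.1 (cotAct (expFlow X t) (conePt v (ne_zero_of_apply hi) hc)))
      ((lieR X (homT i f)).1 ⟨v, mem_overChart hi⟩) 0 := by
  refine (hasDerivAt_flow X (homT i f) (mem_overChart hi)).congr_of_eventuallyEq ?_
  filter_upwards [eventually_flow_ne X hi] with t ht
  rw [extZero_of_mem _ (mem_overChart ht), homT_apply i f ht (pairAct_cone _ hc), cotAct_conePt]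

lemma hasDerivAt_nzAct (X : Matrix (Fin (n + 1)) (Fin (n + 1)) ℝ) (F : HD n) {i : Fin (n + 1)}
    {v : (Fin (n + 1) → ℝ) × (Fin (n + 1) → ℝ)} (hi : v.1 i ≠ 0) :
    HasDerivAt (fun t => F.1 (nzAct (expFlow X t) ⟨v.1, ne_zero_of_apply hi⟩))
      ((lieR X (homDens i F)).1 ⟨v, mem_overChart hi⟩) 0 := by
  refine (hasDerivAt_flow X (homDens i F) (mem_overChart hi)).congr_of_eventuallyEq ?_
  filter_upwards [eventually_flow_ne X hi] with t ht
  rw [extZero_of_mem _ (mem_overChart ht), homDens_apply i F ht]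
  rfl

lemma contDiff_extZero_homPt {i : Fin (n + 1)} (f : Hom n i) :
    ContDiff ℝ ∞ (fun w => extZero f.1 (homPt i w)) :=
  contDiff_iff_contDiffAt.2 fun w => (f.2 _ (mem_overChart (by simp))).comp w
    (contDiff_homPt i).contDiffAt

lemma contDiff_deriv_cotAct (X : Matrix (Fin (n + 1)) (Fin (n + 1)) ℝ) (f : SmoothT n)
    (i : Fin (n + 1)) : ContDiff ℝ ∞ (fun w : (Fin n → ℝ) × (Fin n → ℝ) =>
      deriv (fun t : ℝ => f.1 (cotAct (expFlow X t) (cotChart i w.1 w.2))) 0) := by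
  refine (congrArg (ContDiff ℝ ∞) (funext fun w => ?_)).mpr
    (contDiff_extZero_homPt (lieR X (homT i f)))
  rw [cotChart_eq_conePt, extZero_of_mem _ (mem_overChart (by simp))]
  exact (hasDerivAt_cotAct X f (by simp) (homPt_cone i w)).deriv

/-- The infinitesimal action on functions on the cotangent bundle. -/
def infT (X : Matrix (Fin (n + 1)) (Fin (n + 1)) ℝ) : SmoothT n →ₗ[ℂ] SmoothT n where
  toFun f := ⟨fun m => deriv (fun t : ℝ => f.1 (cotAct (expFlow X t) m)) 0,
    contDiff_deriv_cotAct X f⟩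
  map_add' f g := by
    apply Subtype.ext
    funext m
    obtain ⟨v, h0, hc, rfl⟩ := exists_conePt m
    obtain ⟨i, hi⟩ := Function.ne_iff.1 h0
    have h1 := hasDerivAt_cotAct X f hi hc
    have h2 := hasDerivAt_cotAct X g hi hc
    change deriv (fun t => f.1 (cotAct (expFlow X t) (conePt v h0 hc)) +
      g.1 (cotAct (expFlow X t) (conePt v h0 hc))) 0 = deriv _ 0 + deriv _ 0
    exact deriv_fun_add h1.differentiableAt h2.differentiableAt
  map_smul' c f := by
    apply Subtype.ext
    funext m
    exact deriv_const_mul_field (v := fun t => f.1 (cotAct (expFlow X t) m)) c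

lemma infT_conePt (X : Matrix (Fin (n + 1)) (Fin (n + 1)) ℝ) (f : SmoothT n) {i : Fin (n + 1)}
    {v : (Fin (n + 1) → ℝ) × (Fin (n + 1) → ℝ)} (hi : v.1 i ≠ 0) (hc : v.1 ⬝ᵥ v.2 = 0) :
    (infT X f).1 (conePt v (ne_zero_of_apply hi) hc) =
      (lieR X (homT i f)).1 ⟨v, mem_overChart hi⟩ := (hasDerivAt_cotAct X f hi hc).deriv

lemma isInfT_infT (X : Matrix (Fin (n + 1)) (Fin (n + 1)) ℝ) (f : SmoothT n) :
    IsInfT X f (infT X f) := by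
  intro m
  obtain ⟨v, h0, hc, rfl⟩ := exists_conePt m
  obtain ⟨i, hi⟩ := Function.ne_iff.1 h0
  have h := hasDerivAt_cotAct X f hi hc
  rwa [← infT_conePt X f hi hc] at h

lemma infT_eq {X : Matrix (Fin (n + 1)) (Fin (n + 1)) ℝ} {f f' : SmoothT n} (h : IsInfT X f f') :
    f' = infT X f := Subtype.ext (funext fun m => (h m).unique (isInfT_infT X f m))

/-- The infinitesimal action on half-densities. -/
def infD (X : Matrix (Fin (n + 1)) (Fin (n + 1)) ℝ) (F : HD n) : HD n :=
  ⟨fun x => deriv (fun t : ℝ => F.1 (nzAct (expFlow X t) x)) 0, fun t x y h => by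
    change deriv _ 0 = _ * deriv _ 0
    rw [← deriv_const_mul_field]
    congr 1
    funext s
    refine F.2.1 t _ _ ?_
    change (expFlow X s).val.mulVec y.1 = t • (expFlow X s).val.mulVec x.1
    rw [h, Matrix.mulVec_smul], fun i => by
    refine (congrArg (ContDiff ℝ ∞) (funext fun u => ?_)).mpr
      ((contDiff_extZero_homPt (lieR X (homDens i F))).comp
        (contDiff_id.prodMk (contDiff_const (c := 0))))
    rw [Function.comp_apply, extZero_of_mem _ (mem_overChart (by simp))]
    exact (hasDerivAt_nzAct X F (v := homPt i (u, 0)) (by simp)).deriv⟩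

lemma isInfDens_iff {X : Matrix (Fin (n + 1)) (Fin (n + 1)) ℝ} {F F' : HD n} :
    IsInfDens X F F' ↔ F' = infD X F := by
  have h : IsInfDens X F (infD X F) := by
    intro x
    obtain ⟨i, hi⟩ := Function.ne_iff.1 x.2
    have h := hasDerivAt_nzAct X F (v := (x.1, 0)) hi
    exact h.differentiableAt.hasDerivAt
  exact ⟨fun h' => Subtype.ext (funext fun x => (h' x).unique (h x)), fun h' => h' ▸ h⟩

lemma homDens_infD (X : Matrix (Fin (n + 1)) (Fin (n + 1)) ℝ) (F : HD n) (i : Fin (n + 1)) :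
    homDens i (infD X F) = lieR X (homDens i F) := by
  ext w
  exact (homDens_apply i _ w.2.1).trans (hasDerivAt_nzAct X F w.2.1).deriv

lemma homDens_quantDeg {d : ℕ} (φ : PolDeg n d) (F : HD n) (i : Fin (n + 1)) :
    homDens i (quantDeg n d φ F) = (homD n i).quantOp n d (homT i φ.1) (homDens i F) := by
  have h := quantOp_densPull (n := n) i (Ω := overChart i ⊤) (fun _ => overChart_ne)
    (fun _ => overChart_mem) d (toChart i φ.1) (fun u => F.1 (nzChart i u)) (F.2.2 i)
  refine Eq.trans ?_ h.symm
  ext w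
  have h1 := congrArg (fun f : Ch n => f.1 (chPt (affPt i w.1))) (densChart_quantDeg i φ F)
  rw [Sm.mul_apply, affPull_apply]
  exact (densPull_apply _ _ _ _ _ w).trans (congrArg (densW n (w.1.1 i) * ·) h1)

lemma homT_slide {f : SmoothT n} {i : Fin (n + 1)} {v : (Fin (n + 1) → ℝ) × (Fin (n + 1) → ℝ)}
    (hv : v ∈ overChart i (⊤ : Opens ((Fin n → ℝ) × (Fin n → ℝ))))
    (hv' : slide i (v, 1) ∈ overChart i (⊤ : Opens ((Fin n → ℝ) × (Fin n → ℝ)))) :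
    (homT i f).1 ⟨v, hv⟩ = (homT i f).1 ⟨_, hv'⟩ := by
  have h1 := affPull_apply (U := ⊤) i (fun _ => overChart_ne) (fun _ => overChart_mem) (toChart i f)
    ⟨v, hv⟩
  have h2 := affPull_apply (U := ⊤) i (fun _ => overChart_ne) (fun _ => overChart_mem) (toChart i f)
    ⟨_, hv'⟩
  refine h1.trans (Eq.trans ?_ h2.symm)
  exact congrArg (toChart i f).1 (Subtype.ext (affPt_slide i v).symm)

lemma homT_inv (i : Fin (n + 1)) (f : SmoothT n) : (homD n i).Inv (homT i f) :=
  affPull_inv i (fun _ => overChart_ne) (fun _ => overChart_mem) (toChart i f)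

lemma homT_E {d : ℕ} (i : Fin (n + 1)) (φ : PolDeg n d) :
    (homD n i).E (homT i φ.1) = (d : ℂ) • homT i φ.1 := by
  have h := (homogenize_affPull i (U := ⊤) (Ω := overChart i ⊤) (fun _ => overChart_ne)
    (fun _ => overChart_mem)).compat.E (toChart i φ.1)
  refine h.trans ((congrArg _ (E_toChart φ.2 i)).trans ?_)
  exact map_smul (affPull i (U := ⊤) (Ω := overChart i ⊤) (fun _ => overChart_ne)
    (fun _ => overChart_mem)).toLinearMap _ _

lemma E_lieR_homT (X : Matrix (Fin (n + 1)) (Fin (n + 1)) ℝ) {d : ℕ} (i : Fin (n + 1))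
    (φ : PolDeg n d) :
    (homD n i).E (lieR X (homT i φ.1)) = (d : ℂ) • lieR X (homT i φ.1) := by
  refine ((homD n i).lie_E _ _).symm.trans ?_
  rw [homT_E, Derivation.map_smul]

/-- `homT i φ'` and the Lie derivative of `homT i φ` agree on the cone only, but the quantization of
invariant symbols sees nothing else. -/
lemma quantOp_lieR {X : Matrix (Fin (n + 1)) (Fin (n + 1)) ℝ} {d : ℕ} {φ φ' : PolDeg n d}
    (h : φ'.1 = infT X φ.1) (F : HD n) {i : Fin (n + 1)} {x : Fin (n + 1) → ℝ} (hi : x i ≠ 0) :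
    ((homD n i).quantOp n d (homT i φ'.1) (homDens i F)).1 ⟨(x, 0), mem_overChart hi⟩ =
      ((homD n i).quantOp n d (lieR X (homT i φ.1)) (homDens i F)).1
        ⟨(x, 0), mem_overChart hi⟩ := by
  refine quantOp_eq_on_cone (Ω := overChart i (⊤ : Opens ((Fin n → ℝ) × (Fin n → ℝ)))) (j := i)
    (fun _ => overChart_ne) (c := (n : ℂ)) (by simp) (quant_ne_zero n d)
    (Darboux.Inv.lie _ (homT_inv i φ.1)) (E_lieR_homT X i φ)
    (Ex_densPull i (fun _ => overChart_ne) (fun _ => overChart_mem) _ (F.2.2 i)) (F := homT i φ'.1)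
    (fun v hv hv' => ?_) (mem_overChart hi) (dotProduct_zero _)
  rw [homT_slide hv hv', homT_apply i _ hv'.1 (slide_mem_cone hv.1), h,
    infT_conePt X φ.1 hv'.1 (slide_mem_cone hv.1)]

lemma homDens_infD_quantDeg (X : Matrix (Fin (n + 1)) (Fin (n + 1)) ℝ) {d : ℕ} (φ : PolDeg n d)
    (F : HD n) (i : Fin (n + 1)) :
    homDens i (infD X (quantDeg n d φ F)) =
      (homD n i).quantOp n d (lieR X (homT i φ.1)) (homDens i F) +
        homDens i (quantDeg n d φ (infD X F)) := by
  refine (homDens_infD X _ i).trans ((congrArg (lieR X) (homDens_quantDeg φ F i)).trans ?_)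
  refine ((homD n i).lie_quantOp _ _ _ _ _).trans (congrArg _ ?_)
  rw [homDens_quantDeg, homDens_infD]

/-- Upstairs this is the Leibniz rule `lie_quantOp` for linear vector fields, which holds because
`star` and `lap` are invariant under linear changes of coordinates. -/
lemma quantDeg_inf {X : Matrix (Fin (n + 1)) (Fin (n + 1)) ℝ} {d : ℕ} {φ φ' : PolDeg n d}
    (h : φ'.1 = infT X φ.1) (F : HD n) :
    infD X (quantDeg n d φ F) = quantDeg n d φ' F + quantDeg n d φ (infD X F) := by
  refine Subtype.ext (funext fun x => ?_)
  obtain ⟨i, hi⟩ := Function.ne_iff.1 x.2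
  have hv : ∀ G : HD n, G.1 x = (homDens i G).1 ⟨(x.1, 0), mem_overChart hi⟩ := fun G =>
    (homDens_apply i G (v := (x.1, 0)) hi).symm
  refine (hv _).trans ((congrArg (fun g : Hom n i => g.1 ⟨(x.1, 0), mem_overChart hi⟩)
    (homDens_infD_quantDeg X φ F i)).trans ?_)
  refine congrArg₂ (· + ·) ?_ (hv _).symm
  rw [hv, homDens_quantDeg]
  exact (quantOp_lieR h F hi).symm

end Infinitesimal

/-! ### Polarization -/

section Polarization

variable {O : Type*} [CommRing O] [Algebra ℂ O] {V : Set O}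

/-- `L ((B + t A)^(d+1))` is a polynomial in `t` vanishing at all real `t`; its linear coefficient
is `(d + 1) L (A B^d)`. -/
lemma polarize (hV : ∀ A ∈ V, ∀ B ∈ V, ∀ t : ℝ, A + (t : ℂ) • B ∈ V) {L : O →ₗ[ℂ] ℂ} {d : ℕ}
    (h : ∀ A ∈ V, L (A ^ (d + 1)) = 0) {A B : O} (hA : A ∈ V) (hB : B ∈ V) : L (A * B ^ d) = 0 := by
  let P : ℂ[X] := ∑ m ∈ range (d + 2), monomial m (L (A ^ m * B ^ (d + 1 - m)) * (d + 1).choose m)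
  have hP : ∀ t : ℝ, P.eval (t : ℂ) = 0 := by
    intro t
    refine Eq.trans ?_ (h _ (hV B hB A hA t))
    rw [add_comm B, add_pow, map_sum, eval_finsetSum]
    refine sum_congr rfl fun m _ => ?_
    have e : ((t : ℂ) • A) ^ m * B ^ (d + 1 - m) * ((d + 1).choose m : O) =
        ((t : ℂ) ^ m * (d + 1).choose m) • (A ^ m * B ^ (d + 1 - m)) := by
      rw [_root_.smul_pow, Algebra.smul_def, Algebra.smul_def, map_mul, map_natCast]
      ring
    rw [e, map_smul, eval_monomial, smul_eq_mul]
    ring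
  have h0 : P = 0 := eq_zero_of_infinite_isRoot P
    ((Set.infinite_range_of_injective Complex.ofReal_injective).mono
      (by rintro _ ⟨t, rfl⟩; exact hP t))
  have h1 := congrArg (fun Q : ℂ[X] => Q.coeff 1) h0
  simp only [P, finsetSum_coeff, coeff_monomial, coeff_zero] at h1
  rw [sum_ite_eq' (range (d + 2)) 1, if_pos (by simp)] at h1
  simpa [Nat.cast_add_one_ne_zero] using h1

/-- A functional vanishing on `𝔪^(d+1)` and on the `d`-th powers of representatives of `𝔪 / 𝔪^2`
vanishes on `𝔪^d`. -/
lemma eq_zero_of_powers {𝔪 : Ideal O} (hV : ∀ A ∈ V, ∀ B ∈ V, ∀ t : ℝ, A + (t : ℂ) • B ∈ V)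
    (hVm : V ⊆ 𝔪) (h0 : ∀ f, ∃ c : ℂ, f - algebraMap ℂ O c ∈ 𝔪)
    (h1 : ∀ f ∈ 𝔪, ∃ A ∈ V, ∃ B ∈ V, f - (A + Complex.I • B) ∈ 𝔪 ^ 2)
    (d : ℕ) (L : O →ₗ[ℂ] ℂ) (hL : ∀ g ∈ 𝔪 ^ (d + 1), L g = 0) (h : ∀ A ∈ V, L (A ^ d) = 0) :
    ∀ g ∈ 𝔪 ^ d, L g = 0 := by
  induction d generalizing L with
  | zero =>
    intro g _
    obtain ⟨c, hc⟩ := h0 g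
    by_cases hV0 : V.Nonempty
    · obtain ⟨A, hA⟩ := hV0
      have e : g = (g - algebraMap ℂ O c) + c • A ^ 0 := by
        rw [pow_zero, Algebra.algebraMap_eq_smul_one]; abel
      rw [e, map_add, map_smul, h A hA, hL _ (by simpa using hc), smul_zero, add_zero]
    · obtain ⟨A, hA, -⟩ := h1 0 𝔪.zero_mem
      exact absurd ⟨A, hA⟩ hV0
  | succ d ih =>
    intro g hg
    -- The functional `b ↦ L (A b)` satisfies the induction hypothesis: polarization takes care of
    -- the `d`-th powers.
    have key : ∀ A ∈ V, ∀ b ∈ 𝔪 ^ d, L (A * b) = 0 := fun A hA b hb =>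
      ih (L ∘ₗ LinearMap.mulLeft ℂ A) (fun g hg => hL _ (by
        rw [pow_succ']; exact Ideal.mul_mem_mul (hVm hA) hg)) (fun B hB => polarize hV h hA hB) b hb
    rw [pow_succ'] at hg
    refine Submodule.mul_induction_on hg (fun a ha b hb => ?_) (fun a b ha hb => ?_)
    · obtain ⟨A, hA, B, hB, hr⟩ := h1 a ha
      have e : a * b = (a - (A + Complex.I • B)) * b + (A * b + Complex.I • (B * b)) := by
        rw [← smul_mul_assoc]; ring
      rw [e, map_add, map_add, map_smul, key A hA b hb, key B hB b hb, hL, smul_zero, add_zero,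
        add_zero]
      rw [show d + 1 + 1 = 2 + d by ring, pow_add]
      exact Ideal.mul_mem_mul hr hb
    · rw [map_add, ha, hb, add_zero]

end Polarization

/-! ### Functions on the base vanishing at a point -/

section Base

variable {n : ℕ}

/-- Evaluation at a point of the base. -/
def evP (l : ℙ ℝ (Fin (n + 1) → ℝ)) : SmoothP n →ₐ[ℂ] ℂ :=
  (Pi.evalAlgHom ℂ _ l).comp (SmoothP n).val

/-- Functions vanishing at a point. -/
abbrev pker (i : Fin (n + 1)) (u : Fin n → ℝ) : Ideal (SmoothP n) :=
  RingHom.ker (evP (projChart i u))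

lemma mem_pker {i : Fin (n + 1)} {u : Fin n → ℝ} {f : SmoothP n} :
    f ∈ pker i u ↔ f.1 (projChart i u) = 0 := Iff.rfl

/-- The projection of the cotangent bundle. -/
def cotProj : CotP ℝ n → ℙ ℝ (Fin (n + 1) → ℝ) :=
  Quotient.lift (fun v => Projectivization.mk ℝ v.1.1 v.2.1) (by
    rintro v w ⟨t, h, -⟩
    exact ((Projectivization.mk_eq_mk_iff' ℝ _ _ _ _).2 ⟨t, h.symm⟩).symm)

lemma cotProj_cotChart (i : Fin (n + 1)) (u ξ : Fin n → ℝ) :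
    cotProj (cotChart i u ξ) = projChart i u := rfl

/-- The zero section of the cotangent bundle. -/
def zeroSec (l : ℙ ℝ (Fin (n + 1) → ℝ)) : CotP ℝ n :=
  Quotient.mk (cotSetoid ℝ n) ⟨(l.rep, 0), l.rep_nonzero, by simp⟩

lemma zeroSec_projChart (i : Fin (n + 1)) (u : Fin n → ℝ) :
    zeroSec (projChart i u) = cotChart i u 0 := by
  obtain ⟨a, ha⟩ := Projectivization.exists_smul_eq_mk_rep ℝ (nzChart i u).1 (nzChart i u).2
  refine (Quotient.sound (s := cotSetoid ℝ n) ?_).symm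
  refine ⟨a, ha.symm, ?_⟩
  have : i.insertNth (-((0 : Fin n → ℝ) ⬝ᵥ u)) (0 : Fin n → ℝ) = (0 : Fin (n + 1) → ℝ) := by
    funext k
    refine Fin.succAboveCases i ?_ (fun j => ?_) k <;> simp
  simp only [this, smul_zero]

/-- Pullback to the cotangent bundle. -/
def pullT : SmoothP n →ₐ[ℂ] SmoothT n where
  toFun f := ⟨fun m => f.1 (cotProj m), fun i => (f.2 i).comp contDiff_fst⟩
  map_one' := rfl
  map_mul' _ _ := rfl
  map_zero' := rfl
  map_add' _ _ := rfl
  commutes' _ := rfl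

/-- Restriction to the zero section. -/
def zeroRes : SmoothT n →ₐ[ℂ] SmoothP n where
  toFun f := ⟨fun l => f.1 (zeroSec l), fun i => by
    simp only [zeroSec_projChart]
    exact (f.2 i).comp (contDiff_id.prodMk contDiff_const)⟩
  map_one' := rfl
  map_mul' _ _ := rfl
  map_zero' := rfl
  map_add' _ _ := rfl
  commutes' _ := rfl

lemma zeroRes_pullT (f : SmoothP n) : zeroRes (pullT f) = f := by
  apply Subtype.ext
  funext l
  change f.1 (cotProj (zeroSec l)) = f.1 l
  rw [show cotProj (zeroSec l) = l from l.mk_rep]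

/-- The statement on the base is deduced from `mem_sq` on the cotangent bundle: pull back, then
restrict to the zero section, which maps one vanishing ideal into the other. -/
lemma mem_pker_sq {i : Fin (n + 1)} {u : Fin n → ℝ} {f : SmoothP n} (h0 : f.1 (projChart i u) = 0)
    (h1 : ∀ w, fderiv ℝ (fun u' => f.1 (projChart i u')) u w = 0) : f ∈ pker i u ^ 2 := by
  have h2 := mem_sq (i := i) (w₀ := (u, 0)) (f := pullT f) h0 fun v => by
    refine (Sm.d_apply_of_eq (F := fun w => f.1 (projChart i w.1)) (fun _ => rfl) _ _).trans ?_
    have hd : HasFDerivAt (fun u' => f.1 (projChart i u'))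
      (fderiv ℝ (fun u' => f.1 (projChart i u')) u) u :=
        ((f.2 i).differentiable (by simp) u).hasFDerivAt
    have h3 : HasFDerivAt (fun w : (Fin n → ℝ) × (Fin n → ℝ) => f.1 (projChart i w.1)) _ (u, 0) :=
      HasFDerivAt.comp (u, (0 : Fin n → ℝ)) (g := fun u' => f.1 (projChart i u')) hd hasFDerivAt_fst
    change fderiv ℝ _ (u, 0) v = 0
    rw [h3.fderiv]
    exact h1 _
  have h3 := Ideal.mem_map_of_mem (zeroRes (n := n)) h2
  rw [zeroRes_pullT, Ideal.map_pow] at h3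
  refine Ideal.pow_right_mono (Ideal.map_le_iff_le_comap.2 fun g hg => ?_) 2 h3
  change g.1 (zeroSec (projChart i u)) = 0
  rw [zeroSec_projChart]
  exact hg

/-! ### Test functions -/

lemma dot_self_pos {x : Fin (n + 1) → ℝ} (h : x ≠ 0) : 0 < x ⬝ᵥ x :=
  lt_of_le_of_ne (sum_nonneg fun _ _ => mul_self_nonneg _) fun h0 => h (dotProduct_self_eq_zero.1 h0.symm)

lemma contDiff_nzChart (i : Fin (n + 1)) (a : Fin (n + 1)) :
    ContDiff ℝ ∞ fun u : Fin n → ℝ => (nzChart i u).1 a := by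
  refine Fin.succAboveCases i ?_ (fun l => ?_) a
  · simpa [nzChart] using contDiff_const
  · simp only [nzChart, Fin.insertNth_apply_succAbove]; fun_prop

lemma contDiff_dot_self (i : Fin (n + 1)) :
    ContDiff ℝ ∞ fun u : Fin n → ℝ => (nzChart i u).1 ⬝ᵥ (nzChart i u).1 :=
  ContDiff.sum fun a _ => (contDiff_nzChart i a).mul (contDiff_nzChart i a)

lemma rep_quot (a b : Fin (n + 1)) {x : Fin (n + 1) → ℝ} (hx : x ≠ 0) :
    (Projectivization.mk ℝ x hx).rep a * (Projectivization.mk ℝ x hx).rep b /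
      ((Projectivization.mk ℝ x hx).rep ⬝ᵥ (Projectivization.mk ℝ x hx).rep) =
        x a * x b / (x ⬝ᵥ x) := by
  obtain ⟨t, ht⟩ := Projectivization.exists_smul_eq_mk_rep ℝ x hx
  have h0 := (dot_self_pos hx).ne'
  have ht0 : (t : ℝ) ≠ 0 := t.ne_zero
  rw [← ht, Units.smul_def]
  simp only [Pi.smul_apply, smul_eq_mul, smul_dotProduct, dotProduct_smul]
  field_simp

/-- The function `x_a x_b / |x|^2` on the projective space. -/
def quadFn (a b : Fin (n + 1)) : SmoothP n :=
  ⟨fun l => ((l.rep a * l.rep b / (l.rep ⬝ᵥ l.rep) : ℝ) : ℂ), fun i => by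
    simp only [projChart, rep_quot]
    exact Complex.ofRealCLM.contDiff.comp (((contDiff_nzChart i a).mul (contDiff_nzChart i b)).div
      (contDiff_dot_self i) fun u => (dot_self_pos (nzChart i u).2).ne')⟩

lemma quadFn_mk (a b : Fin (n + 1)) {x : Fin (n + 1) → ℝ} (hx : x ≠ 0) :
    (quadFn a b).1 (Projectivization.mk ℝ x hx) = ((x a * x b / (x ⬝ᵥ x) : ℝ) : ℂ) :=
  congrArg Complex.ofReal (rep_quot a b hx)

/-- A function with a given differential at a point: `[y] ↦ (ξ · y) (x · y) / |y|^2`. -/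
def testFn (v : (Fin (n + 1) → ℝ) × (Fin (n + 1) → ℝ)) : SmoothP n :=
  ∑ p : Fin (n + 1) × Fin (n + 1), ((v.2 p.1 * v.1 p.2 : ℝ) : ℂ) • quadFn p.1 p.2

lemma testFn_mk (v : (Fin (n + 1) → ℝ) × (Fin (n + 1) → ℝ)) {y : Fin (n + 1) → ℝ} (hy : y ≠ 0) :
    (testFn v).1 (Projectivization.mk ℝ y hy) = (((v.2 ⬝ᵥ y) * (v.1 ⬝ᵥ y) / (y ⬝ᵥ y) : ℝ) : ℂ) := by
  have h : (testFn v).1 (Projectivization.mk ℝ y hy) = ∑ p : Fin (n + 1) × Fin (n + 1),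
      ((v.2 p.1 * v.1 p.2 : ℝ) : ℂ) * (quadFn p.1 p.2).1 (Projectivization.mk ℝ y hy) := by
    rw [testFn]
    exact map_sum (evP (Projectivization.mk ℝ y hy)) _ _
  simp only [h, quadFn_mk, ← Complex.ofReal_mul, ← Complex.ofReal_sum]
  congr 1
  rw [Fintype.sum_prod_type, show v.2 ⬝ᵥ y = ∑ a, v.2 a * y a from rfl,
    show v.1 ⬝ᵥ y = ∑ a, v.1 a * y a from rfl, sum_mul_sum, sum_div]
  refine sum_congr rfl fun a _ => ?_
  rw [sum_div]
  exact sum_congr rfl fun b _ => by ring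

lemma testFn_smul (t : ℝ) (x ξ : Fin (n + 1) → ℝ) : testFn (x, t • ξ) = (t : ℂ) • testFn (x, ξ) := by
  rw [testFn, testFn, smul_sum]
  exact sum_congr rfl fun p _ => by rw [smul_smul]; simp [mul_assoc]

lemma testFn_add (x ξ η : Fin (n + 1) → ℝ) : testFn (x, ξ + η) = testFn (x, ξ) + testFn (x, η) := by
  rw [testFn, testFn, testFn, ← sum_add_distrib]
  exact sum_congr rfl fun p _ => by rw [← add_smul]; simp [add_mul]

lemma testFn_homPt_self (i : Fin (n + 1)) (u ξ : Fin n → ℝ) :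
    (testFn (homPt i (u, ξ))).1 (projChart i u) = 0 := by
  have h : (homPt i (u, ξ)).2 ⬝ᵥ (nzChart i u).1 = 0 := by
    rw [dotProduct_comm]; exact homPt_cone i (u, ξ)
  rw [projChart, testFn_mk, h]
  simp

/-- Along a line through `u` the factor `ξ · y` is linear and vanishes at `u`, while `(x · y) /
|y|²` equals `1` there. -/
lemma fderiv_testFn (i : Fin (n + 1)) (u ξ w : Fin n → ℝ) :
    fderiv ℝ (fun u' => (testFn (homPt i (u, ξ))).1 (projChart i u')) u w = ((ξ ⬝ᵥ w : ℝ) : ℂ) := by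
  have hd := ((testFn (homPt i (u, ξ))).2 i).differentiable (by simp) u
  rw [← hd.lineDeriv_eq_fderiv, lineDeriv]
  have h1 : ∀ t : ℝ, (homPt i (u, ξ)).2 ⬝ᵥ (nzChart i (u + t • w)).1 = t * (ξ ⬝ᵥ w) := by
    intro t
    rw [dotProduct, Fin.sum_univ_succAbove _ i]
    simp [homPt, nzChart, mul_add, sum_add_distrib, dotProduct, mul_sum, mul_left_comm]
  have hs : ContDiff ℝ ∞ fun t : ℝ => ((homPt i (u, ξ)).1 ⬝ᵥ (nzChart i (u + t • w)).1) /
      ((nzChart i (u + t • w)).1 ⬝ᵥ (nzChart i (u + t • w)).1) := by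
    have hl : ContDiff ℝ ∞ fun t : ℝ => u + t • w := by fun_prop
    exact ContDiff.div (ContDiff.sum fun a _ => contDiff_const.mul ((contDiff_nzChart i a).comp hl))
      ((contDiff_dot_self i).comp hl) fun t => (dot_self_pos (nzChart i (u + t • w)).2).ne'
  have h2 := ((hasDerivAt_id (0 : ℝ)).mul (hs.differentiable (by simp) 0).hasDerivAt).const_mul (ξ ⬝ᵥ w)
  have h3 : HasDerivAt (fun t : ℝ => (testFn (homPt i (u, ξ))).1 (projChart i (u + t • w)))
      ((ξ ⬝ᵥ w : ℝ) : ℂ) (0 : ℝ) := by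
    have h4 := h2.ofReal_comp
    refine HasDerivAt.congr_of_eventuallyEq (h4.congr_deriv ?_)
      (Filter.Eventually.of_forall fun t => ?_)
    · have e : (homPt i (u, ξ)).1 ⬝ᵥ (nzChart i u).1 / ((nzChart i u).1 ⬝ᵥ (nzChart i u).1) = 1 :=
        div_self (dot_self_pos (nzChart i u).2).ne'
      simp [e]
    · refine (testFn_mk _ (nzChart i (u + t • w)).2).trans ?_
      rw [h1]
      simp only [Pi.mul_apply, id]
      congr 1
      ring
  exact h3.deriv

/-- The real and imaginary parts of the differential of `f` at the point are matched separately by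
test functions. -/
lemma exists_testFn (i : Fin (n + 1)) (u : Fin n → ℝ) {f : SmoothP n} (hf : f ∈ pker i u) :
    ∃ p q : Fin n → ℝ, f - (testFn (homPt i (u, p)) + Complex.I • testFn (homPt i (u, q))) ∈
      pker i u ^ 2 := by
  have hd := fun f : SmoothP n => (f.2 i).differentiable (by simp) u
  refine ⟨fun k => (fderiv ℝ (fun u' => f.1 (projChart i u')) u (Pi.single k 1)).re,
    fun k => (fderiv ℝ (fun u' => f.1 (projChart i u')) u (Pi.single k 1)).im,
    mem_pker_sq ?_ fun w => ?_⟩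
  · change f.1 _ - ((testFn _).1 _ + Complex.I * (testFn _).1 _) = 0
    rw [mem_pker.1 hf, testFn_homPt_self, testFn_homPt_self]
    simp
  · change fderiv ℝ (fun u' => f.1 (projChart i u') - ((testFn _).1 (projChart i u') +
      Complex.I * (testFn _).1 (projChart i u'))) u w = 0
    rw [fderiv_fun_sub (hd f) ((hd _).fun_add ((hd _).const_mul _)), fderiv_fun_add (hd _)
      ((hd _).const_mul _), fderiv_const_mul (hd _)]
    simp only [sub_apply, add_apply, smul_apply, fderiv_testFn, smul_eq_mul]
    have e : w = ∑ k, w k • Pi.single k (1 : ℝ) := by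
      funext j; simp [Finset.sum_apply, Pi.single_apply]
    conv_lhs => rw [e]
    simp only [map_sum, map_smul]
    rw [← e]
    simp only [dotProduct, Complex.ofReal_sum, Complex.ofReal_mul, mul_sum, ← sum_add_distrib,
      ← sum_sub_distrib]
    refine sum_eq_zero fun k _ => ?_
    rw [Complex.real_smul]
    linear_combination -(w k : ℂ) *
      Complex.re_add_im (fderiv ℝ (fun u' => f.1 (projChart i u')) u (Pi.single k 1))

end Base

/-! ### Differential operators on half-densities and their symbols -/

section Symbols

variable {n : ℕ}

/-- Evaluation of half-densities. -/
def evD (x : NZ ℝ n) : HD n →ₗ[ℂ] ℂ := LinearMap.proj x ∘ₗ (HD n).subtype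

lemma evD_smul {i : Fin (n + 1)} {u : Fin n → ℝ} (f : SmoothP n) (F : HD n) :
    evD (nzChart i u) (f • F) = f.1 (projChart i u) * evD (nzChart i u) F := rfl

lemma evD_ext {F G : HD n} (h : ∀ i u, evD (nzChart i u) F = evD (nzChart i u) G) : F = G :=
  densChart_ext fun i => Sm.ext fun w => h i w.1.1

instance : IsScalarTower ℂ (SmoothP n) (HD n) :=
  ⟨fun _ _ _ => Subtype.ext (funext fun _ => mul_assoc _ _ _)⟩

lemma algebraMap_smul_dens (c : ℂ) (F : HD n) :
    (algebraMap ℂ (SmoothP n) c • F : HD n) = (c • F : HD n) := rfl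

/-- The operator maps densities vanishing to order `k` at a point to densities vanishing there. -/
def Kills (k : ℕ) (D : Module.End ℂ (HD n)) : Prop :=
  ∀ (i : Fin (n + 1)) (u : Fin n → ℝ), ∀ g ∈ pker i u ^ k, ∀ F : HD n, evD (nzChart i u) (D (g • F)) = 0

lemma evD_commutator (D : Module.End ℂ (HD n)) (f : SmoothP n) (F : HD n) (i : Fin (n + 1))
    (u : Fin n → ℝ) : evD (nzChart i u) ((D * densMul f - densMul f * D : Module.End ℂ (HD n)) F) =
      evD (nzChart i u) (D ((f - algebraMap ℂ (SmoothP n) (f.1 (projChart i u))) • F)) := by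
  rw [sub_smul, algebraMap_smul_dens, map_sub, map_sub, LinearMap.map_smul, LinearMap.map_smul]
  rfl

lemma sub_algebraMap_mem (f : SmoothP n) (i : Fin (n + 1)) (u : Fin n → ℝ) :
    f - algebraMap ℂ (SmoothP n) (f.1 (projChart i u)) ∈ pker i u :=
  mem_pker.2 (sub_self (f.1 (projChart i u)))

/-- At a given point, the commutator with `f` is composition with multiplication by `f` minus its
value there, an arbitrary element of the vanishing ideal. Iterated commutators thus test `D` on
powers of that ideal, point by point. -/
lemma isDensOp_iff_kills {k : ℕ} {D : Module.End ℂ (HD n)} : IsDensOp k D ↔ Kills (k + 1) D := by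
  refine ⟨fun h i u g hg F => IsDiffOp.eval_pow (evD (nzChart i u)).toAddMonoidHom
    (fun f hf s => by
      change f.1 (projChart i u) * _ = 0
      rw [mem_pker.1 hf, zero_mul]) h (map_add D) hg F,
    fun h => ?_⟩
  induction k generalizing D with
  | zero =>
    refine isDensOp_zero.2 fun f => LinearMap.ext fun F => evD_ext fun i u => ?_
    rw [evD_commutator, h i u _ (by simpa using sub_algebraMap_mem f i u)]
    exact (map_zero _).symm
  | succ k ih =>
    refine isDensOp_succ.2 fun f => ih fun i u g hg F => ?_
    rw [evD_commutator, smul_smul]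
    refine h i u _ ?_ F
    rw [pow_succ']
    exact Ideal.mul_mem_mul (sub_algebraMap_mem f i u) hg

lemma Kills.eq_zero {D : Module.End ℂ (HD n)} (h : Kills 0 D) : D = 0 :=
  LinearMap.ext fun F => evD_ext fun i u => by simpa using h i u 1 (by simp) F

/-- The standard half-density `|x|^(-(n+1)/2)`. -/
def stdDens (n : ℕ) : HD n :=
  ⟨fun x => (((x.1 ⬝ᵥ x.1) ^ (-(((n : ℝ) + 1) / 4)) : ℝ) : ℂ), fun t x y h => by
    have ht : t ≠ 0 := fun h0 => y.2 (by simp [h, h0])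
    have e : (t * t) ^ (-(((n : ℝ) + 1) / 4)) = |t| ^ (-(1 / 2 * ((n : ℝ) + 1))) := by
      rw [← abs_mul_abs_self, ← sq, ← Real.rpow_natCast, ← Real.rpow_mul (abs_nonneg t)]
      congr 1
      push_cast
      ring
    simp only [h, smul_dotProduct, dotProduct_smul, smul_eq_mul]
    rw [← mul_assoc, Real.mul_rpow (mul_self_nonneg t) (dot_self_pos x.2).le, e, Complex.ofReal_mul],
    fun i => Complex.ofRealCLM.contDiff.comp ((contDiff_dot_self i).rpow_const_of_ne fun u =>
      (dot_self_pos (nzChart i u).2).ne')⟩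

lemma stdDens_ne_zero (x : NZ ℝ n) : (stdDens n).1 x ≠ 0 :=
  Complex.ofReal_ne_zero.2 (Real.rpow_pos_of_pos (dot_self_pos x.2) _).ne'

lemma evD_stdDens_ne_zero (x : NZ ℝ n) : evD x (stdDens n) ≠ 0 := stdDens_ne_zero x

lemma dens_quot (G : HD n) {x y : NZ ℝ n} (h : Projectivization.mk ℝ y.1 y.2 = Projectivization.mk ℝ x.1 x.2) :
    G.1 y / (stdDens n).1 y = G.1 x / (stdDens n).1 x := by
  obtain ⟨t, ht⟩ := (Projectivization.mk_eq_mk_iff' ℝ _ _ _ _).1 h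
  have ht0 : t ≠ 0 := fun h0 => y.2 (by simp [← ht, h0])
  rw [G.2.1 t x y ht.symm, (stdDens n).2.1 t x y ht.symm]
  exact mul_div_mul_left _ _ (densW_ne_zero n ht0)

/-- The quotient of a half-density by the standard one. -/
def quotStd (G : HD n) : SmoothP n :=
  ⟨fun l => G.1 ⟨l.rep, l.rep_nonzero⟩ / (stdDens n).1 ⟨l.rep, l.rep_nonzero⟩, fun i => by
    have h : ∀ u, G.1 ⟨(projChart i u).rep, (projChart i u).rep_nonzero⟩ /
        (stdDens n).1 ⟨(projChart i u).rep, (projChart i u).rep_nonzero⟩ =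
        G.1 (nzChart i u) / (stdDens n).1 (nzChart i u) := fun u =>
      dens_quot G (projChart i u).mk_rep
    simp only [h]
    simp only [div_eq_mul_inv]
    exact (G.2.2 i).mul (((stdDens n).2.2 i).inv fun u => stdDens_ne_zero _)⟩

lemma quotStd_apply (G : HD n) (i : Fin (n + 1)) (u : Fin n → ℝ) :
    (quotStd G).1 (projChart i u) = evD (nzChart i u) G / evD (nzChart i u) (stdDens n) :=
  dens_quot G (projChart i u).mk_rep

lemma quotStd_smul (G : HD n) : quotStd G • stdDens n = G := evD_ext fun i u => by
  rw [evD_smul, quotStd_apply, div_mul_cancel₀ _ (evD_stdDens_ne_zero _)]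

lemma mem_polDeg_of_dil {d : ℕ} {f : SmoothT n} (h : ∀ (t : ℝ) m, f.1 (dil t m) = (t : ℂ) ^ d * f.1 m) :
    f ∈ PolDeg n d := by
  refine mem_polDeg_iff.2 (Subtype.ext (funext fun m => ?_))
  change deriv (fun t : ℝ => f.1 (dil t m)) 1 = (d : ℂ) * f.1 m
  simp only [h]
  have h1 : HasDerivAt (fun t : ℝ => (t : ℂ)) 1 1 := Complex.ofRealCLM.hasDerivAt
  simpa using ((h1.pow d).mul_const (f.1 m)).deriv

/-- The test function of a covector. -/
def testCot : CotP ℝ n → SmoothP n :=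
  Quotient.lift (fun v => testFn v.1) (by
    rintro v w ⟨t, h1, h2⟩
    refine sum_congr rfl fun p _ => ?_
    rw [h1, h2]
    congr 2
    simp only [Pi.smul_apply, smul_eq_mul, Units.val_inv_eq_inv_val]
    field_simp [t.ne_zero])

lemma testCot_cotChart (i : Fin (n + 1)) (u ξ : Fin n → ℝ) :
    testCot (cotChart i u ξ) = testFn (homPt i (u, ξ)) := rfl

lemma testCot_dil (t : ℝ) (m : CotP ℝ n) : testCot (dil t m) = (t : ℂ) • testCot m := by
  induction m using Quotient.inductionOn with
  | _ v => exact testFn_smul t v.1.1 v.1.2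

lemma cotProj_dil (t : ℝ) (m : CotP ℝ n) : cotProj (dil t m) = cotProj m := by
  induction m using Quotient.inductionOn with
  | _ v => rfl

/-- `testFn` is a combination of fixed functions `quadFn` with coefficients polynomial in the
covector's coordinates. Expanding the power leaves finitely many fixed densities to which `D` is
applied, so smoothness in the covector is evident. -/
lemma contDiff_symbol (d : ℕ) (D : Module.End ℂ (HD n)) (i : Fin (n + 1)) :
    ContDiff ℝ ∞ fun w : (Fin n → ℝ) × (Fin n → ℝ) =>
      (quotStd (D (testFn (homPt i w) ^ d • stdDens n))).1 (projChart i w.1) := by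
  have h : ∀ w : (Fin n → ℝ) × (Fin n → ℝ),
      (quotStd (D (testFn (homPt i w) ^ d • stdDens n))).1 (projChart i w.1) =
      ∑ s : Fin d → Fin (n + 1) × Fin (n + 1),
        (∏ j, (((homPt i w).2 (s j).1 * (homPt i w).1 (s j).2 : ℝ) : ℂ)) *
          (quotStd (D ((∏ j, quadFn (s j).1 (s j).2) • stdDens n))).1 (projChart i w.1) := by
    intro w
    rw [quotStd_apply, testFn, Fintype.sum_pow, sum_smul, map_sum, map_sum, sum_div]
    refine sum_congr rfl fun s _ => ?_
    rw [prod_smul, smul_assoc, map_smul, map_smul, quotStd_apply, smul_eq_mul, mul_div_assoc]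
  simp only [h]
  have h1 : ContDiff ℝ ∞ fun w : (Fin n → ℝ) × (Fin n → ℝ) => homPt i w := contDiff_homPt i
  have h2 := contDiff_pi.1 (contDiff_fst.comp h1)
  have h3 := contDiff_pi.1 (contDiff_snd.comp h1)
  exact ContDiff.sum fun s _ => (contDiff_prod fun j _ => Complex.ofRealCLM.contDiff.comp
    ((h3 _).mul (h2 _))).mul (((quotStd _).2 i).comp contDiff_fst)

/-- The symbol is defined by applying `D` to powers of test functions times the standard
half-density. No bound on the order of `D` is needed for this; it enters only when the symbol is
compared with `D`. -/
lemma exists_symbol (d : ℕ) (D : Module.End ℂ (HD n)) : ∃ φ : PolDeg n d, ∀ i u ξ,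
    evD (nzChart i u) (D (testFn (homPt i (u, ξ)) ^ d • stdDens n)) =
      (d.factorial : ℂ) * φ.1.1 (cotChart i u ξ) * evD (nzChart i u) (stdDens n) := by
  let F : CotP ℝ n → ℂ := fun m =>
    (d.factorial : ℂ)⁻¹ * (quotStd (D (testCot m ^ d • stdDens n))).1 (cotProj m)
  have hF : ∀ i, ContDiff ℝ ∞ (fun w : (Fin n → ℝ) × (Fin n → ℝ) => F (cotChart i w.1 w.2)) := fun i =>
    contDiff_const.mul (contDiff_symbol d D i)
  refine ⟨⟨⟨F, hF⟩, mem_polDeg_of_dil fun t m => ?_⟩, fun i u ξ => ?_⟩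
  · change _ * _ = _ * (_ * _)
    obtain ⟨i, u, ξ, rfl⟩ := exists_cotChart m
    rw [testCot_dil, cotProj_dil, _root_.smul_pow, smul_assoc, map_smul, cotProj_cotChart,
      quotStd_apply, quotStd_apply, map_smul, smul_eq_mul]
    ring
  · change _ = _ * ((d.factorial : ℂ)⁻¹ * _) * _
    rw [testCot_cotChart, cotProj_cotChart, mul_inv_cancel_left₀ (by exact_mod_cast d.factorial_ne_zero),
      quotStd_apply, div_mul_cancel₀ _ (evD_stdDens_ne_zero _)]

lemma evD_of_hasSymbol {d : ℕ} {D : Module.End ℂ (HD n)} {φ : SmoothT n} (h : HasSymbol d D φ)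
    (i : Fin (n + 1)) (u ξ : Fin n → ℝ) :
    evD (nzChart i u) (D (testFn (homPt i (u, ξ)) ^ d • stdDens n)) =
      (d.factorial : ℂ) * φ.1 (cotChart i u ξ) * evD (nzChart i u) (stdDens n) := by
  have hre : ∀ l, ((testFn (homPt i (u, ξ))).1 l).im = 0 := by
    intro l
    rw [← l.mk_rep, testFn_mk]
    exact Complex.ofReal_im _
  refine (h.2 (testFn (homPt i (u, ξ))) i u (stdDens n) hre (testFn_homPt_self i u ξ)).trans ?_
  congr 3
  have hd := ((testFn (homPt i (u, ξ))).2 i).differentiable (by simp) u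
  have h1 : HasFDerivAt (fun u' => ((testFn (homPt i (u, ξ))).1 (projChart i u')).re) _ u :=
    (Complex.reCLM.hasFDerivAt (x := (testFn (homPt i (u, ξ))).1 (projChart i u))).comp u
      hd.hasFDerivAt
  refine congrArg (fun η => φ.1 (cotChart i u η)) (funext fun k => ?_)
  rw [h1.fderiv]
  simp [fderiv_testFn]

lemma hasSymbol_unique {d : ℕ} {D : Module.End ℂ (HD n)} {φ φ' : SmoothT n} (h : HasSymbol d D φ)
    (h' : HasSymbol d D φ') : φ = φ' := by
  apply Subtype.ext
  funext m
  obtain ⟨i, u, ξ, rfl⟩ := exists_cotChart m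
  have h1 := (evD_of_hasSymbol h i u ξ).symm.trans (evD_of_hasSymbol h' i u ξ)
  exact mul_left_cancel₀ (by exact_mod_cast d.factorial_ne_zero)
    (mul_right_cancel₀ (stdDens_ne_zero _) h1)

/-- If the symbol vanishes, the order drops: by polarization, powers of test functions detect
everything in `𝔪^d` modulo `𝔪^(d+1)`. The standard half-density, which vanishes nowhere, reduces
densities to functions. -/
lemma kills_of_testFn {d : ℕ} {D : Module.End ℂ (HD n)} (h : Kills (d + 1) D)
    (h0 : ∀ i u ξ, evD (nzChart i u) (D (testFn (homPt i (u, ξ)) ^ d • stdDens n)) = 0) :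
    Kills d D := by
  intro i u g hg F
  rw [← quotStd_smul F, smul_smul]
  let L : SmoothP n →ₗ[ℂ] ℂ := evD (nzChart i u) ∘ₗ D ∘ₗ
    { toFun := fun g => g • stdDens n
      map_add' := fun a b => add_smul a b _
      map_smul' := fun c a => smul_assoc c a _ }
  refine eq_zero_of_powers (V := Set.range fun ξ => testFn (homPt i (u, ξ))) (𝔪 := pker i u)
    ?_ ?_ (fun f => ⟨_, sub_algebraMap_mem f i u⟩) (fun f hf => ?_) d L (fun g hg => h i u g hg _)
    ?_ _ (Ideal.mul_mem_right _ _ hg)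
  · rintro _ ⟨ξ, rfl⟩ _ ⟨η, rfl⟩ t
    refine ⟨ξ + t • η, ?_⟩
    have e : homPt i (u, ξ + t • η) = ((homPt i (u, ξ)).1, (homPt i (u, ξ)).2 + t • (homPt i (u, η)).2) := by
      refine Prod.ext rfl ?_
      funext k
      refine Fin.succAboveCases i ?_ (fun j => ?_) k
      · simp [homPt, add_dotProduct, smul_dotProduct]
        ring
      · simp [homPt]
    simp only [e, testFn_add, testFn_smul]
    rfl
  · rintro _ ⟨ξ, rfl⟩
    exact testFn_homPt_self i u ξ
  · obtain ⟨p, q, h1⟩ := exists_testFn i u hf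
    exact ⟨_, ⟨p, rfl⟩, _, ⟨q, rfl⟩, h1⟩
  · rintro _ ⟨ξ, rfl⟩
    exact h0 i u ξ

/-! ### The quantization map -/

/-- The quantization map, into all operators on half-densities. -/
def quantEnd (n : ℕ) : Pol n →ₗ[ℂ] Module.End ℂ (HD n) := polLift (quantDeg n)

lemma quantEnd_toPol {d : ℕ} (φ : PolDeg n d) : quantEnd n (toPol φ) = quantDeg n d φ :=
  polLift_toPol _ φ

/-- Subtracting the quantization of the principal symbol lowers the order by one. -/
lemma quantEnd_surj {d : ℕ} {D : Module.End ℂ (HD n)} (h : Kills d D) : ∃ φ, quantEnd n φ = D := by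
  induction d generalizing D with
  | zero => exact ⟨0, by rw [h.eq_zero, map_zero]⟩
  | succ d ih =>
    obtain ⟨φ, hφ⟩ := exists_symbol d D
    obtain ⟨ψ, hψ⟩ := ih (D := D - quantDeg n d φ) (kills_of_testFn (fun i u g hg F => by
      rw [LinearMap.sub_apply, map_sub, h i u g hg, isDensOp_iff_kills.1 (isDensOp_quantDeg φ) i u g hg,
        sub_zero]) fun i u ξ => by
      rw [LinearMap.sub_apply, map_sub, hφ, evD_of_hasSymbol (hasSymbol_quantDeg φ), sub_self])
    exact ⟨ψ + toPol φ, by rw [map_add, quantEnd_toPol, hψ, sub_add_cancel]⟩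

lemma kills_quantEnd {d : ℕ} {φ : Pol n} (h : ∀ e, d ≤ e → comp e φ = 0) : Kills d (quantEnd n φ) := by
  classical
  intro i u g hg F
  rw [← sum_comp φ, map_sum, LinearMap.sum_apply, map_sum]
  refine sum_eq_zero fun e _ => ?_
  by_cases he : d ≤ e
  · rw [h e he]; simp
  · rw [comp_eq_toPol, quantEnd_toPol]
    exact isDensOp_iff_kills.1 (isDensOp_quantDeg _) i u g (Ideal.pow_le_pow_right (by omega) hg) F

/-- The component of highest degree is the principal symbol of the whole operator, hence zero; the
induction removes the components from the top. -/
lemma quantEnd_eq_zero (d : ℕ) {φ : Pol n} (h : ∀ e, d ≤ e → comp e φ = 0) (h0 : quantEnd n φ = 0) :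
    φ = 0 := by
  classical
  induction d with
  | zero =>
    rw [← sum_comp φ]
    exact sum_eq_zero fun e _ => h e (Nat.zero_le e)
  | succ d ih =>
    refine ih fun e he => ?_
    obtain rfl | he := he.eq_or_lt
    · have h1 : quantDeg n d (components φ d) = - quantEnd n (φ - comp d φ) := by
        rw [map_sub, h0, comp_eq_toPol, quantEnd_toPol, zero_sub, neg_neg]
      have h2 : Kills d (quantEnd n (φ - comp d φ)) := kills_quantEnd fun e he => by
        have h3 : comp e (φ - comp d φ) + comp e (comp d φ) = comp e φ := by
          rw [← comp_add, sub_add_cancel]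
        rw [comp_eq_toPol d, comp_toPol, ← comp_eq_toPol] at h3
        split_ifs at h3 with hde
        · subst hde; rw [comp_eq_toPol d φ] at h3 ⊢; exact add_eq_right.1 h3
        · rw [add_zero] at h3; rw [h3]; exact h e (by omega)
      have h4 : (components φ d).1 = 0 := by
        apply Subtype.ext
        funext m
        obtain ⟨i, u, ξ, rfl⟩ := exists_cotChart m
        have h5 := evD_of_hasSymbol (hasSymbol_quantDeg (components φ d)) i u ξ
        rw [h1, LinearMap.neg_apply, map_neg, h2 i u _ (Ideal.pow_mem_pow (testFn_homPt_self i u ξ) d),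
          neg_zero] at h5
        exact (mul_eq_zero.1 ((mul_eq_zero.1 h5.symm).resolve_right (stdDens_ne_zero _))).resolve_left
          (by exact_mod_cast d.factorial_ne_zero)
      exact Subtype.ext h4
    · exact h e he

lemma quantEnd_mem (φ : Pol n) : quantEnd n φ ∈ DensOps (1 / 2) n := by
  refine pol_induction (P := fun φ => quantEnd n φ ∈ DensOps (1 / 2) n) ?_ (fun φ ψ h1 h2 => ?_)
    (fun d f => ?_) φ
  · rw [map_zero]; exact Subalgebra.zero_mem _
  · rw [map_add]; exact Subalgebra.add_mem _ h1 h2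
  · rw [quantEnd_toPol]; exact ⟨d, isDensOp_quantDeg f⟩

/-- The quantization map. -/
def quantMap (n : ℕ) : Pol n ≃ₗ[ℂ] DensOps (1 / 2) n :=
  LinearEquiv.ofBijective ((quantEnd n).codRestrict (DensOps (1 / 2) n).toSubmodule quantEnd_mem) (by
    classical
    refine ⟨(injective_iff_map_eq_zero _).2 fun φ h => ?_, fun D => ?_⟩
    · refine quantEnd_eq_zero ((components φ).support.sup id + 1) (fun e he => ?_)
        (congrArg Subtype.val h)
      have h1 : e ∉ (components φ).support := fun h1 => by
        have := le_sup (f := id) h1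
        simp only [id] at this
        omega
      rw [comp_eq_toPol, DFinsupp.notMem_support_iff.1 h1]
      rfl
    · obtain ⟨k, hk⟩ := D.2
      obtain ⟨φ, hφ⟩ := quantEnd_surj (isDensOp_iff_kills.1 hk)
      exact ⟨φ, Subtype.ext hφ⟩)

lemma quantMap_apply (φ : Pol n) : (quantMap n φ).1 = quantEnd n φ := rfl

end Symbols

/-! ### Equivariance of the quantization map -/

section Equivariance

variable {n : ℕ}

lemma cotAct_dil (g : GL (Fin (n + 1)) ℝ) (t : ℝ) (m : CotP ℝ n) :
    cotAct g (dil t m) = dil t (cotAct g m) := by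
  induction m using Quotient.inductionOn with
  | _ v =>
    refine congrArg (Quotient.mk (cotSetoid ℝ n)) (Subtype.ext (Prod.ext rfl ?_))
    exact Matrix.smul_vecMul t v.1.2 (g⁻¹ : GL (Fin (n + 1)) ℝ).val

/-- The action on functions on the cotangent bundle. -/
def actT (g : GL (Fin (n + 1)) ℝ) (f : SmoothT n) : SmoothT n :=
  ⟨fun m => f.1 (cotAct g m), fun j => contDiff_iff_contDiffAt.2 fun w => by
    obtain ⟨i, hi⟩ := Function.ne_iff.1 (nzAct g ⟨(homPt j w).1, homPt_ne_zero j w⟩).2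
    have h1 : ContDiff ℝ ∞ fun w => pairAct g (homPt j w) :=
      (contDiff_pairAct g).comp (contDiff_homPt j)
    have h2 : ContDiffAt ℝ ∞ (fun w => extZero (homT i f).1 (pairAct g (homPt j w))) w :=
      ((homT i f).2 _ (mem_overChart hi)).comp w h1.contDiffAt
    refine h2.congr_of_eventuallyEq ?_
    have h3 : ContinuousAt (fun w => (pairAct g (homPt j w)).1 i) w :=
      ((continuous_apply i).comp (continuous_fst.comp h1.continuous)).continuousAt
    filter_upwards [h3.eventually_ne hi] with w' hw
    rw [extZero_of_mem _ (mem_overChart hw), homT_apply i f hw (pairAct_cone g (homPt_cone j w')),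
      cotChart_eq_conePt, cotAct_conePt]⟩

lemma actT_mem (g : GL (Fin (n + 1)) ℝ) {d : ℕ} {f : SmoothT n} (hf : f ∈ PolDeg n d) :
    actT g f ∈ PolDeg n d := mem_polDeg_of_dil fun t m => by
  change f.1 (cotAct g (dil t m)) = _ * f.1 (cotAct g m)
  rw [cotAct_dil, PolDeg.dil_eq hf]

lemma infT_mem (X : Matrix (Fin (n + 1)) (Fin (n + 1)) ℝ) {d : ℕ} {f : SmoothT n}
    (hf : f ∈ PolDeg n d) : infT X f ∈ PolDeg n d := mem_polDeg_of_dil fun t m => by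
  change deriv (fun s => f.1 (cotAct (expFlow X s) (dil t m))) 0 = _ * deriv _ 0
  simp only [cotAct_dil, PolDeg.dil_eq hf]
  exact deriv_const_mul_field _

lemma infT_mem_pol (X : Matrix (Fin (n + 1)) (Fin (n + 1)) ℝ) {f : SmoothT n} (hf : f ∈ Pol n) :
    infT X f ∈ Pol n :=
  (iSup_le fun d _ hf => le_iSup (PolDeg n) d (infT_mem X hf) : Pol n ≤ (Pol n).comap (infT X)) hf

/-- The infinitesimal action on symbols. -/
def infPol (X : Matrix (Fin (n + 1)) (Fin (n + 1)) ℝ) : Module.End ℂ (Pol n) :=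
  (infT X).restrict fun _ hf => infT_mem_pol X hf

lemma infD_add (X : Matrix (Fin (n + 1)) (Fin (n + 1)) ℝ) (F G : HD n) :
    infD X (F + G) = infD X F + infD X G :=
  (isInfDens_iff.1 fun x => ((isInfDens_iff.2 rfl : IsInfDens X F (infD X F)) x).add
    ((isInfDens_iff.2 rfl : IsInfDens X G (infD X G)) x)).symm

lemma infD_zero (X : Matrix (Fin (n + 1)) (Fin (n + 1)) ℝ) : infD X (0 : HD n) = 0 := by
  simpa using infD_add X (0 : HD n) 0

lemma infD_quantEnd (X : Matrix (Fin (n + 1)) (Fin (n + 1)) ℝ) (φ : Pol n) (F : HD n) :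
    infD X (quantEnd n φ F) = quantEnd n (infPol X φ) F + quantEnd n φ (infD X F) := by
  refine pol_induction (P := fun φ => infD X (quantEnd n φ F) =
    quantEnd n (infPol X φ) F + quantEnd n φ (infD X F)) ?_ (fun φ ψ h1 h2 => ?_) (fun d f => ?_) φ
  · simp [infD_zero]
  · simp only [map_add, LinearMap.add_apply, infD_add, h1, h2]
    abel
  · have e : infPol X (toPol f) = toPol ⟨infT X f.1, infT_mem X f.2⟩ := rfl
    rw [e, quantEnd_toPol, quantEnd_toPol]
    exact quantDeg_inf (φ' := ⟨infT X f.1, infT_mem X f.2⟩) rfl F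

lemma actT_mem_pol (g : GL (Fin (n + 1)) ℝ) {f : SmoothT n} (hf : f ∈ Pol n) : actT g f ∈ Pol n :=
  pol_induction (P := fun φ => actT g φ.1 ∈ Pol n) (Pol n).zero_mem
    (fun _ _ h1 h2 => (Pol n).add_mem h1 h2) (fun d f => le_iSup (PolDeg n) d (actT_mem g f.2)) ⟨f, hf⟩

lemma quantEnd_actT (g : GL (Fin (n + 1)) ℝ) (φ : Pol n) {F F' : HD n}
    (hF : ∀ x, F'.1 (nzAct g x) = F.1 x) (x : NZ ℝ n) :
    (quantEnd n φ F').1 (nzAct g x) = (quantEnd n ⟨actT g φ.1, actT_mem_pol g φ.2⟩ F).1 x := by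
  refine pol_induction (P := fun φ => (quantEnd n φ F').1 (nzAct g x) =
    (quantEnd n ⟨actT g φ.1, actT_mem_pol g φ.2⟩ F).1 x) ?_ (fun φ ψ h1 h2 => ?_) (fun d f => ?_) φ
  · have e : (⟨actT g (0 : Pol n).1, actT_mem_pol g (0 : Pol n).2⟩ : Pol n) = 0 := rfl
    rw [e, map_zero]
    rfl
  · have e : (⟨actT g (φ + ψ).1, actT_mem_pol g (φ + ψ).2⟩ : Pol n) =
      ⟨actT g φ.1, actT_mem_pol g φ.2⟩ + ⟨actT g ψ.1, actT_mem_pol g ψ.2⟩ := rfl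
    rw [e, map_add, map_add]
    exact congrArg₂ (· + ·) h1 h2
  · rw [quantEnd_toPol, quantDeg_translate (φ := ⟨actT g f.1, actT_mem g f.2⟩) (φ' := f)
      (fun _ => rfl) hF, ← quantEnd_toPol]

lemma isEquivariantQuantization_quantMap : IsEquivariantQuantization (quantMap n) where
  symbol d φ hφ := by
    have e : φ = toPol ⟨φ.1, hφ⟩ := rfl
    rw [quantMap_apply, e, quantEnd_toPol]
    exact hasSymbol_quantDeg _
  equivariant g φ φ' F F' hφ hF x := by
    rw [quantMap_apply, quantMap_apply, quantEnd_actT _ φ' hF]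
    have e : (⟨actT (slGL g) φ'.1, actT_mem_pol _ φ'.2⟩ : Pol n) = φ :=
      Subtype.ext (Subtype.ext (funext hφ))
    rw [e]
  inf_equivariant X _ φ φ' hφ F F' hF := by
    have e : φ' = infPol X φ := Subtype.ext (infT_eq hφ)
    rw [isInfDens_iff] at hF ⊢
    rw [quantMap_apply, quantMap_apply, infD_quantEnd, hF, e]

/-! ### The Casimir operator and uniqueness -/

/-- The derivation is the derivative along a flow that preserves the cone, so it descends to
functions on the cone. -/
lemma lieR_congr_cone (X : Matrix (Fin (n + 1)) (Fin (n + 1)) ℝ) {i : Fin (n + 1)} {f g : Hom n i}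
    (h : ∀ v, ∀ hi : v.1 i ≠ 0, v.1 ⬝ᵥ v.2 = 0 →
      f.1 ⟨v, mem_overChart hi⟩ = g.1 ⟨v, mem_overChart hi⟩)
    {v : (Fin (n + 1) → ℝ) × (Fin (n + 1) → ℝ)} (hi : v.1 i ≠ 0) (hc : v.1 ⬝ᵥ v.2 = 0) :
    (lieR X f).1 ⟨v, mem_overChart hi⟩ = (lieR X g).1 ⟨v, mem_overChart hi⟩ := by
  refine (hasDerivAt_flow X f (mem_overChart hi)).unique
    ((hasDerivAt_flow X g (mem_overChart hi)).congr_of_eventuallyEq ?_)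
  filter_upwards [eventually_flow_ne X hi] with t ht
  rw [extZero_of_mem _ (mem_overChart ht), extZero_of_mem _ (mem_overChart ht),
    h _ ht (pairAct_cone _ hc)]

lemma smoothT_ext_cone {f g : SmoothT n} (h : ∀ v, ∀ i, ∀ hi : v.1 i ≠ 0, ∀ hc : v.1 ⬝ᵥ v.2 = 0,
    f.1 (conePt v (ne_zero_of_apply hi) hc) = g.1 (conePt v (ne_zero_of_apply hi) hc)) : f = g := by
  apply Subtype.ext
  funext m
  obtain ⟨v, h0, hc, rfl⟩ := exists_conePt m
  obtain ⟨i, hi⟩ := Function.ne_iff.1 h0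
  exact h v i hi hc

/-- Scalar matrices generate the scalings and act trivially on invariant functions. Therefore the
Casimir operator of `gl` may be used although equivariance is only assumed for `sl`. -/
lemma infT_sub_smul_one (X : Matrix (Fin (n + 1)) (Fin (n + 1)) ℝ) (c : ℝ) (f : SmoothT n) :
    infT (X - c • 1) f = infT X f := by
  refine smoothT_ext_cone fun v i hi hc => ?_
  rw [infT_conePt _ _ hi hc, infT_conePt _ _ hi hc]
  have h0 := Darboux.Inv.lie_one (homT_inv i f) (c : ℂ)
  have h : lieR (X - c • 1) (homT i f) = lieR X (homT i f) := by
    rw [← sub_zero (lieR X (homT i f)), ← h0]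
    simp only [lieR, Darboux.lie_apply, ← sum_sub_distrib, ← sub_smul]
    refine sum_congr rfl fun a _ => sum_congr rfl fun b _ => ?_
    congr 1
    by_cases hab : a = b <;> simp [hab]
  rw [h]

lemma lieR_single (a b : Fin (n + 1)) {i : Fin (n + 1)} (f : Hom n i) :
    lieR (Matrix.single a b 1) f = (homD n i).lie (Pi.single a (Pi.single b 1)) f := by
  have e : (fun c d => ((Matrix.single a b (1 : ℝ) c d : ℝ) : ℂ)) =
      Pi.single a (Pi.single b (1 : ℂ)) := by
    funext c d
    by_cases h1 : a = c <;> by_cases h2 : b = d <;>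
      simp [Matrix.single, h1, h2, eq_comm]
  exact congrArg (fun Y => (homD n i).lie Y f) e

lemma J_cone {i : Fin (n + 1)} {v : (Fin (n + 1) → ℝ) × (Fin (n + 1) → ℝ)} (hi : v.1 i ≠ 0)
    (hc : v.1 ⬝ᵥ v.2 = 0) : (homD n i).J.1 ⟨v, mem_overChart hi⟩ = 0 := by
  have e : Sm.ev ⟨v, mem_overChart hi⟩ (homD n i).J = ((v.1 ⬝ᵥ v.2 : ℝ) : ℂ) := by
    rw [Darboux.J, map_sum, dotProduct, Complex.ofReal_sum]
    refine sum_congr rfl fun a _ => ?_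
    rw [map_mul, Complex.ofReal_mul]
    rfl
  rw [← Sm.ev_apply, e, hc, Complex.ofReal_zero]

lemma casimir_scalar {M : Type*} [AddCommGroup M] [Module ℂ M] (d c : ℂ) (h : M) :
    (2 : ℂ) • (d • d • h + c • d • h) = (2 * (d * (d + c))) • h := by module

lemma casimir_homT {d : ℕ} (i : Fin (n + 1)) (f : PolDeg n d) :
    ∑ a, ∑ b, lieR (Matrix.single a b 1) (lieR (Matrix.single b a 1) (homT i f.1)) =
      (2 * (d * (d + n)) : ℂ) • homT i f.1 - (2 : ℂ) • ((homD n i).J * (homD n i).lap (homT i f.1)) := by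
  simp only [lieR_single]
  refine (Darboux.Inv.casimir (S := homD n i) (c := (n : ℂ)) (by simp) (homT_inv i f.1)).trans ?_
  rw [homT_E, LinearMap.map_smul, homT_E]
  exact congrArg (· - _) (casimir_scalar _ _ _)

/-- Upstairs the Casimir operator is scalar up to a multiple of `J`, which vanishes on the cone. -/
lemma casimir_cone {d : ℕ} (i : Fin (n + 1)) (f : PolDeg n d)
    {v : (Fin (n + 1) → ℝ) × (Fin (n + 1) → ℝ)} (hi : v.1 i ≠ 0) (hc : v.1 ⬝ᵥ v.2 = 0) :
    ∑ a, ∑ b, (lieR (Matrix.single a b 1) (lieR (Matrix.single b a 1) (homT i f.1))).1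
      ⟨v, mem_overChart hi⟩ = (2 * (d * (d + n)) : ℂ) * (homT i f.1).1 ⟨v, mem_overChart hi⟩ := by
  have h := congrArg (fun g : Hom n i => Sm.ev ⟨v, mem_overChart hi⟩ g) (casimir_homT i f)
  simp only [map_sum, map_sub] at h
  refine h.trans ?_
  change (2 * (d * (d + n)) : ℂ) * (homT i f.1).1 _ - 2 * ((homD n i).J.1 _ * _) = _
  rw [J_cone hi hc, zero_mul, mul_zero, sub_zero]

/-- The Casimir operator on homogeneous symbols. -/
lemma casimir_polDeg {d : ℕ} (f : PolDeg n d) :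
    ∑ a, ∑ b, infT (Matrix.single a b 1) (infT (Matrix.single b a 1) f.1) =
      (2 * (d * (d + n)) : ℂ) • f.1 := by
  refine smoothT_ext_cone fun v i hi hc => ?_
  have h := casimir_cone i f hi hc
  rw [homT_apply i f.1 hi hc] at h
  refine Eq.trans ?_ h
  rw [← evT_apply, map_sum]
  refine sum_congr rfl fun a _ => ?_
  rw [map_sum]
  refine sum_congr rfl fun b _ => ?_
  rw [evT_apply, infT_conePt _ _ hi hc]
  exact lieR_congr_cone _ (fun v hi hc => by rw [homT_apply i _ hi hc, infT_conePt _ _ hi hc]) hi hc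

lemma casimir_pol : ∑ a, ∑ b, infPol (n := n) (Matrix.single a b 1) * infPol (Matrix.single b a 1) =
    diagOp n fun d => 2 * (d * (d + n)) := pol_hom_ext fun d f => by
  rw [diagOp_toPol]
  apply Subtype.ext
  refine Eq.trans ?_ (casimir_polDeg f)
  simp only [LinearMap.sum_apply, Module.End.mul_apply]
  rw [← Submodule.subtype_apply, map_sum]
  refine sum_congr rfl fun a _ => ?_
  rw [map_sum]
  rfl

lemma comp_diagOp (c : ℕ → ℂ) (e : ℕ) (φ : Pol n) : comp e (diagOp n c φ) = c e • comp e φ := by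
  refine pol_induction (P := fun φ => comp e (diagOp n c φ) = c e • comp e φ) ?_
    (fun φ ψ h1 h2 => ?_) (fun d f => ?_) φ
  · have : comp e (0 : Pol n) = 0 := comp_sum ∅ e (fun k : ℕ => (0 : Pol n))
    rw [map_zero, this, smul_zero]
  · rw [map_add, comp_add, comp_add, h1, h2, smul_add]
  · have h : diagOp n c (toPol f) = toPol (c d • f) := diagOp_toPol c f
    rw [h, comp_toPol, comp_toPol]
    split_ifs with hd
    · subst hd; rfl
    · rw [smul_zero]

lemma mem_polDeg_of_diagOp {c : ℕ → ℂ} (hc : Function.Injective c) {d : ℕ} {φ : Pol n}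
    (h : diagOp n c φ = c d • φ) : φ.1 ∈ PolDeg n d := by
  classical
  have h1 : ∀ e ≠ d, comp e φ = 0 := fun e he => by
    have h2 : comp e (c d • φ) = c d • comp e φ :=
      Subtype.ext (congrArg (fun x : Π₀ d, PolDeg n d => (x e).1) (map_smul (componentsL n) (c d) φ))
    have h3 := congrArg (comp e) h
    rw [comp_diagOp, h2, ← sub_eq_zero, ← sub_smul] at h3
    exact (smul_eq_zero.1 h3).resolve_left (sub_ne_zero.2 fun h4 => he (hc h4))
  rw [← sum_comp φ, ← Submodule.subtype_apply, map_sum]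
  refine Submodule.sum_mem _ fun e _ => ?_
  by_cases he : e = d
  · subst he; exact (components φ e).2
  · rw [h1 e he, map_zero]; exact Submodule.zero_mem _

/-- The comparison map `N` commutes with the Lie algebra, hence with the Casimir operator, so it
preserves the eigenspaces, which are the homogeneous components. The symbol condition makes it the
identity on each of them. -/
theorem isEquivariantQuantization_unique {Q : Pol n ≃ₗ[ℂ] DensOps (1 / 2) n}
    (hQ : IsEquivariantQuantization Q) : Q = quantMap n := by
  let N : Module.End ℂ (Pol n) := (quantMap n).symm.toLinearMap ∘ₗ Q.toLinearMap
  have hN : ∀ φ, quantEnd n (N φ) = (Q φ).1 := fun φ => by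
    rw [← quantMap_apply]
    exact congrArg Subtype.val ((quantMap n).apply_symm_apply (Q φ))
  have inj : ∀ {φ ψ}, quantEnd n φ = quantEnd n ψ → φ = ψ := fun h =>
    (quantMap n).injective (Subtype.ext h)
  have h0 : ∀ X : Matrix (Fin (n + 1)) (Fin (n + 1)) ℝ, X.trace = 0 →
      infPol X * N = N * infPol X := fun X hX => LinearMap.ext fun φ => inj (LinearMap.ext fun F => by
    have h1 := isInfDens_iff.1 (hQ.inf_equivariant X hX φ (infPol X φ) (isInfT_infT X φ.1) F
      (infD X F) (isInfDens_iff.2 rfl))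
    rw [← hN, ← hN, infD_quantEnd] at h1
    exact (add_right_cancel h1).symm)
  -- Removing the trace changes nothing in the action, so commutation extends to all matrices, in
  -- particular to the elementary ones in the Casimir operator.
  have h1 : ∀ X, infPol X * N = N * infPol X := fun X => by
    have h2 : infPol (X - (X.trace / (n + 1)) • 1) = infPol X :=
      LinearMap.ext fun φ => Subtype.ext (infT_sub_smul_one X _ φ.1)
    rw [← h2]
    refine h0 _ ?_
    rw [Matrix.trace_sub, Matrix.trace_smul, Matrix.trace_one, smul_eq_mul, Fintype.card_fin]
    push_cast
    field_simp
    ring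
  have h2 : (diagOp n fun d => 2 * (d * (d + n))) * N = N * diagOp n fun d => 2 * (d * (d + n)) := by
    rw [← casimir_pol]
    simp only [sum_mul, mul_sum, mul_assoc, h1]
    simp only [← mul_assoc, h1]
  have hinj : Function.Injective fun d : ℕ => (2 * (d * (d + n)) : ℂ) := by
    intro d e h
    have h' : d * (d + n) = e * (e + n) := by
      have := mul_left_cancel₀ two_ne_zero h
      exact_mod_cast this
    by_contra hne
    rcases Nat.lt_or_gt_of_ne hne with h3 | h3 <;> nlinarith
  -- Once `N f` is homogeneous of degree `d`, both `f` and `N f` are principal symbols of the same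
  -- operator `Q f`.
  have h3 : ∀ (d : ℕ) (f : PolDeg n d), N (toPol f) = toPol f := fun d f => by
    have h4 : (N (toPol f)).1 ∈ PolDeg n d := mem_polDeg_of_diagOp hinj (by
      rw [← Module.End.mul_apply, h2, Module.End.mul_apply, diagOp_toPol, map_smul])
    refine Subtype.ext (hasSymbol_unique (D := (Q (toPol f)).1) (d := d) ?_ (hQ.symbol d _ f.2))
    rw [← hN]
    exact isEquivariantQuantization_quantMap.symbol d _ h4
  have h4 : N = 1 := pol_hom_ext h3
  refine LinearEquiv.ext fun φ => Subtype.ext ?_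
  rw [← hN, h4]
  rfl

end Equivariance

/-! ### The star product -/

section Star

variable {n : ℕ}

/-- The factor between the star product and the invariant bidifferential operator. -/
def starFactor (n q j k : ℕ) : ℂ := eigS n q j * eigS n q k * eigT n q (j + k - q)

/-- The homogeneous parts of the star product. -/
def starPart {j k : ℕ} (q : ℕ) (hq : q ≤ j + k) (φ : PolDeg n j) (ψ : PolDeg n k) :
    PolDeg n (j + k - q) :=
  (starFactor n q j k)⁻¹ • ⟨realBidiff n q φ.1 ψ.1, realBidiff_mem hq φ.2 ψ.2⟩

/-- Dividing `bidiff` by the eigenvalues of `S_p` and `T_p` restores the rational coefficients of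
`bidiff_eq`. -/
lemma toChart_starPart (hn : Odd n) {j k q : ℕ} (hq : q ≤ j + k) (φ : PolDeg n j) (ψ : PolDeg n k)
    (i : Fin (n + 1)) : toChart i (starPart q hq φ ψ).1 =
      ∑ a ∈ antidiagonal q, symbCoeff n (j + k - q : ℕ) a.1 • ((chD n).lap ^ a.1)
        ((chD n).starSeq (fun s => quantCoeff n j s • ((chD n).lap ^ s) (toChart i φ.1))
          (fun s => quantCoeff n k s • ((chD n).lap ^ s) (toChart i ψ.1)) a.2) := by
  have h : toChart i (starPart q hq φ ψ).1 =
      (starFactor n q j k)⁻¹ • toChart i (realBidiff n q φ.1 ψ.1) := rfl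
  have h0 : starFactor n q j k ≠ 0 :=
    mul_ne_zero (mul_ne_zero (eigS_ne_zero hn q j) (eigS_ne_zero hn q k)) (eigT_ne_zero n q _)
  rw [h, toChart_realBidiff, (chD n).bidiff_eq (ch_noNeg n) hq (E_toChart φ.2 i) (E_toChart ψ.2 i)]
  exact inv_smul_smul₀ h0 _

/-- The product of two quantized operators is first written in standard ordered symbols
(`quantOp_comp`), then each of these in quantized ones (`sum_quantOp_symbCoeff`). -/
lemma chQuant_comp (hn : Odd n) {j k : ℕ} (φ : PolDeg n j) (ψ : PolDeg n k) (i : Fin (n + 1))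
    (F : Ch n) : chQuant n j (toChart i φ.1) (chQuant n k (toChart i ψ.1) F) =
      ∑ q ∈ (range (j + k + 1)).attach, chQuant n (j + k - q.1)
        (toChart i (starPart q.1 (Nat.lt_succ_iff.1 (mem_range.1 q.2)) φ ψ).1) F := by
  rw [(ch_noNeg n).quantOp_comp n (E_toChart φ.2 i) (E_toChart ψ.2 i),
    ← (chD n).sum_quantOp_symbCoeff hn.pos,
    Finset.Nat.sum_antidiagonal_eq_sum_range_succ (fun a b => (chD n).quantOp n b
      (∑ c ∈ antidiagonal a, symbCoeff n b c.1 • ((chD n).lap ^ c.1)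
        ((chD n).starSeq (fun s => quantCoeff n j s • ((chD n).lap ^ s) (toChart i φ.1))
          (fun s => quantCoeff n k s • ((chD n).lap ^ s) (toChart i ψ.1)) c.2)) F), ← sum_attach]
  exact sum_congr rfl fun q _ => by rw [toChart_starPart hn]

lemma quantDeg_mul (hn : Odd n) {j k : ℕ} (φ : PolDeg n j) (ψ : PolDeg n k) :
    quantDeg n j φ * quantDeg n k ψ = ∑ q ∈ (range (j + k + 1)).attach, quantDeg n (j + k - q.1)
      (starPart q.1 (Nat.lt_succ_iff.1 (mem_range.1 q.2)) φ ψ) :=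
  LinearMap.ext fun F => densChart_ext fun i => by
    rw [Module.End.mul_apply, densChart_quantDeg, densChart_quantDeg, chQuant_comp hn,
      LinearMap.sum_apply, map_sum]
    exact sum_congr rfl fun q _ => (densChart_quantDeg i _ F).symm

lemma quantMap_symm_mul (hn : Odd n) {j k : ℕ} (φ : PolDeg n j) (ψ : PolDeg n k) :
    (quantMap n).symm (quantMap n (toPol φ) * quantMap n (toPol ψ)) =
      ∑ q ∈ (range (j + k + 1)).attach,
        toPol (starPart q.1 (Nat.lt_succ_iff.1 (mem_range.1 q.2)) φ ψ) := by
  rw [LinearEquiv.symm_apply_eq]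
  apply Subtype.ext
  rw [quantMap_apply, map_sum]
  simp only [quantEnd_toPol]
  rw [← quantDeg_mul hn, ← quantEnd_toPol, ← quantEnd_toPol]
  rfl

lemma comp_quantMap_symm_mul (hn : Odd n) {j k p : ℕ} (hp : p ≤ j + k) (φ : PolDeg n j)
    (ψ : PolDeg n k) :
    comp (j + k - p) ((quantMap n).symm (quantMap n (toPol φ) * quantMap n (toPol ψ))) =
      toPol (starPart p hp φ ψ) := by
  rw [quantMap_symm_mul hn, comp_sum, sum_eq_single ⟨p, mem_range.2 (Nat.lt_succ_of_le hp)⟩]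
  · rw [comp_toPol, if_pos rfl]
  · intro q _ hq
    have := mem_range.1 q.2
    rw [comp_toPol, if_neg fun h => hq (Subtype.ext (by change q.1 = p; omega))]
  · exact fun h => absurd (mem_attach _ _) h

/-- The eigenvalue of `T_p` cancels against `starFactor`. For `p > j + k` the coefficient is zero by
definition and the operator vanishes for reasons of degree. -/
lemma opT_starTerm (hn : Odd n) (p : ℕ) {j k : ℕ} (φ : PolDeg n j) (ψ : PolDeg n k) :
    (opT n p (if p ≤ j + k then comp (j + k - p)
      ((quantMap n).symm (quantMap n (toPol φ) * quantMap n (toPol ψ))) else 0)).1 =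
      ((eigS n p j)⁻¹ * (eigS n p k)⁻¹) • realBidiff n p φ.1 ψ.1 := by
  split_ifs with hp
  · rw [comp_quantMap_symm_mul hn hp, opT_eq, diagOp_toPol]
    change eigT n p (j + k - p) • (starFactor n p j k)⁻¹ • realBidiff n p φ.1 ψ.1 = _
    rw [smul_smul, starFactor]
    congr 1
    have := eigT_ne_zero n p (j + k - p)
    rw [mul_inv, mul_inv]
    field_simp
  · rw [map_zero, realBidiff_eq_zero (by omega) φ.2 ψ.2, smul_zero]
    rfl

lemma isUnit_opT (n p : ℕ) : IsUnit (opT n p) := by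
  rw [opT_eq]; exact (isUnit_diagOp (eigT_ne_zero n p)).1

lemma isUnit_opS (hn : Odd n) (p : ℕ) : IsUnit (opS n p) := by
  rw [opS_eq]; exact (isUnit_diagOp (eigS_ne_zero hn p)).1

lemma inverse_opS_apply (hn : Odd n) (p : ℕ) (φ : Pol n) : opS n p (Ring.inverse (opS n p) φ) = φ := by
  rw [← Module.End.mul_apply, Ring.mul_inverse_cancel _ (isUnit_opS hn p), Module.End.one_apply]

lemma opS_inverse_apply (hn : Odd n) (p : ℕ) (φ : Pol n) : Ring.inverse (opS n p) (opS n p φ) = φ := by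
  rw [← Module.End.mul_apply, Ring.inverse_mul_cancel _ (isUnit_opS hn p), Module.End.one_apply]

lemma opT_injective (n p : ℕ) : Function.Injective (opT n p) := by
  refine Function.LeftInverse.injective (g := (Ring.inverse (opT n p) : Module.End ℂ (Pol n))) fun φ => ?_
  rw [← Module.End.mul_apply, Ring.inverse_mul_cancel _ (isUnit_opT n p), Module.End.one_apply]

open Classical in
lemma inverse_opS_eq_sum (hn : Odd n) (p : ℕ) (φ : Pol n) : (Ring.inverse (opS n p) φ).1 =
    ∑ j ∈ (components φ).support, (eigS n p j)⁻¹ • (components φ j).1 := by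
  rw [opS_eq, (isUnit_diagOp (eigS_ne_zero hn p)).2]
  conv_lhs => rw [← sum_comp φ]
  rw [map_sum, ← Submodule.subtype_apply, map_sum]
  exact sum_congr rfl fun j _ => congrArg Subtype.val (diagOp_toPol _ _)

theorem opT_starCoeff (hn : Odd n) (p : ℕ) (φ ψ : Pol n) :
    (opT n p (starCoeff (quantMap n) p φ ψ)).1 =
      realBidiff n p (Ring.inverse (opS n p) φ).1 (Ring.inverse (opS n p) ψ).1 := by
  classical
  rw [inverse_opS_eq_sum hn, inverse_opS_eq_sum hn, starCoeff, map_sum, ← Submodule.subtype_apply,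
    map_sum, map_sum (realBidiff n p), LinearMap.sum_apply]
  refine sum_congr (by congr!) fun j _ => ?_
  rw [map_sum, map_sum, map_sum]
  refine sum_congr (by congr!) fun k _ => ?_
  refine (opT_starTerm hn p (components φ j) (components ψ k)).trans ?_
  rw [LinearMap.map_smul, LinearMap.map_smul, LinearMap.smul_apply, smul_smul, mul_comm]

/-- As `T_p` is invertible, the required form of the star product says only that `Z` and
`realBidiff` agree on the arguments `S_p⁻¹ φ`, `S_p⁻¹ ψ`. -/
theorem starForm_iff (hn : Odd n) (p : ℕ) {Z : SmoothT n →ₗ[ℂ] SmoothT n →ₗ[ℂ] SmoothT n}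
    {φ ψ : Pol n} : StarForm (quantMap n) p Z φ ψ ↔
      realBidiff n p (Ring.inverse (opS n p) φ).1 (Ring.inverse (opS n p) ψ).1 =
        Z (Ring.inverse (opS n p) φ).1 (Ring.inverse (opS n p) ψ).1 := by
  have hT := isUnit_opT n p
  rw [← opT_starCoeff hn]
  constructor
  · rintro ⟨ζ, h1, h2⟩
    rw [h2, ← Module.End.mul_apply, Ring.mul_inverse_cancel _ hT, ← h1]
    rfl
  · intro h
    refine ⟨_, h, ?_⟩
    rw [← Module.End.mul_apply, Ring.inverse_mul_cancel _ hT]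
    rfl

theorem eq_realBidiff (hn : Odd n) (p : ℕ) {Z : SmoothT n →ₗ[ℂ] SmoothT n →ₗ[ℂ] SmoothT n}
    (hZ : IsBidiff Z) (h : ∀ φ ψ : Pol n, φ.1 ∈ momentumAlg n → ψ.1 ∈ momentumAlg n →
      realBidiff n p φ.1 ψ.1 = Z φ.1 ψ.1) : Z = realBidiff n p :=
  bidiff_ext hn.pos hZ (isBidiff_realBidiff n p) fun r hr s hs =>
    (h ⟨r, (momentumAlg_stable hr).1⟩ ⟨s, (momentumAlg_stable hs).1⟩ hr hs).symm

theorem eq_realBidiff_of_starForm (hn : Odd n) (p : ℕ)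
    {Z : SmoothT n →ₗ[ℂ] SmoothT n →ₗ[ℂ] SmoothT n} (hZ : IsBidiff Z)
    (h : ∀ φ ψ : Pol n, φ.1 ∈ momentumAlg n → ψ.1 ∈ momentumAlg n →
      StarForm (quantMap n) p Z φ ψ) : Z = realBidiff n p :=
  eq_realBidiff hn p hZ fun φ ψ hφ hψ => by
    have h1 := (starForm_iff hn p).1 (h _ _ (opS_mem_momentumAlg p hφ) (opS_mem_momentumAlg p hψ))
    rwa [opS_inverse_apply hn, opS_inverse_apply hn] at h1

theorem eq_starCoeff (hn : Odd n) (p : ℕ) {C : Pol n → Pol n → Pol n}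
    {W : SmoothT n →ₗ[ℂ] SmoothT n →ₗ[ℂ] SmoothT n} (hW : IsBidiff W)
    (hC : ∀ φ ψ : Pol n, W φ.1 ψ.1 = (opT n p (C (opS n p φ) (opS n p ψ))).1)
    (h : ∀ φ ψ : Pol n, φ.1 ∈ momentumAlg n → ψ.1 ∈ momentumAlg n →
      C φ ψ = starCoeff (quantMap n) p φ ψ) : C = starCoeff (quantMap n) p := by
  have h1 : W = realBidiff n p := eq_realBidiff hn p hW fun φ ψ hφ hψ => by
    rw [hC, h _ _ (opS_mem_momentumAlg p hφ) (opS_mem_momentumAlg p hψ), opT_starCoeff hn,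
      opS_inverse_apply hn, opS_inverse_apply hn]
  funext φ ψ
  refine opT_injective n p (Subtype.ext ?_)
  rw [opT_starCoeff hn, ← h1, hC, inverse_opS_apply hn, inverse_opS_apply hn]

end Star

/-! ### Polynomials and subalgebras stable under the partial derivatives -/

namespace Darboux

variable {ι : Type} [Fintype ι] [DecidableEq ι] {O : Type} [CommRing O] [Algebra ℂ O]
  (S : Darboux ι O)

/-- A derivation of a subalgebra. -/
def restrictDer {A : Subalgebra ℂ O} (D : Derivation ℂ O O) (h : ∀ f ∈ A, D f ∈ A) :
    Derivation ℂ A A :=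
  Derivation.mk'
    { toFun := fun f => ⟨D f.1, h _ f.2⟩
      map_add' := fun f g => Subtype.ext (map_add D f.1 g.1)
      map_smul' := fun c f => Subtype.ext (D.map_smul c f.1) }
    fun f g => Subtype.ext (D.leibniz f.1 g.1)

/-- The canonical coordinates on a subalgebra stable under the partial derivatives. -/
def restrict (A : Subalgebra ℂ O) (h1 : ∀ a, ∀ f ∈ A, S.dx a f ∈ A) (h2 : ∀ a, ∀ f ∈ A, S.dξ a f ∈ A)
    (h3 : ∀ a, S.x a ∈ A) (h4 : ∀ a, S.ξ a ∈ A) : Darboux ι A where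
  dx a := restrictDer (S.dx a) (h1 a)
  dξ a := restrictDer (S.dξ a) (h2 a)
  x a := ⟨S.x a, h3 a⟩
  ξ a := ⟨S.ξ a, h4 a⟩
  dx_dx a b f := Subtype.ext (S.dx_dx a b f.1)
  dx_dξ a b f := Subtype.ext (S.dx_dξ a b f.1)
  dξ_dξ a b f := Subtype.ext (S.dξ_dξ a b f.1)
  dx_x a b := Subtype.ext ((S.dx_x a b).trans (by split_ifs <;> rfl))
  dx_ξ a b := Subtype.ext (S.dx_ξ a b)
  dξ_x a b := Subtype.ext (S.dξ_x a b)
  dξ_ξ a b := Subtype.ext ((S.dξ_ξ a b).trans (by split_ifs <;> rfl))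

lemma compat_restrict {A : Subalgebra ℂ O} (h1 : ∀ a, ∀ f ∈ A, S.dx a f ∈ A)
    (h2 : ∀ a, ∀ f ∈ A, S.dξ a f ∈ A) (h3 : ∀ a, S.x a ∈ A) (h4 : ∀ a, S.ξ a ∈ A) :
    Compat (S.restrict A h1 h2 h3 h4) S A.val.toLinearMap :=
  compat_of_commute (fun _ _ => rfl) (fun _ _ => rfl) fun _ => rfl

/-- The operator is run inside the subalgebra, and naturality under the inclusion identifies the
results. -/
lemma bidiff_mem {A : Subalgebra ℂ O} (h1 : ∀ a, ∀ f ∈ A, S.dx a f ∈ A)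
    (h2 : ∀ a, ∀ f ∈ A, S.dξ a f ∈ A) (h3 : ∀ a, S.x a ∈ A) (h4 : ∀ a, S.ξ a ∈ A)
    (c : ℂ) (p : ℕ) (σ τ : ℕ → ℂ[X]) {f g : O} (hf : f ∈ A) (hg : g ∈ A) :
    S.bidiff c p σ τ f g ∈ A := by
  have h := (S.compat_restrict h1 h2 h3 h4).bidiff c p σ τ ⟨f, hf⟩ ⟨g, hg⟩
  exact h ▸ ((S.restrict A h1 h2 h3 h4).bidiff c p σ τ ⟨f, hf⟩ ⟨g, hg⟩).2

/-- Polynomials in the coordinates. -/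
def poly : MvPolynomial (ι ⊕ ι) ℂ →ₐ[ℂ] O := MvPolynomial.aeval (Sum.elim S.x S.ξ)

lemma derivation_poly {D : Derivation ℂ O O} {D' : Derivation ℂ (MvPolynomial (ι ⊕ ι) ℂ) (MvPolynomial (ι ⊕ ι) ℂ)}
    (h : ∀ a, D (S.poly (MvPolynomial.X a)) = S.poly (D' (MvPolynomial.X a)))
    (P : MvPolynomial (ι ⊕ ι) ℂ) : D (S.poly P) = S.poly (D' P) := by
  induction P using MvPolynomial.induction_on with
  | C c =>
    have h1 : S.poly (MvPolynomial.C c) = algebraMap ℂ O c := S.poly.commutes c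
    have h2 : D' (MvPolynomial.C c) = 0 := D'.map_algebraMap c
    rw [h1, h2, D.map_algebraMap, map_zero]
  | add P R hP hR => rw [map_add, map_add, map_add, map_add, hP, hR]
  | mul_X P a hP =>
    rw [map_mul, D.leibniz, D'.leibniz, map_add, smul_eq_mul, smul_eq_mul, smul_eq_mul, smul_eq_mul,
      map_mul, map_mul, hP, h]

lemma dx_poly (a : ι) (P : MvPolynomial (ι ⊕ ι) ℂ) :
    S.dx a (S.poly P) = S.poly (MvPolynomial.pderiv (Sum.inl a) P) := by
  refine S.derivation_poly (fun b => ?_) P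
  cases b with
  | inl b => simp [poly, S.dx_x, MvPolynomial.pderiv_X, Pi.single_apply, eq_comm]
  | inr b => simp [poly, S.dx_ξ, MvPolynomial.pderiv_X]

lemma dξ_poly (a : ι) (P : MvPolynomial (ι ⊕ ι) ℂ) :
    S.dξ a (S.poly P) = S.poly (MvPolynomial.pderiv (Sum.inr a) P) := by
  refine S.derivation_poly (fun b => ?_) P
  cases b with
  | inl b => simp [poly, S.dξ_x, MvPolynomial.pderiv_X]
  | inr b => simp [poly, S.dξ_ξ, MvPolynomial.pderiv_X, Pi.single_apply, eq_comm]

end Darboux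

/-! ### Rational functions on open subsets of `ℂ^n × ℂ^n` -/

section Rational

variable {n : ℕ}

/-- The canonical coordinates on an open subset of `ℂ^n × ℂ^n`. -/
abbrev cxD (Ω : Opens ((Fin n → ℂ) × (Fin n → ℂ))) : Darboux (Fin n) (Sm ℂ Ω) :=
  (Frame.std ℂ (Fin n)).darboux Ω

/-- Evaluation of a polynomial. -/
abbrev pev (P : MvPolynomial (Fin n ⊕ Fin n) ℂ) (w : (Fin n → ℂ) × (Fin n → ℂ)) : ℂ :=
  MvPolynomial.eval (Sum.elim w.1 w.2) P

variable {Ω : Opens ((Fin n → ℂ) × (Fin n → ℂ))}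

lemma poly_apply (P : MvPolynomial (Fin n ⊕ Fin n) ℂ) (w : Ω) : ((cxD Ω).poly P).1 w = pev P w.1 := by
  induction P using MvPolynomial.induction_on with
  | C c =>
    have h1 : (cxD Ω).poly (MvPolynomial.C c) = algebraMap ℂ _ c := (cxD Ω).poly.commutes c
    rw [h1, pev, MvPolynomial.eval_C]
    rfl
  | add P R hP hR => rw [map_add, Sm.add_apply, hP, hR, pev, pev, pev, map_add]
  | mul_X P a hP =>
    have h1 : (cxD Ω).poly (MvPolynomial.X a) = Sum.elim (cxD Ω).x (cxD Ω).ξ a :=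
      MvPolynomial.aeval_X _ a
    rw [map_mul, Sm.mul_apply, hP, h1, pev, pev, map_mul, MvPolynomial.eval_X]
    cases a <;> rfl

lemma contDiff_pev (P : MvPolynomial (Fin n ⊕ Fin n) ℂ) : ContDiff ℂ ∞ (pev P) := by
  rw [contDiff_iff_contDiffAt]
  intro w
  refine (((cxD ⊤).poly P).2 w trivial).congr_of_eventuallyEq (Filter.Eventually.of_forall fun v => ?_)
  rw [extZero_of_mem _ (Opens.mem_top v), poly_apply]

/-- Functions which are locally quotients of polynomials. -/
def Rat (Ω : Opens ((Fin n → ℂ) × (Fin n → ℂ))) : Subalgebra ℂ (Sm ℂ Ω) where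
  carrier := {f | ∀ w : Ω, ∃ P R, pev R w.1 ≠ 0 ∧ (cxD Ω).poly R * f = (cxD Ω).poly P}
  mul_mem' := by
    intro f g hf hg w
    obtain ⟨P, R, h1, h2⟩ := hf w
    obtain ⟨P', R', h3, h4⟩ := hg w
    exact ⟨P * P', R * R', by rw [pev, map_mul]; exact mul_ne_zero h1 h3, by
      rw [map_mul, map_mul, mul_mul_mul_comm, h2, h4]⟩
  add_mem' := by
    intro f g hf hg w
    obtain ⟨P, R, h1, h2⟩ := hf w
    obtain ⟨P', R', h3, h4⟩ := hg w
    exact ⟨R' * P + R * P', R * R', by rw [pev, map_mul]; exact mul_ne_zero h1 h3, by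
      rw [map_mul, map_add, map_mul, map_mul, ← h2, ← h4]; ring⟩
  algebraMap_mem' c w := ⟨MvPolynomial.C c, 1, by simp [pev], by
    rw [map_one, one_mul]; exact ((cxD Ω).poly.commutes c).symm⟩

lemma poly_mem_rat (P : MvPolynomial (Fin n ⊕ Fin n) ℂ) : (cxD Ω).poly P ∈ Rat Ω := fun _ =>
  ⟨P, 1, by simp [pev], by rw [map_one, one_mul]⟩

/-- The quotient rule in multiplied form: differentiating `R f = P` and multiplying by `R` gives `R²
D f = R D P - P D R`. -/
lemma derivation_mem_rat {D : Derivation ℂ (Sm ℂ Ω) (Sm ℂ Ω)}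
    (hD : ∀ P, ∃ P', D ((cxD Ω).poly P) = (cxD Ω).poly P') {f : Sm ℂ Ω} (hf : f ∈ Rat Ω) :
    D f ∈ Rat Ω := fun w => by
  obtain ⟨P, R, h1, h2⟩ := hf w
  obtain ⟨P', hP⟩ := hD P
  obtain ⟨R', hR⟩ := hD R
  have h3 := congrArg D h2
  rw [D.leibniz, hP, hR, smul_eq_mul, smul_eq_mul] at h3
  refine ⟨R * P' - P * R', R * R, by rw [pev, map_mul]; exact mul_ne_zero h1 h1, ?_⟩
  rw [map_mul, map_sub, map_mul, map_mul, ← h3, ← h2]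
  ring

lemma dx_mem_rat (a : Fin n) (f : Sm ℂ Ω) (hf : f ∈ Rat Ω) : (cxD Ω).dx a f ∈ Rat Ω :=
  derivation_mem_rat (fun P => ⟨_, (cxD Ω).dx_poly a P⟩) hf

lemma dξ_mem_rat (a : Fin n) (f : Sm ℂ Ω) (hf : f ∈ Rat Ω) : (cxD Ω).dξ a f ∈ Rat Ω :=
  derivation_mem_rat (fun P => ⟨_, (cxD Ω).dξ_poly a P⟩) hf

lemma x_mem_rat (a : Fin n) : (cxD Ω).x a ∈ Rat Ω := by
  have e : (cxD Ω).poly (MvPolynomial.X (Sum.inl a)) = (cxD Ω).x a := MvPolynomial.aeval_X _ _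
  rw [← e]; exact poly_mem_rat _

lemma ξ_mem_rat (a : Fin n) : (cxD Ω).ξ a ∈ Rat Ω := by
  have e : (cxD Ω).poly (MvPolynomial.X (Sum.inr a)) = (cxD Ω).ξ a := MvPolynomial.aeval_X _ _
  rw [← e]; exact poly_mem_rat _

lemma bidiff_mem_rat (p : ℕ) {f g : Sm ℂ Ω} (hf : f ∈ Rat Ω) (hg : g ∈ Rat Ω) :
    (cxD Ω).bidiff n p (sig p) (tau p) f g ∈ Rat Ω :=
  (cxD Ω).bidiff_mem dx_mem_rat dξ_mem_rat x_mem_rat ξ_mem_rat _ _ _ _ hf hg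

lemma E_mem_rat {f : Sm ℂ Ω} (hf : f ∈ Rat Ω) : (cxD Ω).E f ∈ Rat Ω := by
  rw [Darboux.E_apply]
  exact Subalgebra.sum_mem _ fun a _ => Subalgebra.mul_mem _ (ξ_mem_rat a) (dξ_mem_rat a f hf)

/-! ### Regular functions in charts -/

/-- A Zariski open set in a chart. -/
def zop (U : ZOpen n) (i : Fin (n + 1)) : Opens ((Fin n → ℂ) × (Fin n → ℂ)) where
  carrier := {w | cotChart i w.1 w.2 ∈ U.carrier}
  is_open' := by
    obtain ⟨S, hS⟩ := U.isOpen i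
    have h : {w : (Fin n → ℂ) × (Fin n → ℂ) | cotChart i w.1 w.2 ∈ U.carrier} =
        ⋃ P ∈ S, {w | pev P w ≠ 0} := by
      ext w
      simp [hS, pev]
    rw [h]
    exact isOpen_biUnion fun P _ => isOpen_ne_fun (contDiff_pev P).continuous continuous_const

/-- A regular function in a chart. -/
def regChart (U : ZOpen n) (i : Fin (n + 1)) : Reg U →ₐ[ℂ] Sm ℂ (zop U i) where
  toFun φ := ⟨fun w => φ.1 ⟨cotChart i w.1.1 w.1.2, w.2⟩, fun w hw => by
    obtain ⟨P, R, h1, h2⟩ := φ.2 i w.1 w.2 hw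
    refine (((contDiff_pev P).contDiffAt.div (contDiff_pev R).contDiffAt h1)).congr_of_eventuallyEq ?_
    filter_upwards [(zop U i).isOpen.mem_nhds hw,
      (contDiff_pev R).continuous.continuousAt.eventually_ne h1] with v hv hR
    rw [extZero_of_mem _ hv]
    exact h2 v.1 v.2 hv hR⟩
  map_one' := rfl
  map_mul' _ _ := rfl
  map_zero' := rfl
  map_add' _ _ := rfl
  commutes' _ := rfl

lemma regChart_mem (U : ZOpen n) (i : Fin (n + 1)) (φ : Reg U) : regChart U i φ ∈ Rat (zop U i) :=
  fun w => by
    obtain ⟨P, R, h1, h2⟩ := φ.2 i w.1.1 w.1.2 w.2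
    -- The identity `R φ = P` is known only where `R ≠ 0`; the additional factor `R` makes it valid
    -- on the whole chart.
    refine ⟨R * P, R * R, by rw [pev, map_mul]; exact mul_ne_zero h1 h1, ?_⟩
    ext v
    rw [Sm.mul_apply, poly_apply, poly_apply, pev, pev, map_mul, map_mul]
    by_cases hR : MvPolynomial.eval (Sum.elim v.1.1 v.1.2) R = 0
    · simp [hR]
    · rw [mul_assoc]
      congr 1
      exact (congrArg _ (h2 _ _ v.2 hR)).trans (mul_div_cancel₀ _ hR)

lemma regChart_ext {U : ZOpen n} {φ ψ : Reg U} (h : ∀ i, regChart U i φ = regChart U i ψ) : φ = ψ := by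
  apply Subtype.ext
  funext m
  obtain ⟨m, hm⟩ := m
  obtain ⟨i, u, ξ, rfl⟩ := exists_cotChart m
  exact congrArg (fun f : Sm ℂ (zop U i) => f.1 ⟨(u, ξ), hm⟩) (h i)

lemma exists_reg {U : ZOpen n} {c : ∀ i, Sm ℂ (zop U i)} (hc : ∀ i, c i ∈ Rat (zop U i))
    (h : ∀ i j, ChartEq 1 i j (c j) (c i)) : ∃ F : Reg U, ∀ i, regChart U i F = c i := by
  obtain ⟨F, hF⟩ := exists_glue U.carrier (fun i w => extZero (c i).1 w)
    (fun i j v hj hi hv hU => by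
      have hi' : (pairAct 1 v).1 i ≠ 0 := by simpa using hi
      have hU' : affPt i (pairAct 1 v) ∈ zop U i := by
        change cotChart i (affPt i (pairAct 1 v)).1 (affPt i (pairAct 1 v)).2 ∈ U.carrier
        rw [← cotAct_cotChart_affPt 1 hj hi' hv, cotAct_one]
        exact hU
      have h1 := h i j v ⟨⟨hj, hi'⟩, hU, hU'⟩ hv
      refine (extZero_of_mem (c j).1 (w := affPt j v) hU).trans (h1.trans ?_)
      exact (extZero_of_mem (c i).1 hU').symm.trans (by rw [pairAct_one]))
  have hF' : ∀ i (w : zop U i), F (cotChart i w.1.1 w.1.2) = (c i).1 w := fun i w =>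
    (hF i w.1 w.2).trans (extZero_coe _ w)
  refine ⟨⟨fun m => F m.1, fun i u ξ hm => ?_⟩, fun i => Sm.ext fun w => hF' i w⟩
  obtain ⟨P, R, h1, h2⟩ := hc i ⟨(u, ξ), hm⟩
  refine ⟨P, R, h1, fun u' ξ' hm' hR => ?_⟩
  have h3 := congrArg (fun f : Sm ℂ (zop U i) => f.1 ⟨(u', ξ'), hm'⟩) h2
  simp only [Sm.mul_apply, poly_apply] at h3
  rw [eq_div_iff hR, mul_comm]
  exact (congrArg _ (hF' i ⟨(u', ξ'), hm'⟩)).trans h3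

/-- A regular function is translated to another one, where both are defined. -/
def RegEq (g : GL (Fin (n + 1)) ℂ) {U V : ZOpen n} (φ : Reg U) (φ' : Reg V) : Prop :=
  ∀ m, ∀ h : m ∈ U.carrier, ∀ h' : cotAct g m ∈ V.carrier, φ'.1 ⟨cotAct g m, h'⟩ = φ.1 ⟨m, h⟩

lemma regEq_iff {g : GL (Fin (n + 1)) ℂ} {U V : ZOpen n} {φ : Reg U} {φ' : Reg V} :
    RegEq g φ φ' ↔ ∀ i j, ChartEq g i j (regChart U j φ) (regChart V i φ') := by
  constructor
  · intro h i j v hv hc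
    have e := cotAct_cotChart_affPt g hv.1.1 hv.1.2 hc
    have h1 := h _ hv.2.1 (by rw [e]; exact hv.2.2)
    refine h1.symm.trans (congrArg φ'.1 (Subtype.ext e))
  · intro h m hm hm'
    obtain ⟨v, h0, hc, rfl⟩ := exists_conePt m
    obtain ⟨j, hj⟩ := Function.ne_iff.1 h0
    obtain ⟨i, hi⟩ := Function.ne_iff.1 (nzAct g ⟨v.1, h0⟩).2
    have e1 := conePt_eq_cotChart hj hc
    have e2 := conePt_eq_cotChart (v := pairAct g v) hi (pairAct_cone g hc)
    have hm2 : cotChart i (affPt i (pairAct g v)).1 (affPt i (pairAct g v)).2 ∈ V.carrier := by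
      rw [← e2]; exact hm'
    have h1 := h i j v ⟨⟨hj, hi⟩, (e1 ▸ hm : cotChart _ _ _ ∈ _), hm2⟩ hc
    exact (congrArg φ'.1 (Subtype.ext e2)).trans (h1.symm.trans (congrArg φ.1 (Subtype.ext e1.symm)))

lemma regEq_self {U : ZOpen n} (φ : Reg U) : RegEq 1 φ φ := fun m _ _ =>
  congrArg φ.1 (Subtype.ext (cotAct_one m))

end Rational

/-! ### The complex bidifferential operator -/

section Complex

variable {n : ℕ}

/-- The operator in a complex chart. -/
abbrev cxBidiff (p : ℕ) (Ω : Opens ((Fin n → ℂ) × (Fin n → ℂ))) :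
    Sm ℂ Ω →ₗ[ℂ] Sm ℂ Ω →ₗ[ℂ] Sm ℂ Ω := (cxD Ω).bidiff n p (sig p) (tau p)

lemma exists_cxBidiff (p : ℕ) (U : ZOpen n) : ∃ Z : Reg U →ₗ[ℂ] Reg U →ₗ[ℂ] Reg U, ∀ i φ ψ,
    regChart U i (Z φ ψ) = cxBidiff p (zop U i) (regChart U i φ) (regChart U i ψ) := by
  choose Z hZ using fun φ ψ : Reg U => exists_reg
    (c := fun i => cxBidiff p (zop U i) (regChart U i φ) (regChart U i ψ))
    (fun i => bidiff_mem_rat p (regChart_mem U i φ) (regChart_mem U i ψ))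
    fun i j => (regEq_iff.1 (regEq_self φ) i j).bidiff p (regEq_iff.1 (regEq_self ψ) i j)
  refine ⟨LinearMap.mk₂ ℂ Z ?_ ?_ ?_ ?_, fun i φ ψ => hZ φ ψ i⟩
  · exact fun f f' g => regChart_ext fun i => by
      rw [map_add, hZ, hZ, hZ, map_add, map_add, LinearMap.add_apply]
  · exact fun c f g => regChart_ext fun i => by
      rw [map_smul, hZ, hZ, map_smul, map_smul, LinearMap.smul_apply]
  · exact fun f g g' => regChart_ext fun i => by rw [map_add, hZ, hZ, hZ, map_add, map_add]
  · exact fun c f g => regChart_ext fun i => by rw [map_smul, hZ, hZ, map_smul, map_smul]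

/-- The invariant bidifferential operator on regular functions. -/
def regBidiff (p : ℕ) (U : ZOpen n) : Reg U →ₗ[ℂ] Reg U →ₗ[ℂ] Reg U := (exists_cxBidiff p U).choose

lemma regChart_regBidiff (p : ℕ) (U : ZOpen n) (i : Fin (n + 1)) (φ ψ : Reg U) :
    regChart U i (regBidiff p U φ ψ) = cxBidiff p (zop U i) (regChart U i φ) (regChart U i ψ) :=
  (exists_cxBidiff p U).choose_spec i φ ψ

lemma RegEq.bidiff {g : GL (Fin (n + 1)) ℂ} {U V : ZOpen n} {φ ψ : Reg U} {φ' ψ' : Reg V}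
    (h1 : RegEq g φ φ') (h2 : RegEq g ψ ψ') (p : ℕ) :
    RegEq g (regBidiff p U φ ψ) (regBidiff p V φ' ψ') := regEq_iff.2 fun i j => by
  rw [regChart_regBidiff, regChart_regBidiff]
  exact (regEq_iff.1 h1 i j).bidiff p (regEq_iff.1 h2 i j)

lemma regEq_of_restrict {U V : ZOpen n} {hVU : V.carrier ⊆ U.carrier} {φ : Reg U} {φ' : Reg V}
    (h : ∀ m : V.carrier, φ'.1 m = φ.1 ⟨m, hVU m.2⟩) : RegEq 1 φ φ' := fun m _ h' =>
  (h ⟨_, h'⟩).trans (congrArg φ.1 (Subtype.ext (cotAct_one m)))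

lemma RegEq.restrict {U V : ZOpen n} {φ : Reg U} {φ' : Reg V} (h : RegEq 1 φ φ')
    (hVU : V.carrier ⊆ U.carrier) (m : V.carrier) : φ'.1 m = φ.1 ⟨m, hVU m.2⟩ := by
  have h1 := h m.1 (hVU m.2) (by rw [cotAct_one]; exact m.2)
  exact (congrArg φ'.1 (Subtype.ext (cotAct_one m.1).symm)).trans h1

lemma IsTranslate.regEq {g : Matrix.SpecialLinearGroup (Fin (n + 1)) ℂ} {U V : ZOpen n}
    {hUV : ∀ m, cotAct (slGL g) m ∈ V.carrier ↔ m ∈ U.carrier} {φ : Reg U} {φ' : Reg V}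
    (h : IsTranslate g hUV φ φ') : RegEq (slGL g) φ φ' := fun m hm _ => h ⟨m, hm⟩

lemma isDiffOp_of_regChart {k : ℕ} {U : ZOpen n} {D : Reg U → Reg U}
    {D' : ∀ i, Sm ℂ (zop U i) → Sm ℂ (zop U i)}
    (hD : ∀ i φ, regChart U i (D φ) = D' i (regChart U i φ))
    (h : ∀ i, IsDiffOp (Sm ℂ (zop U i)) k (D' i)) : IsDiffOp (Reg U) k D :=
  IsDiffOp.of_family (Oi := fun i => Sm ℂ (zop U i)) (Mi := fun i => Sm ℂ (zop U i))
    (Ni := fun i => Sm ℂ (zop U i)) (fun i => regChart U i) (fun i => regChart U i)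
    (fun i => regChart U i) (fun _ _ _ => rfl) (fun _ _ _ => rfl) (fun _ _ _ => rfl)
    (fun _ _ h => regChart_ext h) hD h

/-- The invariant algebraic bidifferential operator on the complex cotangent bundle. -/
def algBidiff (n p : ℕ) : AlgBidiffOp n where
  toFun := regBidiff p
  restrict _ _ hVU _ _ _ _ h1 h2 :=
    ((regEq_of_restrict (hVU := hVU) h1).bidiff (regEq_of_restrict (hVU := hVU) h2) p).restrict hVU
  bidiff := ⟨bidiffOrder p, fun U => ⟨fun φ => isDiffOp_of_regChart
      (fun i ψ => regChart_regBidiff p U i φ ψ) fun i =>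
        ((cxD (zop U i)).isBidiffOfOrder_bidiff n p (sig p) (tau p)).1 (regChart U i φ),
    fun ψ => isDiffOp_of_regChart (fun i φ => regChart_regBidiff p U i φ ψ) fun i =>
        ((cxD (zop U i)).isBidiffOfOrder_bidiff n p (sig p) (tau p)).2 (regChart U i ψ)⟩⟩

lemma isInvariant_algBidiff (n p : ℕ) : (algBidiff n p).IsInvariant :=
  fun _ _ _ hUV _ _ _ _ h1 h2 m => (h1.regEq.bidiff h2.regEq p) m m.2 ((hUV m).2 m.2)

/-! ### The complex Euler operator -/

lemma hasDerivAt_dil {Ω : Opens ((Fin n → ℂ) × (Fin n → ℂ))} (f : Sm ℂ Ω) (w : Ω) :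
    HasDerivAt (fun t : ℂ => extZero f.1 (w.1.1, t • w.1.2)) (((cxD Ω).E f).1 w) 1 := by
  have hc : HasDerivAt (fun t : ℂ => (w.1.1, t • w.1.2)) (0, w.1.2) 1 :=
    (hasDerivAt_const 1 w.1.1).prodMk (by simpa using (hasDerivAt_id (1 : ℂ)).smul_const w.1.2)
  have e : (w.1.1, (1 : ℂ) • w.1.2) = w.1 := by rw [one_smul]
  have hw : (w.1.1, (1 : ℂ) • w.1.2) ∈ Ω := by rw [e]; exact w.2
  have h2 : (Sm.d (0, w.1.2) f).1 w = (Sm.d (0, w.1.2) f).1 ⟨_, hw⟩ :=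
    congrArg (Sm.d (0, w.1.2) f).1 (Subtype.ext e.symm)
  exact (Sm.hasDerivAt_comp f hc hw).congr_deriv (h2.symm.trans (Frame.E_std f w).symm)

/-- The Euler operator is the derivative along the fibre dilations, which commute with the changes
of charts and with `g` and preserve the cone. -/
lemma ChartEq.E {g : GL (Fin (n + 1)) ℂ} {i j : Fin (n + 1)}
    {Ω Ω' : Opens ((Fin n → ℂ) × (Fin n → ℂ))} {f : Sm ℂ Ω} {f' : Sm ℂ Ω'}
    (h : ChartEq g i j f f') : ChartEq g i j ((cxD Ω).E f) ((cxD Ω').E f') := by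
  intro v hv hc
  refine (hasDerivAt_dil f ⟨_, hv.2.1⟩).unique
    ((hasDerivAt_dil f' ⟨_, hv.2.2⟩).congr_of_eventuallyEq ?_)
  have hcont : Continuous fun t : ℂ => ((v.1, t • v.2) : (Fin (n + 1) → ℂ) × (Fin (n + 1) → ℂ)) := by
    fun_prop
  have hv1 : ((v.1, (1 : ℂ) • v.2) : (Fin (n + 1) → ℂ) × (Fin (n + 1) → ℂ)) ∈ overlap g i j Ω Ω' := by
    rw [one_smul]; exact hv
  filter_upwards [hcont.continuousAt.preimage_mem_nhds ((overlap g i j Ω Ω').isOpen.mem_nhds hv1)]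
    with t ht
  have e1 : affPt j (v.1, t • v.2) = ((affPt j v).1, t • (affPt j v).2) :=
    Prod.ext rfl (by funext k; simp [affPt, mul_left_comm])
  have e2 : affPt i (pairAct g (v.1, t • v.2)) =
      ((affPt i (pairAct g v)).1, t • (affPt i (pairAct g v)).2) :=
    Prod.ext rfl (by funext k; simp [affPt, pairAct, Matrix.smul_vecMul, mul_left_comm])
  have h1 := h _ ht (by rw [dotProduct_smul, hc, smul_zero])
  rw [← e1, ← e2]
  exact (extZero_of_mem _ ht.2.1).trans (h1.trans (extZero_of_mem _ ht.2.2).symm)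

/-- The shifted Euler operator in a complex chart. -/
abbrev cxEuler (Ω : Opens ((Fin n → ℂ) × (Fin n → ℂ))) : Sm ℂ Ω →ₗ[ℂ] Sm ℂ Ω :=
  (cxD Ω).E + ((n : ℂ) / 2) • LinearMap.id

lemma cxEuler_apply {Ω : Opens ((Fin n → ℂ) × (Fin n → ℂ))} (f : Sm ℂ Ω) (w : Ω) :
    (cxEuler Ω f).1 w = ((cxD Ω).E f).1 w + (n : ℂ) / 2 * f.1 w := rfl

lemma ChartEq.cxEuler {g : GL (Fin (n + 1)) ℂ} {i j : Fin (n + 1)}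
    {Ω Ω' : Opens ((Fin n → ℂ) × (Fin n → ℂ))} {f : Sm ℂ Ω} {f' : Sm ℂ Ω'}
    (h : ChartEq g i j f f') : ChartEq g i j (cxEuler Ω f) (cxEuler Ω' f') := fun v hv hc => by
  rw [cxEuler_apply, cxEuler_apply, h v hv hc, h.E v hv hc]

lemma exists_cxEuler (U : ZOpen n) : ∃ L : Reg U →ₗ[ℂ] Reg U, ∀ i φ,
    regChart U i (L φ) = cxEuler (zop U i) (regChart U i φ) := by
  choose L hL using fun φ : Reg U => exists_reg (c := fun i => cxEuler (zop U i) (regChart U i φ))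
    (fun i => Subalgebra.add_mem _ (E_mem_rat (regChart_mem U i φ))
      (Subalgebra.smul_mem _ (regChart_mem U i φ) _))
    fun i j => (regEq_iff.1 (regEq_self φ) i j).cxEuler
  refine ⟨⟨⟨L, ?_⟩, ?_⟩, fun i φ => hL φ i⟩
  · exact fun f f' => regChart_ext fun i => by rw [map_add, hL, hL, hL, map_add, map_add]
  · exact fun c f => regChart_ext fun i => by
      rw [map_smul, hL, hL, map_smul, map_smul, RingHom.id_apply]

/-- The shifted Euler operator on regular functions. -/
def regEuler (U : ZOpen n) : Reg U →ₗ[ℂ] Reg U := (exists_cxEuler U).choose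

lemma regChart_regEuler (U : ZOpen n) (i : Fin (n + 1)) (φ : Reg U) :
    regChart U i (regEuler U φ) = cxEuler (zop U i) (regChart U i φ) :=
  (exists_cxEuler U).choose_spec i φ

lemma RegEq.euler {g : GL (Fin (n + 1)) ℂ} {U V : ZOpen n} {φ : Reg U} {φ' : Reg V}
    (h : RegEq g φ φ') : RegEq g (regEuler U φ) (regEuler V φ') := regEq_iff.2 fun i j => by
  rw [regChart_regEuler, regChart_regEuler]
  exact (regEq_iff.1 h i j).cxEuler

lemma Darboux.isDiffOp_E_add_smul {ι : Type} [Fintype ι] [DecidableEq ι] {O : Type} [CommRing O]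
    [Algebra ℂ O] (S : Darboux ι O) (c : ℂ) :
    IsDiffOp O 1 ⇑(S.E + c • LinearMap.id : O →ₗ[ℂ] O) := by
  have h0 : IsDiffOp O 0 (fun f : O => f) := fun _ _ => rfl
  exact S.isDiffOp_E.add ((h0.mono (Nat.zero_le 1)).csmul c)

/-- The shifted Euler operator on the complex cotangent bundle. -/
def algEuler (n : ℕ) : AlgDiffOp n where
  toFun := regEuler
  restrict _ _ hVU _ _ h := (regEq_of_restrict (hVU := hVU) h).euler.restrict hVU
  diff := ⟨1, fun U => isDiffOp_of_regChart (fun i φ => regChart_regEuler U i φ) fun i =>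
    (cxD (zop U i)).isDiffOp_E_add_smul ((n : ℂ) / 2)⟩

lemma isInvariant_algEuler (n : ℕ) : (algEuler n).IsInvariant :=
  fun _ _ _ hUV _ _ h m => h.regEq.euler m m.2 ((hUV m).2 m.2)

end Complex

/-! ### Restriction to the real points -/

section RealPoints

variable {n : ℕ}

/-- The inclusion of the real points. -/
def realEmb (n : ℕ) : ((Fin n → ℝ) × (Fin n → ℝ)) →L[ℝ] ((Fin n → ℂ) × (Fin n → ℂ)) :=
  (ContinuousLinearMap.pi fun k => Complex.ofRealCLM.comp (ContinuousLinearMap.proj k)).prodMap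
    (ContinuousLinearMap.pi fun k => Complex.ofRealCLM.comp (ContinuousLinearMap.proj k))

/-- The real points of an open set. -/
def realPart (Ω : Opens ((Fin n → ℂ) × (Fin n → ℂ))) : Opens ((Fin n → ℝ) × (Fin n → ℝ)) :=
  Ω.comap ⟨realEmb n, (realEmb n).continuous⟩

/-- Restriction to the real points. -/
def realRes (Ω : Opens ((Fin n → ℂ) × (Fin n → ℂ))) : Sm ℂ Ω →ₐ[ℂ] Sm ℝ (realPart Ω) where
  toFun F := ⟨fun w => F.1 ⟨realEmb n w.1, w.2⟩, fun w hw =>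
    (((F.2 _ hw).restrict_scalars ℝ).comp w (realEmb n).contDiff.contDiffAt).congr_of_eventuallyEq (by
      filter_upwards [(realPart Ω).isOpen.mem_nhds hw] with v hv
      exact (extZero_of_mem _ hv).trans (extZero_of_mem F.1 (w := realEmb n v) hv).symm)⟩
  map_one' := rfl
  map_mul' _ _ := rfl
  map_zero' := rfl
  map_add' _ _ := rfl
  commutes' _ := rfl

lemma d_realRes {Ω : Opens ((Fin n → ℂ) × (Fin n → ℂ))} (F : Sm ℂ Ω)
    (v : (Fin n → ℝ) × (Fin n → ℝ)) :
    Sm.d v (realRes Ω F) = realRes Ω (Sm.d (realEmb n v) F) := by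
  ext w
  have h1 : HasFDerivAt (extZero F.1) (fderiv ℂ (extZero F.1) (realEmb n w.1)) (realEmb n w.1) :=
    (Sm.differentiableAt F w.2).hasFDerivAt
  have h2 := (h1.restrictScalars ℝ).comp w.1 (realEmb n).hasFDerivAt
  rw [Sm.d_apply_of_eq (F := fun w => extZero F.1 (realEmb n w))
    (fun w => (extZero_of_mem F.1 (w := realEmb n w.1) w.2).symm)]
  exact congrArg (fun L => L v) h2.fderiv

lemma realEmb_single (a : Fin n) :
    realEmb n (Pi.single a 1, 0) = (Pi.single a 1, 0) ∧
      realEmb n (0, Pi.single a 1) = (0, Pi.single a 1) := by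
  have h : (fun k => (((Pi.single a 1 : Fin n → ℝ) k : ℝ) : ℂ)) = Pi.single a 1 := by
    funext k
    by_cases hk : k = a <;> simp [hk]
  have h0 : (fun k => (((0 : Fin n → ℝ) k : ℝ) : ℂ)) = 0 := by
    funext k; simp
  exact ⟨Prod.ext h h0, Prod.ext h0 h⟩

/-- The real coordinate directions embed as the complex ones, so complex partial derivatives
restrict to real ones and all formulas in coordinates restrict with them. -/
lemma compat_realRes (Ω : Opens ((Fin n → ℂ) × (Fin n → ℂ))) :
    Darboux.Compat (cxD Ω) ((Frame.std ℝ (Fin n)).darboux (realPart Ω)) (realRes Ω).toLinearMap :=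
  Darboux.compat_of_commute
    (fun a f => (d_realRes f _).trans
      (congrArg (fun v => realRes Ω (Sm.d v f)) (realEmb_single a).1))
    (fun a f => (d_realRes f _).trans
      (congrArg (fun v => realRes Ω (Sm.d v f)) (realEmb_single a).2)) fun _ => rfl

lemma germEq_iff {U : ZOpen n} {i : Fin (n + 1)} {w : (Fin n → ℝ) × (Fin n → ℝ)} {f : SmoothT n}
    {φ : Reg U} : GermEq i w f φ ↔ ∃ (N : Opens ((Fin n → ℝ) × (Fin n → ℝ)))
      (h : N ≤ realPart (zop U i)), w ∈ N ∧
        Sm.res le_top (toChart i f) = Sm.res h (realRes _ (regChart U i φ)) := by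
  constructor
  · intro h
    obtain ⟨N, hN, ho, hw⟩ := eventually_nhds_iff.1 h
    have hle : (⟨N, ho⟩ : Opens _) ≤ realPart (zop U i) := fun v hv => (hN v hv).1
    refine ⟨⟨N, ho⟩, hle, hw, Sm.ext fun v => ?_⟩
    exact (Sm.res_apply le_top (toChart i f) v).trans
      ((hN v.1 v.2).2.trans (Sm.res_apply hle (realRes _ (regChart U i φ)) v).symm)
  · rintro ⟨N, h, hw, he⟩
    filter_upwards [N.isOpen.mem_nhds hw] with v hv
    refine ⟨h hv, ?_⟩
    have h1 := congrArg (fun F : Sm ℝ N => F.1 ⟨v, hv⟩) he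
    simp only [Sm.res_apply] at h1
    exact h1

lemma res_realBidiff (p : ℕ) (i : Fin (n + 1)) (N : Opens ((Fin n → ℝ) × (Fin n → ℝ)))
    (f h : SmoothT n) : Sm.res (le_top : N ≤ ⊤) (toChart i (realBidiff n p f h)) =
      ((Frame.std ℝ (Fin n)).darboux N).bidiff n p (sig p) (tau p)
        (Sm.res le_top (toChart i f)) (Sm.res le_top (toChart i h)) :=
  (congrArg _ (toChart_realBidiff p i f h)).trans
    (((Frame.std ℝ (Fin n)).compat_res (le_top : N ≤ ⊤)).bidiff n p (sig p) (tau p) _ _).symm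

lemma res_regBidiff (p : ℕ) {U : ZOpen n} {i : Fin (n + 1)} {N : Opens ((Fin n → ℝ) × (Fin n → ℝ))}
    (hN : N ≤ realPart (zop U i)) (φ ψ : Reg U) :
    Sm.res hN (realRes _ (regChart U i (regBidiff p U φ ψ))) =
      ((Frame.std ℝ (Fin n)).darboux N).bidiff n p (sig p) (tau p)
        (Sm.res hN (realRes _ (regChart U i φ))) (Sm.res hN (realRes _ (regChart U i ψ))) :=
  ((congrArg (fun F => Sm.res hN (realRes _ F)) (regChart_regBidiff p U i φ ψ)).trans
    (congrArg (Sm.res hN) ((compat_realRes (zop U i)).bidiff n p (sig p) (tau p) _ _).symm)).trans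
    (((Frame.std ℝ (Fin n)).compat_res hN).bidiff n p (sig p) (tau p) _ _).symm

lemma Sm.res_res {Ω₁ Ω₂ Ω₃ : Opens ((Fin n → ℝ) × (Fin n → ℝ))} (h : Ω₁ ≤ Ω₂) (h' : Ω₂ ≤ Ω₃)
    (F : Sm ℝ Ω₃) : Sm.res h (Sm.res h' F) = Sm.res (h.trans h') F := by
  ext w
  rw [Sm.res_apply, Sm.res_apply, Sm.res_apply]

/-- The real and the complex operator are given by one formula in coordinates; naturality under
restriction to real points and to a common neighbourhood identifies the germs. -/
lemma extends_algBidiff (n p : ℕ) : (algBidiff n p).Extends (realBidiff n p) := by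
  intro U φ ψ f h i w hf hh
  obtain ⟨N, hN, hw, e⟩ := germEq_iff.1 hf
  obtain ⟨N', hN', hw', e'⟩ := germEq_iff.1 hh
  refine germEq_iff.2 ⟨N ⊓ N', inf_le_left.trans hN, ⟨hw, hw'⟩, ?_⟩
  have e1 := congrArg (Sm.res (inf_le_left : N ⊓ N' ≤ N)) e
  have e2 := congrArg (Sm.res (inf_le_right : N ⊓ N' ≤ N')) e'
  rw [Sm.res_res, Sm.res_res] at e1 e2
  refine (res_realBidiff p i _ f h).trans (Eq.trans ?_ (res_regBidiff p _ φ ψ).symm)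
  exact congrArg₂ (fun a b => ((Frame.std ℝ (Fin n)).darboux (N ⊓ N')).bidiff n p (sig p) (tau p) a b)
    e1 e2

lemma extends_algEuler (n : ℕ) :
    (algEuler n).Extends (euler + ((n : ℂ) / 2) • LinearMap.id) := by
  intro U φ f i w hf
  obtain ⟨N, hN, hw, e⟩ := germEq_iff.1 hf
  refine germEq_iff.2 ⟨N, hN, hw, ?_⟩
  have h1 : Sm.res (le_top : N ≤ ⊤) (toChart i (euler f)) =
      ((Frame.std ℝ (Fin n)).darboux N).E (Sm.res le_top (toChart i f)) :=
    (congrArg _ (toChart_euler i f)).trans (((Frame.std ℝ (Fin n)).compat_res (le_top : N ≤ ⊤)).E _).symm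
  have h2 : Sm.res hN (realRes _ ((cxD (zop U i)).E (regChart U i φ))) =
      ((Frame.std ℝ (Fin n)).darboux N).E (Sm.res hN (realRes _ (regChart U i φ))) :=
    (congrArg (Sm.res hN) ((compat_realRes (zop U i)).E _).symm).trans
      (((Frame.std ℝ (Fin n)).compat_res hN).E _).symm
  have h3 := congrArg (fun F => Sm.res hN (realRes _ F)) (regChart_regEuler U i φ)
  have h4 := h1.trans ((congrArg ((Frame.std ℝ (Fin n)).darboux N).E e).trans h2.symm)
  refine Eq.trans ?_ h3.symm
  ext v
  have h5 := congrArg (fun F : Sm ℝ N => F.1 v) e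
  have h6 := congrArg (fun F : Sm ℝ N => F.1 v) h4
  simp only [Sm.res_apply] at h5 h6
  rw [Sm.res_apply, Sm.res_apply]
  exact congrArg₂ (fun a b : ℂ => a + (n : ℂ) / 2 * b) h6 h5

/-! ### Uniqueness of algebraic extensions -/

lemma exists_germEq {U : ZOpen n} (φ : Reg U) (i : Fin (n + 1)) {w : (Fin n → ℝ) × (Fin n → ℝ)}
    (hw : realPt i w ∈ U.carrier) : ∃ f : SmoothT n, GermEq i w f φ := by
  have hN : (realPart (zop U i) : Set _) ∈ nhds w := (realPart (zop U i)).isOpen.mem_nhds hw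
  obtain ⟨f, hf, -⟩ := exists_germ i hN (c := extZero (realRes _ (regChart U i φ)).1)
    (realRes _ (regChart U i φ)).2
  refine ⟨f, ?_⟩
  filter_upwards [hf, hN] with v hv hvN
  exact ⟨hvN, hv.trans (extZero_of_mem _ hvN)⟩

lemma GermEq.unique {U : ZOpen n} {i : Fin (n + 1)} {w : (Fin n → ℝ) × (Fin n → ℝ)} {f : SmoothT n}
    {φ φ' : Reg U} (h : GermEq i w f φ) (h' : GermEq i w f φ') (hw : realPt i w ∈ U.carrier) :
    φ.1 ⟨_, hw⟩ = φ'.1 ⟨_, hw⟩ := by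
  obtain ⟨_, h1⟩ := Filter.Eventually.self_of_nhds h
  obtain ⟨_, h2⟩ := Filter.Eventually.self_of_nhds h'
  exact h1.symm.trans h2

/-- A polynomial vanishing on a product of infinite sets is zero; here each set is the real line in
`ℂ`. -/
lemma mvPolynomial_eq_zero_of_real {P : MvPolynomial (Fin n ⊕ Fin n) ℂ}
    (h : ∀ w, pev P (realEmb n w) = 0) : P = 0 := by
  refine MvPolynomial.funext_set (fun _ => Set.range ((↑) : ℝ → ℂ))
    (fun _ => Set.infinite_range_of_injective Complex.ofReal_injective) fun x hx => ?_
  choose r hr using fun a => hx a trivial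
  rw [map_zero, ← h (fun k => r (Sum.inl k), fun k => r (Sum.inr k)), pev]
  congr 1
  congr 1
  funext a
  cases a <;> exact (hr _).symm

/-- Zariski density of the real points: near a given complex point the difference is a quotient of
polynomials, and its numerator is forced to vanish by its real values. -/
lemma reg_eq_of_real {U : ZOpen n} {φ ψ : Reg U}
    (h : ∀ i w, ∀ hw : realPt i w ∈ U.carrier, φ.1 ⟨_, hw⟩ = ψ.1 ⟨_, hw⟩) : φ = ψ := by
  refine regChart_ext fun i => ?_
  ext w
  obtain ⟨S, hS⟩ := U.isOpen i
  obtain ⟨G, hG, hGw⟩ := (hS w.1.1 w.1.2).1 w.2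
  obtain ⟨P, R, hR, hP⟩ := Subalgebra.sub_mem _ (regChart_mem U i φ) (regChart_mem U i ψ) w
  have h1 : ∀ v : zop U i, pev R v.1 * ((regChart U i φ).1 v - (regChart U i ψ).1 v) = pev P v.1 :=
    fun v => by
      have h2 := congrArg (fun F : Sm ℂ (zop U i) => F.1 v) hP
      simp only [Sm.mul_apply, poly_apply] at h2
      exact h2
  -- `P` is only known to vanish at the real points of the open set. The locus `G ≠ 0` lies in that
  -- set, so `G * P` vanishes at all real points; at `w` itself `G` is nonzero and can be cancelled.
  have h3 : G * P = 0 := mvPolynomial_eq_zero_of_real fun v => by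
    rw [pev, map_mul]
    by_cases hv : pev G (realEmb n v) = 0
    · exact mul_eq_zero_of_left hv _
    · have hm : realEmb n v ∈ zop U i := (hS _ _).2 ⟨G, hG, hv⟩
      refine mul_eq_zero_of_right _ ((h1 ⟨_, hm⟩).symm.trans ?_)
      exact mul_eq_zero_of_right _ (sub_eq_zero.2 (h i v hm))
  have h4 : pev P w.1 = 0 := by
    have h5 := congrArg (fun P => pev P w.1) h3
    simp only [pev, map_mul, map_zero] at h5
    exact (mul_eq_zero.1 h5).resolve_left hGw
  exact sub_eq_zero.1 ((mul_eq_zero.1 ((h1 w).trans h4)).resolve_left hR)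

/-- At a real point every germ of a regular function is the germ of a global smooth function, so the
values of an extension at real points are dictated by the real operator. -/
lemma AlgBidiffOp.ext_of_extends {Z Z' : AlgBidiffOp n}
    {Y : SmoothT n →ₗ[ℂ] SmoothT n →ₗ[ℂ] SmoothT n} (h : Z.Extends Y) (h' : Z'.Extends Y) : Z = Z' := by
  have e : Z.toFun = Z'.toFun := by
    funext U
    refine LinearMap.ext₂ fun φ ψ => reg_eq_of_real fun i w hw => ?_
    obtain ⟨f, hf⟩ := exists_germEq φ i hw
    obtain ⟨g, hg⟩ := exists_germEq ψ i hw
    exact (h U φ ψ f g i w hf hg).unique (h' U φ ψ f g i w hf hg) hw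
  cases Z
  cases Z'
  cases e
  rfl

lemma AlgDiffOp.ext_of_extends {L L' : AlgDiffOp n} {Y : SmoothT n →ₗ[ℂ] SmoothT n}
    (h : L.Extends Y) (h' : L'.Extends Y) : L = L' := by
  have e : L.toFun = L'.toFun := by
    funext U
    refine LinearMap.ext fun φ => reg_eq_of_real fun i w hw => ?_
    obtain ⟨f, hf⟩ := exists_germEq φ i hw
    exact (h U φ f i w hf).unique (h' U φ f i w hf) hw
  cases L
  cases L'
  cases e
  rfl

end RealPoints

end StarProj

end

open StarProj in
theorem theorem5 (n p : ℕ) (hn : Odd n) (hp : 1 ≤ p) :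
    (∃! Q : Pol n ≃ₗ[ℂ] DensOps (1 / 2) n, IsEquivariantQuantization Q) ∧
    IsUnit (opT n p) ∧ IsUnit (opS n p) ∧
    (∀ Q : Pol n ≃ₗ[ℂ] DensOps (1 / 2) n, IsEquivariantQuantization Q →
      ∃ Z : SmoothT n →ₗ[ℂ] SmoothT n →ₗ[ℂ] SmoothT n,
        IsBidiff Z ∧ IsSLRInvariant Z ∧ (∀ φ ψ : Pol n, StarForm Q p Z φ ψ) ∧
        (∀ Z' : SmoothT n →ₗ[ℂ] SmoothT n →ₗ[ℂ] SmoothT n, IsBidiff Z' →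
          (∀ φ ψ : Pol n, φ.1 ∈ momentumAlg n → ψ.1 ∈ momentumAlg n → StarForm Q p Z' φ ψ) →
          Z' = Z) ∧
        (∀ C' : Pol n → Pol n → Pol n,
          (∃ W : SmoothT n →ₗ[ℂ] SmoothT n →ₗ[ℂ] SmoothT n, IsBidiff W ∧
            ∀ φ ψ : Pol n, W φ.1 ψ.1 = (opT n p (C' (opS n p φ) (opS n p ψ))).1) →
          (∀ φ ψ : Pol n, φ.1 ∈ momentumAlg n → ψ.1 ∈ momentumAlg n →
            C' φ ψ = starCoeff Q p φ ψ) →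
          C' = starCoeff Q p) ∧
        (∃ Zc : AlgBidiffOp n, Zc.IsInvariant ∧ Zc.Extends Z ∧
          ∀ Zc' : AlgBidiffOp n, Zc'.Extends Z → Zc' = Zc)) ∧
    (∃ Ec : AlgDiffOp n, Ec.IsInvariant ∧ Ec.Extends (euler + ((n : ℂ) / 2) • LinearMap.id) ∧
      ∀ Ec' : AlgDiffOp n, Ec'.Extends (euler + ((n : ℂ) / 2) • LinearMap.id) → Ec' = Ec) := by
  refine ⟨⟨quantMap n, isEquivariantQuantization_quantMap, fun Q hQ =>
      isEquivariantQuantization_unique hQ⟩, isUnit_opT n p, isUnit_opS hn p, fun Q hQ => ?_,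
    algEuler n, isInvariant_algEuler n, extends_algEuler n, fun L hL =>
      AlgDiffOp.ext_of_extends hL (extends_algEuler n)⟩
  obtain rfl := isEquivariantQuantization_unique hQ
  exact ⟨realBidiff n p, isBidiff_realBidiff n p, isSLRInvariant_realBidiff n p,
    fun φ ψ => (starForm_iff hn p).2 rfl, fun Z hZ h => eq_realBidiff_of_starForm hn p hZ h,
    fun C ⟨W, hW, hC⟩ h => eq_starCoeff hn p hW hC h, algBidiff n p, isInvariant_algBidiff n p,
    extends_algBidiff n p, fun Z hZ => AlgBidiffOp.ext_of_extends hZ (extends_algBidiff n p)⟩
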